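/- **Stationary phase point on a single singularity.** Let $U\subset\mathbb C^3$ be an open neighbourhood of a real point $\xi^*$, and let $g,G$ be holomorphic on $U$ and real at real points. Put $\sigma=\{g=0\}$, $\sigma'=\sigma\cap\mathbb R^3$. Assume $g(\xi^*)=0$, $\nabla g(\xi^*)\neq 0$, $\nabla G(\xi^*)\ne0$, and that $\xi^*$ is a nondegenerate critical point of $G|_{\sigma'}$. *Coordinates.* Near $\xi^*$ there is a biholomorphic change of coordinates $\xi\mapsto w=(w_1,w_2,w_3)$, taking real points exactly to real points, with $w(\xi^*)=0$, $w_1=\alpha g$ and $$G=G(\xi^*)+w_1+\tfrac12(\beta_2w_2^2+\beta_3w_3^2)+O\big(|w_1||w|+|w|^3\big),$$ where $\alpha,\beta_2,\beta_3$ are nonzero real constants. Fix any such coordinates, and let $J=\det(\partial\xi/\partial w)$ at $w=0$. *Domains.* Let $D_r$ be the closed cube of half-side $r$ around $\xi^*$ in $\mathbb R^3$. For a smooth $\eta:\mathbb R^3\to\mathbb R^3$ consider the domain $\Gamma_\eta=\{x+i\eta(x):x\in D_r\}$, oriented as $\mathbb R^3$; call it $\delta$-small if $|\eta|\le\delta$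 and $|D\eta|\le\delta$ on $D_r$. It passes below (above) $\sigma$ if $\operatorname{Im}w_1<0$ (respectively $>0$) at all its points with $\operatorname{Re}w_1=0$, where $w_1$ stands for $\alpha g$; "below" is the side on which $|e^{i\Lambda G}|$ grows. It is desired over $S\subset D_r$ if $\operatorname{Im}G(x+i\eta(x))>0$ for $x\in S$. A $\delta$-small allowed deformation is a continuous family $(\eta_\tau)_{0\le\tau\le1}$ of smooth $\delta$-small fields such that no $\Gamma_{\eta_\tau}$ meets $\sigma$. Put $$u(\Lambda)=\int_{\Gamma_{\eta_1}}F(\xi)\,e^{i\Lambda G(\xi)}\,d\xi_1\wedge d\xi_2\wedge d\xi_3 .$$ There is $R>0$ such that the following holds for every $r\in(0,R)$. 1. For every $\varepsilon>0$ there is $\delta>0$ such that for every field $\eta_0$ that is $\delta$-small on $D_{2r}$: if $\Gamma_{\eta_0}$ passes above $\sigma$ over $D_{2r}$, there is an $\varepsilon$-small allowed deformation over $D_r$ that starts at $\eta_0$ and ends at a domain that is desired over all of $D_r$; if it passes below $\sigma$ over $D_{2r}$, then for every $r_1>0$ there is such a deformation whose final domain is desired at all points of $D_r$ outside the open cube of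 half-side $r_1$ around $\xi^*$. 2. There is $\delta>0$ such that for every $\delta$-small allowed deformation $(\eta_\tau)$ over $D_r$ whose final domain is desired at all points of $D_r$ outside the open cube of half-side $r/2$ around $\xi^*$: (a) if $\Gamma_{\eta_0}$ passes above $\sigma$, the point gives no contribution: for every $F$ holomorphic on $U\setminus\{\alpha g\in -i[0,\infty)\}$ there is $\zeta>0$ with $u(\Lambda)=O(e^{-\zeta\Lambda})$ as $\Lambda\to+\infty$; (b) if $\Gamma_{\eta_0}$ passes below $\sigma$, the final domain is never desired over all of $D_r$. Let moreover $F$ be holomorphic on $U\setminus\{\alpha g\in i[0,\infty)\}$ (the branch of $F$ on the domain of integration) with $F=(C(w_2,w_3)+o(1))\,w_1^{\mu}$ as $\xi\to\xi^*$ in this set, where $C$ is holomorphic near $(0,0)$, $C(0,0)\ne0$, $\mu\in\mathbb C$ with $\mu=-1$ or $\mu\notin\mathbb Z$, and $-3\pi/2<\arg w_1<\pi/2$. Then, as $\Lambda\to+\infty$, $$u(\Lambda)\sim\Phi(\Lambda)\,\exp\Big\{i\Lambda G(\xi^*)+\frac{i\pi}4(\operatorname{sign}\beta_2+\operatorname{sign}\beta_3)\Big\}\,\frac{2\pi|J|}{\Lambda\sqrt{|\beta_2\beta_3|}},\qquad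 \Phi(\Lambda)=C(0,0)\,\Lambda^{-\mu-1}I(\mu),$$ with $I(-1)=2\pi i$ and $I(\mu)=e^{\pi i(\mu+1)/2}(1-e^{-2\pi i\mu})\,\Gamma(1+\mu)$ for $\mu\notin\mathbb Z$. Furthermore, $\Phi$ is the leading term of the integral of $F$ across the singularity: there is $\rho_0>0$ such that, for all $\rho\in(0,\rho_0)$, all $F,C,\mu$ as in (b), and every $C^1$ contour $\tilde\gamma_-=\{t+ih(t):-\rho\le t\le\rho\}$ with $|h|\le\rho$, $h(0)<0$ and $h(\pm\rho)>0$, $$\int_{\tilde\gamma_-}F(w_1,0,0)\,e^{i\Lambda w_1}\,dw_1\sim\Phi(\Lambda)\qquad(\Lambda\to+\infty).$$ -/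

import Mathlib

open Filter Topology Asymptotics Set
open scoped ContDiff

/-- Real three-space. With its sup norm, `Metric.closedBall p r` is the cube of half-side `r`
centred at `p`; these cubes serve as the small neighbourhoods of a real point. -/
abbrev R3 : Type := Fin 3 → ℝ

/-- Complex three-space, the space of the integration variables `ξ`. -/
abbrev C3 : Type := Fin 3 → ℂ

/-- The inclusion of real points into complex space. -/
def toC3 (x : R3) : C3 := fun i => (x i : ℂ)

/-- The point of the domain `Γ = {x + i η(x)}` whose real part is `x`. -/
def domainPt (η : R3 → R3) (x : R3) : C3 := fun i => (x i : ℂ) + Complex.I * (η x i : ℂ)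

/-- The density of the form `dξ₁ ∧ dξ₂ ∧ dξ₃` on `Γ = {x + i η(x)}` in the parameters `x`:
the determinant of the derivative of `x ↦ x + i η(x)`. -/
noncomputable def volumeDensity (η : R3 → R3) (x : R3) : ℂ :=
  Matrix.det (Matrix.of fun j k : Fin 3 =>
    (if j = k then (1 : ℂ) else 0) +
      Complex.I * ((fderiv ℝ η x (Pi.single k 1) j : ℝ) : ℂ))

/-- The integral of `F(ξ) exp(i Λ G(ξ)) dξ₁ ∧ dξ₂ ∧ dξ₃` over the part of `Γ = {x + i η(x)}` with
real part in the closed cube of half-side `r` around `p`; `Γ` is oriented as `ℝ³`. -/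
noncomputable def localIntegral (F G : C3 → ℂ) (p : R3) (r : ℝ) (η : R3 → R3) (Λ : ℝ) : ℂ :=
  ∫ x in Metric.closedBall p r,
    F (domainPt η x) * Complex.exp (Complex.I * (Λ : ℂ) * G (domainPt η x)) * volumeDensity η x

/-- `η` is smooth, and on the cube of half-side `r` around `p` it is at most `δ` in size together
with its first derivatives. -/
def IsSmallField (p : R3) (r δ : ℝ) (η : R3 → R3) : Prop :=
  ContDiff ℝ ∞ η ∧ ∀ x ∈ Metric.closedBall p r, ‖η x‖ ≤ δ ∧ ‖fderiv ℝ η x‖ ≤ δ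

/-- Over the cube of half-side `r` around `p`, the domain `Γ = {x + i η(x)}` passes below the set
`W = 0`: wherever `W` is purely imaginary on `Γ`, it lies on the negative imaginary half-axis. -/
def PassesBelow (W : C3 → ℂ) (p : R3) (r : ℝ) (η : R3 → R3) : Prop :=
  ∀ x ∈ Metric.closedBall p r, (W (domainPt η x)).re = 0 → (W (domainPt η x)).im < 0

/-- Over the cube of half-side `r` around `p`, the domain `Γ = {x + i η(x)}` passes above the set
`W = 0`. -/
def PassesAbove (W : C3 → ℂ) (p : R3) (r : ℝ) (η : R3 → R3) : Prop :=
  ∀ x ∈ Metric.closedBall p r, (W (domainPt η x)).re = 0 → 0 < (W (domainPt η x)).im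

/-- The domain `Γ = {x + i η(x)}` is desired over `S`: the exponential factor decays on it. -/
def DesiredOn (G : C3 → ℂ) (S : Set R3) (η : R3 → R3) : Prop :=
  ∀ x ∈ S, 0 < (G (domainPt η x)).im

/-- `η τ`, `0 ≤ τ ≤ 1`, is a deformation, over the cube of half-side `r` around `p` and through
small fields (of size at most `δ`), that is allowed: no `Γ(τ)` meets the singularity `g = 0`. -/
structure IsAllowedDeformation (g : C3 → ℂ) (p : R3) (r δ : ℝ) (η : ℝ → R3 → R3) : Prop where
  continuousOn : ContinuousOn (fun q : ℝ × R3 => η q.1 q.2) (Icc (0 : ℝ) 1 ×ˢ Metric.closedBall p r)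
  small : ∀ τ ∈ Icc (0 : ℝ) 1, IsSmallField p r δ (η τ)
  avoids : ∀ τ ∈ Icc (0 : ℝ) 1, ∀ x ∈ Metric.closedBall p r, g (domainPt (η τ) x) ≠ 0

/-- The Hessian matrix at the origin of a real function of two real variables. -/
noncomputable def hessian2 (f : (Fin 2 → ℝ) → ℝ) : Matrix (Fin 2) (Fin 2) ℝ :=
  Matrix.of fun i j => iteratedFDeriv ℝ 2 f 0 ![Pi.single i 1, Pi.single j 1]

/-- `p` is a nondegenerate critical point of the restriction of `G` to the real surface
`{x ∈ ℝ³ : g(x) = 0}`, expressed in a regular parametrization `φ` of the surface near `p`. -/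
def IsNondegenerateCriticalPointOn (g G : C3 → ℂ) (p : R3) : Prop :=
  ∃ φ : (Fin 2 → ℝ) → R3,
    ContDiffAt ℝ ∞ φ 0 ∧ φ 0 = p ∧ Function.Injective (fderiv ℝ φ 0) ∧
    (∀ᶠ t in 𝓝 0, g (toC3 (φ t)) = 0) ∧
    fderiv ℝ (fun t => (G (toC3 (φ t))).re) 0 = 0 ∧
    (hessian2 fun t => (G (toC3 (φ t))).re).det ≠ 0

/-- The real data near the point `p`: `g` and `G` are holomorphic on the open set `U`, real at
real points, `p` lies on the regular singularity `g = 0`, is a nondegenerate critical point of the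
restriction of `G` to it, and is not a critical point of `G`. -/
structure IsStationaryOnSingularity (U : Set C3) (g G : C3 → ℂ) (p : R3) : Prop where
  isOpen : IsOpen U
  mem : toC3 p ∈ U
  holo_g : DifferentiableOn ℂ g U
  holo_G : DifferentiableOn ℂ G U
  real_g : ∀ x : R3, toC3 x ∈ U → (g (toC3 x)).im = 0
  real_G : ∀ x : R3, toC3 x ∈ U → (G (toC3 x)).im = 0
  zero : g (toC3 p) = 0
  regular : fderiv ℂ g (toC3 p) ≠ 0
  stationary : IsNondegenerateCriticalPointOn g G p
  not_critical : fderiv ℂ G (toC3 p) ≠ 0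

/-- `w` is a real biholomorphic change of coordinates near `p` with `w₁ = α g` and
`G = G(p) + w₁ + (β₂ w₂² + β₃ w₃²) / 2 + …`. The dots stand for the terms that are negligible
when `w₁` has the size of `w₂²` and `w₃²`. (The components `w₁, w₂, w₃` have indices `0, 1, 2`.) -/
structure IsNormalizingChart (U : Set C3) (g G : C3 → ℂ) (p : R3)
    (w : OpenPartialHomeomorph C3 C3) (α β₂ β₃ : ℝ) : Prop where
  mem : toC3 p ∈ w.source
  subset : w.source ⊆ U
  center : w (toC3 p) = 0
  holo : DifferentiableOn ℂ w w.source
  holo_symm : DifferentiableOn ℂ w.symm w.target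
  real : ∀ ξ ∈ w.source, (∀ i, (ξ i).im = 0) ↔ ∀ i, (w ξ i).im = 0
  α_ne : α ≠ 0
  β₂_ne : β₂ ≠ 0
  β₃_ne : β₃ ≠ 0
  first : ∀ ξ ∈ w.source, w ξ 0 = (α : ℂ) * g ξ
  phase : (fun ξ => G ξ - (G (toC3 p) + w ξ 0
      + 1 / 2 * ((β₂ : ℂ) * w ξ 1 ^ 2 + (β₃ : ℂ) * w ξ 2 ^ 2)))
    =O[𝓝 (toC3 p)] fun ξ => ‖w ξ 0‖ * ‖w ξ‖ + ‖w ξ‖ ^ 3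

/-- The Jacobian determinant `J = det (∂ξ/∂w)` at `w = 0`. -/
noncomputable def jacobianDet (w : OpenPartialHomeomorph C3 C3) : ℂ :=
  Matrix.det (Matrix.of fun i j : Fin 3 => fderiv ℂ w.symm 0 (Pi.single j 1) i)

/-- The complex plane cut along the half-axis `i [0, ∞)`. -/
def cutAbove : Set ℂ := {s | s.re = 0 → s.im < 0}

/-- The complex plane cut along the half-axis `-i [0, ∞)`. -/
def cutBelow : Set ℂ := {s | s.re = 0 → 0 < s.im}

/-- The branch of `s ^ μ` on `cutAbove` with `-3π/2 < arg s < π/2`; so `arg s = 0` for `s > 0`,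
and `arg s = -π` for `s < 0`, which is reached from `s > 0` by passing below the origin. -/
noncomputable def powBelow (s μ : ℂ) : ℂ :=
  Complex.exp (μ * (Complex.log (Complex.I * s) - Complex.I * Real.pi / 2))

/-- In the coordinates `w`, the leading term of `F` at `p` is `C(w₂, w₃) w₁ ^ μ`, with `C`
holomorphic and nonzero at the origin. `F` is the branch, on the cut neighbourhood, that is
integrated over a domain passing below `w₁ = 0`. -/
structure HasPowerSingularity (F : C3 → ℂ) (p : R3) (w : OpenPartialHomeomorph C3 C3)
    (C : ℂ × ℂ → ℂ) (μ : ℂ) : Prop where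
  analyticAt : AnalyticAt ℂ C 0
  ne_zero : C 0 ≠ 0
  exponent : μ = -1 ∨ ∀ n : ℤ, μ ≠ n
  leading : (fun ξ => F ξ - C (w ξ 1, w ξ 2) * powBelow (w ξ 0) μ)
    =o[𝓝[{ξ | w ξ 0 ∈ cutAbove}] (toC3 p)] fun ξ => powBelow (w ξ 0) μ

open Classical in
/-- The constant `I(μ)`. -/
noncomputable def singConst (μ : ℂ) : ℂ :=
  if μ = -1 then 2 * Real.pi * Complex.I
  else Complex.exp (Real.pi * Complex.I * (μ + 1) / 2) *
    (1 - Complex.exp (-(Complex.I * 2 * Real.pi * μ))) * Complex.Gamma (1 + μ)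

/-- `Φ(Λ) = C(0,0) Λ ^ (-μ-1) I(μ)`. -/
noncomputable def Phi (C : ℂ × ℂ → ℂ) (μ : ℂ) (Λ : ℝ) : ℂ :=
  C 0 * (Λ : ℂ) ^ (-μ - 1) * singConst μ

/-- The integral of `F(w₁, 0, 0) exp(i Λ w₁) dw₁` along the contour `w₁ = t + i h(t)`,
`-ρ ≤ t ≤ ρ`. -/
noncomputable def contourIntegral (F : C3 → ℂ) (w : OpenPartialHomeomorph C3 C3)
    (ρ : ℝ) (h : ℝ → ℝ) (Λ : ℝ) : ℂ :=
  ∫ t in (-ρ)..ρ, F (w.symm ![(t : ℂ) + Complex.I * (h t : ℂ), 0, 0]) *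
    Complex.exp (Complex.I * (Λ : ℂ) * ((t : ℂ) + Complex.I * (h t : ℂ))) *
    (1 + Complex.I * ((deriv h t : ℝ) : ℂ))

/-- The contour `t + i h(t)`, `-ρ ≤ t ≤ ρ`, starts and ends in the upper half-plane and passes
below the origin. -/
structure IsLowerContour (ρ : ℝ) (h : ℝ → ℝ) : Prop where
  smooth : ContDiff ℝ 1 h
  bound : ∀ t ∈ Icc (-ρ) ρ, |h t| ≤ ρ
  left : 0 < h (-ρ)
  below : h 0 < 0
  right : 0 < h ρ

/-- The leading term of the contribution of `p` for a domain passing below the singularity. -/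
noncomputable def leadingTerm (G : C3 → ℂ) (p : R3) (w : OpenPartialHomeomorph C3 C3)
    (β₂ β₃ : ℝ) (C : ℂ × ℂ → ℂ) (μ : ℂ) (Λ : ℝ) : ℂ :=
  Phi C μ Λ *
    Complex.exp (Complex.I * (Λ : ℂ) * G (toC3 p)
      + Complex.I * (Real.pi : ℂ) / 4 * ((Real.sign β₂ + Real.sign β₃ : ℝ) : ℂ)) *
    ((2 * Real.pi * ‖jacobianDet w‖ / (Λ * Real.sqrt |β₂ * β₃|) : ℝ) : ℂ)

open Complex Metric MeasureTheory
open scoped Real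
open ContinuousLinearMap (proj le_opNorm opNorm_le_bound pi_apply flip_apply restrictScalarsL)
open intervalIntegral (integral_of_le integral_eq_sub_of_hasDerivAt integral_comp_mul_left)
open Real (exp_pos norm_eq_abs sqrt_pos sq_sqrt exp_le_exp sign_of_pos sign_of_neg rpow_le_rpow mul_rpow
  pi_pos sign sqrt_sq sqrt_nonneg sqrt_mul)

/-! ### Holomorphic functions of several variables are smooth -/

section Holomorphic

variable {E : Type*} [NormedAddCommGroup E] [NormedSpace ℂ E]

/-! In the coordinates `w` the phase is, to leading order, a constant plus `w₁ + ½(β₂w₂² + β₃w₃²)`,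
so at the point `y + iθ` its imaginary part is about `θ₁ + β₂y₂θ₂ + β₃y₃θ₃`. On the upper side the
constant field `θ = (s, 0, 0)` makes this positive everywhere. On the lower side `θ₁ < 0` is forced
where `y₁ = 0`, but the choice `θ₂ = sβ₂y₂`, `θ₃ = sβ₃y₃` gains `s(β₂²y₂² + β₃²y₃²)` whatever the
signs of the `β`s, so only an arbitrarily small neighbourhood of the origin resists. The model
domain for the lower side is `dipField`: its first component dips to depth `sκ` at `y₁ = 0` and
grows like `s|y₁|`. That the remainder of the phase is harmless follows from Cauchy estimates which
keep the normal coordinate apart from the tangential ones (`exists_fderiv_rem_le`,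
`exists_im_dip_ge`, `exists_im_const_ge`).

A small domain, read in the coordinates, is again a graph `y + iθ(y)` (`exists_surfaceChart`). The
integrand is a closed form, so by Stokes' theorem (`setIntegral_density_add`) the graph may be moved
to a model graph over a compact part of the parameters. The homotopy is linear in `θ`: convexity of
the two sides keeps it off the cut, and near concavity of `Im G` in imaginary directions
(`exists_im_combo_ge`) keeps it desired over the rim, where the given domain and the model both are.
Hence, up to an exponentially small error, the integral is zero above the singularity, and below it
is the integral of the dip domain over a small box (`exists_norm_localIntegral_sub_le`). The side on
which the final domain passes is that of the initial one, by a connectedness argument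
(`pos_of_homotopy`).

Over the box, Cauchy's theorem in the slices of fixed `(w₂, w₃)` moves the contour to depth `1/Λ`.
Scaling `w₁` by `1/Λ` and `w₂, w₃` by `1/√Λ` then gives a dominated limit (`exists_tendsto_box`):
the product of Hankel's integral and two Fresnel integrals along tilted lines. Hankel's integral is
computed for `Re μ > -1` by collapsing a parabola onto the cut, for other nonintegral `μ` by
integration by parts, and at `μ = -1` by continuity. The limit is not zero; applied to `F = 1/w₁`
this shows that a domain on the lower side is never desired everywhere.

The deformations start with a shift along a real vector `n` that moves only `w₁` to first order. A
shift towards the side already taken avoids the singularity (`exists_shift_avoids`). Above, this is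
enough; below, the shifted field is afterwards exchanged for a multiple of the dip field.

Coordinates exist because `G - αg` is critical at the point for a Lagrange multiplier `α`, with a
Hessian that is nondegenerate on the tangent plane. One takes `w₁ = αg` and linear `w₂, w₃` that
diagonalize this Hessian. The Morse lemma is not needed, since every second-order term containing
`w₁` belongs to the allowed error. -/

theorem fderiv_apply_eq_circleIntegral {f : E → ℂ} {x v : E} {ρ : ℝ} (hρ : 0 < ρ)
    (hf : ∀ z ∈ closedBall (0 : ℂ) ρ, DifferentiableAt ℂ f (x + z • v)) :
    fderiv ℂ f x v = (2 * π * I : ℂ)⁻¹ •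
      ∮ z in C(0, ρ), (1 / (z - 0) ^ (1 + 1)) • f (x + z • v) := by
  have hline : ∀ z : ℂ, HasDerivAt (fun z : ℂ => x + z • v) v z := fun z => by
    simpa using ((hasDerivAt_id z).smul_const v).const_add x
  have hd : ∀ z ∈ closedBall (0 : ℂ) ρ,
      DifferentiableAt ℂ (fun z : ℂ => f (x + z • v)) z := fun z hz =>
    (hf z hz).comp z (hline z).differentiableAt
  have h0 : HasDerivAt (fun z : ℂ => f (x + z • v)) (fderiv ℂ f x v) 0 := by
    have h1 := hf 0 (mem_closedBall_self hρ.le)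
    have h2 := HasFDerivAt.comp_hasDerivAt (0 : ℂ) (by simpa using h1.hasFDerivAt) (hline 0)
    exact h2
  have hcl : DiffContOnCl ℂ (fun z : ℂ => f (x + z • v)) (ball 0 ρ) := by
    refine DifferentiableOn.diffContOnCl ?_; rw [closure_ball _ hρ.ne']
    exact fun z hz => (hd z hz).differentiableWithinAt
  have h := hcl.circleIntegral_one_div_sub_center_pow_smul hρ 1
  have h2 : (2 * π * I : ℂ) ≠ 0 := two_pi_I_ne_zero
  rw [h, iteratedDeriv_one, ← h0.deriv]
  rw [smul_smul, Nat.factorial_one, Nat.cast_one, div_one, inv_mul_cancel₀ h2, one_smul]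

/-- Cauchy's estimate on the complex line through `x` in the direction `v`. The free radius `ρ`
later turns the size of the phase remainder into bounds for its partial derivatives. -/
theorem norm_fderiv_apply_le_of_forall_le {f : E → ℂ} {x v : E} {ρ M : ℝ} (hρ : 0 < ρ)
    (hf : ∀ z ∈ closedBall (0 : ℂ) ρ, DifferentiableAt ℂ f (x + z • v))
    (hM : ∀ z : ℂ, ‖z‖ = ρ → ‖f (x + z • v)‖ ≤ M) : ‖fderiv ℂ f x v‖ ≤ M / ρ := by
  have hline : ∀ z : ℂ, HasDerivAt (fun z : ℂ => x + z • v) v z := fun z => by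
    simpa using ((hasDerivAt_id z).smul_const v).const_add x
  have hd : ∀ z ∈ closedBall (0 : ℂ) ρ,
      DifferentiableAt ℂ (fun z : ℂ => f (x + z • v)) z := fun z hz =>
    (hf z hz).comp z (hline z).differentiableAt
  have h0 : HasDerivAt (fun z : ℂ => f (x + z • v)) (fderiv ℂ f x v) 0 := by
    have h1 := hf 0 (mem_closedBall_self hρ.le)
    have h2 := HasFDerivAt.comp_hasDerivAt (0 : ℂ) (by simpa using h1.hasFDerivAt) (hline 0)
    exact h2
  rw [← h0.deriv]; refine norm_deriv_le_of_forall_mem_sphere_norm_le hρ ?_ ?_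
  · refine DifferentiableOn.diffContOnCl ?_; rw [closure_ball _ hρ.ne']
    exact fun z hz => (hd z hz).differentiableWithinAt
  · intro z hz; exact hM z (by simpa using hz)

variable [FiniteDimensional ℂ E]

/-- For `x` near `x0` the directional derivative is a Cauchy integral over a circle of fixed radius,
and it is differentiated under the integral sign. The domination comes from Cauchy's estimate for
the full derivative. -/
theorem differentiableOn_fderiv_apply_of_holomorphic {f : E → ℂ} {U : Set E} (hU : IsOpen U)
    (hf : DifferentiableOn ℂ f U) (v : E) : DifferentiableOn ℂ (fun x => fderiv ℂ f x v) U := by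
  let _ : MeasurableSpace E := borel E
  have : BorelSpace E := ⟨rfl⟩; have : CompleteSpace E := FiniteDimensional.complete ℂ E
  have : ProperSpace E := FiniteDimensional.proper ℂ E; intro x0 hx0
  refine DifferentiableAt.differentiableWithinAt ?_
  obtain ⟨ρ, hρ, hball⟩ : ∃ ρ > 0, closedBall x0 (3 * ρ) ⊆ U := by
    obtain ⟨e, he, h⟩ := nhds_basis_closedBall.mem_iff.1 (hU.mem_nhds hx0)
    exact ⟨e / 3, by positivity, by simpa [mul_div_cancel₀] using h⟩
  obtain ⟨M, hM⟩ := (isCompact_closedBall x0 (3 * ρ)).exists_bound_of_continuousOn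
    (hf.continuousOn.mono hball)
  have hfd : ∀ x ∈ closedBall x0 (3 * ρ), DifferentiableAt ℂ f x := fun x hx =>
    (hf x (hball hx)).differentiableAt (hU.mem_nhds (hball hx))
  have hM0 : 0 ≤ M := (norm_nonneg _).trans (hM x0 (mem_closedBall_self (by positivity)))
  have hD : ∀ x ∈ closedBall x0 (2 * ρ), ‖fderiv ℂ f x‖ ≤ M / ρ := by
    intro x hx; have hx' : dist x x0 ≤ 2 * ρ := hx
    refine ContinuousLinearMap.opNorm_le_of_unit_norm (by positivity) fun u hu => ?_
    have hmem : ∀ z : ℂ, ‖z‖ ≤ ρ → x + z • u ∈ closedBall x0 (3 * ρ) := fun z hz => by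
      rw [mem_closedBall]
      calc dist (x + z • u) x0 ≤ dist (x + z • u) x + dist x x0 := dist_triangle _ _ _
        _ ≤ ρ + 2 * ρ := by
          gcongr; simpa [dist_eq_norm, norm_smul, hu] using hz
        _ = 3 * ρ := by ring
    exact norm_fderiv_apply_le_of_forall_le hρ
      (fun z hz => hfd _ (hmem z (by simpa using hz))) fun z hz => hM _ (hmem z hz.le)
  -- With this radius the circle in the direction `v` moves a point by at most `ρ`, hence stays in
  -- the ball where the derivative is bounded. The `+ 1` covers `v = 0`.
  set t : ℝ := ρ / (‖v‖ + 1) with ht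
  have htpos : 0 < t := by positivity
  have htv : t * ‖v‖ ≤ ρ := by
    rw [ht, div_mul_eq_mul_div, div_le_iff₀ (by positivity)]; nlinarith [norm_nonneg v]
  have hmem : ∀ x ∈ ball x0 ρ, ∀ z : ℂ, ‖z‖ ≤ t →
      x + z • v ∈ closedBall x0 (2 * ρ) := fun x hx z hz => by
    rw [mem_closedBall]
    calc dist (x + z • v) x0 ≤ dist (x + z • v) x + dist x x0 := dist_triangle _ _ _
      _ ≤ ρ + ρ := by
        gcongr
        · simp only [dist_eq_norm, add_sub_cancel_left, norm_smul]
          exact (mul_le_mul_of_nonneg_right hz (norm_nonneg v)).trans htv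
        · exact (mem_ball.1 hx).le
      _ = 2 * ρ := by ring
  have h23 : closedBall x0 (2 * ρ) ⊆ closedBall x0 (3 * ρ) :=
    closedBall_subset_closedBall (by linarith)
  have heq : (fun x => fderiv ℂ f x v) =ᶠ[𝓝 x0] fun x => (2 * π * I : ℂ)⁻¹ •
      ∮ z in C(0, t), (1 / (z - 0) ^ (1 + 1)) • f (x + z • v) := by
    filter_upwards [ball_mem_nhds x0 hρ] with x hx
    exact fderiv_apply_eq_circleIntegral htpos fun z hz =>
      hfd _ (h23 (hmem x hx z (by simpa using hz)))
  refine DifferentiableAt.congr_of_eventuallyEq ?_ heq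
  refine DifferentiableAt.fun_const_smul ?_ _; simp only [circleIntegral]
  have hcn : ∀ θ : ℝ, ‖circleMap 0 t θ‖ = t := fun θ => by simp [abs_of_pos htpos]
  have hcont : Continuous (fun θ : ℝ => deriv (circleMap 0 t) θ * (1 / (circleMap 0 t θ - 0) ^ (1 + 1))) := by
    refine Continuous.mul ?_ ?_
    · rw [show deriv (circleMap 0 t) = fun θ => circleMap 0 t θ * I from
        funext fun θ => deriv_circleMap 0 t θ]
      exact (continuous_circleMap 0 t).mul continuous_const
    · refine Continuous.div continuous_const
        (((continuous_circleMap 0 t).sub continuous_const).pow _) fun θ => pow_ne_zero _ ?_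
      rw [sub_zero, ← norm_pos_iff, hcn]; exact htpos
  have hfc : ∀ x ∈ ball x0 ρ, Continuous fun θ : ℝ => f (x + circleMap 0 t θ • v) := by
    intro x hx; refine continuous_iff_continuousAt.2 fun θ => ?_
    refine ContinuousAt.comp (g := f) (hfd _ (h23 (hmem x hx _ (hcn θ).le))).continuousAt ?_
    exact (continuous_const.add ((continuous_circleMap 0 t).smul continuous_const)).continuousAt
  refine (intervalIntegral.hasFDerivAt_integral_of_dominated_of_fderiv_le (𝕜 := ℂ)
    (F' := fun x θ => (deriv (circleMap 0 t) θ * (1 / (circleMap 0 t θ - 0) ^ (1 + 1))) •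
      fderiv ℂ f (x + circleMap 0 t θ • v))
    (bound := fun θ => ‖deriv (circleMap 0 t) θ * (1 / (circleMap 0 t θ - 0) ^ (1 + 1))‖ * (M / ρ))
    (ball_mem_nhds x0 hρ) ?_ ?_ ?_ ?_ ?_ ?_).differentiableAt
  · filter_upwards [ball_mem_nhds x0 hρ] with x hx
    simp only [smul_eq_mul, ← mul_assoc]
    exact (hcont.mul (hfc x hx)).aestronglyMeasurable
  · simp only [smul_eq_mul, ← mul_assoc]
    exact (hcont.mul (hfc x0 (mem_ball_self hρ))).intervalIntegrable _ _
  · refine MeasureTheory.AEStronglyMeasurable.smul hcont.aestronglyMeasurable ?_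
    refine Measurable.aestronglyMeasurable ?_
    -- Continuity of the derivative is not known yet; a derivative is measurable in any case.
    refine (measurable_fderiv ℂ f).comp ?_
    exact (continuous_const.add ((continuous_circleMap 0 t).smul continuous_const)).measurable
  · refine .of_forall fun θ _ x hx => ?_
    rw [norm_smul]; gcongr; exact hD _ (hmem x hx _ (hcn θ).le)
  · exact (hcont.norm.mul continuous_const).intervalIntegrable _ _
  · refine .of_forall fun θ _ x hx => ?_
    have h1 := (hfd _ (h23 (hmem x hx _ (hcn θ).le))).hasFDerivAt.comp x
      ((hasFDerivAt_id x).add_const (circleMap 0 t θ • v))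
    simp only [smul_eq_mul, ← mul_assoc]; simpa using h1.const_mul _

/-- In finite dimension the derivative is `C^n` as soon as all directional derivatives are, and
these are again holomorphic, so the induction applies to them. -/
theorem contDiffOn_nat_of_holomorphic {U : Set E} (hU : IsOpen U) (n : ℕ) :
    ∀ {f : E → ℂ}, DifferentiableOn ℂ f U → ContDiffOn ℂ n f U := by
  induction n with
  | zero => intro f hf; exact contDiffOn_zero.2 hf.continuousOn
  | succ n ih =>
    intro f hf; push_cast; rw [contDiffOn_succ_iff_fderiv_of_isOpen hU]; refine ⟨hf, by simp, ?_⟩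
    rw [contDiffOn_clm_apply]
    exact fun v => ih (differentiableOn_fderiv_apply_of_holomorphic hU hf v)

theorem contDiffOn_infty_of_holomorphic {U : Set E} (hU : IsOpen U)
    {f : E → ℂ} (hf : DifferentiableOn ℂ f U) : ContDiffOn ℂ ∞ f U :=
  contDiffOn_infty.2 fun n => contDiffOn_nat_of_holomorphic hU n hf

theorem contDiffOn_pi_infty_of_holomorphic {ι : Type*} [Fintype ι] {U : Set E} (hU : IsOpen U)
    {f : E → ι → ℂ} (hf : DifferentiableOn ℂ f U) : ContDiffOn ℂ ∞ f U :=
  contDiffOn_pi.2 fun i => contDiffOn_infty_of_holomorphic hU ((differentiableOn_pi.1 hf) i)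

end Holomorphic

/-! ### Stokes' theorem for holomorphic volume forms on graph domains -/

/-- The partial derivative of a complex function of three real variables. -/
noncomputable def partialDeriv (u : R3 → ℂ) (k : Fin 3) (y : R3) : ℂ := fderiv ℝ u y (Pi.single k 1)

/-- The Jacobian determinant of three complex functions of three real variables. -/
noncomputable def jacobian3 (a b c : R3 → ℂ) (y : R3) : ℂ :=
  partialDeriv a 0 y * (partialDeriv b 1 y * partialDeriv c 2 y
      - partialDeriv b 2 y * partialDeriv c 1 y)
    + partialDeriv a 1 y * (partialDeriv b 2 y * partialDeriv c 0 y
      - partialDeriv b 0 y * partialDeriv c 2 y)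
    + partialDeriv a 2 y * (partialDeriv b 0 y * partialDeriv c 1 y
      - partialDeriv b 1 y * partialDeriv c 0 y)

/-- Integration by parts against the constant `1`. -/
theorem integral_partialDeriv_eq_zero {g : R3 → ℂ} (hg : ContDiff ℝ 1 g)
    (hc : HasCompactSupport g) (k : Fin 3) : ∫ y, partialDeriv g k y = 0 := by
  have hcont : Continuous fun y => fderiv ℝ g y (Pi.single k 1) :=
    (hg.continuous_fderiv one_ne_zero).clm_apply continuous_const
  have hcs : HasCompactSupport fun y => fderiv ℝ g y (Pi.single k 1) := hc.fderiv_apply ℝ _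
  have h := integral_smul_fderiv_eq_neg_fderiv_smul_of_integrable (𝕜 := ℝ) (μ := volume)
    (f := fun _ : R3 => (1 : ℝ)) (g := g) (v := Pi.single k 1) (by simp)
    (by simpa using hcont.integrable_of_hasCompactSupport hcs)
    (by simpa using hg.continuous.integrable_of_hasCompactSupport hc)
    (fun _ _ => differentiableAt_const _) (fun y _ => hg.differentiable one_ne_zero y)
  simpa [partialDeriv] using h

/-- Extension by zero: off the support of `a` the product vanishes locally, so nothing is asked of
`V` outside `Y`. -/
theorem contDiff_mul_of_tsupport_subset {a V : R3 → ℂ} {Y : Set R3} {n : WithTop ℕ∞}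
    (hY : IsOpen Y) (ha : ContDiff ℝ n a) (hs : tsupport a ⊆ Y) (hV : ContDiffOn ℝ n V Y) :
    ContDiff ℝ n (fun y => a y * V y) := by
  rw [contDiff_iff_contDiffAt]; intro y; by_cases hy : y ∈ tsupport a
  · exact ha.contDiffAt.mul (hV.contDiffAt (hY.mem_nhds (hs hy)))
  · have h0 : (fun y => a y * V y) =ᶠ[𝓝 y] fun _ => 0 := by
      filter_upwards [notMem_tsupport_iff_eventuallyEq.1 hy] with z hz; simp [hz]
    exact contDiffAt_const.congr_of_eventuallyEq h0

theorem contDiffOn_partialDeriv {b : R3 → ℂ} {Y : Set R3} (hY : IsOpen Y)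
    (hb : ContDiffOn ℝ 2 b Y) (k : Fin 3) : ContDiffOn ℝ 1 (partialDeriv b k) Y :=
  (hb.fderiv_of_isOpen hY (by norm_num)).clm_apply contDiffOn_const

theorem partialDeriv_partialDeriv_comm {b : R3 → ℂ} {Y : Set R3} (hY : IsOpen Y)
    (hb : ContDiffOn ℝ 2 b Y) {y : R3} (hy : y ∈ Y) (k l : Fin 3) :
    partialDeriv (partialDeriv b k) l y = partialDeriv (partialDeriv b l) k y := by
  have hsym : IsSymmSndFDerivAt ℝ b y :=
    (hb.contDiffAt (hY.mem_nhds hy)).isSymmSndFDerivAt (by simp)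
  have hd : DifferentiableAt ℝ (fderiv ℝ b) y :=
    ((hb.fderiv_of_isOpen hY (m := 1) (by norm_num)).contDiffAt
      (hY.mem_nhds hy)).differentiableAt one_ne_zero
  have h : ∀ k l : Fin 3, partialDeriv (partialDeriv b k) l y
      = fderiv ℝ (fderiv ℝ b) y (Pi.single l 1) (Pi.single k 1) := fun k l => by
    change fderiv ℝ (fun z => fderiv ℝ b z (Pi.single k 1)) y (Pi.single l 1) = _
    rw [fderiv_clm_apply hd (differentiableAt_const _)]; simp
  rw [h, h]; exact hsym _ _

theorem partialDeriv_mul {a b : R3 → ℂ} {y : R3} (ha : DifferentiableAt ℝ a y)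
    (hb : DifferentiableAt ℝ b y) (k : Fin 3) :
    partialDeriv (fun z => a z * b z) k y
      = partialDeriv a k y * b y + a y * partialDeriv b k y := by
  simp only [partialDeriv]; rw [fderiv_fun_mul ha hb]; simp; ring

theorem partialDeriv_sub {a b : R3 → ℂ} {y : R3} (ha : DifferentiableAt ℝ a y)
    (hb : DifferentiableAt ℝ b y) (k : Fin 3) :
    partialDeriv (fun z => a z - b z) k y = partialDeriv a k y - partialDeriv b k y := by
  simp only [partialDeriv]; rw [fderiv_fun_sub ha hb]; simp

/-- The Jacobian determinant of a compactly supported function and two further functions has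
integral zero. -/
theorem integral_jacobian3_eq_zero {a b c : R3 → ℂ} {Y : Set R3} (hY : IsOpen Y)
    (ha : ContDiff ℝ 1 a) (hac : HasCompactSupport a) (hs : tsupport a ⊆ Y)
    (hb : ContDiffOn ℝ 2 b Y) (hc : ContDiffOn ℝ 2 c Y) : ∫ y, jacobian3 a b c y = 0 := by
  set V : Fin 3 → Fin 3 → R3 → ℂ := fun k l y =>
    partialDeriv b k y * partialDeriv c l y - partialDeriv b l y * partialDeriv c k y with hVdef
  have hV : ∀ k l, ContDiffOn ℝ 1 (V k l) Y := fun k l =>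
    ((contDiffOn_partialDeriv hY hb k).mul (contDiffOn_partialDeriv hY hc l)).sub
      ((contDiffOn_partialDeriv hY hb l).mul (contDiffOn_partialDeriv hY hc k))
  have hg : ∀ k l, ContDiff ℝ 1 (fun y => a y * V k l y) := fun k l =>
    contDiff_mul_of_tsupport_subset hY ha hs (hV k l)
  have hgc : ∀ k l, HasCompactSupport (fun y => a y * V k l y) := fun k l => hac.mul_right
  have hint : ∀ k l m, Integrable (partialDeriv (fun y => a y * V k l y) m) := fun k l m =>
    (((hg k l).continuous_fderiv one_ne_zero).clm_apply
      continuous_const).integrable_of_hasCompactSupport ((hgc k l).fderiv_apply ℝ _)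
  -- The Jacobian is `∇a · (∇b × ∇c)`, and `∇b × ∇c` is divergence-free by the symmetry of second
  -- derivatives; so it is the divergence of `a (∇b × ∇c)`. Off the support of `a` both sides
  -- vanish.
  have hkey : ∀ y, jacobian3 a b c y = partialDeriv (fun y => a y * V 1 2 y) 0 y
      + partialDeriv (fun y => a y * V 2 0 y) 1 y + partialDeriv (fun y => a y * V 0 1 y) 2 y := by
    intro y; by_cases hy : y ∈ tsupport a
    · have hyY := hY.mem_nhds (hs hy)
      have hda : DifferentiableAt ℝ a y := ha.differentiable one_ne_zero y
      have hdb : ∀ k, DifferentiableAt ℝ (partialDeriv b k) y := fun k =>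
        ((contDiffOn_partialDeriv hY hb k).contDiffAt hyY).differentiableAt one_ne_zero
      have hdc : ∀ k, DifferentiableAt ℝ (partialDeriv c k) y := fun k =>
        ((contDiffOn_partialDeriv hY hc k).contDiffAt hyY).differentiableAt one_ne_zero
      have hpV : ∀ k l m, partialDeriv (V k l) m y
          = (partialDeriv (partialDeriv b k) m y * partialDeriv c l y
            + partialDeriv b k y * partialDeriv (partialDeriv c l) m y)
            - (partialDeriv (partialDeriv b l) m y * partialDeriv c k y
            + partialDeriv b l y * partialDeriv (partialDeriv c k) m y) := fun k l m => by
        have h := partialDeriv_sub ((hdb k).fun_mul (hdc l)) ((hdb l).fun_mul (hdc k)) m; rw [hVdef]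
        refine h.trans ?_; rw [ partialDeriv_mul (hdb k) (hdc l), partialDeriv_mul (hdb l) (hdc k)]
      have hdV : ∀ k l, DifferentiableAt ℝ (V k l) y := fun k l =>
        ((hV k l).contDiffAt hyY).differentiableAt one_ne_zero
      rw [partialDeriv_mul hda (hdV _ _), partialDeriv_mul hda (hdV _ _),
        partialDeriv_mul hda (hdV _ _), hpV, hpV, hpV,
        partialDeriv_partialDeriv_comm hY hb (hs hy) 1 0,
        partialDeriv_partialDeriv_comm hY hb (hs hy) 2 0,
        partialDeriv_partialDeriv_comm hY hb (hs hy) 2 1,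
        partialDeriv_partialDeriv_comm hY hc (hs hy) 1 0,
        partialDeriv_partialDeriv_comm hY hc (hs hy) 2 0,
        partialDeriv_partialDeriv_comm hY hc (hs hy) 2 1]
      simp only [jacobian3, hVdef]; ring
    · have h0 : ∀ V : R3 → ℂ, (fun y => a y * V y) =ᶠ[𝓝 y] fun _ => 0 := fun V => by
        filter_upwards [notMem_tsupport_iff_eventuallyEq.1 hy] with z hz; simp [hz]
      have ha0 : a =ᶠ[𝓝 y] fun _ => 0 := notMem_tsupport_iff_eventuallyEq.1 hy
      simp only [jacobian3, partialDeriv, (h0 _).fderiv_eq, ha0.fderiv_eq]; simp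
  simp only [hkey]; have h2 := (hint 1 2 0).fun_add (hint 2 0 1)
  rw [integral_add h2 (hint _ _ _),
    integral_add (hint _ _ _) (hint _ _ _), integral_partialDeriv_eq_zero (hg _ _) (hgc _ _),
    integral_partialDeriv_eq_zero (hg _ _) (hgc _ _),
    integral_partialDeriv_eq_zero (hg _ _) (hgc _ _)]
  simp

theorem clm_apply_eq_sum (L : C3 →L[ℂ] ℂ) (v : C3) :
    L v = L (Pi.single 0 1) * v 0 + L (Pi.single 1 1) * v 1 + L (Pi.single 2 1) * v 2 := by
  have hv : v = v 0 • (Pi.single 0 1 : C3) + v 1 • (Pi.single 1 1 : C3)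
      + v 2 • (Pi.single 2 1 : C3) := by
    funext i; fin_cases i <;> simp
  conv_lhs => rw [hv]
  simp only [map_add, map_smul, smul_eq_mul]; ring

/-- The entry `∂(x_j + i η_j) / ∂x_k`. -/
noncomputable def domainEntry (η : R3 → R3) (y : R3) (j k : Fin 3) : ℂ :=
  (if j = k then (1 : ℂ) else 0) + I * ((fderiv ℝ η y (Pi.single k 1) j : ℝ) : ℂ)

theorem hasFDerivAt_domainPt {η : R3 → R3} {y : R3} (h : DifferentiableAt ℝ η y) :
    HasFDerivAt (domainPt η) (ContinuousLinearMap.pi fun j =>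
      ofRealCLM.comp (proj j)
        + I • ofRealCLM.comp ((proj j).comp (fderiv ℝ η y))) y := by
  rw [hasFDerivAt_pi']; intro j
  have h1 : HasFDerivAt (fun x : R3 => ((x j : ℝ) : ℂ))
      (ofRealCLM.comp (proj j)) y :=
    (ofRealCLM.comp (proj (R := ℝ) (φ := fun _ : Fin 3 => ℝ) j)).hasFDerivAt
  have h2 : HasFDerivAt (fun x : R3 => ((η x j : ℝ) : ℂ))
      (ofRealCLM.comp ((proj j).comp (fderiv ℝ η y))) y :=
    (ofRealCLM.comp
      (proj (R := ℝ) (φ := fun _ : Fin 3 => ℝ) j)).hasFDerivAt.comp y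
        h.hasFDerivAt
  exact h1.add (h2.const_mul I)

theorem contDiffOn_domainPt {η : R3 → R3} {Y : Set R3} {n : WithTop ℕ∞}
    (h : ContDiffOn ℝ n η Y) : ContDiffOn ℝ n (domainPt η) Y := by
  rw [contDiffOn_pi]; intro j
  have h1 : ContDiffOn ℝ n (fun x : R3 => ((x j : ℝ) : ℂ)) Y :=
    (ofRealCLM.comp
      (proj (R := ℝ) (φ := fun _ : Fin 3 => ℝ) j)).contDiff.contDiffOn
  have h2 : ContDiffOn ℝ n (fun x : R3 => ((η x j : ℝ) : ℂ)) Y :=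
    (ofRealCLM.comp
      (proj (R := ℝ) (φ := fun _ : Fin 3 => ℝ) j)).contDiff.comp_contDiffOn h
  exact h1.add (contDiffOn_const.mul h2)

theorem fderiv_domainPt_single {η : R3 → R3} {y : R3} (h : DifferentiableAt ℝ η y)
    (k : Fin 3) : fderiv ℝ (domainPt η) y (Pi.single k 1) = fun j => domainEntry η y j k := by
  rw [(hasFDerivAt_domainPt h).fderiv]; funext j
  simp only [domainEntry, pi_apply, add_apply,
    ContinuousLinearMap.comp_apply, ContinuousLinearMap.proj_apply,
    smul_apply, smul_eq_mul, ofRealCLM_apply, Pi.single_apply]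
  split_ifs <;> simp

theorem partialDeriv_domainPt {η : R3 → R3} {y : R3} (h : DifferentiableAt ℝ η y)
    (j k : Fin 3) : partialDeriv (fun x => domainPt η x j) k y = domainEntry η y j k := by
  have h1 := (hasFDerivAt_pi'.1 (hasFDerivAt_domainPt h).differentiableAt.hasFDerivAt) j
  rw [partialDeriv, h1.fderiv, ContinuousLinearMap.comp_apply, fderiv_domainPt_single h]; rfl

theorem partialDeriv_comp_domainPt {H : C3 → ℂ} {η : R3 → R3} {y : R3}
    (h : DifferentiableAt ℝ η y) (hH : DifferentiableAt ℂ H (domainPt η y)) (k : Fin 3) :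
    partialDeriv (fun x => H (domainPt η x)) k y
      = fderiv ℂ H (domainPt η y) (fun j => domainEntry η y j k) := by
  have h1 : HasFDerivAt (fun x => H (domainPt η x)) _ y :=
    (hH.hasFDerivAt.restrictScalars ℝ).comp y (hasFDerivAt_domainPt h).differentiableAt.hasFDerivAt
  rw [partialDeriv, h1.fderiv, ContinuousLinearMap.comp_apply, fderiv_domainPt_single h]; rfl

/-- The `t`-derivative of the density `H dξ1 ∧ dξ2 ∧ dξ3` on `{y + i (θ + t ψ)(y)}`. -/
noncomputable def deformationRate (H : C3 → ℂ) (θ ψ : R3 → R3) (t : ℝ) (y : R3) : ℂ :=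
  let Φ := fun j y => domainPt (fun y => θ y + t • ψ y) y j
  let a := fun j y => (I * (ψ y j : ℂ)) * H (domainPt (fun y => θ y + t • ψ y) y)
  jacobian3 (a 0) (Φ 1) (Φ 2) y + jacobian3 (a 1) (Φ 2) (Φ 0) y + jacobian3 (a 2) (Φ 0) (Φ 1) y

theorem domainEntry_add_smul {θ ψ : R3 → R3} {y : R3} (hθ : DifferentiableAt ℝ θ y)
    (hψ : DifferentiableAt ℝ ψ y) (t : ℝ) (j k : Fin 3) :
    domainEntry (fun y => θ y + t • ψ y) y j k
      = domainEntry θ y j k + t * (I * ((fderiv ℝ ψ y (Pi.single k 1) j : ℝ) : ℂ)) := by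
  simp only [domainEntry]; rw [fderiv_fun_add hθ (hψ.fun_const_smul t), fderiv_fun_const_smul hψ]
  simp; ring

theorem volumeDensity_eq (η : R3 → R3) (y : R3) :
    volumeDensity η y =
      domainEntry η y 0 0 * domainEntry η y 1 1 * domainEntry η y 2 2
      - domainEntry η y 0 0 * domainEntry η y 1 2 * domainEntry η y 2 1
      - domainEntry η y 0 1 * domainEntry η y 1 0 * domainEntry η y 2 2
      + domainEntry η y 0 1 * domainEntry η y 1 2 * domainEntry η y 2 0
      + domainEntry η y 0 2 * domainEntry η y 1 0 * domainEntry η y 2 1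
      - domainEntry η y 0 2 * domainEntry η y 1 1 * domainEntry η y 2 0 := by
  rw [volumeDensity, Matrix.det_fin_three]; rfl

theorem partialDeriv_smul_comp_domainPt {H : C3 → ℂ} {θ ψ : R3 → R3} {y : R3} {t : ℝ}
    (hθ : DifferentiableAt ℝ θ y) (hψ : DifferentiableAt ℝ ψ y)
    (hH : DifferentiableAt ℂ H (domainPt (fun y => θ y + t • ψ y) y)) (j k : Fin 3) :
    partialDeriv (fun y => (I * (ψ y j : ℂ)) * H (domainPt (fun y => θ y + t • ψ y) y)) k y
      = (I * ((fderiv ℝ ψ y (Pi.single k 1) j : ℝ) : ℂ)) * H (domainPt (fun y => θ y + t • ψ y) y)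
        + (I * (ψ y j : ℂ)) * fderiv ℂ H (domainPt (fun y => θ y + t • ψ y) y)
          (fun m => domainEntry θ y m k
            + t * (I * ((fderiv ℝ ψ y (Pi.single k 1) m : ℝ) : ℂ))) := by
  have hη : DifferentiableAt ℝ (fun y => θ y + t • ψ y) y := hθ.add (hψ.const_smul t)
  have h1 : HasFDerivAt (fun y => I * (ψ y j : ℂ))
      (I • ofRealCLM.comp ((proj j).comp (fderiv ℝ ψ y))) y := by
    have := (ofRealCLM.comp
      (proj (R := ℝ) (φ := fun _ : Fin 3 => ℝ) j)).hasFDerivAt.comp y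
        hψ.hasFDerivAt
    exact this.const_mul I
  have h2 : DifferentiableAt ℝ (fun y => H (domainPt (fun y => θ y + t • ψ y) y)) y :=
    (hH.restrictScalars ℝ).comp y (hasFDerivAt_domainPt hη).differentiableAt
  rw [partialDeriv_mul h1.differentiableAt h2, partialDeriv_comp_domainPt hη hH, partialDeriv,
    h1.fderiv]
  simp only [domainEntry_add_smul hθ hψ]; simp

/-- Cartan's formula in coordinates. The form `H dξ₁ ∧ dξ₂ ∧ dξ₃` is closed because `H` is
holomorphic, so its derivative along the velocity `iψ` is the exterior derivative of the contraction
with `iψ`; the three Jacobians of `deformationRate` are the three terms of the latter. -/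
theorem hasDerivAt_density {H : C3 → ℂ} {θ ψ : R3 → R3} {y : R3} {t : ℝ}
    (hθ : DifferentiableAt ℝ θ y) (hψ : DifferentiableAt ℝ ψ y)
    (hH : DifferentiableAt ℂ H (domainPt (fun y => θ y + t • ψ y) y)) :
    HasDerivAt (fun t : ℝ => H (domainPt (fun y => θ y + t • ψ y) y)
      * volumeDensity (fun y => θ y + t • ψ y) y) (deformationRate H θ ψ t y) t := by
  have hη : DifferentiableAt ℝ (fun y => θ y + t • ψ y) y := hθ.add (hψ.const_smul t)
  have hΦ : HasDerivAt (fun t : ℝ => domainPt (fun y => θ y + t • ψ y) y)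
      (fun j => I * (ψ y j : ℂ)) t := by
    rw [hasDerivAt_pi]; intro j
    have h1 : HasDerivAt (fun t : ℝ => ((θ y + t • ψ y) j : ℝ)) (ψ y j) t := by
      simpa using ((hasDerivAt_id t).mul_const (ψ y j)).const_add (θ y j)
    exact (h1.ofReal_comp.const_mul I).const_add _
  have hh : HasDerivAt (fun t : ℝ => H (domainPt (fun y => θ y + t • ψ y) y)) _ t :=
    (hH.hasFDerivAt.restrictScalars ℝ).comp_hasDerivAt t hΦ
  have he : ∀ j k, HasDerivAt (fun t : ℝ => domainEntry (fun y => θ y + t • ψ y) y j k)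
      (I * ((fderiv ℝ ψ y (Pi.single k 1) j : ℝ) : ℂ)) t := fun j k => by
    simp only [domainEntry_add_smul hθ hψ]
    simpa using ((hasDerivAt_id t).ofReal_comp.mul_const _).const_add (domainEntry θ y j k)
  simp only [volumeDensity_eq]
  have hdet := hh.mul (((((((he 0 0).mul (he 1 1)).mul (he 2 2)).sub
    (((he 0 0).mul (he 1 2)).mul (he 2 1))).sub (((he 0 1).mul (he 1 0)).mul (he 2 2))).add
    (((he 0 1).mul (he 1 2)).mul (he 2 0))).add (((he 0 2).mul (he 1 0)).mul (he 2 1))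
    |>.sub (((he 0 2).mul (he 1 1)).mul (he 2 0)))
  refine HasDerivAt.congr_deriv hdet ?_
  simp only [deformationRate, jacobian3, partialDeriv_domainPt hη,
    partialDeriv_smul_comp_domainPt hθ hψ hH, ContinuousLinearMap.coe_restrictScalars',
    Pi.mul_apply, Pi.add_apply, Pi.sub_apply]
  -- With the three complex partial derivatives of `H` as unknowns, both sides are polynomials in
  -- these and in the matrix entries. Complex linearity of the derivative is the only analytic
  -- input.
  obtain ⟨c0, c1, c2, hc⟩ : ∃ c0 c1 c2 : ℂ, ∀ v : C3,
      fderiv ℂ H (domainPt (fun y => θ y + t • ψ y) y) v = c0 * v 0 + c1 * v 1 + c2 * v 2 :=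
    ⟨_, _, _, clm_apply_eq_sum _⟩
  simp only [hc, domainEntry_add_smul hθ hψ]; ring

theorem continuousOn_fderiv_apply {η : R3 → R3} {Y : Set R3} (hY : IsOpen Y)
    (h : ContDiffOn ℝ ∞ η Y) (v : R3) (j : Fin 3) :
    ContinuousOn (fun y => ((fderiv ℝ η y v j : ℝ) : ℂ)) Y := by
  have h1 : ContinuousOn (fun y => fderiv ℝ η y v) Y :=
    (h.continuousOn_fderiv_of_isOpen hY (by simp)).clm_apply continuousOn_const
  exact continuous_ofReal.comp_continuousOn ((continuous_apply j).comp_continuousOn h1)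

theorem continuousOn_domainEntry {η : R3 → R3} {Y : Set R3} (hY : IsOpen Y)
    (h : ContDiffOn ℝ ∞ η Y) (j k : Fin 3) : ContinuousOn (fun y => domainEntry η y j k) Y :=
  continuousOn_const.add (continuousOn_const.mul (continuousOn_fderiv_apply hY h _ j))

theorem continuousOn_volumeDensity {η : R3 → R3} {Y : Set R3} (hY : IsOpen Y)
    (h : ContDiffOn ℝ ∞ η Y) : ContinuousOn (volumeDensity η) Y := by
  rw [show volumeDensity η = _ from funext (volumeDensity_eq η)]
  have he := fun j k => continuousOn_domainEntry hY h j k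
  fun_prop

theorem continuousOn_deformationRate {H : C3 → ℂ} {Ω : Set C3} {Y : Set R3} {θ ψ : R3 → R3}
    (hΩ : IsOpen Ω) (hH : DifferentiableOn ℂ H Ω) (hY : IsOpen Y) (hθ : ContDiffOn ℝ ∞ θ Y)
    (hψ : ContDiff ℝ ∞ ψ)
    (hmem : ∀ t ∈ Icc (0 : ℝ) 1, ∀ y ∈ Y, domainPt (fun y => θ y + t • ψ y) y ∈ Ω) :
    ContinuousOn (fun q : ℝ × R3 => deformationRate H θ ψ q.1 q.2) (Icc (0 : ℝ) 1 ×ˢ Y) := by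
  set S : Set (ℝ × R3) := Icc (0 : ℝ) 1 ×ˢ Y with hS
  have hsnd : MapsTo Prod.snd S Y := fun q hq => hq.2
  have hdθ : ∀ y ∈ Y, DifferentiableAt ℝ θ y := fun y hy =>
    (hθ.contDiffAt (hY.mem_nhds hy)).differentiableAt (by simp)
  have hdψ : ∀ y, DifferentiableAt ℝ ψ y := fun y => hψ.differentiable (by simp) y
  have ht : ContinuousOn (fun q : ℝ × R3 => ((q.1 : ℝ) : ℂ)) S := by fun_prop
  have hΦ : ContinuousOn (fun q : ℝ × R3 => domainPt (fun y => θ y + q.1 • ψ y) q.2) S := by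
    have h1 : ContinuousOn (fun q : ℝ × R3 => θ q.2) S := hθ.continuousOn.comp continuousOn_snd hsnd
    have h2 : Continuous (fun q : ℝ × R3 => ψ q.2) := hψ.continuous.comp continuous_snd
    have h3 : ContinuousOn (fun q : ℝ × R3 => θ q.2 + q.1 • ψ q.2) S :=
      h1.add (continuous_fst.smul h2).continuousOn
    refine continuousOn_pi.2 fun j => ?_
    have h4 : ContinuousOn (fun q : ℝ × R3 => (θ q.2 + q.1 • ψ q.2) j) S :=
      (continuous_apply j).comp_continuousOn h3
    have h5 : Continuous (fun q : ℝ × R3 => ((q.2 j : ℝ) : ℂ)) := by fun_prop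
    exact h5.continuousOn.add (continuousOn_const.mul (continuous_ofReal.comp_continuousOn h4))
  have hΦΩ : MapsTo (fun q : ℝ × R3 => domainPt (fun y => θ y + q.1 • ψ y) q.2) S Ω :=
    fun q hq => hmem q.1 hq.1 q.2 hq.2
  have hHΦ := hH.continuousOn.comp hΦ hΦΩ
  have hdH : ∀ q ∈ S, DifferentiableAt ℂ H (domainPt (fun y => θ y + q.1 • ψ y) q.2) :=
    fun q hq => (hH _ (hΦΩ hq)).differentiableAt (hΩ.mem_nhds (hΦΩ hq))
  have hDH : ContinuousOn (fun q : ℝ × R3 =>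
      fderiv ℂ H (domainPt (fun y => θ y + q.1 • ψ y) q.2)) S :=
    ((contDiffOn_infty_of_holomorphic hΩ hH).continuousOn_fderiv_of_isOpen hΩ (by simp)).comp hΦ hΦΩ
  have hE : ∀ j k, ContinuousOn (fun q : ℝ × R3 =>
      I * ((fderiv ℝ ψ q.2 (Pi.single k 1) j : ℝ) : ℂ)) S := fun j k =>
    continuousOn_const.mul ((continuousOn_fderiv_apply isOpen_univ hψ.contDiffOn _ j).comp
      continuousOn_snd (mapsTo_univ _ _))
  have hθE : ∀ j k, ContinuousOn (fun q : ℝ × R3 => domainEntry θ q.2 j k) S := fun j k =>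
    (continuousOn_domainEntry hY hθ j k).comp continuousOn_snd hsnd
  have hM : ∀ j k, ContinuousOn (fun q : ℝ × R3 => domainEntry θ q.2 j k
      + q.1 * (I * ((fderiv ℝ ψ q.2 (Pi.single k 1) j : ℝ) : ℂ))) S := fun j k =>
    (hθE j k).add (ht.mul (hE j k))
  have hψj : ∀ j, ContinuousOn (fun q : ℝ × R3 => I * ((ψ q.2 j : ℝ) : ℂ)) S := fun j =>
    (continuous_const.mul (continuous_ofReal.comp ((continuous_apply j).comp
      (hψ.continuous.comp continuous_snd)))).continuousOn
  have hP1 : ∀ j k, ContinuousOn (fun q : ℝ × R3 =>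
      partialDeriv (fun y => domainPt (fun y => θ y + q.1 • ψ y) y j) k q.2) S := fun j k => by
    refine (hM j k).congr fun q hq => ?_
    rw [partialDeriv_domainPt ((hdθ _ hq.2).fun_add ((hdψ _).fun_const_smul q.1)),
      domainEntry_add_smul (hdθ _ hq.2) (hdψ _)]
  have hP2 : ∀ j k, ContinuousOn (fun q : ℝ × R3 =>
      partialDeriv (fun y => (I * (ψ y j : ℂ))
        * H (domainPt (fun y => θ y + q.1 • ψ y) y)) k q.2) S := fun j k => by
    refine ContinuousOn.congr (f := fun q : ℝ × R3 =>
      (I * ((fderiv ℝ ψ q.2 (Pi.single k 1) j : ℝ) : ℂ))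
          * H (domainPt (fun y => θ y + q.1 • ψ y) q.2)
        + (I * (ψ q.2 j : ℂ)) * fderiv ℂ H (domainPt (fun y => θ y + q.1 • ψ y) q.2)
          (fun m => domainEntry θ q.2 m k
            + q.1 * (I * ((fderiv ℝ ψ q.2 (Pi.single k 1) m : ℝ) : ℂ)))) ?_ fun q hq =>
      partialDeriv_smul_comp_domainPt (hdθ _ hq.2) (hdψ _) (hdH q hq) j k
    exact ((hE j k).mul hHΦ).add ((hψj j).mul (hDH.clm_apply (continuousOn_pi.2 fun m => hM m k)))
  have key : ∀ j k l, ContinuousOn (fun q : ℝ × R3 =>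
      jacobian3 (fun y => (I * (ψ y j : ℂ)) * H (domainPt (fun y => θ y + q.1 • ψ y) y))
        (fun y => domainPt (fun y => θ y + q.1 • ψ y) y k)
        (fun y => domainPt (fun y => θ y + q.1 • ψ y) y l) q.2) S := fun j k l => by
    have h1 := hP2 j; have h2 := hP1 k; have h3 := hP1 l
    unfold jacobian3
    fun_prop
  exact ((key 0 1 2).add (key 1 2 0)).add (key 2 0 1)

/-- Each of the three terms is a Jacobian whose first function carries a factor `ψ j`, hence has
compact support in `Y`. -/
theorem integral_deformationRate {H : C3 → ℂ} {Ω : Set C3} {Y : Set R3} {θ ψ : R3 → R3}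
    (hΩ : IsOpen Ω) (hH : DifferentiableOn ℂ H Ω) (hY : IsOpen Y) (hθ : ContDiffOn ℝ ∞ θ Y)
    (hψ : ContDiff ℝ ∞ ψ) (hc : HasCompactSupport ψ) (hs : tsupport ψ ⊆ Y) {t : ℝ}
    (hmem : ∀ y ∈ Y, domainPt (fun y => θ y + t • ψ y) y ∈ Ω) :
    ∫ y in tsupport ψ, deformationRate H θ ψ t y = 0 := by
  have hη : ContDiffOn ℝ ∞ (fun y => θ y + t • ψ y) Y := hθ.add (hψ.contDiffOn.const_smul t)
  have hΦ := contDiffOn_domainPt hη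
  have hΦj : ∀ j, ContDiffOn ℝ ∞ (fun y => domainPt (fun y => θ y + t • ψ y) y j) Y := fun j =>
    contDiffOn_pi.1 hΦ j
  have hHΦ : ContDiffOn ℝ ∞ (fun y => H (domainPt (fun y => θ y + t • ψ y) y)) Y :=
    ((contDiffOn_infty_of_holomorphic hΩ hH).restrict_scalars ℝ).comp hΦ hmem
  have hψj : ∀ j, ContDiff ℝ ∞ (fun y => I * (ψ y j : ℂ)) := fun j =>
    contDiff_const.mul ((ofRealCLM.comp
      (proj (R := ℝ) (φ := fun _ : Fin 3 => ℝ) j)).contDiff.comp hψ)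
  have hsupp : ∀ j, tsupport (fun y => I * (ψ y j : ℂ)) ⊆ tsupport ψ := fun j => by
    refine closure_mono fun y hy => ?_
    rw [Function.mem_support] at hy ⊢; intro h0; simp [h0] at hy
  have hcs : ∀ j, HasCompactSupport (fun y => I * (ψ y j : ℂ)) := fun j =>
    hc.of_isClosed_subset (isClosed_tsupport _) (hsupp j)
  have ha : ∀ j, ContDiff ℝ ∞ (fun y => (I * (ψ y j : ℂ))
      * H (domainPt (fun y => θ y + t • ψ y) y)) := fun j =>
    contDiff_mul_of_tsupport_subset hY (hψj j) ((hsupp j).trans hs) hHΦ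
  have hac : ∀ j, HasCompactSupport (fun y => (I * (ψ y j : ℂ))
      * H (domainPt (fun y => θ y + t • ψ y) y)) := fun j => (hcs j).mul_right
  have has : ∀ j, tsupport (fun y => (I * (ψ y j : ℂ))
      * H (domainPt (fun y => θ y + t • ψ y) y)) ⊆ tsupport ψ := fun j =>
    (tsupport_mul_subset_left).trans (hsupp j)
  have hle1 : (1 : WithTop ℕ∞) ≤ ∞ := by simp
  have hle2 : (2 : WithTop ℕ∞) ≤ ∞ := ENat.LEInfty.out
  have hz : ∀ j k l, ∫ y, jacobian3 (fun y => (I * (ψ y j : ℂ))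
      * H (domainPt (fun y => θ y + t • ψ y) y))
      (fun y => domainPt (fun y => θ y + t • ψ y) y k)
      (fun y => domainPt (fun y => θ y + t • ψ y) y l) y = 0 := fun j k l =>
    integral_jacobian3_eq_zero hY ((ha j).of_le hle1) (hac j) ((has j).trans hs)
      ((hΦj k).of_le hle2) ((hΦj l).of_le hle2)
  have hoff : ∀ j k l, ∀ y ∉ tsupport ψ, jacobian3 (fun y => (I * (ψ y j : ℂ))
      * H (domainPt (fun y => θ y + t • ψ y) y))
      (fun y => domainPt (fun y => θ y + t • ψ y) y k)
      (fun y => domainPt (fun y => θ y + t • ψ y) y l) y = 0 := fun j k l y hy => by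
    have h0 := notMem_tsupport_iff_eventuallyEq.1 (fun h => hy (has j h))
    simp only [jacobian3, partialDeriv, h0.fderiv_eq]; simp
  have hcont : ∀ j k l, ContinuousOn (jacobian3 (fun y => (I * (ψ y j : ℂ))
      * H (domainPt (fun y => θ y + t • ψ y) y))
      (fun y => domainPt (fun y => θ y + t • ψ y) y k)
      (fun y => domainPt (fun y => θ y + t • ψ y) y l)) Y := fun j k l => by
    have h1 : ∀ m, ContinuousOn (partialDeriv (fun y => (I * (ψ y j : ℂ))
      * H (domainPt (fun y => θ y + t • ψ y) y)) m) Y := fun m =>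
      (contDiffOn_partialDeriv hY ((ha j).of_le hle2).contDiffOn m).continuousOn
    have h2 : ∀ k m, ContinuousOn
      (partialDeriv (fun y => domainPt (fun y => θ y + t • ψ y) y k) m) Y := fun k m =>
      (contDiffOn_partialDeriv hY ((hΦj k).of_le hle2) m).continuousOn
    have h2k := h2 k; have h2l := h2 l
    unfold jacobian3
    fun_prop
  have hK : IsCompact (tsupport ψ) := hc
  have hint : ∀ j k l, IntegrableOn (jacobian3 (fun y => (I * (ψ y j : ℂ))
      * H (domainPt (fun y => θ y + t • ψ y) y))
      (fun y => domainPt (fun y => θ y + t • ψ y) y k)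
      (fun y => domainPt (fun y => θ y + t • ψ y) y l)) (tsupport ψ) := fun j k l =>
    ((hcont j k l).mono hs).integrableOn_compact hK
  simp only [deformationRate]; have h01 := (hint 0 1 2).integrable.fun_add (hint 1 2 0).integrable
  rw [integral_add h01 (hint 2 0 1), integral_add (hint 0 1 2) (hint 1 2 0),
    setIntegral_eq_integral_of_forall_compl_eq_zero (hoff 0 1 2),
    setIntegral_eq_integral_of_forall_compl_eq_zero (hoff 1 2 0),
    setIntegral_eq_integral_of_forall_compl_eq_zero (hoff 2 0 1), hz, hz, hz]
  simp

/-- Stokes' theorem for the form `H dξ1 ∧ dξ2 ∧ dξ3`: its integral over `{y + i θ(y)}` does not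
change when the domain is moved, inside the set where `H` is holomorphic, by a field with compact
support. -/
theorem setIntegral_density_add {H : C3 → ℂ} {Ω : Set C3} {Y : Set R3} {θ ψ : R3 → R3}
    (hΩ : IsOpen Ω) (hH : DifferentiableOn ℂ H Ω) (hY : IsOpen Y) (hθ : ContDiffOn ℝ ∞ θ Y)
    (hψ : ContDiff ℝ ∞ ψ) (hc : HasCompactSupport ψ) (hs : tsupport ψ ⊆ Y)
    (hmem : ∀ t ∈ Icc (0 : ℝ) 1, ∀ y ∈ Y, domainPt (fun y => θ y + t • ψ y) y ∈ Ω)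
    (hint : IntegrableOn (fun y => H (domainPt θ y) * volumeDensity θ y) Y) :
    IntegrableOn (fun y => H (domainPt (fun y => θ y + ψ y) y)
      * volumeDensity (fun y => θ y + ψ y) y) Y ∧
    ∫ y in Y, H (domainPt (fun y => θ y + ψ y) y) * volumeDensity (fun y => θ y + ψ y) y
      = ∫ y in Y, H (domainPt θ y) * volumeDensity θ y := by
  set A : ℝ → R3 → ℂ := fun t y => H (domainPt (fun y => θ y + t • ψ y) y)
      * volumeDensity (fun y => θ y + t • ψ y) y with hA
  have hA0 : (fun y => H (domainPt θ y) * volumeDensity θ y) = A 0 := by simp [hA]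
  have hA1 : (fun y => H (domainPt (fun y => θ y + ψ y) y)
      * volumeDensity (fun y => θ y + ψ y) y) = A 1 := by simp [hA]
  have hK : IsCompact (tsupport ψ) := hc
  have hKm : MeasurableSet (tsupport ψ) := (isClosed_tsupport ψ).measurableSet
  have hdθ : ∀ y ∈ Y, DifferentiableAt ℝ θ y := fun y hy =>
    (hθ.contDiffAt (hY.mem_nhds hy)).differentiableAt (by simp)
  have hdψ : ∀ y, DifferentiableAt ℝ ψ y := fun y => hψ.differentiable (by simp) y
  have hR := (continuousOn_deformationRate hΩ hH hY hθ hψ hmem).mono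
    (prod_mono_right hs : Icc (0 : ℝ) 1 ×ˢ tsupport ψ ⊆ _)
  have hoff : ∀ y ∉ tsupport ψ, A 1 y - A 0 y = 0 := fun y hy => by
    have h0 : ψ =ᶠ[𝓝 y] 0 := notMem_tsupport_iff_eventuallyEq.1 hy
    have h1 : ∀ t : ℝ, (fun y => θ y + t • ψ y) =ᶠ[𝓝 y] θ := fun t => by
      filter_upwards [h0] with z hz; simp [hz]
    have h2 : ∀ t : ℝ, A t y = H (domainPt θ y) * volumeDensity θ y := fun t => by
      have h3 : domainPt (fun y => θ y + t • ψ y) y = domainPt θ y := by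
        have := (h1 t).self_of_nhds; simp only at this; funext i
        change _ + _ * (((θ y + t • ψ y) i : ℝ) : ℂ) = _; rw [this]; rfl
      simp only [hA, volumeDensity, (h1 t).fderiv_eq, h3]
    rw [h2, h2, sub_self]
  have hftc : ∀ y ∈ tsupport ψ, A 1 y - A 0 y = ∫ t in (0 : ℝ)..1, deformationRate H θ ψ t y := by
    intro y hy
    have hsub : ∀ t ∈ uIcc (0 : ℝ) 1, t ∈ Icc (0 : ℝ) 1 := fun t ht => by
      rwa [uIcc_of_le zero_le_one] at ht
    rw [integral_eq_sub_of_hasDerivAt (f := fun t => A t y)]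
    · intro t ht; have hΩt := hmem t (hsub t ht) y (hs hy)
      exact hasDerivAt_density (hdθ y (hs hy)) (hdψ y)
        ((hH _ hΩt).differentiableAt (hΩ.mem_nhds hΩt))
    · refine ContinuousOn.intervalIntegrable ?_
      exact hR.comp (f := fun t : ℝ => (t, y)) (by fun_prop) fun t ht => ⟨hsub t ht, hy⟩
  have hRint : Integrable (fun q : R3 × ℝ => deformationRate H θ ψ q.2 q.1)
      ((volume.restrict (tsupport ψ)).prod (volume.restrict (Ioc (0 : ℝ) 1))) := by
    rw [Measure.prod_restrict]
    refine IntegrableOn.mono_set (t := tsupport ψ ×ˢ Icc (0 : ℝ) 1) ?_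
      (prod_mono_right Ioc_subset_Icc_self)
    refine ContinuousOn.integrableOn_compact (hK.prod isCompact_Icc) ?_
    exact hR.comp (f := fun q : R3 × ℝ => (q.2, q.1)) (by fun_prop) fun q hq => ⟨hq.2, hq.1⟩
  have hdiffK : IntegrableOn (fun y => A 1 y - A 0 y) (tsupport ψ) := by
    refine IntegrableOn.congr_fun (f := fun y => ∫ t in Ioc (0 : ℝ) 1, deformationRate H θ ψ t y)
      hRint.integral_prod_left (fun y hy => ?_) hKm
    rw [hftc y hy, integral_of_le zero_le_one]
  have hdiff : Integrable (fun y => A 1 y - A 0 y) :=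
    (integrableOn_iff_integrable_of_support_subset fun y hy => by
      by_contra h
      exact hy (hoff y h)).1 hdiffK
  -- The difference is the time integral of an exact rate supported in a fixed compact set; Fubini
  -- lets the space integral, which vanishes at each time, be taken first.
  have hzero : ∫ y, (A 1 y - A 0 y) = 0 := by
    rw [← setIntegral_eq_integral_of_forall_compl_eq_zero hoff,
      setIntegral_congr_fun hKm (fun y hy => hftc y hy)]
    simp only [integral_of_le (zero_le_one' ℝ)]
    rw [integral_integral_swap hRint]
    refine (setIntegral_congr_fun (g := fun _ => 0) measurableSet_Ioc fun t ht => ?_).trans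
      (by simp)
    exact integral_deformationRate hΩ hH hY hθ hψ hc hs (hmem t (Ioc_subset_Icc_self ht))
  have hzeroY : ∫ y in Y, (A 1 y - A 0 y) = 0 := by
    rw [← hzero]
    exact setIntegral_eq_integral_of_forall_compl_eq_zero fun y hy => hoff y fun h => hy (hs h)
  rw [hA0] at hint
  -- The domain `Y` need not be compact, so integrability of the new density is inherited from the
  -- old one through the compactly supported difference.
  have hint1 : IntegrableOn (A 1) Y := by
    have := hdiff.integrableOn (s := Y) |>.add hint
    refine this.congr (.of_forall fun y => ?_); simp
  rw [hA1, hA0]; refine ⟨hint1, ?_⟩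
  rw [integral_sub hint1 hint] at hzeroY; exact sub_eq_zero.1 hzeroY

/-! ### Cauchy's theorem for graph contours -/

/-- The point `t + i h(t)` of the graph contour of `h`. -/
noncomputable def graphPt (h : ℝ → ℝ) (t : ℝ) : ℂ := (t : ℂ) + I * (h t : ℂ)

/-- The density of `f(z) dz` on the graph contour of `h`. -/
noncomputable def graphDensity (f : ℂ → ℂ) (h : ℝ → ℝ) (t : ℝ) : ℂ :=
  f (graphPt h t) * (1 + I * ((deriv h t : ℝ) : ℂ))

theorem hasDerivAt_graphPt {h : ℝ → ℝ} {t h' : ℝ} (hh : HasDerivAt h h' t) :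
    HasDerivAt (graphPt h) (1 + I * (h' : ℂ)) t :=
  ((hasDerivAt_id t).ofReal_comp).add ((hh.ofReal_comp).const_mul I)

theorem continuous_graphPt {h : ℝ → ℝ} (hh : Continuous h) : Continuous (graphPt h) := by
  unfold graphPt
  fun_prop

/-- Cauchy's theorem for two graph contours: the difference of the integrals comes from the
vertical segments that join their ends. -/
theorem norm_integral_graphDensity_sub_le {f : ℂ → ℂ} {Ω : Set ℂ} (hΩ : IsOpen Ω)
    (hf : DifferentiableOn ℂ f Ω) {h0 h₁ : ℝ → ℝ} (hh0 : ContDiff ℝ 1 h0) (hh1 : ContDiff ℝ 1 h₁)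
    {a b : ℝ} (hab : a ≤ b)
    (hmem : ∀ τ ∈ Icc (0 : ℝ) 1, ∀ t ∈ Icc a b, graphPt (fun t => h0 t + τ * (h₁ t - h0 t)) t ∈ Ω)
    {M : ℝ}
    (hMa : ∀ τ ∈ Icc (0 : ℝ) 1, ‖f (graphPt (fun t => h0 t + τ * (h₁ t - h0 t)) a)‖ ≤ M)
    (hMb : ∀ τ ∈ Icc (0 : ℝ) 1, ‖f (graphPt (fun t => h0 t + τ * (h₁ t - h0 t)) b)‖ ≤ M) :
    ‖(∫ t in a..b, graphDensity f h₁ t) - ∫ t in a..b, graphDensity f h0 t‖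
      ≤ M * |h₁ b - h0 b| + M * |h₁ a - h0 a| := by
  set Φ : ℝ → ℝ → ℂ := fun τ t => graphPt (fun t => h0 t + τ * (h₁ t - h0 t)) t with hΦdef
  set d0 := deriv h0 with hd₀; set d1 := deriv h₁ with hd₁
  have hd0 : ∀ t, HasDerivAt h0 (d0 t) t := fun t => (hh0.differentiable one_ne_zero t).hasDerivAt
  have hd1 : ∀ t, HasDerivAt h₁ (d1 t) t := fun t => (hh1.differentiable one_ne_zero t).hasDerivAt
  have hcd0 : Continuous d0 := hh0.continuous_deriv le_rfl
  have hcd1 : Continuous d1 := hh1.continuous_deriv le_rfl; have hch0 := hh0.continuous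
  have hch1 := hh1.continuous
  -- `B` is at once the `τ`-derivative of the `dt`-component and the `t`-derivative of the
  -- `dτ`-component of `f dz` pulled back to the rectangle: this is closedness of the form.
  -- Integrating it over the rectangle in both orders leaves only the two vertical ends.
  set B : ℝ → ℝ → ℂ := fun τ t =>
    deriv f (Φ τ t) * (I * ((h₁ t - h0 t : ℝ) : ℂ)) * (1 + I * ((d0 t + τ * (d1 t - d0 t) : ℝ) : ℂ))
      + f (Φ τ t) * (I * ((d1 t - d0 t : ℝ) : ℂ)) with hB
  have hdf : ∀ τ ∈ Icc (0 : ℝ) 1, ∀ t ∈ Icc a b, HasDerivAt f (deriv f (Φ τ t)) (Φ τ t) :=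
    fun τ hτ t ht => ((hf _ (hmem τ hτ t ht)).differentiableAt
      (hΩ.mem_nhds (hmem τ hτ t ht))).hasDerivAt
  have hτder : ∀ τ ∈ Icc (0 : ℝ) 1, ∀ t ∈ Icc a b, HasDerivAt (fun τ : ℝ => f (Φ τ t)
      * (1 + I * ((d0 t + τ * (d1 t - d0 t) : ℝ) : ℂ))) (B τ t) τ := by
    intro τ hτ t ht
    have h1 : HasDerivAt (fun τ : ℝ => Φ τ t) (I * ((h₁ t - h0 t : ℝ) : ℂ)) τ := by
      have : HasDerivAt (fun τ : ℝ => h0 t + τ * (h₁ t - h0 t)) (h₁ t - h0 t) τ := by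
        simpa using ((hasDerivAt_id τ).mul_const (h₁ t - h0 t)).const_add (h0 t)
      exact (this.ofReal_comp.const_mul I).const_add _
    have h2 : HasDerivAt (fun τ : ℝ => (1 + I * ((d0 t + τ * (d1 t - d0 t) : ℝ) : ℂ)))
        (I * ((d1 t - d0 t : ℝ) : ℂ)) τ := by
      have : HasDerivAt (fun τ : ℝ => d0 t + τ * (d1 t - d0 t)) (d1 t - d0 t) τ := by
        simpa using ((hasDerivAt_id τ).mul_const (d1 t - d0 t)).const_add (d0 t)
      exact (this.ofReal_comp.const_mul I).const_add _
    exact ((hdf τ hτ t ht).comp τ h1).mul h2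
  have htder : ∀ τ ∈ Icc (0 : ℝ) 1, ∀ t ∈ Icc a b, HasDerivAt (fun t : ℝ => f (Φ τ t)
      * (I * ((h₁ t - h0 t : ℝ) : ℂ))) (B τ t) t := by
    intro τ hτ t ht
    have h1 : HasDerivAt (Φ τ) (1 + I * ((d0 t + τ * (d1 t - d0 t) : ℝ) : ℂ)) t :=
      hasDerivAt_graphPt ((hd0 t).add (((hd1 t).sub (hd0 t)).const_mul τ))
    have h2 : HasDerivAt (fun t : ℝ => I * ((h₁ t - h0 t : ℝ) : ℂ))
        (I * ((d1 t - d0 t : ℝ) : ℂ)) t :=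
      (((hd1 t).sub (hd0 t)).ofReal_comp).const_mul I
    refine (((hdf τ hτ t ht).comp t h1).mul h2).congr_deriv ?_
    simp only [hB, Function.comp_apply]; ring
  have hΦc : Continuous fun q : ℝ × ℝ => Φ q.1 q.2 := by
    simp only [hΦdef, graphPt]; fun_prop
  have hΦm : MapsTo (fun q : ℝ × ℝ => Φ q.1 q.2) (Icc (0 : ℝ) 1 ×ˢ Icc a b) Ω :=
    fun q hq => hmem q.1 hq.1 q.2 hq.2
  have hfΦ : ContinuousOn (fun q : ℝ × ℝ => f (Φ q.1 q.2)) (Icc (0 : ℝ) 1 ×ˢ Icc a b) :=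
    hf.continuousOn.comp hΦc.continuousOn hΦm
  have hf'Φ : ContinuousOn (fun q : ℝ × ℝ => deriv f (Φ q.1 q.2)) (Icc (0 : ℝ) 1 ×ˢ Icc a b) :=
    (hf.deriv hΩ).continuousOn.comp hΦc.continuousOn hΦm
  have hBc : ContinuousOn (fun q : ℝ × ℝ => B q.1 q.2) (Icc (0 : ℝ) 1 ×ˢ Icc a b) := by
    have e1 : Continuous fun q : ℝ × ℝ => I * ((h₁ q.2 - h0 q.2 : ℝ) : ℂ) := by fun_prop
    have e2 : Continuous fun q : ℝ × ℝ =>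
      (1 + I * ((d0 q.2 + q.1 * (d1 q.2 - d0 q.2) : ℝ) : ℂ)) := by fun_prop
    have e3 : Continuous fun q : ℝ × ℝ => I * ((d1 q.2 - d0 q.2 : ℝ) : ℂ) := by fun_prop
    exact ((hf'Φ.mul e1.continuousOn).mul e2.continuousOn).add (hfΦ.mul e3.continuousOn)
  have hftc : ∀ t ∈ Icc a b, graphDensity f h₁ t - graphDensity f h0 t
      = ∫ τ in Ioc (0 : ℝ) 1, B τ t := by
    intro t ht
    rw [← integral_of_le zero_le_one,
      integral_eq_sub_of_hasDerivAt (f := fun τ : ℝ => f (Φ τ t)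
      * (1 + I * ((d0 t + τ * (d1 t - d0 t) : ℝ) : ℂ)))]
    · simp [graphDensity, hΦdef, graphPt, hd₀, hd₁]
    · intro τ hτ; rw [uIcc_of_le zero_le_one] at hτ; exact hτder τ hτ t ht
    · refine ContinuousOn.intervalIntegrable ?_; rw [uIcc_of_le zero_le_one]
      exact hBc.comp (f := fun τ : ℝ => (τ, t)) (by fun_prop) fun τ hτ => ⟨hτ, ht⟩
  have hBint : Integrable (fun q : ℝ × ℝ => B q.2 q.1)
      ((volume.restrict (Ioc a b)).prod (volume.restrict (Ioc (0 : ℝ) 1))) := by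
    rw [Measure.prod_restrict]
    refine IntegrableOn.mono_set (t := Icc a b ×ˢ Icc (0 : ℝ) 1) ?_
      (prod_mono Ioc_subset_Icc_self Ioc_subset_Icc_self)
    refine ContinuousOn.integrableOn_compact (isCompact_Icc.prod isCompact_Icc) ?_
    exact hBc.comp (f := fun q : ℝ × ℝ => (q.2, q.1)) (by fun_prop) fun q hq => ⟨hq.2, hq.1⟩
  have hint : ∀ τ ∈ Icc (0 : ℝ) 1, ∀ h : ℝ → ℝ, ContDiff ℝ 1 h →
      (∀ t ∈ Icc a b, graphPt h t ∈ Ω) → IntervalIntegrable (graphDensity f h) volume a b := by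
    intro τ hτ h hh hm; refine ContinuousOn.intervalIntegrable ?_; rw [uIcc_of_le hab]
    have h1 : ContinuousOn (fun t => f (graphPt h t)) (Icc a b) :=
      hf.continuousOn.comp (continuous_graphPt hh.continuous).continuousOn hm
    have h2 : Continuous (deriv h) := hh.continuous_deriv le_rfl
    have h3 : Continuous fun t => 1 + I * ((deriv h t : ℝ) : ℂ) := by fun_prop
    exact h1.mul h3.continuousOn
  have hi1 := hint 1 (by simp) h₁ hh1 fun t ht => by simpa [graphPt] using hmem 1 (by simp) t ht
  have hi0 := hint 0 (by simp) h0 hh0 fun t ht => by simpa [graphPt] using hmem 0 (by simp) t ht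
  have hend : (∫ t in a..b, graphDensity f h₁ t) - ∫ t in a..b, graphDensity f h0 t
      = ∫ τ in Ioc (0 : ℝ) 1, (f (Φ τ b) * (I * ((h₁ b - h0 b : ℝ) : ℂ))
        - f (Φ τ a) * (I * ((h₁ a - h0 a : ℝ) : ℂ))) := by
    rw [← intervalIntegral.integral_sub hi1 hi0, integral_of_le hab,
      setIntegral_congr_fun measurableSet_Ioc (fun t ht => hftc t (Ioc_subset_Icc_self ht)),
      integral_integral_swap hBint]
    refine setIntegral_congr_fun measurableSet_Ioc fun τ hτ => ?_
    have hτ' := Ioc_subset_Icc_self hτ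
    rw [← integral_of_le hab,
      integral_eq_sub_of_hasDerivAt (f := fun t : ℝ => f (Φ τ t)
      * (I * ((h₁ t - h0 t : ℝ) : ℂ)))]
    · intro t ht; rw [uIcc_of_le hab] at ht; exact htder τ hτ' t ht
    · refine ContinuousOn.intervalIntegrable ?_; rw [uIcc_of_le hab]
      exact hBc.comp (f := fun t : ℝ => (τ, t)) (by fun_prop) fun t ht => ⟨hτ', ht⟩
  rw [hend]
  have hbound := norm_setIntegral_le_of_norm_le_const (μ := volume) (s := Ioc (0 : ℝ) 1)
    (C := M * |h₁ b - h0 b| + M * |h₁ a - h0 a|)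
    (f := fun τ : ℝ => f (Φ τ b) * (I * ((h₁ b - h0 b : ℝ) : ℂ))
        - f (Φ τ a) * (I * ((h₁ a - h0 a : ℝ) : ℂ))) (by simp) fun τ hτ => by
      have hτ' := Ioc_subset_Icc_self hτ
      refine (norm_sub_le _ _).trans ?_
      simp only [norm_mul, norm_I, one_mul, norm_real, norm_eq_abs]; gcongr
      · exact hMb τ hτ'
      · exact hMa τ hτ'
  simpa using hbound

/-! ### The cut planes and the branch of the power -/

theorem isOpen_cutAbove : IsOpen cutAbove := by
  have : cutAbove = {s : ℂ | s.re ≠ 0} ∪ {s : ℂ | s.im < 0} := by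
    ext s; simp only [cutAbove, mem_ofPred_eq, mem_union]; tauto
  rw [this]
  exact (isOpen_ne_fun continuous_re continuous_const).union
    (isOpen_lt continuous_im continuous_const)

theorem isOpen_cutBelow : IsOpen cutBelow := by
  have : cutBelow = {s : ℂ | s.re ≠ 0} ∪ {s : ℂ | 0 < s.im} := by
    ext s; simp only [cutBelow, mem_ofPred_eq, mem_union]; tauto
  rw [this]
  exact (isOpen_ne_fun continuous_re continuous_const).union
    (isOpen_lt continuous_const continuous_im)

theorem ne_zero_of_mem_cutAbove {s : ℂ} (hs : s ∈ cutAbove) : s ≠ 0 := by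
  rintro rfl; simpa using hs (by simp)

/-- Multiplication by `I` turns the cut `i [0, ∞)` into that of the principal logarithm, which is
why `powBelow` is defined through `log (I * s)`. -/
theorem I_mul_mem_slitPlane {s : ℂ} (hs : s ∈ cutAbove) : I * s ∈ slitPlane := by
  rw [mem_slitPlane_iff]; by_cases h : s.re = 0
  · left; simpa using hs h
  · right; simpa using h

theorem mul_mem_cutAbove {s : ℂ} (hs : s ∈ cutAbove) {c : ℝ} (hc : 0 < c) :
    (c : ℂ) * s ∈ cutAbove := by
  intro h
  simp only [mul_re, ofReal_re, ofReal_im, zero_mul, sub_zero,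
    mul_im, add_zero, mul_eq_zero, hc.ne', false_or] at h ⊢
  exact mul_neg_of_pos_of_neg hc (hs h)

theorem powBelow_ne_zero (s μ : ℂ) : powBelow s μ ≠ 0 := exp_ne_zero _

theorem powBelow_mul {s : ℂ} (hs : s ≠ 0) {c : ℝ} (hc : 0 < c) (μ : ℂ) :
    powBelow ((c : ℂ) * s) μ = (c : ℂ) ^ μ * powBelow s μ := by
  have hc' : (c : ℂ) ≠ 0 := by exact_mod_cast hc.ne'
  rw [powBelow, powBelow, cpow_def_of_ne_zero hc', ← exp_add,
    show I * ((c : ℂ) * s) = (c : ℂ) * (I * s) by ring,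
    log_ofReal_mul hc (mul_ne_zero I_ne_zero hs), ofReal_log hc.le]
  congr 1; ring

theorem powBelow_sub_one {s : ℂ} (hs : s ≠ 0) (μ : ℂ) : powBelow s (μ - 1) = powBelow s μ / s := by
  have h : exp (log (I * s) - I * π / 2) = s := by
    rw [exp_sub, exp_log (mul_ne_zero I_ne_zero hs),
      show I * π / 2 = π / 2 * I by ring, exp_pi_div_two_mul_I,
      mul_div_cancel_left₀ _ I_ne_zero]
  rw [powBelow, powBelow, sub_mul, one_mul, exp_sub, h]

theorem powBelow_neg_one {s : ℂ} (hs : s ≠ 0) : powBelow s (-1) = s⁻¹ := by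
  have := powBelow_sub_one hs 0; rw [zero_sub] at this; rw [this, powBelow]; simp

theorem hasDerivAt_powBelow {s : ℂ} (hs : s ∈ cutAbove) (μ : ℂ) :
    HasDerivAt (fun s => powBelow s μ) (μ * powBelow s (μ - 1)) s := by
  have h1 : HasDerivAt (fun s : ℂ => I * s) I s := by simpa using (hasDerivAt_id s).const_mul I
  have h2 := (((h1.clog (I_mul_mem_slitPlane hs)).sub_const (I * π / 2)).const_mul μ).cexp
  refine h2.congr_deriv ?_; have hs0 := ne_zero_of_mem_cutAbove hs
  rw [powBelow_sub_one hs0, powBelow]; field_simp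

theorem continuous_powBelow_exponent (s : ℂ) : Continuous fun μ => powBelow s μ := by
  unfold powBelow
  fun_prop

/-- The number `x + x⁻¹` is at least `1` and dominates both `x` and `x⁻¹`, so one bound serves
exponents of either sign and small as well as large `x`. -/
theorem rpow_le_add_inv_rpow {x a A : ℝ} (hx : 0 < x) (ha : |a| ≤ A) : x ^ a ≤ (x + x⁻¹) ^ A := by
  have hx' : 0 < x⁻¹ := inv_pos.2 hx
  have h1 : 1 ≤ x + x⁻¹ := by
    rcases le_total 1 x with h | h
    · linarith
    · have := (one_le_inv₀ hx).2 h; linarith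
  refine le_trans ?_ (Real.rpow_le_rpow_of_exponent_le h1 ha); rcases le_total 0 a with h | h
  · rw [abs_of_nonneg h]; exact rpow_le_rpow hx.le (by linarith) h
  · rw [abs_of_nonpos h, show x ^ a = (x⁻¹) ^ (-a) by rw [Real.inv_rpow hx.le, Real.rpow_neg hx.le, inv_inv]]
    exact rpow_le_rpow hx'.le (by linarith) (by linarith)

/-- The argument on this branch is bounded by `2π`, so an imaginary part of the exponent costs only
a constant factor. -/
theorem norm_powBelow_le {s μ : ℂ} (hs : s ≠ 0) :
    ‖powBelow s μ‖ ≤ ‖s‖ ^ μ.re * Real.exp (2 * π * |μ.im|) := by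
  have hpos : 0 < ‖s‖ := norm_pos_iff.2 hs
  have hI : I * s ≠ 0 := mul_ne_zero I_ne_zero hs
  rw [powBelow, norm_exp, Real.rpow_def_of_pos hpos, ← Real.exp_add]; refine exp_le_exp.2 ?_
  have h1 : (log (I * s) - I * π / 2).re = Real.log ‖s‖ := by simp [log_re]
  have h2 : (log (I * s) - I * π / 2).im = (I * s).arg - π / 2 := by simp [log_im]
  rw [mul_re, h1, h2]
  have h3 : |(I * s).arg - π / 2| ≤ 2 * π := by
    have := neg_pi_lt_arg (I * s); have := arg_le_pi (I * s); rw [abs_le]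
    constructor <;> linarith [pi_pos]
  have h4 : -(μ.im * ((I * s).arg - π / 2)) ≤ 2 * π * |μ.im| := by
    refine (neg_le_abs _).trans ?_; rw [abs_mul, mul_comm]; gcongr
  linarith

/-- A power is absorbed by an exponential of arbitrarily small rate `c`. For `a > 0` this is the
`a`-th power of `1 + t ≤ (1 + a/c) e^{ct/a}`. -/
theorem exists_one_add_rpow_le_exp (a : ℝ) {c : ℝ} (hc : 0 < c) :
    ∃ K > 0, ∀ t : ℝ, 0 ≤ t → (1 + t) ^ a ≤ K * Real.exp (c * t) := by
  rcases le_or_gt a 0 with ha | ha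
  · refine ⟨1, one_pos, fun t ht => ?_⟩; rw [one_mul]
    exact (Real.rpow_le_one_of_one_le_of_nonpos (by linarith) ha).trans
      (Real.one_le_exp (by positivity))
  · refine ⟨(1 + a / c) ^ a, by positivity, fun t ht => ?_⟩
    have h1 : 1 + t ≤ (1 + a / c) * Real.exp (c / a * t) := by
      have h2 := Real.add_one_le_exp (c / a * t)
      have h3 : (1 + a / c) * (c / a * t + 1) ≤ (1 + a / c) * Real.exp (c / a * t) := by gcongr
      have h4 : (1 + a / c) * (c / a * t + 1) = 1 + t + c / a * t + a / c := by
        field_simp; ring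
      have : 0 ≤ c / a * t := by positivity
      have : 0 ≤ a / c := by positivity
      linarith
    calc (1 + t) ^ a ≤ ((1 + a / c) * Real.exp (c / a * t)) ^ a :=
          rpow_le_rpow (by positivity) h1 ha.le
      _ = (1 + a / c) ^ a * Real.exp (c * t) := by
          rw [mul_rpow (by positivity) (by positivity), ← Real.exp_mul]; congr 2; field_simp

/-! ### The dip profile -/

/-- A smooth profile which passes below the origin at depth `s κ` and grows like `s |t|`. -/
noncomputable def dipProfile (s κ t : ℝ) : ℝ := s * (√(t ^ 2 + κ ^ 2) - 2 * κ)

theorem contDiff_dipProfile (s : ℝ) {κ : ℝ} (hκ : κ ≠ 0) {n : WithTop ℕ∞} :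
    ContDiff ℝ n (dipProfile s κ) := by
  unfold dipProfile
  refine contDiff_const.mul (ContDiff.sub ?_ contDiff_const)
  exact ContDiff.sqrt (by fun_prop) fun t => by positivity

theorem hasDerivAt_dipProfile (s : ℝ) {κ : ℝ} (hκ : κ ≠ 0) (t : ℝ) :
    HasDerivAt (dipProfile s κ) (s * (t / √(t ^ 2 + κ ^ 2))) t := by
  have h1 : HasDerivAt (fun t : ℝ => t ^ 2 + κ ^ 2) (2 * t) t := by
    simpa using (hasDerivAt_pow 2 t).add_const (κ ^ 2)
  have h2 := ((h1.sqrt (by positivity)).sub_const (2 * κ)).const_mul s; refine h2.congr_deriv ?_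
  field_simp

theorem abs_deriv_dipProfile_le {s κ : ℝ} (hs : 0 ≤ s) (hκ : κ ≠ 0) (t : ℝ) :
    |deriv (dipProfile s κ) t| ≤ s := by
  rw [(hasDerivAt_dipProfile s hκ t).deriv, abs_mul, abs_of_nonneg hs, abs_div,
    abs_of_nonneg (sqrt_nonneg _)]
  have h : |t| ≤ √(t ^ 2 + κ ^ 2) := Real.abs_le_sqrt (by nlinarith [sq_nonneg κ])
  have : |t| / √(t ^ 2 + κ ^ 2) ≤ 1 := div_le_one_of_le₀ h (sqrt_nonneg _); nlinarith

theorem abs_le_sqrt_add (t κ : ℝ) : |t| ≤ √(t ^ 2 + κ ^ 2) :=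
  Real.abs_le_sqrt (by nlinarith [sq_nonneg κ])

theorem sqrt_add_le (t : ℝ) {κ : ℝ} (hκ : 0 ≤ κ) : √(t ^ 2 + κ ^ 2) ≤ |t| + κ := by
  refine Real.sqrt_le_iff.2 ⟨by positivity, ?_⟩; have := sq_abs t
  nlinarith [mul_nonneg (abs_nonneg t) hκ]

theorem dipProfile_lower {s κ : ℝ} (hs : 0 ≤ s) (t : ℝ) : s * (|t| - 2 * κ) ≤ dipProfile s κ t := by
  unfold dipProfile
  gcongr; exact abs_le_sqrt_add t κ

theorem dipProfile_upper {s κ : ℝ} (hs : 0 ≤ s) (hκ : 0 ≤ κ) (t : ℝ) :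
    dipProfile s κ t ≤ s * (|t| - κ) := by
  unfold dipProfile
  refine mul_le_mul_of_nonneg_left ?_ hs; linarith [sqrt_add_le t hκ]

theorem graphPt_dipProfile_mem_cutAbove {s κ : ℝ} (hs : 0 < s) (hκ : 0 < κ) (t : ℝ) :
    graphPt (dipProfile s κ) t ∈ cutAbove := by
  intro h; have ht : t = 0 := by simpa [graphPt] using h
  have := dipProfile_upper hs.le hκ.le t
  have h2 : s * (|t| - κ) < 0 := by
    rw [ht]; simp only [abs_zero, zero_sub, mul_neg]; linarith [mul_pos hs hκ]
  simp only [graphPt, add_im, ofReal_im, mul_im, I_re, I_im, ofReal_re]; linarith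

/-- Where `|t| ≥ 1/4` the real part is large enough; nearer to the origin the profile is still below
`-3s/4`. -/
theorem norm_graphPt_dipProfile_ge {s : ℝ} (hs : 0 < s) (hs1 : s ≤ 1) (t : ℝ) :
    s / 4 ≤ ‖graphPt (dipProfile s 1) t‖ := by
  rcases le_total (1 / 4) |t| with h | h
  · have h1 : |(graphPt (dipProfile s 1) t).re| ≤ ‖graphPt (dipProfile s 1) t‖ := abs_re_le_norm _
    have h2 : (graphPt (dipProfile s 1) t).re = t := by simp [graphPt]
    rw [h2] at h1; linarith
  · have h1 : |(graphPt (dipProfile s 1) t).im| ≤ ‖graphPt (dipProfile s 1) t‖ := abs_im_le_norm _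
    have h2 : (graphPt (dipProfile s 1) t).im = dipProfile s 1 t := by simp [graphPt]
    have h3 := dipProfile_upper hs.le zero_le_one t; rw [h2] at h1
    have h4 : dipProfile s 1 t ≤ s * (1 / 4 - 1) := h3.trans (by gcongr)
    have := neg_abs_le (dipProfile s 1 t); linarith

theorem norm_graphPt_dipProfile_le {s : ℝ} (hs : 0 < s) (hs1 : s ≤ 1) (t : ℝ) :
    ‖graphPt (dipProfile s 1) t‖ ≤ 2 * (1 + |t|) := by
  have h1 : |dipProfile s 1 t| ≤ 2 + |t| := by
    have h2 := dipProfile_upper hs.le zero_le_one t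
    have h3 := dipProfile_lower (κ := 1) hs.le t; have h0 := abs_nonneg t; rw [abs_le]
    constructor <;> nlinarith
  unfold graphPt
  refine (norm_add_le _ _).trans ?_
  simp only [norm_mul, norm_I, norm_real, norm_eq_abs, one_mul]; linarith

/-- Powers of the points of the profile are dominated by a slowly growing exponential, uniformly
for bounded exponents. -/
theorem exists_norm_powBelow_dipProfile_le {s : ℝ} (hs : 0 < s) (hs1 : s ≤ 1) (A : ℝ) {c : ℝ}
    (hc : 0 < c) : ∃ K > 0, ∀ μ : ℂ, |μ.re| ≤ A → |μ.im| ≤ A → ∀ t : ℝ,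
      ‖powBelow (graphPt (dipProfile s 1) t) μ‖ ≤ K * Real.exp (c * |t|) := by
  obtain ⟨K, hK, hKb⟩ := exists_one_add_rpow_le_exp A hc
  refine ⟨(2 + 4 / s) ^ A * K * Real.exp (2 * π * A), by positivity, fun μ hre him t => ?_⟩
  set z := graphPt (dipProfile s 1) t with hz
  have hA : 0 ≤ A := (abs_nonneg _).trans hre
  have hz4 := norm_graphPt_dipProfile_ge hs hs1 t
  have hzpos : 0 < ‖z‖ := lt_of_lt_of_le (by positivity) hz4
  have h1 : ‖z‖ + ‖z‖⁻¹ ≤ (2 + 4 / s) * (1 + |t|) := by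
    have h2 : ‖z‖⁻¹ ≤ 4 / s := by
      rw [show 4 / s = (s / 4)⁻¹ by rw [inv_div]]
      exact inv_anti₀ (by positivity) hz4
    have h3 := norm_graphPt_dipProfile_le hs hs1 t
    have h4 : 0 ≤ 4 / s * |t| := by positivity
    nlinarith
  calc ‖powBelow z μ‖ ≤ ‖z‖ ^ μ.re * Real.exp (2 * π * |μ.im|) :=
        norm_powBelow_le (norm_pos_iff.1 hzpos)
    _ ≤ (‖z‖ + ‖z‖⁻¹) ^ A * Real.exp (2 * π * A) := by
        gcongr; exact rpow_le_add_inv_rpow hzpos hre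
    _ ≤ ((2 + 4 / s) * (1 + |t|)) ^ A * Real.exp (2 * π * A) := by gcongr
    _ = (2 + 4 / s) ^ A * (1 + |t|) ^ A * Real.exp (2 * π * A) := by
        rw [mul_rpow (by positivity) (by positivity)]
    _ ≤ (2 + 4 / s) ^ A * (K * Real.exp (c * |t|)) * Real.exp (2 * π * A) := by
        gcongr; exact hKb _ (abs_nonneg t)
    _ = _ := by ring

/-! ### Hankel's integral -/

/-- The integrand `z ^ μ e ^ {i z}` of Hankel's integral. -/
noncomputable def hankelIntegrand (μ z : ℂ) : ℂ := powBelow z μ * exp (I * z)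

theorem hasDerivAt_hankelIntegrand {z : ℂ} (hz : z ∈ cutAbove) (μ : ℂ) :
    HasDerivAt (hankelIntegrand μ) (μ * hankelIntegrand (μ - 1) z + I * hankelIntegrand μ z) z := by
  have h1 : HasDerivAt (fun z : ℂ => exp (I * z)) (exp (I * z) * I) z := by
    simpa using ((hasDerivAt_id z).const_mul I).cexp
  refine ((hasDerivAt_powBelow hz μ).mul h1).congr_deriv ?_; simp only [hankelIntegrand]; ring

theorem norm_exp_I_mul_graphPt (h : ℝ → ℝ) (t : ℝ) : ‖exp (I * graphPt h t)‖ = Real.exp (-h t) := by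
  rw [norm_exp]; simp [graphPt]

theorem continuous_graphDensity {f : ℂ → ℂ} {Ω : Set ℂ} (hf : ContinuousOn f Ω) {h : ℝ → ℝ}
    (hh : ContDiff ℝ 1 h) (hm : ∀ t, graphPt h t ∈ Ω) : Continuous (graphDensity f h) := by
  have h1 : Continuous fun t => f (graphPt h t) :=
    hf.comp_continuous (continuous_graphPt hh.continuous) hm
  have h2 : Continuous (deriv h) := hh.continuous_deriv le_rfl
  have h3 : Continuous fun t => 1 + I * ((deriv h t : ℝ) : ℂ) := by fun_prop
  exact h1.mul h3

theorem continuousOn_hankelIntegrand (μ : ℂ) : ContinuousOn (hankelIntegrand μ) cutAbove :=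
  fun _ hz => (hasDerivAt_hankelIntegrand hz μ).continuousAt.continuousWithinAt

theorem integrable_comp_abs_of_integrableOn_Ioi {f : ℝ → ℝ} (hf : IntegrableOn f (Ioi 0)) :
    Integrable fun t => f |t| := by
  have h1 : IntegrableOn (fun t => f |t|) (Ioi 0) :=
    hf.congr_fun (fun t ht => by rw [abs_of_pos ht]) measurableSet_Ioi
  have h2 : IntegrableOn (fun t => f |t|) (Iic 0) := by
    rw [integrableOn_Iic_iff_integrableOn_Iio]; have h3 := h1.comp_neg; simpa using h3
  rw [← integrableOn_univ, ← Iic_union_Ioi (a := (0 : ℝ))]; exact h2.union h1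

theorem integrable_exp_neg_mul_abs {c : ℝ} (hc : 0 < c) :
    Integrable fun t : ℝ => Real.exp (-(c * |t|)) := by
  refine integrable_comp_abs_of_integrableOn_Ioi (f := fun t => Real.exp (-(c * t))) ?_
  have := exp_neg_integrableOn_Ioi 0 hc
  simpa only [neg_mul] using this

/-- Hankel's integrand is dominated on the contour, uniformly for bounded exponents. -/
theorem exists_norm_graphDensity_hankelIntegrand_le {s : ℝ} (hs : 0 < s) (hs1 : s ≤ 1) (A : ℝ) :
    ∃ K > 0, ∀ μ : ℂ, |μ.re| ≤ A → |μ.im| ≤ A → ∀ t : ℝ,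
      ‖hankelIntegrand μ (graphPt (dipProfile s 1) t)‖ ≤ K * Real.exp (-(s / 2 * |t|)) ∧
      ‖graphDensity (hankelIntegrand μ) (dipProfile s 1) t‖ ≤ K * Real.exp (-(s / 2 * |t|)) := by
  obtain ⟨K, hK, hb⟩ := exists_norm_powBelow_dipProfile_le hs hs1 A (c := s / 2) (by positivity)
  have h0 : ∀ μ : ℂ, |μ.re| ≤ A → |μ.im| ≤ A → ∀ t : ℝ,
      ‖hankelIntegrand μ (graphPt (dipProfile s 1) t)‖
        ≤ K * Real.exp (2 * s) * Real.exp (-(s / 2 * |t|)) := fun μ h1 h2 t => by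
    rw [hankelIntegrand, norm_mul, norm_exp_I_mul_graphPt]
    have h3 := dipProfile_lower (κ := 1) hs.le t
    calc _ ≤ (K * Real.exp (s / 2 * |t|)) * Real.exp (-(s * (|t| - 2 * 1))) := by
          gcongr; exact hb μ h1 h2 t
      _ = _ := by
          rw [mul_assoc, mul_assoc, ← Real.exp_add, ← Real.exp_add]; congr 2; ring
  refine ⟨2 * (K * Real.exp (2 * s)), by positivity, fun μ h1 h2 t => ⟨?_, ?_⟩⟩
  · refine (h0 μ h1 h2 t).trans ?_; have : 0 < K * Real.exp (2 * s) := by positivity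
    exact mul_le_mul_of_nonneg_right (by linarith) (exp_pos _).le
  · rw [graphDensity, norm_mul]
    have h4 : ‖1 + I * ((deriv (dipProfile s 1) t : ℝ) : ℂ)‖ ≤ 2 := by
      refine (norm_add_le _ _).trans ?_
      simp only [norm_one, norm_mul, norm_I, one_mul, norm_real, norm_eq_abs]
      linarith [abs_deriv_dipProfile_le hs.le one_ne_zero t]
    calc _ ≤ (K * Real.exp (2 * s) * Real.exp (-(s / 2 * |t|))) * 2 := by
          gcongr; exact h0 μ h1 h2 t
      _ = _ := by ring

theorem continuous_graphDensity_hankelIntegrand {s : ℝ} (hs : 0 < s) (μ : ℂ) :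
    Continuous (graphDensity (hankelIntegrand μ) (dipProfile s 1)) :=
  continuous_graphDensity (continuousOn_hankelIntegrand μ) (contDiff_dipProfile s one_ne_zero)
    (graphPt_dipProfile_mem_cutAbove hs one_pos)

theorem integrable_graphDensity_hankelIntegrand {s : ℝ} (hs : 0 < s) (hs1 : s ≤ 1) (μ : ℂ) :
    Integrable (graphDensity (hankelIntegrand μ) (dipProfile s 1)) := by
  obtain ⟨K, hK, hb⟩ := exists_norm_graphDensity_hankelIntegrand_le hs hs1 (max |μ.re| |μ.im|)
  refine Integrable.mono' ((integrable_exp_neg_mul_abs (c := s / 2) (by positivity)).const_mul K)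
    (continuous_graphDensity_hankelIntegrand hs μ).aestronglyMeasurable
    (.of_forall fun t => (hb μ (le_max_left _ _) (le_max_right _ _) t).2)

/-- Hankel's integral over the contour given by the dip profile. -/
noncomputable def hankelIntegral (s : ℝ) (μ : ℂ) : ℂ :=
  ∫ t, graphDensity (hankelIntegrand μ) (dipProfile s 1) t

/-- Integration by parts along the contour: `z^μ e^{iz}` decays at both ends, so its derivative has
integral zero. The relation carries Hankel's formula from `Re μ > -1` to all nonintegral `μ`. -/
theorem hankelIntegral_recursion {s : ℝ} (hs : 0 < s) (hs1 : s ≤ 1) (μ : ℂ) :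
    hankelIntegral s μ = I * μ * hankelIntegral s (μ - 1) := by
  have hder : ∀ t, HasDerivAt (fun t => hankelIntegrand μ (graphPt (dipProfile s 1) t))
      (μ * graphDensity (hankelIntegrand (μ - 1)) (dipProfile s 1) t
        + I * graphDensity (hankelIntegrand μ) (dipProfile s 1) t) t := fun t => by
    have h1 := (hasDerivAt_hankelIntegrand (graphPt_dipProfile_mem_cutAbove hs one_pos t) μ).comp t
      (hasDerivAt_graphPt ((contDiff_dipProfile s one_ne_zero (n := 1)).differentiable
        one_ne_zero t).hasDerivAt)
    refine h1.congr_deriv ?_; simp only [graphDensity]; ring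
  have hi1 := (integrable_graphDensity_hankelIntegrand hs hs1 (μ - 1)).const_mul μ
  have hi2 := (integrable_graphDensity_hankelIntegrand hs hs1 μ).const_mul I
  obtain ⟨K, hK, hb⟩ := exists_norm_graphDensity_hankelIntegrand_le hs hs1 (max |μ.re| |μ.im|)
  have hlim : ∀ l : Filter ℝ, Tendsto (fun t : ℝ => |t|) l atTop →
      Tendsto (fun t => hankelIntegrand μ (graphPt (dipProfile s 1) t)) l (𝓝 0) := fun l hl => by
    refine squeeze_zero_norm (fun t => (hb μ (le_max_left _ _) (le_max_right _ _) t).1) ?_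
    have h2 : Tendsto (fun t : ℝ => Real.exp (-(s / 2 * |t|))) l (𝓝 0) :=
      Real.tendsto_exp_neg_atTop_nhds_zero.comp (hl.const_mul_atTop (by positivity))
    simpa using h2.const_mul K
  have h := integral_of_hasDerivAt_of_tendsto hder (hi1.add hi2)
    (hlim _ tendsto_abs_atBot_atTop) (hlim _ tendsto_abs_atTop_atTop)
  rw [integral_add hi1 hi2, integral_const_mul, integral_const_mul, sub_zero] at h
  have h3 : I * (μ * hankelIntegral s (μ - 1) + I * hankelIntegral s μ) = 0 := by
    rw [hankelIntegral, hankelIntegral, h, mul_zero]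
  have h4 : I * I = -1 := I_mul_I
  linear_combination h4 * hankelIntegral s μ - h3

/-- The domination is uniform for bounded exponents. Continuity is what gives the value at `μ = -1`,
where the formula with `Gamma` degenerates. -/
theorem continuous_hankelIntegral {s : ℝ} (hs : 0 < s) (hs1 : s ≤ 1) :
    Continuous (hankelIntegral s) := by
  rw [continuous_iff_continuousAt]; intro μ0
  obtain ⟨K, hK, hb⟩ := exists_norm_graphDensity_hankelIntegrand_le hs hs1 (‖μ0‖ + 1)
  refine continuousAt_of_dominated (F := fun μ t =>
    graphDensity (hankelIntegrand μ) (dipProfile s 1) t)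
    (bound := fun t => K * Real.exp (-(s / 2 * |t|))) ?_ ?_ ?_ ?_
  · exact .of_forall fun μ =>
      (continuous_graphDensity_hankelIntegrand hs μ).aestronglyMeasurable
  · filter_upwards [ball_mem_nhds μ0 one_pos] with μ hμ
    have h1 : ‖μ‖ ≤ ‖μ0‖ + 1 := by
      have := norm_sub_norm_le μ μ0; rw [mem_ball, dist_eq_norm] at hμ; linarith
    exact .of_forall fun t => (hb μ ((abs_re_le_norm μ).trans h1)
      ((abs_im_le_norm μ).trans h1) t).2
  · exact (integrable_exp_neg_mul_abs (c := s / 2) (by positivity)).const_mul K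
  · refine .of_forall fun t => Continuous.continuousAt ?_
    simp only [graphDensity, hankelIntegrand]
    have := continuous_powBelow_exponent (graphPt (dipProfile s 1) t); fun_prop

/-- The parabola `z = i ζ²`, `Im ζ = -c`, as a graph. -/
noncomputable def parabola (c t : ℝ) : ℝ := t ^ 2 / (4 * c ^ 2) - c ^ 2

/-- Hankel's integrand in the variable `ζ = u - i c`, up to a constant. -/
noncomputable def gammaIntegrand (μ : ℂ) (c u : ℝ) : ℂ :=
  exp ((2 * μ + 1) * log ((u : ℂ) - I * c)) * exp (-((u : ℂ) - I * c) ^ 2)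

theorem hasDerivAt_parabola (c t : ℝ) : HasDerivAt (parabola c) (2 * t / (4 * c ^ 2)) t := by
  have := ((hasDerivAt_pow 2 t).div_const (4 * c ^ 2)).sub_const (c ^ 2)
  change HasDerivAt (fun t : ℝ => t ^ 2 / (4 * c ^ 2) - c ^ 2) _ _; simpa using this

theorem contDiff_parabola (c : ℝ) {n : WithTop ℕ∞} : ContDiff ℝ n (parabola c) := by
  unfold parabola
  fun_prop

/-- Here `arg ζ` lies in `(-π, 0)`, so `2 arg ζ + π` lies in the principal strip. -/
theorem log_neg_sq {ζ : ℂ} (hζ : ζ.im < 0) : log (-ζ ^ 2) = 2 * log ζ + π * I := by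
  have h0 : ζ ≠ 0 := fun h => by simp [h] at hζ
  have h1 : exp (2 * log ζ + π * I) = -ζ ^ 2 := by
    rw [exp_add, exp_pi_mul_I, two_mul, exp_add, exp_log h0]; ring
  have h2 := arg_neg_iff.2 hζ; have h3 := neg_pi_lt_arg ζ; rw [← h1, log_exp]
  · simp [log_im]; linarith
  · simp [log_im]; linarith

/-- The substitution `z = iζ²` with `ζ = u - ic`: then `z = 2cu + i(u² - c²)` runs along the
parabola, `iz = -ζ²` makes the exponential Gaussian, and `1 + i h' = iζ/c` supplies the extra factor
`ζ`. -/
theorem graphDensity_parabola (μ : ℂ) {c : ℝ} (hc : 0 < c) (u : ℝ) :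
    graphDensity (hankelIntegrand μ) (parabola c) (2 * c * u)
      = (1 / c : ℂ) * (I * exp (μ * (I * π / 2))) * gammaIntegrand μ c u := by
  have hcc : (c : ℂ) ≠ 0 := by exact_mod_cast hc.ne'
  set ζ : ℂ := (u : ℂ) - I * c with hζ
  have him : ζ.im < 0 := by simp [hζ, hc]
  have hζ0 : ζ ≠ 0 := fun h => by simp [h] at him
  have hI : I ^ 2 = -1 := I_sq
  have hz : graphPt (parabola c) (2 * c * u) = I * ζ ^ 2 := by
    have h1 : parabola c (2 * c * u) = u ^ 2 - c ^ 2 := by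
      unfold parabola
      field_simp; ring
    rw [graphPt, h1, hζ]; push_cast
    linear_combination (2 * (c : ℂ) * u - I * c ^ 2) * hI
  have hd : (1 + I * ((deriv (parabola c) (2 * c * u) : ℝ) : ℂ)) = I * ζ / c := by
    rw [(hasDerivAt_parabola c _).deriv]
    have h1 : 2 * (2 * c * u) / (4 * c ^ 2) = u / c := by
      field_simp; ring
    rw [h1, hζ]; push_cast; field_simp
    linear_combination (c : ℂ) * hI
  have hlog : exp (log ζ) = ζ := exp_log hζ0
  have hII : I * (I * ζ ^ 2) = -ζ ^ 2 := by linear_combination ζ ^ 2 * hI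
  rw [graphDensity, hz, hd, hankelIntegrand, powBelow, hII, log_neg_sq him, gammaIntegrand]
  have h2 : μ * (2 * log ζ + π * I - I * π / 2) = μ * (I * π / 2) + 2 * μ * log ζ := by ring
  have h3 : exp ((2 * μ + 1) * log ζ) = exp (2 * μ * log ζ) * ζ := by
    rw [add_mul, one_mul, exp_add, hlog]
  rw [h2, exp_add, ← hζ, h3]; field_simp

/-- Since `|u| ≤ |ζ| ≤ 2 + |u|`, one end or the other bounds the power, according to the sign of the
exponent. The bound does not depend on `c`, so it dominates the collapse `c → 0`. -/
theorem norm_gammaIntegrand_le {μ : ℂ} {c u : ℝ} (hc : 0 < c) (hc1 : c ≤ 1) (hu : u ≠ 0) :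
    ‖gammaIntegrand μ c u‖ ≤ Real.exp (4 * π * |μ.im| + 1) *
      ((|u| ^ (2 * μ.re + 1) + (2 + |u|) ^ |2 * μ.re + 1|) * Real.exp (-|u| ^ 2)) := by
  set ζ : ℂ := (u : ℂ) - I * c with hζ
  have hre : ζ.re = u := by simp [hζ]
  have him : ζ.im = -c := by simp [hζ]
  have hζ0 : ζ ≠ 0 := fun h => by simp [h] at him; linarith
  have hpos : 0 < ‖ζ‖ := norm_pos_iff.2 hζ0
  have hlow : |u| ≤ ‖ζ‖ := hre ▸ abs_re_le_norm ζ
  have hup : ‖ζ‖ ≤ 2 + |u| := by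
    have := norm_le_abs_re_add_abs_im ζ
    rw [hre, him, abs_neg, abs_of_pos hc] at this; linarith
  have hu' : 0 < |u| := abs_pos.2 hu
  have h1 : ‖exp ((2 * μ + 1) * log ζ)‖ ≤ ‖ζ‖ ^ (2 * μ.re + 1) * Real.exp (4 * π * |μ.im|) := by
    rw [norm_exp, Real.rpow_def_of_pos hpos, ← Real.exp_add]; refine exp_le_exp.2 ?_
    have h2 : |ζ.arg| ≤ π := abs_arg_le_pi ζ
    have h4 : -(2 * μ.im * ζ.arg) ≤ 4 * π * |μ.im| := by
      refine (neg_le_abs _).trans ?_; rw [abs_mul, abs_mul, abs_of_pos (zero_lt_two' ℝ)]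
      have := mul_le_mul_of_nonneg_left h2 (abs_nonneg μ.im)
      have := mul_nonneg pi_pos.le (abs_nonneg μ.im); linarith
    simp only [mul_re, add_re, one_re, add_im, mul_im, one_im, log_re, log_im, re_ofNat, im_ofNat]
    linarith
  have h2 : ‖exp (-ζ ^ 2)‖ ≤ Real.exp 1 * Real.exp (-|u| ^ 2) := by
    rw [norm_exp, ← Real.exp_add]; refine exp_le_exp.2 ?_
    have : (-ζ ^ 2).re = c ^ 2 - u ^ 2 := by
      rw [pow_two, neg_re, mul_re, hre, him]; ring
    rw [this, sq_abs]; nlinarith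
  have h3 : ‖ζ‖ ^ (2 * μ.re + 1) ≤ |u| ^ (2 * μ.re + 1) + (2 + |u|) ^ |2 * μ.re + 1| := by
    rcases le_total 0 (2 * μ.re + 1) with h | h
    · rw [abs_of_nonneg h]; have := rpow_le_rpow hpos.le hup h
      have : 0 ≤ |u| ^ (2 * μ.re + 1) := by positivity
      linarith
    · have := Real.rpow_le_rpow_of_nonpos hu' hlow h
      have : 0 ≤ (2 + |u|) ^ |2 * μ.re + 1| := by positivity
      linarith
  rw [gammaIntegrand, norm_mul, ← hζ]
  calc _ ≤ ((|u| ^ (2 * μ.re + 1) + (2 + |u|) ^ |2 * μ.re + 1|)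
        * Real.exp (4 * π * |μ.im|)) * (Real.exp 1 * Real.exp (-|u| ^ 2)) := by
        gcongr; exact h1.trans (by gcongr)
    _ = _ := by
        rw [Real.exp_add]; ring

theorem integrable_gammaBound {a : ℝ} (ha : -1 < a) :
    Integrable fun u : ℝ => (|u| ^ a + (2 + |u|) ^ |a|) * Real.exp (-|u| ^ 2) := by
  refine integrable_comp_abs_of_integrableOn_Ioi
    (f := fun u => (u ^ a + (2 + u) ^ |a|) * Real.exp (-u ^ 2)) ?_
  simp only [add_mul]; refine Integrable.add ?_ ?_
  · have h : IntegrableOn (fun u : ℝ => u ^ a * Real.exp (-u ^ 2)) (Ioi 0) := by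
      simpa using integrableOn_rpow_mul_exp_neg_mul_sq (b := 1) one_pos ha
    exact h
  · obtain ⟨K, hK, hb⟩ := exists_one_add_rpow_le_exp |a| one_pos
    have h1 : Integrable fun u : ℝ => K * Real.exp 2 * Real.exp (-(1 / 2) * u ^ 2) :=
      (integrable_exp_neg_mul_sq (by norm_num)).const_mul _
    refine Integrable.mono' h1.integrableOn ?_ ?_
    · refine Measurable.aestronglyMeasurable ?_; fun_prop
    · rw [ae_restrict_iff' measurableSet_Ioi]
      refine .of_forall fun u hu => ?_
      have hu' : (0 : ℝ) < u := hu; have h2 := hb (1 + u) (by linarith)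
      rw [Real.norm_of_nonneg (by positivity), show 2 + u = 1 + (1 + u) by ring]
      calc _ ≤ (K * Real.exp (1 * (1 + u))) * Real.exp (-u ^ 2) := by gcongr
        _ = K * Real.exp (1 + u - u ^ 2) := by
            rw [mul_assoc, ← Real.exp_add]; ring_nf
        _ ≤ K * Real.exp (2 + -(1 / 2) * u ^ 2) := by
            gcongr; nlinarith [sq_nonneg (u - 1)]
        _ = _ := by rw [Real.exp_add]; ring

theorem continuous_gammaIntegrand (μ : ℂ) {c : ℝ} (hc : 0 < c) :
    Continuous (gammaIntegrand μ c) := by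
  unfold gammaIntegrand
  have h : Continuous fun u : ℝ => log ((u : ℂ) - I * c) := by
    refine Continuous.clog (by fun_prop) fun u => ?_
    rw [mem_slitPlane_iff]; right; simp [hc.ne']
  fun_prop

theorem integrable_gammaIntegrand {μ : ℂ} (hμ : -1 < μ.re) {c : ℝ} (hc : 0 < c) (hc1 : c ≤ 1) :
    Integrable (gammaIntegrand μ c) := by
  refine Integrable.mono' ((integrable_gammaBound (a := 2 * μ.re + 1) (by linarith)).const_mul
      (Real.exp (4 * π * |μ.im| + 1)))
    (continuous_gammaIntegrand μ hc).aestronglyMeasurable ?_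
  have : ∀ᵐ u : ℝ, u ≠ 0 := by simp [ae_iff]
  filter_upwards [this] with u hu
  exact norm_gammaIntegrand_le hc hc1 hu

/-- The limit of the integrand as the parabola collapses to the cut. -/
noncomputable def gammaLimit (μ : ℂ) (u : ℝ) : ℂ :=
  if 0 < u then exp ((2 * μ + 1) * Real.log u) * exp (-(u : ℂ) ^ 2)
  else exp ((2 * μ + 1) * (Real.log (-u) - I * π)) * exp (-(u : ℂ) ^ 2)

/-- For `u < 0` the points `u - ic` reach the negative axis from below, where the logarithm is `log
|u| - iπ`; this is the second branch of `gammaLimit`. -/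
theorem tendsto_gammaIntegrand (μ : ℂ) {u : ℝ} (hu : u ≠ 0) :
    Tendsto (fun c => gammaIntegrand μ c u) (𝓝[>] 0) (𝓝 (gammaLimit μ u)) := by
  have hζ : Tendsto (fun c : ℝ => (u : ℂ) - I * c) (𝓝[>] 0) (𝓝 (u : ℂ)) := by
    have : Continuous fun c : ℝ => (u : ℂ) - I * c := by fun_prop
    have h := this.tendsto 0; simp only [ofReal_zero, mul_zero, sub_zero] at h
    exact h.mono_left nhdsWithin_le_nhds
  have hsq : Tendsto (fun c : ℝ => exp (-((u : ℂ) - I * c) ^ 2)) (𝓝[>] 0)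
      (𝓝 (exp (-(u : ℂ) ^ 2))) :=
    (continuous_exp.tendsto _).comp ((hζ.pow 2).neg)
  have hexp : ∀ L : ℂ, Tendsto (fun c : ℝ => log ((u : ℂ) - I * c)) (𝓝[>] 0)
      (𝓝 L) → Tendsto (fun c : ℝ => exp ((2 * μ + 1)
        * log ((u : ℂ) - I * c))) (𝓝[>] 0)
        (𝓝 (exp ((2 * μ + 1) * L))) := fun L hL =>
    (continuous_exp.tendsto _).comp (hL.const_mul _)
  rcases lt_or_gt_of_ne hu with h | h
  · have hl : Tendsto (fun c : ℝ => log ((u : ℂ) - I * c)) (𝓝[>] 0)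
        (𝓝 (Real.log (-u) - I * π)) := by
      have h1 := tendsto_log_nhdsWithin_im_neg_of_re_neg_of_im_zero (z := (u : ℂ))
        (by simpa using h) (by simp)
      have h2 : Tendsto (fun c : ℝ => (u : ℂ) - I * c) (𝓝[>] 0)
          (𝓝[{z : ℂ | z.im < 0}] (u : ℂ)) := by
        refine tendsto_nhdsWithin_iff.2 ⟨hζ, ?_⟩
        filter_upwards [self_mem_nhdsWithin] with c hc; simpa using hc
      have h3 := h1.comp h2; have h4 : ‖(u : ℂ)‖ = -u := by simp [abs_of_neg h]
      rw [h4, mul_comm] at h3; exact h3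
    simp only [gammaLimit, not_lt.2 h.le, if_false]; exact (hexp _ hl).mul hsq
  · have hl : Tendsto (fun c : ℝ => log ((u : ℂ) - I * c)) (𝓝[>] 0) (𝓝 (Real.log u : ℂ)) := by
      have h1 := (continuousAt_clog (x := (u : ℂ)) (by
        rw [mem_slitPlane_iff]; left; simpa using h)).tendsto.comp hζ
      rwa [← ofReal_log h.le] at h1
    simp only [gammaLimit, h, if_true]; exact (hexp _ hl).mul hsq

/-- Euler's integral after the substitution `y = u²`. -/
theorem integral_exp_log_mul_exp_neg_sq {μ : ℂ} (hμ : -1 < μ.re) :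
    ∫ u in Ioi (0 : ℝ), exp ((2 * μ + 1) * Real.log u) * exp (-(u : ℂ) ^ 2)
      = Gamma (1 + μ) / 2 := by
  rw [Gamma_eq_integral (by simpa using by linarith), GammaIntegral,
    ← integral_comp_rpow_Ioi_of_pos (p := 2)
      (g := fun y : ℝ => ((Real.exp (-y) : ℝ) : ℂ) * (y : ℂ) ^ (1 + μ - 1)) two_pos, eq_div_iff two_ne_zero, ← integral_mul_const]
  refine setIntegral_congr_fun measurableSet_Ioi fun u hu => ?_
  have hu' : (0 : ℝ) < u := hu; have hu0 : (u : ℂ) ≠ 0 := by exact_mod_cast hu'.ne'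
  have h1 : u ^ (2 : ℝ) = u ^ 2 := by norm_cast
  have h2 : ((u ^ 2 : ℝ) : ℂ) ≠ 0 := by exact_mod_cast (pow_pos hu' 2).ne'
  simp only [h1]; rw [cpow_def_of_ne_zero h2, ← ofReal_log (by positivity), Real.log_pow]
  have h3 : exp (Real.log u : ℂ) = u := by rw [← ofReal_exp, Real.exp_log hu']
  have h4 : (2 : ℝ) - 1 = 1 := by norm_num
  rw [h4, Real.rpow_one, add_mul, one_mul, exp_add, h3]
  have h5 : ((Nat.cast 2 * Real.log u : ℝ) : ℂ) * (1 + μ - 1) = 2 * μ * Real.log u := by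
    push_cast; ring
  rw [h5]; simp only [real_smul]; push_cast; ring

/-- The negative half-line repeats the positive one up to the monodromy factor `e^{-iπ(2μ+1)} =
-e^{-2πiμ}`. -/
theorem integral_gammaLimit {μ : ℂ} (hμ : -1 < μ.re) :
    ∫ u, gammaLimit μ u = (1 - exp (-(I * 2 * π * μ))) * Gamma (1 + μ) / 2 := by
  have hpos : ∀ u ∈ Ioi (0 : ℝ), gammaLimit μ u
      = exp ((2 * μ + 1) * Real.log u) * exp (-(u : ℂ) ^ 2) := fun u hu => by
    simp only [gammaLimit, if_pos (mem_Ioi.1 hu)]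
  have hneg : ∀ u ∈ Ioi (0 : ℝ), gammaLimit μ (-u)
      = -exp (-(I * 2 * π * μ))
        * (exp ((2 * μ + 1) * Real.log u) * exp (-(u : ℂ) ^ 2)) := fun u hu => by
    have hu' : ¬ (0 : ℝ) < -u := by
      have : (0 : ℝ) < u := hu; linarith
    simp only [gammaLimit, if_neg hu', neg_neg]
    have h1 : (2 * μ + 1) * (Real.log u - I * π) = (2 * μ + 1) * Real.log u
        + (-(I * 2 * π * μ) + -(π * I)) := by ring
    rw [h1, exp_add, exp_add, exp_neg (π * I), exp_pi_mul_I]; push_cast; rw [neg_sq]; ring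
  have hmeas : AEStronglyMeasurable
      (fun u : ℝ => exp ((2 * μ + 1) * Real.log u) * exp (-(u : ℂ) ^ 2))
      (volume.restrict (Ioi 0)) := by
    refine Measurable.aestronglyMeasurable ?_; fun_prop
  have hI : IntegrableOn
      (fun u : ℝ => exp ((2 * μ + 1) * Real.log u) * exp (-(u : ℂ) ^ 2))
      (Ioi 0) := by
    refine Integrable.mono' (integrableOn_rpow_mul_exp_neg_mul_sq (b := 1) one_pos
      (s := 2 * μ.re + 1) (by linarith)) hmeas ?_
    rw [ae_restrict_iff' measurableSet_Ioi]
    refine .of_forall fun u hu => ?_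
    have hu' : (0 : ℝ) < u := hu; rw [norm_mul, norm_exp, norm_exp, Real.rpow_def_of_pos hu']
    refine le_of_eq ?_; congr 2
    · simp; ring
    · rw [← ofReal_pow, ← ofReal_neg, ofReal_re]; ring
  have hi1 : IntegrableOn (gammaLimit μ) (Ioi 0) :=
    hI.congr_fun (fun u hu => (hpos u hu).symm) measurableSet_Ioi
  have hi2 : IntegrableOn (gammaLimit μ) (Iic 0) := by
    rw [integrableOn_Iic_iff_integrableOn_Iio]
    have h : IntegrableOn (fun u => gammaLimit μ (-u)) (Ioi 0) :=
      IntegrableOn.congr_fun (f := fun u : ℝ => -exp (-(I * 2 * π * μ))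
        * (exp ((2 * μ + 1) * Real.log u) * exp (-(u : ℂ) ^ 2)))
        (hI.const_mul _) (fun u hu => (hneg u hu).symm) measurableSet_Ioi
    simpa using h.comp_neg
  rw [← intervalIntegral.integral_Iic_add_Ioi hi2 hi1, setIntegral_congr_fun measurableSet_Ioi hpos,
    ← neg_zero, ← integral_comp_neg_Ioi, neg_zero, setIntegral_congr_fun measurableSet_Ioi hneg,
    integral_const_mul, integral_exp_log_mul_exp_neg_sq hμ]
  ring

theorem integrable_graphDensity_parabola {μ : ℂ} (hμ : -1 < μ.re) {c : ℝ} (hc : 0 < c)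
    (hc1 : c ≤ 1) : Integrable (graphDensity (hankelIntegrand μ) (parabola c)) := by
  refine (integrable_comp_mul_left_iff _ (R := 2 * c) (by positivity)).1 ?_
  simp only [graphDensity_parabola μ hc]
  exact (integrable_gammaIntegrand hμ hc hc1).const_mul _

theorem integral_graphDensity_parabola (μ : ℂ) {c : ℝ} (hc : 0 < c) :
    ∫ t, graphDensity (hankelIntegrand μ) (parabola c) t
      = 2 * (I * exp (μ * (I * π / 2))) * ∫ u, gammaIntegrand μ c u := by
  have h := Measure.integral_comp_mul_left (graphDensity (hankelIntegrand μ) (parabola c)) (2 * c)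
  simp only [graphDensity_parabola μ hc] at h
  rw [integral_const_mul, abs_of_pos (by positivity), eq_comm, inv_smul_eq_iff₀ (by positivity)] at h
  rw [h, real_smul]; have hcc : (c : ℂ) ≠ 0 := by exact_mod_cast hc.ne'
  push_cast; field_simp

theorem norm_hankelIntegrand_le_of_im_ge {μ z : ℂ} {A B b : ℝ} (hre : |μ.re| ≤ A)
    (him : |μ.im| ≤ A) (hz1 : 1 ≤ ‖z‖) (hzB : ‖z‖ + 1 ≤ B) (hb : b ≤ z.im) :
    ‖hankelIntegrand μ z‖ ≤ B ^ A * Real.exp (2 * π * A) * Real.exp (-b) := by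
  have hA : 0 ≤ A := (abs_nonneg _).trans hre
  have hpos : 0 < ‖z‖ := by linarith
  rw [hankelIntegrand, norm_mul]
  have h1 : ‖exp (I * z)‖ ≤ Real.exp (-b) := by
    rw [norm_exp]; simpa using hb
  have hB : 0 ≤ B := by linarith
  have h2 : ‖z‖⁻¹ ≤ 1 := inv_le_one_of_one_le₀ hz1
  calc _ ≤ (‖z‖ ^ μ.re * Real.exp (2 * π * |μ.im|)) * Real.exp (-b) := by
        gcongr; exact norm_powBelow_le (norm_pos_iff.1 hpos)
    _ ≤ _ := by
        gcongr; refine (rpow_le_add_inv_rpow hpos hre).trans ?_; gcongr; linarith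

/-- Both contours pass below the origin, so Cauchy's theorem applies on `[-N, N]`. The vertical
segments at `±N` lie above height `s(N - 2)`, where `e^{iz}` decays exponentially, while their
lengths and the power grow only polynomially. -/
theorem hankelIntegral_eq_parabola {s : ℝ} (hs : 0 < s) (hs1 : s ≤ 1) {μ : ℂ} (hμ : -1 < μ.re)
    {c : ℝ} (hc : 0 < c) (hc1 : c ≤ 1) :
    hankelIntegral s μ = ∫ t, graphDensity (hankelIntegrand μ) (parabola c) t := by
  set f := hankelIntegrand μ with hf
  have ht0 : Tendsto (fun N : ℝ => ∫ t in (-N)..N, graphDensity f (dipProfile s 1) t) atTop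
      (𝓝 (hankelIntegral s μ)) :=
    intervalIntegral_tendsto_integral (integrable_graphDensity_hankelIntegrand hs hs1 μ)
      tendsto_neg_atTop_atBot tendsto_id
  have ht1 : Tendsto (fun N : ℝ => ∫ t in (-N)..N, graphDensity f (parabola c) t) atTop
      (𝓝 (∫ t, graphDensity f (parabola c) t)) :=
    intervalIntegral_tendsto_integral (integrable_graphDensity_parabola hμ hc hc1)
      tendsto_neg_atTop_atBot tendsto_id
  set A : ℝ := max |μ.re| |μ.im| with hA
  have hA0 : 0 ≤ A := (abs_nonneg _).trans (le_max_left _ _)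
  set K1 : ℝ := 1 + 1 / (4 * c ^ 2) with hK1
  have hK₁1 : 1 ≤ K1 := by
    have : 0 ≤ 1 / (4 * c ^ 2) := by positivity
    linarith
  obtain ⟨K, hK, hKb⟩ := exists_one_add_rpow_le_exp (2 * A + 2) (c := s / 2) (by positivity)
  set C : ℝ := 2 * K1 * ((3 * K1) ^ A * Real.exp (2 * π * A)) * Real.exp (2 * s) * K with hC
  have hbound : ∀ N : ℝ, 2 ≤ N → ‖(∫ t in (-N)..N, graphDensity f (parabola c) t)
      - ∫ t in (-N)..N, graphDensity f (dipProfile s 1) t‖ ≤ C * Real.exp (-(s / 2 * N)) := by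
    intro N hN
    have hends : ∀ t : ℝ, |t| = N → s * (N - 2) ≤ dipProfile s 1 t ∧ s * (N - 2) ≤ parabola c t ∧
        dipProfile s 1 t ≤ K1 * (1 + N) ^ 2 ∧ parabola c t ≤ K1 * (1 + N) ^ 2 := by
      intro t ht; have htt : t ^ 2 = N ^ 2 := by rw [← ht, sq_abs]
      have h1 := dipProfile_lower (κ := 1) hs.le t
      have h2 := dipProfile_upper hs.le zero_le_one t
      have h3 : N ^ 2 / 4 ≤ N ^ 2 / (4 * c ^ 2) := by
        gcongr; nlinarith
      have h5 : (N ^ 2) / (4 * c ^ 2) = N ^ 2 * (1 / (4 * c ^ 2)) := by ring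
      have h6 : 0 ≤ 1 / (4 * c ^ 2) := by positivity
      refine ⟨by rw [ht] at h1; linarith, ?_, ?_, ?_⟩
      -- Here `c ≤ 1` is used: `N²/4 - 1 ≥ N - 2` because `(N - 2)² ≥ 0`.
      · rw [parabola, htt]; have h7 : s * (N - 2) ≤ N - 2 := by nlinarith
        nlinarith [sq_nonneg (N - 2)]
      · rw [ht] at h2; have h7 : s * (N - 1) ≤ N - 1 := by nlinarith
        nlinarith
      · rw [parabola, htt, h5]; nlinarith [sq_nonneg c]
    have hM : ∀ t : ℝ, |t| = N → ∀ τ ∈ Icc (0 : ℝ) 1,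
        ‖f (graphPt (fun t => dipProfile s 1 t + τ * (parabola c t - dipProfile s 1 t)) t)‖
          ≤ (3 * K1 * (1 + N) ^ 2) ^ A * Real.exp (2 * π * A) * Real.exp (-(s * (N - 2))) := by
      intro t ht τ hτ; obtain ⟨e1, e2, e3, e4⟩ := hends t ht
      set v := dipProfile s 1 t + τ * (parabola c t - dipProfile s 1 t) with hv
      have hv1 : s * (N - 2) ≤ v := by nlinarith [hτ.1, hτ.2]
      have hv2 : v ≤ K1 * (1 + N) ^ 2 := by nlinarith [hτ.1, hτ.2]
      have hv0 : 0 ≤ v := le_trans (by nlinarith) hv1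
      set z := graphPt (fun t => dipProfile s 1 t + τ * (parabola c t - dipProfile s 1 t)) t with hz
      have hzre : z.re = t := by simp [hz, graphPt]
      have hzim : z.im = v := by simp [hz, graphPt, hv]
      refine norm_hankelIntegrand_le_of_im_ge (le_max_left _ _) (le_max_right _ _) ?_ ?_ ?_
      · have := abs_re_le_norm z; rw [hzre, ht] at this; linarith
      · have := norm_le_abs_re_add_abs_im z; rw [hzre, hzim, ht, abs_of_nonneg hv0] at this; nlinarith
      · rw [hzim]; exact hv1
    have hdiff : ∀ t : ℝ, |t| = N → |parabola c t - dipProfile s 1 t| ≤ K1 * (1 + N) ^ 2 := by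
      intro t ht; obtain ⟨e1, e2, e3, e4⟩ := hends t ht
      have : 0 ≤ s * (N - 2) := by nlinarith
      rw [abs_le]; constructor <;> linarith
    have hNa : |N| = N := abs_of_nonneg (by linarith)
    have hNa' : |-N| = N := by rw [abs_neg, hNa]
    have hmem : ∀ τ ∈ Icc (0 : ℝ) 1, ∀ t ∈ Icc (-N) N, graphPt (fun t => dipProfile s 1 t
        + τ * (parabola c t - dipProfile s 1 t)) t ∈ cutAbove := by
      intro τ hτ t _ h0; have ht : t = 0 := by simpa [graphPt] using h0
      have h1 := dipProfile_upper (κ := 1) hs.le zero_le_one 0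
      have h2 : parabola c 0 = -c ^ 2 := by simp [parabola]
      have h3 : 0 < c ^ 2 := by positivity
      rw [abs_zero] at h1
      have h4 : (graphPt (fun t => dipProfile s 1 t
          + τ * (parabola c t - dipProfile s 1 t)) t).im
          = (1 - τ) * dipProfile s 1 0 + τ * -c ^ 2 := by
        simp only [graphPt, ht, h2, add_im, ofReal_im, mul_im, I_re, I_im, ofReal_re]; ring
      rw [h4]; rcases eq_or_lt_of_le hτ.1 with h | h
      · rw [← h]; linarith
      · have h5 : (1 - τ) * dipProfile s 1 0 ≤ 0 :=
          mul_nonpos_of_nonneg_of_nonpos (by linarith [hτ.2]) (by linarith)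
        have h6 : 0 < τ * c ^ 2 := by positivity
        linarith
    have h := norm_integral_graphDensity_sub_le isOpen_cutAbove
      (fun z hz => (hasDerivAt_hankelIntegrand hz μ).differentiableAt.differentiableWithinAt)
      (contDiff_dipProfile s one_ne_zero) (contDiff_parabola c) (a := -N) (b := N) (by linarith)
      hmem (hM (-N) hNa') (hM N hNa)
    refine h.trans ?_; have hNN : (0 : ℝ) ≤ 1 + N := by linarith
    calc _ ≤ (3 * K1 * (1 + N) ^ 2) ^ A * Real.exp (2 * π * A)
            * Real.exp (-(s * (N - 2))) * (K1 * (1 + N) ^ 2)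
          + (3 * K1 * (1 + N) ^ 2) ^ A * Real.exp (2 * π * A)
            * Real.exp (-(s * (N - 2))) * (K1 * (1 + N) ^ 2) := by
          gcongr
          · exact hdiff N hNa
          · exact hdiff (-N) hNa'
      _ = 2 * K1 * ((3 * K1) ^ A * Real.exp (2 * π * A)) * Real.exp (2 * s)
          * ((1 + N) ^ (2 * A + 2) * Real.exp (-(s * N))) := by
          have h1 : (3 * K1 * (1 + N) ^ 2) ^ A = (3 * K1) ^ A * (1 + N) ^ (2 * A) := by
            rw [mul_rpow (by positivity) (by positivity), ← Real.rpow_natCast_mul hNN]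
            norm_cast
          have h2 : (1 + N) ^ (2 * A + 2) = (1 + N) ^ (2 * A) * (1 + N) ^ 2 := by
            rw [Real.rpow_add (by linarith)]; norm_cast
          have h3 : Real.exp (-(s * (N - 2))) = Real.exp (2 * s) * Real.exp (-(s * N)) := by
            rw [← Real.exp_add]; ring_nf
          rw [h1, h2, h3]; ring
      _ ≤ 2 * K1 * ((3 * K1) ^ A * Real.exp (2 * π * A)) * Real.exp (2 * s)
          * ((K * Real.exp (s / 2 * N)) * Real.exp (-(s * N))) := by
          gcongr; exact hKb N (by linarith)
      _ = C * Real.exp (-(s / 2 * N)) := by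
          have h3 : Real.exp (s / 2 * N) * Real.exp (-(s * N)) = Real.exp (-(s / 2 * N)) := by
            rw [← Real.exp_add]; ring_nf
          rw [hC, ← h3]; ring
  have hzero : Tendsto (fun N : ℝ => (∫ t in (-N)..N, graphDensity f (parabola c) t)
      - ∫ t in (-N)..N, graphDensity f (dipProfile s 1) t) atTop (𝓝 0) := by
    refine squeeze_zero_norm' ((eventually_ge_atTop 2).mono hbound) ?_
    have h2 : Tendsto (fun t : ℝ => Real.exp (-(s / 2 * t))) atTop (𝓝 0) :=
      Real.tendsto_exp_neg_atTop_nhds_zero.comp (tendsto_id.const_mul_atTop (by positivity))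
    simpa using h2.const_mul C
  have h := tendsto_nhds_unique hzero (ht1.sub ht0)
  exact (sub_eq_zero.1 h.symm).symm

/-- The integral over the parabola does not depend on its parameter `c`; as `c → 0` the parabola
collapses onto the two edges of the cut. The condition on `μ` makes the singularity at the tip
integrable. -/
theorem hankelIntegral_of_neg_one_lt_re {s : ℝ} (hs : 0 < s) (hs1 : s ≤ 1) {μ : ℂ}
    (hμ : -1 < μ.re) : hankelIntegral s μ = exp (π * I * (μ + 1) / 2) *
      (1 - exp (-(I * 2 * π * μ))) * Gamma (1 + μ) := by
  have hlim : Tendsto (fun c : ℝ => ∫ u, gammaIntegrand μ c u) (𝓝[>] 0)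
      (𝓝 (∫ u, gammaLimit μ u)) := by
    have hev : ∀ᶠ c : ℝ in 𝓝[>] 0, 0 < c ∧ c ≤ 1 := by
      filter_upwards [Ioc_mem_nhdsGT (zero_lt_one' ℝ)] with c hc; exact hc
    have hne : ∀ᵐ u : ℝ, u ≠ 0 := by simp [ae_iff]
    refine tendsto_integral_filter_of_dominated_convergence
      (fun u => Real.exp (4 * π * |μ.im| + 1) * ((|u| ^ (2 * μ.re + 1)
        + (2 + |u|) ^ |2 * μ.re + 1|) * Real.exp (-|u| ^ 2))) ?_ ?_ ?_ ?_
    · exact hev.mono fun c hc => (continuous_gammaIntegrand μ hc.1).aestronglyMeasurable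
    · exact hev.mono fun c hc => hne.mono fun u hu => norm_gammaIntegrand_le hc.1 hc.2 hu
    · exact (integrable_gammaBound (by linarith)).const_mul _
    · exact hne.mono fun u hu => tendsto_gammaIntegrand μ hu
  have hlim2 := hlim.const_mul (2 * (I * exp (μ * (I * π / 2))))
  have hconst : (fun c : ℝ => 2 * (I * exp (μ * (I * π / 2)))
      * ∫ u, gammaIntegrand μ c u) =ᶠ[𝓝[>] 0] fun _ => hankelIntegral s μ := by
    filter_upwards [Ioc_mem_nhdsGT (zero_lt_one' ℝ)] with c hc
    rw [hankelIntegral_eq_parabola hs hs1 hμ hc.1 hc.2, integral_graphDensity_parabola μ hc.1]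
  have h := tendsto_nhds_unique (hlim2.congr' hconst) tendsto_const_nhds
  rw [← h, integral_gammaLimit hμ]
  have hI : exp (π * I * (μ + 1) / 2) = I * exp (μ * (I * π / 2)) := by
    rw [show (π : ℂ) * I * (μ + 1) / 2
      = π / 2 * I + μ * (I * π / 2) by ring, exp_add,
      exp_pi_div_two_mul_I]
  rw [hI]; ring

/-- Descending induction on `Re μ`: under `μ ↦ μ + 1` the recursion and the functional equation of
`Gamma` both produce the factor `I (μ + 1)`, which is not zero for a nonintegral `μ`. -/
theorem hankelIntegral_of_not_int {s : ℝ} (hs : 0 < s) (hs1 : s ≤ 1) (n : ℕ) :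
    ∀ {μ : ℂ}, (∀ k : ℤ, μ ≠ k) → -1 - n < μ.re →
      hankelIntegral s μ = exp (π * I * (μ + 1) / 2) *
      (1 - exp (-(I * 2 * π * μ))) * Gamma (1 + μ) := by
  induction n with
  | zero =>
    intro μ _ h; exact hankelIntegral_of_neg_one_lt_re hs hs1 (by simpa using h)
  | succ n ih =>
    intro μ hμ h
    have hμ1 : μ + 1 ≠ 0 := fun h0 => hμ (-1) (by
      push_cast
      linear_combination h0)
    have h1 := hankelIntegral_recursion hs hs1 (μ + 1)
    rw [add_sub_cancel_right, ih (μ := μ + 1) (fun k hk => hμ (k - 1) (by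
      push_cast
      linear_combination hk)) (by simp at h ⊢; linarith)] at h1
    have h2 : exp (π * I * (μ + 1 + 1) / 2) = I * exp (π * I * (μ + 1) / 2) := by
      rw [show (π : ℂ) * I * (μ + 1 + 1) / 2
        = π / 2 * I + π * I * (μ + 1) / 2 by ring, exp_add,
        exp_pi_div_two_mul_I]
    have h3 : exp (-(I * 2 * π * (μ + 1))) = exp (-(I * 2 * π * μ)) := by
      rw [show -(I * 2 * π * (μ + 1))
        = -(I * 2 * π * μ) + -(2 * π * I) by ring, exp_add,
        exp_neg (2 * π * I), exp_two_pi_mul_I]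
      simp
    have h4 : Gamma (1 + (μ + 1)) = (μ + 1) * Gamma (1 + μ) := by
      rw [show 1 + (μ + 1) = (μ + 1) + 1 by ring, Gamma_add_one _ hμ1, add_comm μ 1]
    rw [h2, h3, h4] at h1; have h5 : I * (μ + 1) ≠ 0 := mul_ne_zero I_ne_zero hμ1
    refine mul_left_cancel₀ h5 ?_; rw [← h1]; ring

/-- Limit `μ = -1 + ε`, `ε → 0+`: the pole of `Gamma ε` cancels the zero of `1 - e^{-2πiε}`, and the
slope of the latter gives `2πi`. -/
theorem hankelIntegral_neg_one {s : ℝ} (hs : 0 < s) (hs1 : s ≤ 1) :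
    hankelIntegral s (-1) = 2 * π * I := by
  have hcont : Tendsto (fun ε : ℝ => hankelIntegral s (-1 + ε)) (𝓝[>] 0)
      (𝓝 (hankelIntegral s (-1))) := by
    have h1 : Continuous fun ε : ℝ => hankelIntegral s (-1 + ε) :=
      (continuous_hankelIntegral hs hs1).comp (by fun_prop)
    have h2 := h1.tendsto 0; simp only [ofReal_zero, add_zero] at h2
    exact h2.mono_left nhdsWithin_le_nhds
  have hslope : Tendsto (fun ε : ℝ => (ε : ℂ)⁻¹ *
      (1 - exp (-(I * 2 * π * ε)))) (𝓝[>] 0)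
      (𝓝 (I * 2 * π)) := by
    have h1 : HasDerivAt (fun ε : ℝ => -exp (-(I * 2 * π * ε))) (I * 2 * π) 0 := by
      have h2 : HasDerivAt (fun ε : ℝ => -(I * 2 * π * (ε : ℂ))) (-(I * 2 * π)) 0 := by
        have := ((hasDerivAt_id (0 : ℝ)).ofReal_comp.const_mul (I * 2 * π)).neg; simpa using! this
      simpa using! h2.cexp.neg
    have h2 := h1.tendsto_slope_zero_right; refine h2.congr fun ε => ?_
    simp; ring
  have hgamma : Tendsto (fun ε : ℝ => Gamma (1 + ε)) (𝓝[>] 0) (𝓝 1) := by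
    have h1 : ContinuousAt (fun ε : ℝ => Gamma (1 + ε)) 0 := by
      refine ContinuousAt.comp (g := Gamma) (f := fun ε : ℝ => (1 + ε : ℂ)) ?_ (by fun_prop)
      refine (differentiableAt_Gamma _ fun m h => ?_).continuousAt; have := congrArg Complex.re h
      simp at this; have hm : (0 : ℝ) ≤ m := Nat.cast_nonneg m; linarith
    have h2 := h1.tendsto; simp only [ofReal_zero, add_zero, Gamma_one] at h2
    exact h2.mono_left nhdsWithin_le_nhds
  have hexp : Tendsto (fun ε : ℝ => exp (π * I * ε / 2)) (𝓝[>] 0) (𝓝 1) := by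
    have h1 : Continuous fun ε : ℝ => exp (π * I * ε / 2) := by fun_prop
    have h2 := h1.tendsto 0; simp only [ofReal_zero, mul_zero, zero_div, exp_zero] at h2
    exact h2.mono_left nhdsWithin_le_nhds
  have hval : (fun ε : ℝ => hankelIntegral s (-1 + ε)) =ᶠ[𝓝[>] 0]
      fun ε : ℝ => exp (π * I * ε / 2) *
        ((ε : ℂ)⁻¹ * (1 - exp (-(I * 2 * π * ε)))) *
        Gamma (1 + ε) := by
    filter_upwards [self_mem_nhdsWithin] with ε hε; have hε' : (0 : ℝ) < ε := hε
    have hεc : (ε : ℂ) ≠ 0 := by exact_mod_cast hε'.ne'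
    rw [hankelIntegral_of_neg_one_lt_re hs hs1 (by simpa using hε')]
    have h1 : Gamma (1 + (ε : ℂ)) = ε * Gamma ε := by rw [add_comm, Gamma_add_one _ hεc]
    have h2 : exp (-(I * 2 * π * (-1 + ε))) = exp (-(I * 2 * π * ε)) := by
      rw [show -(I * 2 * π * (-1 + ε))
        = 2 * π * I + -(I * 2 * π * ε) by ring, exp_add,
        exp_two_pi_mul_I, one_mul]
    rw [h1, h2, show (-1 + (ε : ℂ) + 1) = ε by ring, show (1 + (-1 + (ε : ℂ))) = ε by ring]
    field_simp
  have h := tendsto_nhds_unique (hcont.congr' hval) ((hexp.mul hslope).mul hgamma); rw [h]; ring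

/-- Hankel's formula. -/
theorem hankelIntegral_eq_singConst {s : ℝ} (hs : 0 < s) (hs1 : s ≤ 1) {μ : ℂ}
    (hμ : μ = -1 ∨ ∀ n : ℤ, μ ≠ n) : hankelIntegral s μ = singConst μ := by
  by_cases h : μ = -1
  · rw [singConst, if_pos h, h, hankelIntegral_neg_one hs hs1]
  · obtain ⟨n, hn⟩ := exists_nat_gt (-1 - μ.re); rw [singConst, if_neg h]
    exact hankelIntegral_of_not_int hs hs1 n (hμ.resolve_left h) (by linarith)

/-- Off the integers `1 - e^{-2πiμ}` and `Gamma` do not vanish. A nonzero constant is what makes the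
asymptotic equivalences meaningful. -/
theorem singConst_ne_zero {μ : ℂ} (hμ : μ = -1 ∨ ∀ n : ℤ, μ ≠ n) : singConst μ ≠ 0 := by
  by_cases h : μ = -1
  · rw [singConst, if_pos h]; exact two_pi_I_ne_zero
  · have hμ' := hμ.resolve_left h; rw [singConst, if_neg h]
    refine mul_ne_zero (mul_ne_zero (exp_ne_zero _) ?_) ?_
    · intro h0; obtain ⟨n, hn⟩ := exp_eq_one_iff.1 (sub_eq_zero.1 h0).symm
      refine hμ' (-n) (mul_left_cancel₀ two_pi_I_ne_zero ?_); push_cast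
      linear_combination -hn
    · refine Gamma_ne_zero fun m hm => hμ' (-m - 1) ?_
      push_cast
      linear_combination hm

/-! ### One-dimensional asymptotics across the singularity -/

theorem tendsto_exp_neg_const_mul_atTop {m : ℝ} (hm : 0 < m) :
    Tendsto (fun Λ : ℝ => Real.exp (-(m * Λ))) atTop (𝓝 0) :=
  Real.tendsto_exp_neg_atTop_nhds_zero.comp (tendsto_id.const_mul_atTop hm)

theorem tendsto_cpow_mul_exp_neg (ν : ℂ) {m : ℝ} (hm : 0 < m) :
    Tendsto (fun Λ : ℝ => ‖(Λ : ℂ) ^ ν‖ * Real.exp (-(m * Λ))) atTop (𝓝 0) := by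
  obtain ⟨K, hK, hb⟩ := exists_one_add_rpow_le_exp |ν.re| (c := m / 2) (by positivity)
  have h1 := (tendsto_exp_neg_const_mul_atTop (m := m / 2) (by positivity)).const_mul K
  rw [mul_zero] at h1; refine squeeze_zero_norm' ?_ h1
  filter_upwards [eventually_ge_atTop 1] with Λ hΛ
  have hΛ0 : 0 < Λ := by linarith
  rw [Real.norm_of_nonneg (by positivity), norm_cpow_eq_rpow_re_of_pos hΛ0]
  calc Λ ^ ν.re * Real.exp (-(m * Λ)) ≤ (K * Real.exp (m / 2 * Λ)) * Real.exp (-(m * Λ)) := by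
        gcongr
        calc Λ ^ ν.re ≤ Λ ^ |ν.re| := Real.rpow_le_rpow_of_exponent_le hΛ (le_abs_self _)
          _ ≤ (1 + Λ) ^ |ν.re| := rpow_le_rpow hΛ0.le (by linarith) (abs_nonneg _)
          _ ≤ _ := hb Λ hΛ0.le
    _ = _ := by
        rw [mul_assoc, ← Real.exp_add]; ring_nf

/-- The profile is homogeneous in `(t, κ)`. At depth parameter `1/Λ` the variable `Λz` therefore
runs along one fixed contour. -/
theorem dipProfile_scale {s Λ : ℝ} (hΛ : 0 < Λ) (y : ℝ) :
    dipProfile s Λ⁻¹ (Λ⁻¹ * y) = Λ⁻¹ * dipProfile s 1 y := by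
  have h : (Λ⁻¹ * y) ^ 2 + Λ⁻¹ ^ 2 = Λ⁻¹ ^ 2 * (y ^ 2 + 1 ^ 2) := by ring
  rw [dipProfile, dipProfile, h, sqrt_mul (by positivity), sqrt_sq (by positivity)]; ring

theorem graphPt_dipProfile_scale {s Λ : ℝ} (hΛ : 0 < Λ) (y : ℝ) :
    graphPt (dipProfile s Λ⁻¹) (Λ⁻¹ * y) = ((Λ⁻¹ : ℝ) : ℂ) * graphPt (dipProfile s 1) y := by
  rw [graphPt, graphPt, dipProfile_scale hΛ]; push_cast; ring

theorem deriv_dipProfile_scale {s Λ : ℝ} (hΛ : 0 < Λ) (y : ℝ) :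
    deriv (dipProfile s Λ⁻¹) (Λ⁻¹ * y) = deriv (dipProfile s 1) y := by
  have h : (Λ⁻¹ * y) ^ 2 + Λ⁻¹ ^ 2 = Λ⁻¹ ^ 2 * (y ^ 2 + 1 ^ 2) := by ring
  rw [(hasDerivAt_dipProfile s (by positivity) _).deriv, (hasDerivAt_dipProfile s one_ne_zero _).deriv,
    h, sqrt_mul (by positivity), sqrt_sq (by positivity)]
  field_simp

/-- The scaled value of a function with leading term `c z ^ μ`. -/
theorem tendsto_scaled_powBelow {f : ℂ → ℂ} {c μ : ℂ}
    (hlead : (fun z => f z - c * powBelow z μ) =o[𝓝[cutAbove] 0] fun z => powBelow z μ)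
    {z : ℂ} (hz : z ∈ cutAbove) :
    Tendsto (fun Λ : ℝ => (Λ : ℂ) ^ μ * f (((Λ⁻¹ : ℝ) : ℂ) * z)) atTop (𝓝 (c * powBelow z μ)) := by
  have hto : Tendsto (fun Λ : ℝ => ((Λ⁻¹ : ℝ) : ℂ) * z) atTop (𝓝[cutAbove] 0) := by
    refine tendsto_nhdsWithin_iff.2 ⟨?_, ?_⟩
    · have h1 : Tendsto (fun Λ : ℝ => ((Λ⁻¹ : ℝ) : ℂ)) atTop (𝓝 ((0 : ℝ) : ℂ)) :=
        (continuous_ofReal.tendsto 0).comp tendsto_inv_atTop_zero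
      simpa using h1.mul_const z
    · filter_upwards [eventually_gt_atTop 0] with Λ hΛ
      exact mul_mem_cutAbove hz (inv_pos.2 hΛ)
  have h1 := hlead.comp_tendsto hto
  have h2 : (fun Λ : ℝ => (Λ : ℂ) ^ μ * (f (((Λ⁻¹ : ℝ) : ℂ) * z)
      - c * powBelow (((Λ⁻¹ : ℝ) : ℂ) * z) μ)) =o[atTop]
      fun Λ : ℝ => (Λ : ℂ) ^ μ * powBelow (((Λ⁻¹ : ℝ) : ℂ) * z) μ :=
    (isBigO_refl _ _).mul_isLittleO h1
  have h3 : ∀ᶠ Λ : ℝ in atTop, (Λ : ℂ) ^ μ * powBelow (((Λ⁻¹ : ℝ) : ℂ) * z) μ = powBelow z μ := by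
    filter_upwards [eventually_gt_atTop 0] with Λ hΛ
    have hΛc : (Λ : ℂ) ≠ 0 := by exact_mod_cast hΛ.ne'
    rw [powBelow_mul (ne_zero_of_mem_cutAbove hz) (inv_pos.2 hΛ), ← mul_assoc, ofReal_inv,
      inv_cpow _ _ (by
        rw [arg_ofReal_of_nonneg hΛ.le]
        exact pi_pos.ne), mul_inv_cancel₀, one_mul]
    simp [cpow_eq_zero_iff, hΛc]
  have h4 := h2.congr' (f₂ := fun Λ : ℝ => (Λ : ℂ) ^ μ * f (((Λ⁻¹ : ℝ) : ℂ) * z)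
      - c * powBelow z μ) (g₂ := fun _ => powBelow z μ) (h3.mono fun Λ h => by
        simp only; rw [mul_sub, ← h]
        ring) h3
  have h5 : Tendsto (fun Λ : ℝ => (Λ : ℂ) ^ μ * f (((Λ⁻¹ : ℝ) : ℂ) * z)
      - c * powBelow z μ) atTop (𝓝 0) := by
    rw [isLittleO_const_iff (powBelow_ne_zero z μ)] at h4; exact h4
  simpa using h5.add_const (c * powBelow z μ)

theorem isEquivalent_of_tendsto_cpow_mul {u : ℝ → ℂ} {c ν : ℂ} (hc : c ≠ 0)
    (h : Tendsto (fun Λ : ℝ => (Λ : ℂ) ^ ν * u Λ) atTop (𝓝 c)) :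
    u ~[atTop] fun Λ : ℝ => (Λ : ℂ) ^ (-ν) * c := by
  refine isEquivalent_of_tendsto_one ?_
  have h1 : Tendsto (fun Λ : ℝ => ((Λ : ℂ) ^ ν * u Λ) / c) atTop (𝓝 1) := by
    simpa [div_self hc] using h.div_const c
  refine h1.congr' ?_; filter_upwards [eventually_gt_atTop 0] with Λ hΛ
  have hΛc : (Λ : ℂ) ≠ 0 := by exact_mod_cast hΛ.ne'
  have h2 : (Λ : ℂ) ^ ν ≠ 0 := by simp [cpow_eq_zero_iff, hΛc]
  rw [Pi.div_apply, cpow_neg]; field_simp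

/-- The leading term of a one-dimensional integral along a contour below the singularity. -/
theorem tendsto_contour_integral {f : ℂ → ℂ} {ρ : ℝ} (hρ : 0 < ρ) {c μ : ℂ}
    (hμ : μ = -1 ∨ ∀ n : ℤ, μ ≠ n)
    (hf : DifferentiableOn ℂ f (ball 0 (3 * ρ) ∩ cutAbove))
    (hlead : (fun z => f z - c * powBelow z μ) =o[𝓝[cutAbove] 0] fun z => powBelow z μ)
    {h : ℝ → ℝ} (hh : IsLowerContour ρ h) :
    Tendsto (fun Λ : ℝ => (Λ : ℂ) ^ (μ + 1) * ∫ t in (-ρ)..ρ,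
      graphDensity (fun z => f z * exp (I * Λ * z)) h t) atTop
      (𝓝 (c * singConst μ)) := by
  have hΩ : IsOpen (ball (0 : ℂ) (3 * ρ) ∩ cutAbove) := isOpen_ball.inter isOpen_cutAbove
  have habs0 : ∀ t ∈ Icc (-ρ) ρ, |t| ≤ ρ := fun t ht => abs_le.2 ht
  have hmemΩ : ∀ z : ℂ, |z.re| ≤ ρ → |z.im| ≤ ρ → z ∈ cutAbove →
      z ∈ ball (0 : ℂ) (3 * ρ) ∩ cutAbove := fun z h1 h2 h3 => by
    refine ⟨?_, h3⟩; rw [mem_ball_zero_iff]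
    have := norm_le_abs_re_add_abs_im z; linarith
  have hdip : ∀ κ : ℝ, 0 < κ → 2 * κ ≤ ρ → ∀ t ∈ Icc (-ρ) ρ, |dipProfile 1 κ t| ≤ ρ := by
    intro κ hκ hκρ t ht; have h1 := dipProfile_lower (κ := κ) zero_le_one t
    have h2 := dipProfile_upper (s := 1) zero_le_one hκ.le t; have h3 := habs0 t ht
    have h4 := abs_nonneg t; rw [abs_le]; constructor <;> linarith
  have hcutdip : ∀ κ : ℝ, 0 < κ → ∀ t, graphPt (dipProfile 1 κ) t ∈ cutAbove := fun κ hκ t =>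
    graphPt_dipProfile_mem_cutAbove one_pos hκ t
  -- a compact set that contains the parts of the contours away from the origin
  have hcompact : ∀ ε > 0, ∃ K, ∀ z : ℂ, ε ≤ |z.re| → |z.re| ≤ ρ → |z.im| ≤ ρ →
      ‖f z‖ ≤ K ∧ ‖f z / powBelow z μ‖ ≤ K := by
    intro ε hε; set S : Set ℂ := {z | ε ≤ |z.re| ∧ |z.re| ≤ ρ ∧ |z.im| ≤ ρ} with hS
    have hScl : IsClosed S := by
      refine (isClosed_le continuous_const (continuous_re.abs)).inter
        ((isClosed_le (continuous_re.abs) continuous_const).inter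
        (isClosed_le (continuous_im.abs) continuous_const))
    have hSc : IsCompact S := by
      refine isCompact_of_isClosed_isBounded hScl ?_
      refine (isBounded_closedBall (x := (0 : ℂ)) (r := 2 * ρ)).subset fun z hz => ?_
      rw [mem_closedBall_zero_iff]; have := norm_le_abs_re_add_abs_im z; linarith [hz.2.1, hz.2.2]
    have hScut : S ⊆ cutAbove := fun z hz h0 => by
      have := hz.1; rw [h0, abs_zero] at this; linarith
    have hSΩ : S ⊆ ball (0 : ℂ) (3 * ρ) ∩ cutAbove := fun z hz => hmemΩ z hz.2.1 hz.2.2 (hScut hz)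
    have hfc := hf.continuousOn.mono hSΩ
    have hpc : ContinuousOn (fun z => powBelow z μ) S := fun z hz =>
      (hasDerivAt_powBelow (hScut hz) μ).continuousAt.continuousWithinAt
    obtain ⟨K1, h1⟩ := hSc.exists_bound_of_continuousOn hfc
    obtain ⟨K2, h2⟩ := hSc.exists_bound_of_continuousOn
      (hfc.div hpc fun z _ => powBelow_ne_zero z μ)
    exact ⟨max K1 K2, fun z a b c => ⟨(h1 z ⟨a, b, c⟩).trans (le_max_left _ _),
      (h2 z ⟨a, b, c⟩).trans (le_max_right _ _)⟩⟩
  -- the contour may be replaced by a dip of depth `1 / Λ`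
  have hstep : Tendsto (fun Λ : ℝ => (Λ : ℂ) ^ (μ + 1) * ((∫ t in (-ρ)..ρ,
      graphDensity (fun z => f z * exp (I * Λ * z)) (dipProfile 1 Λ⁻¹) t)
      - ∫ t in (-ρ)..ρ, graphDensity (fun z => f z * exp (I * Λ * z)) h t)) atTop
      (𝓝 0) := by
    obtain ⟨K, hK⟩ := hcompact ρ hρ
    -- A lower bound for the height of both contours at the ends: the dip is at least `ρ - 2/Λ`
    -- there, and this exceeds `ρ/2` once `4/Λ ≤ ρ`.
    set m := min (ρ / 2) (min (h ρ) (h (-ρ))) with hm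
    have hm0 : 0 < m := lt_min (by positivity) (lt_min hh.right hh.left)
    have hlim := (tendsto_cpow_mul_exp_neg (μ + 1) hm0).const_mul (K * (2 * ρ) + K * (2 * ρ))
    rw [mul_zero] at hlim; refine squeeze_zero_norm' ?_ hlim
    filter_upwards [eventually_ge_atTop (4 / ρ), eventually_gt_atTop 0] with Λ hΛ hΛ0
    have hκ : 4 * Λ⁻¹ ≤ ρ := by
      rw [div_le_iff₀ hρ] at hΛ; rw [← div_eq_mul_inv, div_le_iff₀ hΛ0]; linarith
    have hκ0 : 0 < Λ⁻¹ := inv_pos.2 hΛ0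
    have hconv : ∀ τ ∈ Icc (0 : ℝ) 1, ∀ t ∈ Icc (-ρ) ρ,
        |h t + τ * (dipProfile 1 Λ⁻¹ t - h t)| ≤ ρ := fun τ hτ t ht => by
      have h1 := abs_le.1 (hh.bound t ht)
      have h2 := abs_le.1 (hdip Λ⁻¹ hκ0 (by linarith) t ht); have := hτ.1; have := hτ.2; rw [abs_le]
      constructor <;> nlinarith
    have hedge : ∀ t, |t| = ρ → m ≤ h t → ∀ τ ∈ Icc (0 : ℝ) 1,
        ‖(fun z => f z * exp (I * Λ * z))
          (graphPt (fun t => h t + τ * (dipProfile 1 Λ⁻¹ t - h t)) t)‖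
          ≤ K * Real.exp (-(m * Λ)) := fun t ht hmt τ hτ => by
      have htI : t ∈ Icc (-ρ) ρ := abs_le.1 ht.le
      set z := graphPt (fun t => h t + τ * (dipProfile 1 Λ⁻¹ t - h t)) t with hz
      have hre : z.re = t := by simp [hz, graphPt]
      have him : z.im = h t + τ * (dipProfile 1 Λ⁻¹ t - h t) := by simp [hz, graphPt]
      have h1 := (hK z (by rw [hre, ht]) (by rw [hre, ht]) (by rw [him]; exact hconv τ hτ t htI)).1
      have h2 : m ≤ z.im := by
        rw [him]; have h3 := dipProfile_lower (κ := Λ⁻¹) zero_le_one t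
        have h4 : m ≤ ρ / 2 := min_le_left _ _
        have h5 : m ≤ dipProfile 1 Λ⁻¹ t := by
          rw [ht] at h3; linarith
        nlinarith [hτ.1, hτ.2]
      rw [norm_mul]
      have h3 : ‖exp (I * Λ * z)‖ ≤ Real.exp (-(m * Λ)) := by
        rw [norm_exp]; refine exp_le_exp.2 ?_
        have : (I * Λ * z).re = -(Λ * z.im) := by simp
        rw [this]; nlinarith
      have : 0 ≤ K := (norm_nonneg _).trans h1; gcongr
    have hmem : ∀ τ ∈ Icc (0 : ℝ) 1, ∀ t ∈ Icc (-ρ) ρ,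
        graphPt (fun t => h t + τ * (dipProfile 1 Λ⁻¹ t - h t)) t
          ∈ ball (0 : ℂ) (3 * ρ) ∩ cutAbove := fun τ hτ t ht => by
      refine hmemΩ _ ?_ ?_ ?_
      · simpa [graphPt] using habs0 t ht
      · have := hconv τ hτ t ht; simpa [graphPt] using this
      · intro h0; have ht0 : t = 0 := by simpa [graphPt] using h0
        have h1 := dipProfile_upper (s := 1) zero_le_one hκ0.le 0; rw [abs_zero] at h1
        have h2 := hh.below
        have h3 : (graphPt (fun t => h t + τ * (dipProfile 1 Λ⁻¹ t - h t)) t).im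
          = h 0 + τ * (dipProfile 1 Λ⁻¹ 0 - h 0) := by simp [graphPt, ht0]
        rw [h3]; have := hτ.1; have := hτ.2
        rcases le_total τ (1 / 2) with h4 | h4 <;> nlinarith
    have hdiffon : DifferentiableOn ℂ (fun z => f z * exp (I * Λ * z))
        (ball 0 (3 * ρ) ∩ cutAbove) := hf.mul (by fun_prop)
    have hmain := norm_integral_graphDensity_sub_le hΩ hdiffon hh.smooth
      (contDiff_dipProfile 1 hκ0.ne') (by linarith) hmem
      (hedge (-ρ) (by rw [abs_neg, abs_of_pos hρ]) ((min_le_right _ _).trans (min_le_right _ _)))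
      (hedge ρ (abs_of_pos hρ) ((min_le_right _ _).trans (min_le_left _ _)))
    have hd : ∀ t ∈ Icc (-ρ) ρ, |dipProfile 1 Λ⁻¹ t - h t| ≤ 2 * ρ := fun t ht => by
      have h1 := abs_le.1 (hh.bound t ht)
      have h2 := abs_le.1 (hdip Λ⁻¹ hκ0 (by linarith) t ht); rw [abs_le]; constructor <;> linarith
    have hK0 : 0 ≤ K := (norm_nonneg _).trans
      (hK (ρ : ℂ) (by simp [abs_of_pos hρ]) (by simp [abs_of_pos hρ]) (by simp [hρ.le])).1
    rw [norm_mul]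
    calc _ ≤ ‖(Λ : ℂ) ^ (μ + 1)‖ * (K * Real.exp (-(m * Λ)) * (2 * ρ)
          + K * Real.exp (-(m * Λ)) * (2 * ρ)) := by
          gcongr; refine hmain.trans ?_; gcongr
          · exact hd ρ (by simp [hρ.le])
          · exact hd (-ρ) (by simp [hρ.le])
      _ = _ := by ring
  -- rescaling
  have hratio : ∃ K, ∀ᶠ Λ : ℝ in atTop, ∀ t ∈ Icc (-ρ) ρ,
      ‖f (graphPt (dipProfile 1 Λ⁻¹) t)‖ ≤ K * ‖powBelow (graphPt (dipProfile 1 Λ⁻¹) t) μ‖ := by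
    have hO : f =O[𝓝[cutAbove] 0] fun z => powBelow z μ := by
      have h1 := hlead.isBigO.add ((isBigO_refl (fun z => powBelow z μ) _).const_mul_left c)
      refine h1.congr_left fun z => ?_
      simp
    obtain ⟨K1, hK1⟩ := hO.bound; rw [eventually_nhdsWithin_iff, Metric.eventually_nhds_iff] at hK1
    obtain ⟨ε, hε, hball⟩ := hK1; obtain ⟨K2, hK₂⟩ := hcompact (ε / 4) (by positivity)
    refine ⟨max K1 K2, ?_⟩
    filter_upwards [eventually_ge_atTop (8 / ε), eventually_ge_atTop (4 / ρ),
      eventually_gt_atTop 0] with Λ hΛ1 hΛ2 hΛ0 t ht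
    have hκ0 : 0 < Λ⁻¹ := inv_pos.2 hΛ0
    have hκ1 : 8 * Λ⁻¹ ≤ ε := by
      rw [div_le_iff₀ hε] at hΛ1; rw [← div_eq_mul_inv, div_le_iff₀ hΛ0]; linarith
    have hκ2 : 4 * Λ⁻¹ ≤ ρ := by
      rw [div_le_iff₀ hρ] at hΛ2; rw [← div_eq_mul_inv, div_le_iff₀ hΛ0]; linarith
    set z := graphPt (dipProfile 1 Λ⁻¹) t with hz
    have hre : z.re = t := by simp [hz, graphPt]
    have him : z.im = dipProfile 1 Λ⁻¹ t := by simp [hz, graphPt]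
    -- Near the origin the leading term bounds `f`. A point with `‖z‖ ≥ ε` has `|t| ≥ ε/4`, because
    -- `‖z‖ ≤ 2|t| + 2/Λ` and `8/Λ ≤ ε`, so it lies in the compact set.
    rcases lt_or_ge ‖z‖ ε with h1 | h1
    · refine (hball (by simpa using h1) (hcutdip _ hκ0 t)).trans ?_; gcongr; exact le_max_left _ _
    · have h2 := norm_le_abs_re_add_abs_im z
      have h3 : |dipProfile 1 Λ⁻¹ t| ≤ |t| + 2 * Λ⁻¹ := by
        have h4 := dipProfile_lower (κ := Λ⁻¹) zero_le_one t
        have h5 := dipProfile_upper (s := 1) zero_le_one hκ0.le t; have := abs_nonneg t; rw [abs_le]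
        constructor <;> linarith
      rw [hre, him] at h2
      have h6 := (hK₂ z (by rw [hre]; linarith) (by rw [hre]; exact habs0 t ht)
        (by rw [him]; exact hdip _ hκ0 (by linarith) t ht)).2
      rw [norm_div, div_le_iff₀ (norm_pos_iff.2 (powBelow_ne_zero z μ))] at h6; refine h6.trans ?_
      gcongr; exact le_max_right _ _
  obtain ⟨K, hK⟩ := hratio
  have hscale : Tendsto (fun Λ : ℝ => (Λ : ℂ) ^ (μ + 1) * ∫ t in (-ρ)..ρ,
      graphDensity (fun z => f z * exp (I * Λ * z)) (dipProfile 1 Λ⁻¹) t) atTop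
      (𝓝 (c * singConst μ)) := by
    -- Substitution `t = y/Λ`. Of the factor `Λ^{μ+1}` one power pays for `dt`, and `Λ^μ` normalizes
    -- the amplitude.
    set G : ℝ → ℝ → ℂ := fun Λ => (Ioc (-(Λ * ρ)) (Λ * ρ)).indicator fun y =>
      (Λ : ℂ) ^ μ * f (((Λ⁻¹ : ℝ) : ℂ) * graphPt (dipProfile 1 1) y)
        * exp (I * graphPt (dipProfile 1 1) y)
        * (1 + I * ((deriv (dipProfile 1 1) y : ℝ) : ℂ)) with hG
    have heq : ∀ᶠ Λ : ℝ in atTop, ∫ y, G Λ y = (Λ : ℂ) ^ (μ + 1) * ∫ t in (-ρ)..ρ,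
        graphDensity (fun z => f z * exp (I * Λ * z)) (dipProfile 1 Λ⁻¹) t := by
      filter_upwards [eventually_gt_atTop 0] with Λ hΛ0
      have hΛc : (Λ : ℂ) ≠ 0 := by exact_mod_cast hΛ0.ne'
      have h1 : ∫ y, G Λ y = ∫ y in (-(Λ * ρ))..(Λ * ρ), (Λ : ℂ) ^ μ *
          graphDensity (fun z => f z * exp (I * Λ * z)) (dipProfile 1 Λ⁻¹) (Λ⁻¹ * y) := by
        rw [integral_of_le (by nlinarith), hG,
          integral_indicator measurableSet_Ioc]
        refine setIntegral_congr_fun measurableSet_Ioc fun y _ => ?_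
        simp only [graphDensity, graphPt_dipProfile_scale hΛ0, deriv_dipProfile_scale hΛ0]
        have : I * Λ * (((Λ⁻¹ : ℝ) : ℂ) * graphPt (dipProfile 1 1) y)
            = I * graphPt (dipProfile 1 1) y := by
          push_cast; field_simp
        rw [this]; ring
      rw [h1, intervalIntegral.integral_const_mul, integral_comp_mul_left
        (fun t => graphDensity (fun z => f z * exp (I * Λ * z))
          (dipProfile 1 Λ⁻¹) t) (inv_ne_zero hΛ0.ne'), inv_inv, cpow_add _ _ hΛc,
        cpow_one, real_smul]
      have e1 : Λ⁻¹ * -(Λ * ρ) = -ρ := by field_simp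
      have e2 : Λ⁻¹ * (Λ * ρ) = ρ := by field_simp
      rw [e1, e2]; ring
    refine Tendsto.congr' heq ?_
    obtain ⟨K', hK'0, hK'⟩ := exists_norm_graphDensity_hankelIntegrand_le one_pos le_rfl
      (max |μ.re| |μ.im|)
    have hlimval : c * singConst μ
        = ∫ y, c * graphDensity (hankelIntegrand μ) (dipProfile 1 1) y := by
      rw [integral_const_mul, ← hankelIntegral_eq_singConst one_pos le_rfl hμ, hankelIntegral]
    rw [hlimval]
    have hK2 : ∀ᶠ Λ : ℝ in atTop, 0 < Λ ∧ 2 * Λ⁻¹ ≤ ρ := by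
      filter_upwards [eventually_gt_atTop 0, eventually_ge_atTop (4 / ρ)] with Λ hΛ0 hΛ2
      refine ⟨hΛ0, ?_⟩; rw [div_le_iff₀ hρ] at hΛ2
      rw [← div_eq_mul_inv, div_le_iff₀ hΛ0]; linarith
    have hIcc : ∀ Λ : ℝ, 0 < Λ → ∀ y ∈ Icc (-(Λ * ρ)) (Λ * ρ), Λ⁻¹ * y ∈ Icc (-ρ) ρ :=
      fun Λ hΛ y hy => by
        rw [inv_mul_eq_div]
        exact ⟨by rw [le_div_iff₀ hΛ]; linarith [hy.1], by rw [div_le_iff₀ hΛ]; linarith [hy.2]⟩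
    have hcontd : Continuous (deriv (dipProfile 1 1)) :=
      (contDiff_dipProfile 1 one_ne_zero (n := 1)).continuous_deriv le_rfl
    have hcontg : Continuous (graphPt (dipProfile 1 1)) :=
      continuous_graphPt (contDiff_dipProfile 1 one_ne_zero (n := 1)).continuous
    refine tendsto_integral_filter_of_dominated_convergence
      (fun y => max K 0 * (K' * Real.exp (-(1 / 2 * |y|)))) ?_ ?_ ?_ ?_
    · filter_upwards [hK2] with Λ ⟨hΛ0, hΛ2⟩
      have hκ0 : 0 < Λ⁻¹ := inv_pos.2 hΛ0; rw [hG]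
      refine (aestronglyMeasurable_indicator_iff measurableSet_Ioc).2 ?_
      refine ContinuousOn.aestronglyMeasurable ?_ measurableSet_Ioc
      have h1 : ContinuousOn (fun y => f (((Λ⁻¹ : ℝ) : ℂ) * graphPt (dipProfile 1 1) y))
          (Ioc (-(Λ * ρ)) (Λ * ρ)) := by
        refine hf.continuousOn.comp (by fun_prop) fun y hy => ?_
        have hy' := hIcc Λ hΛ0 y (Ioc_subset_Icc_self hy)
        rw [← graphPt_dipProfile_scale hΛ0]
        refine hmemΩ _ ?_ ?_ (hcutdip _ hκ0 _)
        · simpa [graphPt] using habs0 _ hy'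
        · simpa [graphPt] using hdip _ hκ0 hΛ2 _ hy'
      exact ((continuousOn_const.mul h1).mul (by fun_prop)).mul (by fun_prop)
    · filter_upwards [hK2, hK] with Λ ⟨hΛ0, hΛ2⟩ hb
      have hκ0 : 0 < Λ⁻¹ := inv_pos.2 hΛ0
      have hΛc : (Λ : ℂ) ≠ 0 := by exact_mod_cast hΛ0.ne'
      refine .of_forall fun y => ?_
      have hK'y := (hK' μ (le_max_left _ _) (le_max_right _ _) y).2; simp only [hG]
      by_cases hy : y ∈ Ioc (-(Λ * ρ)) (Λ * ρ)
      · rw [indicator_of_mem hy]; have h1 := hb _ (hIcc Λ hΛ0 y (Ioc_subset_Icc_self hy))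
        rw [graphPt_dipProfile_scale hΛ0, powBelow_mul
          (ne_zero_of_mem_cutAbove (hcutdip 1 one_pos y)) hκ0, norm_mul] at h1
        have h2 : ‖(Λ : ℂ) ^ μ‖ * ‖((Λ⁻¹ : ℝ) : ℂ) ^ μ‖ = 1 := by
          rw [norm_cpow_eq_rpow_re_of_pos hΛ0, norm_cpow_eq_rpow_re_of_pos hκ0,
            ← mul_rpow hΛ0.le hκ0.le, mul_inv_cancel₀ hΛ0.ne', Real.one_rpow]
        rw [graphDensity, hankelIntegrand, norm_mul, norm_mul] at hK'y
        rw [norm_mul, norm_mul, norm_mul]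
        calc _ ≤ ‖(Λ : ℂ) ^ μ‖ * (max K 0 * (‖((Λ⁻¹ : ℝ) : ℂ) ^ μ‖
              * ‖powBelow (graphPt (dipProfile 1 1) y) μ‖))
              * ‖exp (I * graphPt (dipProfile 1 1) y)‖
              * ‖1 + I * ((deriv (dipProfile 1 1) y : ℝ) : ℂ)‖ := by
              gcongr; refine h1.trans ?_; gcongr; exact le_max_left _ _
          _ = (‖(Λ : ℂ) ^ μ‖ * ‖((Λ⁻¹ : ℝ) : ℂ) ^ μ‖) * (max K 0 *
              (‖powBelow (graphPt (dipProfile 1 1) y) μ‖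
              * ‖exp (I * graphPt (dipProfile 1 1) y)‖
              * ‖1 + I * ((deriv (dipProfile 1 1) y : ℝ) : ℂ)‖)) := by ring
          _ ≤ _ := by
              rw [h2, one_mul]; gcongr
      · rw [indicator_of_notMem hy, norm_zero]
        have := (norm_nonneg _).trans hK'y; positivity
    · exact ((integrable_exp_neg_mul_abs (c := 1 / 2) (by norm_num)).const_mul K').const_mul _
    · refine .of_forall fun y => ?_
      have h1 := ((tendsto_scaled_powBelow hlead (hcutdip 1 one_pos y)).mul_const
        (exp (I * graphPt (dipProfile 1 1) y))).mul_const
        (1 + I * ((deriv (dipProfile 1 1) y : ℝ) : ℂ))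
      have h2 : c * graphDensity (hankelIntegrand μ) (dipProfile 1 1) y
          = c * powBelow (graphPt (dipProfile 1 1) y) μ
            * exp (I * graphPt (dipProfile 1 1) y)
            * (1 + I * ((deriv (dipProfile 1 1) y : ℝ) : ℂ)) := by
        rw [graphDensity, hankelIntegrand]; ring
      rw [h2]; refine h1.congr' ?_; filter_upwards [eventually_gt_atTop (|y| / ρ)] with Λ hΛ
      rw [div_lt_iff₀ hρ] at hΛ; simp only [hG]
      have hy : y ∈ Ioc (-(Λ * ρ)) (Λ * ρ) := ⟨(abs_lt.1 hΛ).1, (abs_lt.1 hΛ).2.le⟩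
      rw [indicator_of_mem hy]
  have := hscale.sub hstep; rw [sub_zero] at this; refine this.congr fun Λ => ?_
  ring

/-! ### Functions read in the normalized coordinates -/

/-- The points whose first coordinate is not on the closed positive imaginary half-axis. -/
abbrev cutDomain : Set C3 := {ζ | ζ 0 ∈ cutAbove}

/-- The leading term of `f` at the origin is `c (ζ 0) ^ μ`. -/
abbrev HasLeadingPower (f : C3 → ℂ) (c μ : ℂ) : Prop :=
  (fun ζ : C3 => f ζ - c * powBelow (ζ 0) μ) =o[𝓝[cutDomain] 0] fun ζ : C3 => powBelow (ζ 0) μ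

section Chart

variable {U : Set C3} {g G : C3 → ℂ} {p : R3} {w : OpenPartialHomeomorph C3 C3} {α β β' : ℝ}
local notation "NChart" => IsNormalizingChart U g G p w α β β'

theorem IsNormalizingChart.zero_mem_target (hw : NChart) :
    (0 : C3) ∈ w.target := hw.center ▸ w.map_source hw.mem

theorem IsNormalizingChart.symm_zero (hw : NChart) :
    w.symm 0 = toC3 p := by
  rw [← hw.center, w.left_inv hw.mem]

theorem IsNormalizingChart.first_symm (hw : NChart) {ζ : C3}
    (hζ : ζ ∈ w.target) : (α : ℂ) * g (w.symm ζ) = ζ 0 := by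
  rw [← hw.first _ (w.map_target hζ), w.right_inv hζ]

theorem IsNormalizingChart.symm_mem (hw : NChart) {ζ : C3}
    (hζ : ζ ∈ w.target) : w.symm ζ ∈ U := hw.subset (w.map_target hζ)

theorem IsNormalizingChart.differentiableOn_comp_symm
    (hw : NChart) {F : C3 → ℂ} {S : Set ℂ}
    (hF : DifferentiableOn ℂ F {ξ ∈ U | α * g ξ ∈ S}) :
    DifferentiableOn ℂ (fun ζ => F (w.symm ζ)) (w.target ∩ {ζ | ζ 0 ∈ S}) :=
  hF.comp (hw.holo_symm.mono inter_subset_left) fun ζ hζ =>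
    ⟨hw.symm_mem hζ.1, by rw [hw.first_symm hζ.1]; exact hζ.2⟩

/-- The leading term, read in the coordinates `w`. -/
theorem HasPowerSingularity.leading_symm (hw : NChart) {F : C3 → ℂ}
    {C : ℂ × ℂ → ℂ} {μ : ℂ} (hF : HasPowerSingularity F p w C μ) :
    HasLeadingPower (fun ζ => F (w.symm ζ)) (C 0) μ := by
  have hcont : ContinuousAt w.symm 0 := w.continuousAt_symm hw.zero_mem_target
  have hev : ∀ᶠ ζ in 𝓝 (0 : C3), ζ ∈ w.target := w.open_target.mem_nhds hw.zero_mem_target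
  have hto : Tendsto w.symm (𝓝[cutDomain] 0)
      (𝓝[{ξ | w ξ 0 ∈ cutAbove}] (toC3 p)) := by
    refine tendsto_nhdsWithin_iff.2 ⟨?_, ?_⟩
    · rw [← hw.symm_zero]; exact hcont.tendsto.mono_left nhdsWithin_le_nhds
    · filter_upwards [self_mem_nhdsWithin, nhdsWithin_le_nhds hev] with ζ h1 h2
      show w (w.symm ζ) 0 ∈ cutAbove
      rw [w.right_inv h2]; exact h1
  have h1 := hF.leading.comp_tendsto hto
  have h2 : (fun ζ : C3 => F (w.symm ζ) - C (ζ 1, ζ 2) * powBelow (ζ 0) μ)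
      =o[𝓝[cutDomain] 0] fun ζ : C3 => powBelow (ζ 0) μ := by
    refine h1.congr' ?_ ?_ <;>
    · filter_upwards [nhdsWithin_le_nhds hev] with ζ h2
      simp only [Function.comp_apply, w.right_inv h2]
  have h3 : (fun ζ : C3 => C (ζ 1, ζ 2) - C 0) =o[𝓝[cutDomain] 0]
      fun _ => (1 : ℂ) := by
    rw [isLittleO_one_iff]
    have h4 : ContinuousAt (fun ζ : C3 => C (ζ 1, ζ 2)) 0 :=
      ContinuousAt.comp (f := fun ζ : C3 => (ζ 1, ζ 2)) hF.analyticAt.continuousAt (by fun_prop)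
    have h5 := (h4.tendsto.sub_const (C 0)).mono_left
      (nhdsWithin_le_nhds (s := cutDomain))
    rwa [show C ((0 : C3) 1, (0 : C3) 2) - C 0 = 0 from sub_self _] at h5
  have h4 := h3.mul_isBigO (isBigO_refl (fun ζ : C3 => powBelow (ζ 0) μ)
    (𝓝[cutDomain] 0))
  refine ((h2.add (h4.congr_right fun ζ => one_mul _))).congr_left fun ζ => ?_
  ring

/-- `Φ` is the leading term of the one-dimensional integral across the singularity. -/
theorem contourIntegral_isEquivalent (hw : NChart) :
    ∃ ρ0 > 0, ∀ ρ : ℝ, 0 < ρ → ρ < ρ0 → ∀ h : ℝ → ℝ, IsLowerContour ρ h →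
      ∀ (F : C3 → ℂ) (C : ℂ × ℂ → ℂ) (μ : ℂ),
        DifferentiableOn ℂ F {ξ ∈ U | α * g ξ ∈ cutAbove} →
        HasPowerSingularity F p w C μ →
        contourIntegral F w ρ h ~[atTop] Phi C μ := by
  set line : ℂ → C3 := fun z => ![z, 0, 0] with hline
  have hlin : Differentiable ℂ line := by
    rw [differentiable_pi]; intro i; fin_cases i
    · exact differentiable_id
    · exact differentiable_const _
    · exact differentiable_const _
  have hline0 : line 0 = 0 := by
    ext i; fin_cases i <;> rfl
  have hnhds : line ⁻¹' w.target ∈ 𝓝 (0 : ℂ) :=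
    hlin.continuous.continuousAt.preimage_mem_nhds
      (hline0 ▸ w.open_target.mem_nhds hw.zero_mem_target)
  obtain ⟨ε, hε, hball⟩ := Metric.mem_nhds_iff.1 hnhds
  -- `tendsto_contour_integral` asks for holomorphy on the ball of radius `3ρ`, off the cut.
  refine ⟨ε / 3, by positivity, fun ρ hρ hρε h hh F C μ hF hs => ?_⟩
  have hdiff : DifferentiableOn ℂ (fun z => F (w.symm (line z))) (ball 0 (3 * ρ) ∩ cutAbove) := by
    refine (hw.differentiableOn_comp_symm hF).comp hlin.differentiableOn fun z hz => ⟨?_, hz.2⟩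
    exact hball (ball_subset_ball (by linarith) hz.1)
  have hto : Tendsto line (𝓝[cutAbove] 0) (𝓝[cutDomain] 0) := by
    refine tendsto_nhdsWithin_iff.2 ⟨?_, self_mem_nhdsWithin⟩
    have := hlin.continuous.tendsto 0; rw [hline0] at this
    exact this.mono_left nhdsWithin_le_nhds
  have hlead := (hs.leading_symm hw).comp_tendsto hto
  have hmain := isEquivalent_of_tendsto_cpow_mul
    (mul_ne_zero hs.ne_zero (singConst_ne_zero hs.exponent))
    (tendsto_contour_integral hρ hs.exponent hdiff hlead hh)
  refine hmain.congr_right (.of_forall fun Λ => ?_)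
  rw [Phi, show -(μ + 1) = -μ - 1 by ring]; ring

end Chart

/-! ### The normalized phase: bounds for its imaginary part -/

section Phase

variable {V : Set C3} {Γ : C3 → ℂ} {γ β β' : ℝ}

/-- A holomorphic phase `Γ` in normalized coordinates near the origin. -/
structure IsNormalPhase (V : Set C3) (Γ : C3 → ℂ) (γ β β' : ℝ) : Prop where
  isOpen : IsOpen V
  zero_mem : (0 : C3) ∈ V
  holo : DifferentiableOn ℂ Γ V
  real : ∀ y : R3, toC3 y ∈ V → (Γ (toC3 y)).im = 0
  β₂_ne : β ≠ 0
  β₃_ne : β' ≠ 0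
  rem : (fun ζ => Γ ζ - (γ + ζ 0 + 1 / 2 * ((β : ℂ) * ζ 1 ^ 2 + (β' : ℂ) * ζ 2 ^ 2)))
    =O[𝓝 (0 : C3)] fun ζ => ‖ζ 0‖ * ‖ζ‖ + ‖ζ‖ ^ 3

/-- The remainder of a phase after its leading terms. -/
noncomputable def phaseRem (Γ : C3 → ℂ) (γ β β' : ℝ) (ζ : C3) : ℂ :=
  Γ ζ - (γ + ζ 0 + 1 / 2 * ((β : ℂ) * ζ 1 ^ 2 + (β' : ℂ) * ζ 2 ^ 2))

theorem IsNormalPhase.differentiableOn_rem (h : IsNormalPhase V Γ γ β β') :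
    DifferentiableOn ℂ (phaseRem Γ γ β β') V := by
  unfold phaseRem
  exact h.holo.sub (by fun_prop)

theorem IsNormalPhase.im_rem (h : IsNormalPhase V Γ γ β β') {y : R3} (hy : toC3 y ∈ V) :
    (phaseRem Γ γ β β' (toC3 y)).im = 0 := by
  have : (γ : ℂ) + toC3 y 0 + 1 / 2 * ((β : ℂ) * toC3 y 1 ^ 2 + (β' : ℂ) * toC3 y 2 ^ 2)
      = ((γ + y 0 + 1 / 2 * (β * y 1 ^ 2 + β' * y 2 ^ 2) : ℝ) : ℂ) := by
    simp [toC3]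
  rw [phaseRem, this, sub_im, h.real y hy, ofReal_im, sub_zero]

/-- The derivatives of the remainder. -/
theorem IsNormalPhase.exists_fderiv_rem_le (h : IsNormalPhase V Γ γ β β') :
    ∃ K > 0, ∃ b > 0, closedBall (0 : C3) b ⊆ V ∧ ∀ N > 0, N ≤ b → ∀ ζ : C3, ‖ζ‖ ≤ N →
      ‖fderiv ℂ (phaseRem Γ γ β β') ζ (Pi.single 0 1)‖ ≤ K * N ∧
      ∀ j : Fin 3, j ≠ 0 →
        ‖fderiv ℂ (phaseRem Γ γ β β') ζ (Pi.single j 1)‖ ≤ K * (‖ζ 0‖ + N ^ 2) := by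
  obtain ⟨K, hK⟩ := h.rem.bound
  obtain ⟨ε, hε, hb⟩ := eventually_nhds_iff_ball.1 (hK.and (h.isOpen.mem_nhds h.zero_mem))
  have hK' : ∀ ζ ∈ ball (0 : C3) ε, ‖phaseRem Γ γ β β' ζ‖
      ≤ (max K 1) * (‖ζ 0‖ * ‖ζ‖ + ‖ζ‖ ^ 3) := fun ζ hζ => by
    refine (hb ζ hζ).1.trans ?_; rw [Real.norm_of_nonneg (by positivity)]; gcongr
    exact le_max_left _ _
  have hK0 : 0 < max K 1 := lt_max_of_lt_right one_pos
  refine ⟨12 * max K 1 * (1 + ε), by positivity, ε / 4, by positivity, fun ζ hζ => (hb ζ ?_).2,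
    fun N hN hNε ζ hζ => ?_⟩
  · rw [mem_closedBall_zero_iff] at hζ; rw [mem_ball_zero_iff]; linarith
  have hsingle : ∀ j : Fin 3, ‖(Pi.single j (1 : ℂ) : C3)‖ = 1 := fun j => by
    rw [Pi.norm_single, norm_one]
  have hnorm : ∀ (j : Fin 3) (z : ℂ), ‖z‖ ≤ N → ‖ζ + z • (Pi.single j 1 : C3)‖ ≤ 2 * N :=
    fun j z hz => by
    refine (norm_add_le _ _).trans ?_; rw [norm_smul, hsingle]; linarith
  have hdiff : ∀ (j : Fin 3), ∀ z ∈ closedBall (0 : ℂ) N,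
      DifferentiableAt ℂ (phaseRem Γ γ β β') (ζ + z • (Pi.single j 1 : C3)) := fun j z hz => by
    have : ζ + z • (Pi.single j 1 : C3) ∈ V := (hb _ (by
      rw [mem_ball_zero_iff]; have := hnorm j z (by simpa using hz)
      linarith)).2
    exact (h.differentiableOn_rem _ this).differentiableAt (h.isOpen.mem_nhds this)
  have hbound : ∀ (j : Fin 3) (z : ℂ), ‖z‖ = N → ‖phaseRem Γ γ β β' (ζ + z • (Pi.single j 1 : C3))‖
      ≤ max K 1 * (‖(ζ + z • (Pi.single j 1 : C3)) 0‖ * (2 * N) + (2 * N) ^ 3) := fun j z hz => by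
    have h1 := hnorm j z hz.le; refine (hK' _ (by rw [mem_ball_zero_iff]; linarith)).trans ?_
    gcongr
  constructor
  · refine (norm_fderiv_apply_le_of_forall_le hN (hdiff 0) (M := max K 1 * ((2 * N) * (2 * N)
      + (2 * N) ^ 3)) fun z hz => (hbound 0 z hz).trans ?_).trans ?_
    · gcongr; exact (norm_le_pi_norm _ 0).trans (hnorm 0 z hz.le)
    · rw [div_le_iff₀ hN]; have : N * N * N ≤ N * N * (ε / 4) := by gcongr
      have h2 : 0 ≤ N * N * ε := by positivity
      have : (2 * N) * (2 * N) + (2 * N) ^ 3 ≤ 12 * (1 + ε) * N * N := by nlinarith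
      calc _ ≤ max K 1 * (12 * (1 + ε) * N * N) := by gcongr
        _ = _ := by ring
  · intro j hj
    refine (norm_fderiv_apply_le_of_forall_le hN (hdiff j) (M := max K 1 * (‖ζ 0‖ * (2 * N)
      + (2 * N) ^ 3)) fun z hz => (hbound j z hz).trans (le_of_eq ?_)).trans ?_
    -- Moving in a tangential direction leaves the first coordinate unchanged. This keeps the factor
    -- `‖ζ 0‖` in the bound and makes the estimate anisotropic.
    · simp [hj.symm]
    · rw [div_le_iff₀ hN]
      have : ‖ζ 0‖ * (2 * N) + (2 * N) ^ 3 ≤ 12 * (1 + ε) * (‖ζ 0‖ + N ^ 2) * N := by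
        have h1 : 0 ≤ ‖ζ 0‖ * N := by positivity
        have h2 : 0 ≤ ε * (‖ζ 0‖ + N ^ 2) * N := by positivity
        have h3 : 0 ≤ N ^ 3 := by positivity
        nlinarith
      calc _ ≤ max K 1 * (12 * (1 + ε) * (‖ζ 0‖ + N ^ 2) * N) := by gcongr
        _ = _ := by ring

/-- The point `y + i θ`. -/
def complexPt (y θ : R3) : C3 := fun i => (y i : ℂ) + I * (θ i : ℂ)

theorem domainPt_eq_complexPt (η : R3 → R3) (y : R3) : domainPt η y = complexPt y (η y) := rfl

theorem complexPt_zero (y : R3) : complexPt y 0 = toC3 y := by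
  funext i; simp [complexPt, toC3]

theorem norm_complexPt_le (y θ : R3) : ‖complexPt y θ‖ ≤ ‖y‖ + ‖θ‖ := by
  refine (pi_norm_le_iff_of_nonneg (by positivity)).2 fun i => ?_
  refine (norm_add_le _ _).trans ?_
  rw [norm_mul, norm_I, one_mul, norm_real, norm_real]
  exact add_le_add (norm_le_pi_norm y i) (norm_le_pi_norm θ i)

theorem hasDerivAt_comp_complexPt {f : C3 → ℂ} {y a v : R3} {t : ℝ}
    (hf : DifferentiableAt ℂ f (complexPt y (a + t • v))) :
    HasDerivAt (fun t : ℝ => f (complexPt y (a + t • v)))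
      (fderiv ℂ f (complexPt y (a + t • v)) (fun i => I * (v i : ℂ))) t := by
  have h1 : HasDerivAt (fun t : ℝ => complexPt y (a + t • v)) (fun i => I * (v i : ℂ)) t := by
    rw [hasDerivAt_pi]; intro i
    have h2 : HasDerivAt (fun t : ℝ => (a + t • v) i) (v i) t := by
      simpa using ((hasDerivAt_id t).mul_const (v i)).const_add (a i)
    exact (h2.ofReal_comp.const_mul I).const_add _
  exact (hf.hasFDerivAt.restrictScalars ℝ).comp_hasDerivAt t h1

/-- The growth of the imaginary part along a segment in an imaginary direction. -/
theorem norm_sub_comp_complexPt_le {f : C3 → ℂ} {y a v : R3} {M : ℝ}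
    (hf : ∀ t ∈ Icc (0 : ℝ) 1, DifferentiableAt ℂ f (complexPt y (a + t • v)))
    (hM : ∀ t ∈ Icc (0 : ℝ) 1,
      ‖fderiv ℂ f (complexPt y (a + t • v)) (fun i => I * (v i : ℂ))‖ ≤ M) :
    ‖f (complexPt y (a + v)) - f (complexPt y a)‖ ≤ M := by
  have h1 := norm_image_sub_le_of_norm_deriv_le_segment_01' (C := M)
    (f := fun t : ℝ => f (complexPt y (a + t • v)))
    (fun t ht => (hasDerivAt_comp_complexPt (hf t ht)).hasDerivWithinAt)
    (fun t ht => hM t (Ico_subset_Icc_self ht))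
  simpa using h1

/-- The squares contribute only the cross terms `y_j θ_j`. The choice `θ_j = s β_j y_j` makes them
`s β_j² y_j²`, positive for either sign of `β_j`; this is the origin of the dip field. -/
theorem im_complexPt_eq (Γ : C3 → ℂ) (γ β β' : ℝ) (y θ : R3) :
    (Γ (complexPt y θ)).im = θ 0 + β * (y 1 * θ 1) + β' * (y 2 * θ 2)
      + (phaseRem Γ γ β β' (complexPt y θ)).im := by
  have : (γ : ℂ) + complexPt y θ 0 + 1 / 2 * ((β : ℂ) * complexPt y θ 1 ^ 2
      + (β' : ℂ) * complexPt y θ 2 ^ 2)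
      = ((γ + y 0 + 1 / 2 * (β * (y 1 ^ 2 - θ 1 ^ 2) + β' * (y 2 ^ 2 - θ 2 ^ 2)) : ℝ) : ℂ)
        + I * ((θ 0 + β * (y 1 * θ 1) + β' * (y 2 * θ 2) : ℝ) : ℂ) := by
    simp only [complexPt]; push_cast
    linear_combination (1 / 2 * (β * (θ 1 : ℂ) ^ 2) + 1 / 2 * (β' * (θ 2 : ℂ) ^ 2)) * I_sq
  rw [phaseRem, this, sub_im, add_im, ofReal_im, I_mul_im, ofReal_re]; ring

/-- The imaginary part of the phase, with an error given by the derivatives of the remainder. -/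
theorem IsNormalPhase.im_complexPt_ge (h : IsNormalPhase V Γ γ β β') {y θ : R3} {M : ℝ}
    (hV : ∀ t ∈ Icc (0 : ℝ) 1, complexPt y (t • θ) ∈ V)
    (hM : ∀ t ∈ Icc (0 : ℝ) 1,
      ‖fderiv ℂ (phaseRem Γ γ β β') (complexPt y (t • θ)) (fun i => I * (θ i : ℂ))‖ ≤ M) :
    θ 0 + β * (y 1 * θ 1) + β' * (y 2 * θ 2) - M ≤ (Γ (complexPt y θ)).im := by
  have h1 := norm_sub_comp_complexPt_le (f := phaseRem Γ γ β β') (y := y) (a := 0) (v := θ)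
    (M := M) (fun t ht => by
      rw [zero_add]
      exact (h.differentiableOn_rem _ (hV t ht)).differentiableAt (h.isOpen.mem_nhds (hV t ht)))
    (fun t ht => by
      rw [zero_add]
      exact hM t ht)
  rw [zero_add, complexPt_zero] at h1
  have h2 := (abs_im_le_norm _).trans h1
  have h3 : (phaseRem Γ γ β β' (toC3 y)).im = 0 := h.im_rem (by
    have := hV 0 (by simp)
    rwa [zero_smul, complexPt_zero] at this)
  rw [sub_im, h3, sub_zero] at h2; rw [im_complexPt_eq Γ γ β β']; linarith [(abs_le.1 h2).1]

theorem norm_clm_apply_I_mul_le (L : C3 →L[ℂ] ℂ) (θ : R3) :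
    ‖L (fun i => I * (θ i : ℂ))‖ ≤ ‖L (Pi.single 0 1)‖ * |θ 0|
      + ‖L (Pi.single 1 1)‖ * |θ 1| + ‖L (Pi.single 2 1)‖ * |θ 2| := by
  rw [clm_apply_eq_sum]
  refine (norm_add_le _ _).trans (add_le_add ((norm_add_le _ _).trans (add_le_add ?_ ?_)) ?_) <;>
  · rw [norm_mul, norm_mul, norm_I, one_mul, norm_real, norm_eq_abs]

set_option maxHeartbeats 1000000 in
/-- Over the field `s (h, β y2, β' y3)` the imaginary part of the phase grows quadratically in the
tangential directions. -/
theorem IsNormalPhase.exists_im_dip_ge (h : IsNormalPhase V Γ γ β β') :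
    ∃ b > 0, ∃ c > 0, ∀ s κ : ℝ, 0 < s → s ≤ 1 → 0 < κ → κ ≤ b → ∀ y : R3, ‖y‖ ≤ b →
      ∀ k : ℝ, |k| ≤ |y 0| + 2 * κ →
      complexPt y (s • ![k, β * y 1, β' * y 2]) ∈ V ∧
      s * (k - |y 0| / 4 - κ + c * (y 1 ^ 2 + y 2 ^ 2))
        ≤ (Γ (complexPt y (s • ![k, β * y 1, β' * y 2]))).im := by
  obtain ⟨K, hK, b1, hb1, hball, hE⟩ := h.exists_fderiv_rem_le; set B := |β| + |β'| with hB
  have hB0 : 0 ≤ B := by positivity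
  set m := min (β ^ 2) (β' ^ 2) with hm
  have hm0 : 0 < m := lt_min (by have := h.β₂_ne; positivity) (by have := h.β₃_ne; positivity)
  set K1 := K + 2 * B * K + B * K * (2 + B) with hK1
  have hK₁0 : 0 < K1 := by positivity
  set ε := min (min b1 1) (min (1 / (4 * K1)) (m / (4 * K1))) with hε
  have hε0 : 0 < ε := by positivity
  have hε1 : ε ≤ b1 := (min_le_left _ _).trans (min_le_left _ _)
  have hε2 : ε ≤ 1 := (min_le_left _ _).trans (min_le_right _ _)
  have hε3 : ε * K1 ≤ 1 / 4 := by
    have : ε ≤ 1 / (4 * K1) := (min_le_right _ _).trans (min_le_left _ _)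
    rw [le_div_iff₀ (by positivity)] at this; linarith
  have hε4 : ε * K1 ≤ m / 4 := by
    have : ε ≤ m / (4 * K1) := (min_le_right _ _).trans (min_le_right _ _)
    rw [le_div_iff₀ (by positivity)] at this; linarith
  -- The sum `A + P = |y 0| + 2κ + |y 1| + |y 2|` is at most five times this radius, so all points
  -- in question have norm at most `ε`. The gain is `m(y₁² + y₂²)` with zero-based indices, and the
  -- error uses up half of it: hence `m / 2`.
  refine ⟨ε / (5 * (2 + B)), by positivity, m / 2, by positivity,
    fun s κ hs hs1 hκ hκb y hy k hk => ?_⟩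
  set θ : R3 := s • ![k, β * y 1, β' * y 2] with hθ
  have hθ0 : θ 0 = s * k := by simp [hθ]
  have hθ1 : θ 1 = s * (β * y 1) := by simp [hθ]
  have hθ2 : θ 2 = s * (β' * y 2) := by simp [hθ]
  set A := |y 0| + 2 * κ with hA; set P := |y 1| + |y 2| with hP
  have hA0 : 0 < A := by positivity
  have hP0 : 0 ≤ P := by positivity
  have hyi : ∀ i, |y i| ≤ ε / (5 * (2 + B)) := fun i => (norm_le_pi_norm y i).trans hy
  have hAP : (2 + B) * (A + P) ≤ ε := by
    have : A + P ≤ 5 * (ε / (5 * (2 + B))) := by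
      have := hyi 0; have := hyi 1; have := hyi 2; linarith
    calc _ ≤ (2 + B) * (5 * (ε / (5 * (2 + B)))) := by gcongr
      _ = ε := by field_simp
  set N := (2 + B) * (A + P) with hN
  have hN0 : 0 < N := by positivity
  have hθ0' : |θ 0| ≤ s * A := by
    rw [hθ0, abs_mul, abs_of_pos hs]; gcongr
  have hθ1' : |θ 1| ≤ s * (B * |y 1|) := by
    rw [hθ1, abs_mul, abs_mul, abs_of_pos hs]; gcongr; linarith [abs_nonneg β']
  have hθ2' : |θ 2| ≤ s * (B * |y 2|) := by
    rw [hθ2, abs_mul, abs_mul, abs_of_pos hs]; gcongr; linarith [abs_nonneg β]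
  have hs1A : s * A ≤ A := mul_le_of_le_one_left hA0.le hs1
  have hζ : ∀ t ∈ Icc (0 : ℝ) 1, ‖complexPt y (t • θ)‖ ≤ N := fun t ht => by
    refine (norm_complexPt_le _ _).trans ?_
    have h1 : ‖y‖ ≤ |y 0| + P := by
      refine (pi_norm_le_iff_of_nonneg (by positivity)).2 fun i => ?_
      rw [norm_eq_abs]; have := abs_nonneg (y 0); have := abs_nonneg (y 1)
      have := abs_nonneg (y 2); fin_cases i
      · show |y 0| ≤ _
        linarith
      · show |y 1| ≤ _
        linarith
      · show |y 2| ≤ _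
        linarith
    have hbj : ∀ j, s * (B * |y j|) ≤ B * |y j| := fun j => by
      exact mul_le_of_le_one_left (by positivity) hs1
    have h2 : ‖θ‖ ≤ A + B * P := by
      refine (pi_norm_le_iff_of_nonneg (by positivity)).2 fun i => ?_
      rw [norm_eq_abs]; have h3 : 0 ≤ B * |y 1| := by positivity
      have h4 : 0 ≤ B * |y 2| := by positivity
      have h5 : B * P = B * |y 1| + B * |y 2| := by rw [hP]; ring
      have := hbj 1; have := hbj 2; fin_cases i
      · show |θ 0| ≤ _
        linarith
      · show |θ 1| ≤ _
        linarith
      · show |θ 2| ≤ _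
        linarith
    have h3 : ‖t • θ‖ ≤ ‖θ‖ := by
      rw [norm_smul, Real.norm_of_nonneg ht.1]
      exact mul_le_of_le_one_left (norm_nonneg _) ht.2
    have h4 : |y 0| ≤ A := by linarith
    have : N = 2 * A + B * A + 2 * P + B * P := by rw [hN]; ring
    have : 0 ≤ B * A := by positivity
    linarith
  have hζV : ∀ t ∈ Icc (0 : ℝ) 1, complexPt y (t • θ) ∈ V := fun t ht =>
    hball (mem_closedBall_zero_iff.2 ((hζ t ht).trans (hAP.trans hε1)))
  have hζ0 : ∀ t ∈ Icc (0 : ℝ) 1, ‖complexPt y (t • θ) 0‖ ≤ 2 * A := fun t ht => by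
    refine (norm_add_le _ _).trans ?_
    rw [norm_mul, norm_I, one_mul, norm_real, norm_real, norm_eq_abs,
      norm_eq_abs, Pi.smul_apply, smul_eq_mul, abs_mul, abs_of_nonneg ht.1]
    have := mul_le_of_le_one_left (abs_nonneg (θ 0)) ht.2; linarith
  -- The normal component of the field has size `sA` and meets a derivative `O(N)`; the tangential
  -- components have size `sP` and meet a derivative `O(A + N²)`. The products are linear in `A` and
  -- quadratic in `P` with the small factor `ε`, hence a fraction of the leading terms.
  have hmain := h.im_complexPt_ge (M := s * (ε * K1 * A + ε * K1 * P ^ 2)) hζV (fun t ht => by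
    refine (norm_clm_apply_I_mul_le _ _).trans ?_
    have h1 := hE N hN0 (hAP.trans hε1) _ (hζ t ht); have h2 := h1.2 1 (by decide)
    have h3 := h1.2 2 (by decide); have hz := hζ0 t ht
    calc _ ≤ (K * N) * (s * A) + (K * (2 * A + N ^ 2)) * (s * (B * |y 1|))
          + (K * (2 * A + N ^ 2)) * (s * (B * |y 2|)) := by
          gcongr
          · exact h1.1
          · exact h2.trans (by gcongr)
          · exact h3.trans (by gcongr)
      _ = s * (K * N * A + K * B * (2 * A + N * N) * P) := by
          rw [hP]; ring
      _ ≤ s * (K * ε * A + K * B * (2 * A * ε + ε * ((2 + B) * (A * ε + P ^ 2)))) := by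
          have hPε : P ≤ ε := by
            refine le_trans ?_ hAP; have : 0 ≤ B * (A + P) := by positivity
            have : N = 2 * A + 2 * P + B * (A + P) := by rw [hN]; ring
            linarith
          have e1 : K * B * (2 * A + N * N) * P = K * B * (2 * A * P + N * (N * P)) := by ring
          have e2 : N * P = (2 + B) * (A * P + P ^ 2) := by rw [hN]; ring
          rw [e1, e2]; gcongr
      _ ≤ _ := by
          have e3 : ε * K1 * A + ε * K1 * P ^ 2
              - (K * ε * A + K * B * (2 * A * ε + ε * ((2 + B) * (A * ε + P ^ 2))))
              = K * B * (2 + B) * ε * A * (1 - ε) + (K + 2 * B * K) * ε * P ^ 2 := by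
            rw [hK1]; ring
          have e4 : 0 ≤ K * B * (2 + B) * ε * A * (1 - ε) := by
            have : 0 ≤ 1 - ε := by linarith
            positivity
          have e5 : 0 ≤ (K + 2 * B * K) * ε * P ^ 2 := by positivity
          exact mul_le_mul_of_nonneg_left (by linarith) hs.le)
  rw [hθ0, hθ1, hθ2] at hmain; have hfin := hζV 1 (by simp); rw [one_smul] at hfin
  refine ⟨hfin, le_trans ?_ hmain⟩
  have e1 : s * k + β * (y 1 * (s * (β * y 1))) + β' * (y 2 * (s * (β' * y 2)))
      - s * (ε * K1 * A + ε * K1 * P ^ 2)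
      = s * (k + (β ^ 2 * y 1 ^ 2 + β' ^ 2 * y 2 ^ 2) - ε * K1 * A - ε * K1 * P ^ 2) := by ring
  rw [e1]; have e2 : ε * K1 * A ≤ 1 / 4 * A := by gcongr
  have e3 : ε * K1 * P ^ 2 ≤ m / 4 * P ^ 2 := by gcongr
  have e4 : P ^ 2 ≤ 2 * (y 1 ^ 2 + y 2 ^ 2) := by
    rw [hP, ← sq_abs (y 1), ← sq_abs (y 2)]; exact add_sq_le
  have e5 : m * y 1 ^ 2 ≤ β ^ 2 * y 1 ^ 2 := by
    gcongr; exact min_le_left _ _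
  have e6 : m * y 2 ^ 2 ≤ β' ^ 2 * y 2 ^ 2 := by
    gcongr; exact min_le_right _ _
  have e7 : m / 4 * P ^ 2 ≤ m / 4 * (2 * (y 1 ^ 2 + y 2 ^ 2)) := by gcongr
  exact mul_le_mul_of_nonneg_left (by linarith) hs.le

/-- Over a constant field in the direction of `w1` the imaginary part of the phase is positive. -/
theorem IsNormalPhase.exists_im_const_ge (h : IsNormalPhase V Γ γ β β') :
    ∃ b > 0, ∀ s : ℝ, 0 < s → s ≤ b → ∀ y : R3, ‖y‖ ≤ b →
      complexPt y (s • ![1, 0, 0]) ∈ V ∧ s / 2 ≤ (Γ (complexPt y (s • ![1, 0, 0]))).im := by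
  obtain ⟨K, hK, b1, hb1, hball, hE⟩ := h.exists_fderiv_rem_le
  refine ⟨min (b1 / 2) (1 / (4 * K)), by positivity, fun s hs hsb y hy => ?_⟩
  set θ : R3 := s • ![1, 0, 0] with hθ
  have hθ0 : θ 0 = s := by simp [hθ]
  have hθ1 : θ 1 = 0 := by simp [hθ]
  have hθ2 : θ 2 = 0 := by simp [hθ]
  have hsb1 := hsb.trans (min_le_left _ _)
  have hsb2 := hsb.trans (min_le_right _ _)
  have hy1 := hy.trans (min_le_left _ _)
  have hy2 := hy.trans (min_le_right _ _)
  have hζ : ∀ t ∈ Icc (0 : ℝ) 1, ‖complexPt y (t • θ)‖ ≤ ‖y‖ + s := fun t ht => by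
    refine (norm_complexPt_le _ _).trans ?_
    have h2 : ‖θ‖ ≤ s := by
      refine (pi_norm_le_iff_of_nonneg hs.le).2 fun i => ?_
      fin_cases i
      · show ‖θ 0‖ ≤ s
        rw [hθ0, Real.norm_of_nonneg hs.le]
      · show ‖θ 1‖ ≤ s
        rw [hθ1, norm_zero]; exact hs.le
      · show ‖θ 2‖ ≤ s
        rw [hθ2, norm_zero]; exact hs.le
    have h3 : ‖t • θ‖ ≤ ‖θ‖ := by
      rw [norm_smul, Real.norm_of_nonneg ht.1]
      exact mul_le_of_le_one_left (norm_nonneg _) ht.2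
    linarith
  have hN : 0 < ‖y‖ + s := by positivity
  have hζV : ∀ t ∈ Icc (0 : ℝ) 1, complexPt y (t • θ) ∈ V := fun t ht =>
    hball (mem_closedBall_zero_iff.2 ((hζ t ht).trans (by linarith)))
  have hmain := h.im_complexPt_ge (M := s / 2) hζV (fun t ht => by
    refine (norm_clm_apply_I_mul_le _ _).trans ?_
    rw [hθ0, hθ1, hθ2, abs_zero, mul_zero, mul_zero, add_zero, add_zero, abs_of_pos hs]
    have h1 := (hE _ hN (by linarith) _ (hζ t ht)).1
    have h2 : K * (‖y‖ + s) ≤ 1 / 2 := by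
      have : ‖y‖ + s ≤ 1 / (2 * K) := by
        have : 1 / (2 * K) = 1 / (4 * K) + 1 / (4 * K) := by field_simp; norm_num
        linarith
      rw [le_div_iff₀ (by positivity)] at this; linarith
    nlinarith)
  rw [hθ0, hθ1, hθ2] at hmain; have hfin := hζV 1 (by simp); rw [one_smul] at hfin
  exact ⟨hfin, by linarith⟩

/-- Near concavity of the imaginary part of the phase in imaginary directions. -/
theorem IsNormalPhase.exists_im_combo_ge (h : IsNormalPhase V Γ γ β β') :
    ∃ K > 0, ∃ b > 0, (∀ y θ : R3, ‖y‖ ≤ b → ‖θ‖ ≤ b → complexPt y θ ∈ V) ∧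
      ∀ y θ0 θ1 : R3, ‖y‖ ≤ b → ‖θ0‖ ≤ b → ‖θ1‖ ≤ b → ∀ t ∈ Icc (0 : ℝ) 1,
        (1 - t) * (Γ (complexPt y θ0)).im + t * (Γ (complexPt y θ1)).im - K * t * ‖θ1 - θ0‖ ^ 2
          ≤ (Γ (complexPt y (θ0 + t • (θ1 - θ0)))).im := by
  have hC : ContDiffAt ℂ 1 (fderiv ℂ Γ) 0 :=
    ((contDiffOn_infty_of_holomorphic h.isOpen h.holo).contDiffAt
      (h.isOpen.mem_nhds h.zero_mem)).fderiv_right (m := 1) (by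
        rw [one_add_one_eq_two]
        exact ENat.LEInfty.out)
  obtain ⟨K, t, ht, hK⟩ := hC.exists_lipschitzOnWith
  obtain ⟨b, hb, hball⟩ := nhds_basis_closedBall.mem_iff.1
    (inter_mem ht (h.isOpen.mem_nhds h.zero_mem))
  have hmem : ∀ y θ : R3, ‖y‖ ≤ b / 2 → ‖θ‖ ≤ b / 2 → complexPt y θ ∈ t ∩ V := fun y θ h1 h2 =>
    hball (mem_closedBall_zero_iff.2 ((norm_complexPt_le y θ).trans (by linarith)))
  refine ⟨K + 1, by positivity, b / 2, by positivity, fun y θ h1 h2 => (hmem y θ h1 h2).2,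
    fun y θ0 θ1 hy h0 h1 τ hτ => ?_⟩
  set v := θ1 - θ0 with hv
  have hseg : ∀ τ ∈ Icc (0 : ℝ) 1, ‖θ0 + τ • v‖ ≤ b / 2 := fun τ hτ => by
    have : θ0 + τ • v = (1 - τ) • θ0 + τ • θ1 := by
      rw [hv]; module
    rw [this]; refine (norm_add_le _ _).trans ?_
    rw [norm_smul, norm_smul, Real.norm_of_nonneg hτ.1, Real.norm_of_nonneg (by linarith [hτ.2])]
    nlinarith [hτ.1, hτ.2]
  set f : ℝ → ℝ := fun τ => (Γ (complexPt y (θ0 + τ • v))).im with hf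
  set f' : ℝ → ℝ := fun τ =>
    (fderiv ℂ Γ (complexPt y (θ0 + τ • v)) (fun i => I * (v i : ℂ))).im with hf'
  have hder : ∀ τ ∈ Icc (0 : ℝ) 1, HasDerivAt f (f' τ) τ := fun τ hτ => by
    have hm := (hmem y _ hy (hseg τ hτ)).2
    have := hasDerivAt_comp_complexPt (f := Γ) (y := y) (a := θ0) (v := v) (t := τ)
      ((h.holo _ hm).differentiableAt (h.isOpen.mem_nhds hm))
    exact (imCLM.hasFDerivAt.comp_hasDerivAt τ this)
  have hvn : ‖(fun i => I * (v i : ℂ) : C3)‖ ≤ ‖v‖ := by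
    refine (pi_norm_le_iff_of_nonneg (norm_nonneg _)).2 fun i => ?_
    rw [norm_mul, norm_I, one_mul, norm_real]; exact norm_le_pi_norm v i
  have hlip : ∀ a ∈ Icc (0 : ℝ) 1, ∀ c ∈ Icc (0 : ℝ) 1, |f' a - f' c| ≤ K * ‖v‖ ^ 2 :=
    fun a ha c hc => by
    have h2 := hK.norm_sub_le (hmem y _ hy (hseg a ha)).1 (hmem y _ hy (hseg c hc)).1
    have h3 : ‖complexPt y (θ0 + a • v) - complexPt y (θ0 + c • v)‖ ≤ ‖v‖ := by
      refine (pi_norm_le_iff_of_nonneg (norm_nonneg _)).2 fun i => ?_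
      have : (complexPt y (θ0 + a • v) - complexPt y (θ0 + c • v)) i
          = I * (((a - c) * v i : ℝ) : ℂ) := by
        simp [complexPt]; ring
      rw [this, norm_mul, norm_I, one_mul, norm_real, norm_mul]
      have h4 : ‖a - c‖ ≤ 1 := by
        rw [norm_eq_abs, abs_le]; constructor <;> linarith [ha.1, ha.2, hc.1, hc.2]
      have := norm_le_pi_norm v i; have := norm_nonneg (v i); nlinarith
    calc |f' a - f' c| = |((fderiv ℂ Γ (complexPt y (θ0 + a • v))
          - fderiv ℂ Γ (complexPt y (θ0 + c • v))) (fun i => I * (v i : ℂ))).im| := by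
          simp only [hf', sub_apply, sub_im]
      _ ≤ ‖(fderiv ℂ Γ (complexPt y (θ0 + a • v))
          - fderiv ℂ Γ (complexPt y (θ0 + c • v))) (fun i => I * (v i : ℂ))‖ :=
          abs_im_le_norm _
      _ ≤ (K * ‖v‖) * ‖v‖ := by
          refine (le_opNorm _ _).trans ?_; gcongr; exact h2.trans (by gcongr)
      _ = _ := by ring
  have hf0 : f 0 = (Γ (complexPt y θ0)).im := by simp [hf]
  have hf1 : f 1 = (Γ (complexPt y θ1)).im := by simp [hf, hv]
  rw [← hf0, ← hf1]; show _ ≤ f τ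
  have hKv : 0 ≤ K * ‖v‖ ^ 2 := by positivity
  have hpos : 0 ≤ τ * ‖v‖ ^ 2 := mul_nonneg hτ.1 (by positivity)
  rcases eq_or_lt_of_le hτ.1 with h5 | h5
  · rw [← h5]; simp
  rcases eq_or_lt_of_le hτ.2 with h6 | h6
  · rw [h6]; have : 0 ≤ (K + 1) * ‖v‖ ^ 2 := by positivity
    linarith
  -- The mean value theorem on both sides of `τ`: the deviation from the chord is `τ(1 - τ)(f' a -
  -- f' c)`, and the derivatives differ by at most `K‖v‖²`.
  obtain ⟨a, ha, ha'⟩ := exists_hasDerivAt_eq_slope f f' h5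
    (fun x hx => (hder x ⟨hx.1, hx.2.trans h6.le⟩).continuousAt.continuousWithinAt)
    (fun x hx => hder x ⟨hx.1.le, hx.2.le.trans h6.le⟩)
  obtain ⟨c, hc, hc'⟩ := exists_hasDerivAt_eq_slope f f' h6
    (fun x hx => (hder x ⟨h5.le.trans hx.1, hx.2⟩).continuousAt.continuousWithinAt)
    (fun x hx => hder x ⟨h5.le.trans hx.1.le, hx.2.le⟩)
  rw [eq_div_iff (by linarith)] at ha' hc'
  have h7 := hlip a ⟨ha.1.le, ha.2.le.trans h6.le⟩ c ⟨h5.le.trans hc.1.le, hc.2.le⟩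
  have h8 := (abs_le.1 h7).1
  have h9 : f τ - ((1 - τ) * f 0 + τ * f 1) = τ * (1 - τ) * (f' a - f' c) := by
    linear_combination (-(1 - τ)) * ha' + τ * hc'
  have h10 : 0 ≤ τ * (1 - τ) := mul_nonneg h5.le (by linarith)
  have h11 : -(τ * (1 - τ) * (K * ‖v‖ ^ 2)) ≤ τ * (1 - τ) * (f' a - f' c) := by nlinarith
  have h12 : τ * (1 - τ) * (K * ‖v‖ ^ 2) ≤ τ * (K * ‖v‖ ^ 2) :=
    mul_le_mul_of_nonneg_right (by nlinarith) hKv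
  linarith

end Phase

/-! ### Tilted Gaussian integrals and the dip field -/

/-- The constant of a nondegenerate Gaussian integral in two variables. -/
noncomputable def phaseConst (β β' : ℝ) : ℂ :=
  (√(2 * π / |β|) * exp (I * π / 4 * sign β)) * (√(2 * π / |β'|) * exp (I * π / 4 * sign β'))

/-- The Fresnel integral along the line of direction `1 + i s β`. -/
theorem integral_tilted_gaussian {s β : ℝ} (hs : 0 < s) (hβ : β ≠ 0) :
    ∫ y : ℝ, (1 + I * ((s * β : ℝ) : ℂ)) * exp (I * (1 / 2 * (β *
        ((1 + I * ((s * β : ℝ) : ℂ)) * y) ^ 2)))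
      = (√(2 * π / |β|) : ℂ) * exp (I * π / 4 * (sign β : ℂ)) := by
  set d : ℂ := 1 + I * ((s * β : ℝ) : ℂ) with hd
  have hd0 : d ≠ 0 := fun h => by
    have := congrArg Complex.re h; simp [hd] at this
  set b : ℂ := -(I * β * d ^ 2 / 2) with hb
  -- The tilt by `sβ` gives the Gaussian exponent a positive real part, so the Fresnel integral
  -- converges absolutely.
  have hbre : b.re = s * β ^ 2 := by
    have : b = ((s * β ^ 2 : ℝ) : ℂ) + I * ((β * (s ^ 2 * β ^ 2 - 1) / 2 : ℝ) : ℂ) := by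
      rw [hb, hd]; push_cast
      linear_combination (-(s * β ^ 2 : ℂ) - I * s ^ 2 * β ^ 3 / 2) * I_sq
    rw [this, add_re, ofReal_re, I_mul_re, ofReal_im, neg_zero, add_zero]
  have hb0 : 0 < b.re := by
    rw [hbre]; positivity
  have hbne : b ≠ 0 := fun h => by
    rw [h] at hb0; simp at hb0
  have h1 : ∀ y : ℝ, d * exp (I * (1 / 2 * (β * (d * y) ^ 2)))
      = d * exp (-b * (y : ℂ) ^ 2) := fun y => by
    congr 2; rw [hb]; ring
  simp_rw [h1]; rw [integral_const_mul, integral_gaussian_complex hb0]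
  have hβc : (β : ℂ) ≠ 0 := by exact_mod_cast hβ
  set e : ℂ := exp (I * π / 4 * (sign β : ℂ)) with he
  have hsq : √(1 / 2) ^ 2 = 1 / 2 := sq_sqrt (by norm_num)
  have hcos : Real.cos (π / 4) = √2 / 2 := Real.cos_pi_div_four
  have hsin : Real.sin (π / 4) = √2 / 2 := Real.sin_pi_div_four
  have hee : e = ((√2 / 2 : ℝ) : ℂ) * (1 + I * (sign β : ℂ)) := by
    have hpos : exp ((π / 4 : ℝ) * I) = ((√2 / 2 : ℝ) : ℂ) + ((√2 / 2 : ℝ) : ℂ) * I := by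
      rw [exp_mul_I, ← ofReal_cos, ← ofReal_sin, hcos, hsin]
    have hneg : exp ((-(π / 4) : ℝ) * I) = ((√2 / 2 : ℝ) : ℂ) - ((√2 / 2 : ℝ) : ℂ) * I := by
      rw [exp_mul_I, ← ofReal_cos, ← ofReal_sin, Real.cos_neg, Real.sin_neg, hcos, hsin]; push_cast
      ring
    rcases lt_or_gt_of_ne hβ with h | h
    · rw [he, sign_of_neg h, show I * π / 4 * ((-1 : ℝ) : ℂ)
        = ((-(π / 4) : ℝ) : ℂ) * I by push_cast; ring, hneg]
      push_cast; ring
    · rw [he, sign_of_pos h, show I * π / 4 * ((1 : ℝ) : ℂ)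
        = ((π / 4 : ℝ) : ℂ) * I by push_cast; ring, hpos]
      push_cast; ring
  have hsign : sign β * β = |β| := by
    rcases lt_or_gt_of_ne hβ with h | h
    · rw [sign_of_neg h, abs_of_neg h]; ring
    · rw [sign_of_pos h, abs_of_pos h]; ring
  have hsign2 : sign β ^ 2 = 1 := by
    rcases lt_or_gt_of_ne hβ with h | h
    · rw [sign_of_neg h]; norm_num
    · rw [sign_of_pos h]; norm_num
  have hs2 : √2 ^ 2 = 2 := sq_sqrt (by norm_num)
  have he2 : e ^ 2 = I * (sign β : ℂ) := by
    have h3 : ((√2 : ℝ) : ℂ) ^ 2 = 2 := by exact_mod_cast hs2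
    have h4 : ((sign β : ℝ) : ℂ) ^ 2 = 1 := by exact_mod_cast hsign2
    rw [hee]; push_cast
    linear_combination (1 + I * (sign β : ℂ)) ^ 2 / 4 * h3
      + (sign β : ℂ) ^ 2 / 2 * I_sq - h4 / 2
  set q : ℝ := √(2 * π / |β|) with hq
  have hβa : 0 < |β| := abs_pos.2 hβ
  have hq0 : 0 < q := sqrt_pos.2 (by positivity)
  have hq2 : q ^ 2 * |β| = 2 * π := by
    rw [hq, sq_sqrt (by positivity)]; field_simp
  -- The candidate for the square root of `π/b`. It is the principal one because its square is right
  -- and its real part is positive.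
  set v : ℂ := q * e / d with hv
  have hv2 : v ^ 2 = π / b := by
    have h3 : (q : ℂ) ^ 2 * (sign β * β : ℂ) = 2 * π := by
      have : q ^ 2 * (sign β * β) = 2 * π := by rw [hsign, hq2]
      exact_mod_cast this
    rw [eq_div_iff hbne, hv, div_pow, mul_pow, he2, hb]; field_simp
    linear_combination (-I ^ 2) * h3 - 2 * π * I_sq
  have hvre : 0 < v.re := by
    have h3 : v = ((q * (√2 / 2) / (1 + (s * β) ^ 2) : ℝ) : ℂ)
        * ((1 + I * (sign β : ℂ)) * (1 - I * ((s * β : ℝ) : ℂ))) := by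
      have h4 : d * (1 - I * ((s * β : ℝ) : ℂ)) = ((1 + (s * β) ^ 2 : ℝ) : ℂ) := by
        rw [hd]; push_cast
        linear_combination (-(s * β : ℂ) ^ 2) * I_sq
      have h5 : ((1 + (s * β) ^ 2 : ℝ) : ℂ) ≠ 0 := by
        have : 0 < 1 + (s * β) ^ 2 := by positivity
        exact_mod_cast this.ne'
      rw [hv, hee, div_eq_iff hd0,
        ofReal_div (q * (√2 / 2)) (1 + (s * β) ^ 2), div_mul_eq_mul_div, div_mul_eq_mul_div,
        eq_div_iff h5, ← h4]
      push_cast; ring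
    have h4 : ((1 + I * (sign β : ℂ)) * (1 - I * ((s * β : ℝ) : ℂ))).re = 1 + s * |β| := by
      rw [← hsign]; simp; ring
    rw [h3, re_ofReal_mul, h4]; positivity
  have h3 : ((π : ℂ) / b) ^ (1 / 2 : ℂ) = v := by
    rw [← hv2, one_div]; exact sq_cpow_two_inv hvre
  rw [h3, hv]; field_simp

/-- The field whose domain dips below `w1 = 0` to the depth `s κ` and follows the quadratic form in
the tangential directions. -/
noncomputable def dipField (s κ β β' : ℝ) (y : R3) : R3 :=
  ![dipProfile s κ (y 0), s * (β * y 1), s * (β' * y 2)]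

/-- The density of the tangential part of `dipField`. -/
noncomputable def tiltDensity (s β β' : ℝ) : ℂ :=
  (1 + I * ((s * β : ℝ) : ℂ)) * (1 + I * ((s * β' : ℝ) : ℂ))

/-- The points of the domain of `dipField`, with the first coordinate free. -/
noncomputable def dipPt (s β β' : ℝ) (z : ℂ) (u : Fin 2 → ℝ) : C3 :=
  ![z, (1 + I * ((s * β : ℝ) : ℂ)) * u 0, (1 + I * ((s * β' : ℝ) : ℂ)) * u 1]

theorem contDiff_dipField (s β β' : ℝ) {κ : ℝ} (hκ : κ ≠ 0) :
    ContDiff ℝ ∞ (dipField s κ β β') := by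
  rw [contDiff_pi]; intro i; fin_cases i
  · exact (contDiff_dipProfile s hκ).comp (contDiff_apply ℝ ℝ (0 : Fin 3))
  · exact contDiff_const.mul (contDiff_const.mul (contDiff_apply ℝ ℝ (1 : Fin 3)))
  · exact contDiff_const.mul (contDiff_const.mul (contDiff_apply ℝ ℝ (2 : Fin 3)))

theorem dipField_eq_smul (s κ β β' : ℝ) (y : R3) :
    dipField s κ β β' y = s • ![dipProfile 1 κ (y 0), β * y 1, β' * y 2] := by
  funext i; fin_cases i
  · simp [dipField, dipProfile]
  · simp [dipField]
  · simp [dipField]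

theorem domainPt_dipField_cons (s κ β β' t : ℝ) (u : Fin 2 → ℝ) :
    domainPt (dipField s κ β β') (Fin.cons t u) = dipPt s β β' (graphPt (dipProfile s κ) t) u := by
  funext i; fin_cases i
  · simp [domainPt, dipField, dipPt, graphPt]
  · simp [domainPt, dipField, dipPt]; ring
  · have e2 : (Fin.cons t u : Fin 3 → ℝ) 2 = u 1 := rfl
    simp [domainPt, dipField, dipPt, e2]; ring

/-- Each component of the field depends on its own coordinate only, so the determinant is the
product of the diagonal entries. -/
theorem volumeDensity_dipField (s β β' : ℝ) {κ : ℝ} (hκ : κ ≠ 0) (y : R3) :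
    volumeDensity (dipField s κ β β') y =
      (1 + I * ((deriv (dipProfile s κ) (y 0) : ℝ) : ℂ)) * tiltDensity s β β' := by
  have h0 : HasFDerivAt (fun y : R3 => dipProfile s κ (y 0))
      (deriv (dipProfile s κ) (y 0) • (proj 0 : R3 →L[ℝ] ℝ)) y := by
    have h1 : HasDerivAt (dipProfile s κ) (deriv (dipProfile s κ) (y 0)) (y 0) :=
      ((contDiff_dipProfile s hκ (n := 1)).differentiable one_ne_zero _).hasDerivAt
    exact HasDerivAt.comp_hasFDerivAt (f := fun y : R3 => y 0) y h1
      (proj (R := ℝ) (φ := fun _ : Fin 3 => ℝ) 0).hasFDerivAt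
  have hj : ∀ (b : ℝ) (j : Fin 3), HasFDerivAt (fun y : R3 => s * (b * y j))
      ((s * b) • (proj j : R3 →L[ℝ] ℝ)) y := fun b j => by
    have := (proj (R := ℝ) (φ := fun _ : Fin 3 => ℝ) j).hasFDerivAt (x := y)
    refine (this.const_mul (s * b)).congr_of_eventuallyEq (.of_forall fun z => ?_)
    simp [mul_assoc]
  have h : HasFDerivAt (dipField s κ β β') (ContinuousLinearMap.pi
      ![deriv (dipProfile s κ) (y 0) • (proj 0 : R3 →L[ℝ] ℝ),
        (s * β) • proj 1, (s * β') • proj 2]) y := by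
    rw [hasFDerivAt_pi]; intro i; fin_cases i
    · exact h0
    · exact hj β 1
    · exact hj β' 2
  rw [volumeDensity_eq]; simp only [domainEntry, h.fderiv, tiltDensity]
  simp [pi_apply]; ring

/-! ### Estimates and limits on the dip domains -/

section DipEstimates

variable {V : Set C3} {Γ f : C3 → ℂ} {γ β β' : ℝ} {c μ : ℂ}

theorem dipPt_eq_complexPt (s β β' t k : ℝ) (u : Fin 2 → ℝ) :
    dipPt s β β' ((t : ℂ) + I * ((s * k : ℝ) : ℂ)) u
      = complexPt (Fin.cons t u) (s • ![k, β * (Fin.cons t u : R3) 1,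
        β' * (Fin.cons t u : R3) 2]) := by
  have e1 : (Fin.cons t u : Fin 3 → ℝ) 1 = u 0 := rfl
  have e2 : (Fin.cons t u : Fin 3 → ℝ) 2 = u 1 := rfl; funext i; fin_cases i
  · simp [dipPt, complexPt]
  · simp [dipPt, complexPt]; ring
  · simp [dipPt, complexPt, e2]; ring

theorem norm_dipPt_le {s : ℝ} (hs : 0 < s) (hs1 : s ≤ 1) (β β' : ℝ) (z : ℂ) (u : Fin 2 → ℝ) :
    ‖dipPt s β β' z u‖ ≤ ‖z‖ + (1 + |β| + |β'|) * ‖u‖ := by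
  have hj : ∀ (b : ℝ) (j : Fin 2), |b| ≤ |β| + |β'| →
      ‖(1 + I * ((s * b : ℝ) : ℂ)) * u j‖ ≤ ‖z‖ + (1 + |β| + |β'|) * ‖u‖ :=
    fun b j hb => by
    rw [norm_mul, norm_real]
    have h1 : ‖1 + I * ((s * b : ℝ) : ℂ)‖ ≤ 1 + |β| + |β'| := by
      refine (norm_add_le _ _).trans ?_
      rw [norm_one, norm_mul, norm_I, one_mul, norm_real, norm_eq_abs, abs_mul, abs_of_pos hs]
      have := mul_le_of_le_one_left (abs_nonneg b) hs1; linarith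
    have := mul_le_mul h1 (norm_le_pi_norm u j) (norm_nonneg _) (by positivity)
    linarith [norm_nonneg z]
  refine (pi_norm_le_iff_of_nonneg (by positivity)).2 fun i => ?_
  fin_cases i
  · show ‖z‖ ≤ _
    have : 0 ≤ (1 + |β| + |β'|) * ‖u‖ := by positivity
    linarith
  · exact hj β 0 (by linarith [abs_nonneg β'])
  · exact hj β' 1 (by linarith [abs_nonneg β])

/-- Near the origin: the phase and a function with a power singularity on the domains that follow
the quadratic form. -/
theorem IsNormalPhase.exists_dipPt_bounds (h : IsNormalPhase V Γ γ β β')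
    (hlead : HasLeadingPower f c μ) :
    ∃ b > 0, ∃ K > 0, ∃ c0 > 0, ∀ s κ : ℝ, 0 < s → s ≤ 1 → 0 < κ → κ ≤ b → ∀ t : ℝ, |t| ≤ b →
      ∀ u : Fin 2 → ℝ, ‖u‖ ≤ b → ∀ k : ℝ, |k| ≤ |t| + 2 * κ →
      dipPt s β β' ((t : ℂ) + I * ((s * k : ℝ) : ℂ)) u ∈ V ∧
      ((t : ℂ) + I * ((s * k : ℝ) : ℂ) ∈ cutAbove →
        ‖f (dipPt s β β' ((t : ℂ) + I * ((s * k : ℝ) : ℂ)) u)‖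
          ≤ K * ‖powBelow ((t : ℂ) + I * ((s * k : ℝ) : ℂ)) μ‖) ∧
      s * (k - |t| / 4 - κ + c0 * (u 0 ^ 2 + u 1 ^ 2))
        ≤ (Γ (dipPt s β β' ((t : ℂ) + I * ((s * k : ℝ) : ℂ)) u)).im := by
  obtain ⟨b1, hb1, c0, hc0, hQ⟩ := h.exists_im_dip_ge
  have hO : f =O[𝓝[cutDomain] 0] fun ζ : C3 => powBelow (ζ 0) μ := by
    have h1 := hlead.isBigO.add ((isBigO_refl (fun ζ : C3 => powBelow (ζ 0) μ) _).const_mul_left c)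
    refine h1.congr_left fun z => ?_
    ring
  obtain ⟨K, hK⟩ := hO.bound; rw [eventually_nhdsWithin_iff, Metric.eventually_nhds_iff] at hK
  obtain ⟨ε, hε, hball⟩ := hK; set B := 1 + |β| + |β'| with hB
  have hB0 : 0 < B := by positivity
  -- The point has norm at most `2|t| + 2κ + B‖u‖`, less than `ε` when `|t|`, `κ` and `‖u‖` are at
  -- most `ε / (5(B + 1))`.
  refine ⟨min b1 (ε / (5 * (B + 1))), by positivity, max K 1, lt_max_of_lt_right one_pos, c0, hc0,
    fun s κ hs hs1 hκ hκb t ht u hu k hk => ?_⟩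
  have hy : ‖(Fin.cons t u : R3)‖ ≤ b1 := by
    refine (pi_norm_le_iff_of_nonneg hb1.le).2 fun i => ?_
    refine Fin.cases ?_ (fun j => ?_) i
    · exact ht.trans (min_le_left _ _)
    · exact (norm_le_pi_norm u j).trans (hu.trans (min_le_left _ _))
  have h1 := hQ s κ hs hs1 hκ (hκb.trans (min_le_left _ _)) _ hy k hk
  rw [← dipPt_eq_complexPt] at h1
  refine ⟨h1.1, fun hcut => ?_, h1.2⟩
  have h2 : ‖dipPt s β β' ((t : ℂ) + I * ((s * k : ℝ) : ℂ)) u‖ < ε := by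
    refine (norm_dipPt_le hs hs1 _ _ _ _).trans_lt ?_
    have h3 : ‖(t : ℂ) + I * ((s * k : ℝ) : ℂ)‖ ≤ |t| + |k| := by
      refine (norm_add_le _ _).trans ?_
      rw [norm_mul, norm_I, one_mul, norm_real, norm_real,
        norm_eq_abs, norm_eq_abs, abs_mul, abs_of_pos hs]
      have := mul_le_of_le_one_left (abs_nonneg k) hs1; linarith
    have ht' := ht.trans (min_le_right _ _)
    have hu' := hu.trans (min_le_right _ _)
    have hκ' := hκb.trans (min_le_right _ _)
    set e := ε / (5 * (B + 1)) with he
    have he5 : 5 * (B + 1) * e = ε := by rw [he]; field_simp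
    have h4 : B * ‖u‖ ≤ B * e := by gcongr
    have h5 : 0 < e := by positivity
    have h6 : 0 < B * e := by positivity
    linarith
  exact (hball (by simpa using h2) hcut).trans
    (mul_le_mul_of_nonneg_right (le_max_left _ _) (norm_nonneg _))

/-- The pointwise limit of the rescaled integrand. -/
theorem IsNormalPhase.tendsto_scaled (h : IsNormalPhase V Γ γ β β')
    (hlead : HasLeadingPower f c μ) {s : ℝ} (hs : 0 < s) (hs1 : s ≤ 1) {z : ℂ}
    (hz : z ∈ cutAbove) (u : Fin 2 → ℝ) :
    Tendsto (fun Λ : ℝ => (Λ : ℂ) ^ μ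
        * f (dipPt s β β' (((Λ⁻¹ : ℝ) : ℂ) * z) ((√Λ)⁻¹ • u))
        * exp (I * Λ * (Γ (dipPt s β β' (((Λ⁻¹ : ℝ) : ℂ) * z) ((√Λ)⁻¹ • u)) - γ))) atTop
      (𝓝 (c * powBelow z μ * exp (I * (z
        + 1 / 2 * (β * ((1 + I * ((s * β : ℝ) : ℂ)) * u 0) ^ 2
          + β' * ((1 + I * ((s * β' : ℝ) : ℂ)) * u 1) ^ 2))))) := by
  set pt : ℝ → C3 := fun Λ => dipPt s β β' (((Λ⁻¹ : ℝ) : ℂ) * z) ((√Λ)⁻¹ • u) with hpt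
  set B := ‖z‖ + (1 + |β| + |β'|) * ‖u‖ with hB
  have hB0 : 0 ≤ B := by positivity
  have hinv : ∀ Λ : ℝ, 1 ≤ Λ → Λ⁻¹ ≤ (√Λ)⁻¹ := fun Λ hΛ => by
    refine inv_anti₀ (sqrt_pos.2 (by linarith)) ?_
    exact Real.sqrt_le_iff.2 ⟨by linarith, by nlinarith⟩
  have hnorm : ∀ Λ : ℝ, 1 ≤ Λ → ‖pt Λ‖ ≤ B * (√Λ)⁻¹ := fun Λ hΛ => by
    have h0 : 0 ≤ (√Λ)⁻¹ := inv_nonneg.2 (sqrt_nonneg _)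
    refine (norm_dipPt_le hs hs1 _ _ _ _).trans ?_
    rw [norm_mul, norm_real, norm_smul, Real.norm_of_nonneg (inv_nonneg.2 (by linarith)),
      Real.norm_of_nonneg h0]
    have := mul_le_mul_of_nonneg_right (hinv Λ hΛ) (norm_nonneg z); rw [hB]; linarith
  have hsqrt : Tendsto (fun Λ : ℝ => (√Λ)⁻¹) atTop (𝓝 0) :=
    tendsto_inv_atTop_zero.comp Real.tendsto_sqrt_atTop
  have hpt0 : Tendsto pt atTop (𝓝 0) := by
    have h1 := hsqrt.const_mul B; rw [mul_zero] at h1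
    exact squeeze_zero_norm' ((eventually_ge_atTop 1).mono hnorm) h1
  have hptcut : Tendsto pt atTop (𝓝[cutDomain] 0) := by
    refine tendsto_nhdsWithin_iff.2 ⟨hpt0, ?_⟩
    filter_upwards [eventually_gt_atTop 0] with Λ hΛ
    exact mul_mem_cutAbove hz (inv_pos.2 hΛ)
  have hA : Tendsto (fun Λ : ℝ => (Λ : ℂ) ^ μ * f (pt Λ)) atTop (𝓝 (c * powBelow z μ)) := by
    have h1 := hlead.comp_tendsto hptcut
    have h2 : (fun Λ : ℝ => (Λ : ℂ) ^ μ * (f (pt Λ) - c * powBelow (pt Λ 0) μ)) =o[atTop]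
        fun Λ : ℝ => (Λ : ℂ) ^ μ * powBelow (pt Λ 0) μ :=
      (isBigO_refl _ _).mul_isLittleO h1
    have h3 : ∀ᶠ Λ : ℝ in atTop, (Λ : ℂ) ^ μ * powBelow (pt Λ 0) μ = powBelow z μ := by
      filter_upwards [eventually_gt_atTop 0] with Λ hΛ
      have hΛc : (Λ : ℂ) ≠ 0 := by exact_mod_cast hΛ.ne'
      show (Λ : ℂ) ^ μ * powBelow (((Λ⁻¹ : ℝ) : ℂ) * z) μ = powBelow z μ
      rw [powBelow_mul (ne_zero_of_mem_cutAbove hz) (inv_pos.2 hΛ), ← mul_assoc,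
        ofReal_inv, inv_cpow _ _ (by
          rw [arg_ofReal_of_nonneg hΛ.le]
          exact pi_pos.ne), mul_inv_cancel₀, one_mul]
      simp [cpow_eq_zero_iff, hΛc]
    have h4 := h2.congr' (f₂ := fun Λ : ℝ => (Λ : ℂ) ^ μ * f (pt Λ) - c * powBelow z μ)
      (g₂ := fun _ => powBelow z μ) (h3.mono fun Λ h => by
        simp only; rw [mul_sub, ← h]
        ring) h3
    rw [isLittleO_const_iff (powBelow_ne_zero z μ)] at h4
    simpa using h4.add_const (c * powBelow z μ)
  refine hA.mul ((continuous_exp.tendsto _).comp ?_)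
  -- The normal coordinate scales like `1/Λ` and the whole point like `1/√Λ`, so the remainder is
  -- `O(Λ^{-3/2})`. This is why terms `|w₁||w|` and `|w|³` are negligible.
  have hrem : Tendsto (fun Λ : ℝ => (Λ : ℂ) * phaseRem Γ γ β β' (pt Λ)) atTop (𝓝 0) := by
    obtain ⟨K, hK⟩ := (h.rem.comp_tendsto hpt0).bound
    have h1 := hsqrt.const_mul (max K 0 * (‖z‖ * B + B ^ 3)); rw [mul_zero] at h1
    refine squeeze_zero_norm' ?_ h1
    filter_upwards [hK, eventually_ge_atTop 1] with Λ hKΛ hΛ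
    have hΛ0 : 0 < Λ := by linarith
    have hq : Λ = √Λ ^ 2 := (sq_sqrt hΛ0.le).symm
    have hq0 : 0 < √Λ := sqrt_pos.2 hΛ0
    have h2 : ‖phaseRem Γ γ β β' (pt Λ)‖ ≤ K * ‖(‖pt Λ 0‖ * ‖pt Λ‖ + ‖pt Λ‖ ^ 3)‖ := hKΛ
    rw [Real.norm_of_nonneg (by positivity)] at h2
    have h3 : ‖pt Λ 0‖ = Λ⁻¹ * ‖z‖ := by
      show ‖((Λ⁻¹ : ℝ) : ℂ) * z‖ = _
      rw [norm_mul, norm_real, Real.norm_of_nonneg (inv_nonneg.2 hΛ0.le)]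
    have h4 := hnorm Λ hΛ; rw [norm_mul, norm_real, Real.norm_of_nonneg hΛ0.le]
    calc Λ * ‖phaseRem Γ γ β β' (pt Λ)‖
        ≤ Λ * (max K 0 * (Λ⁻¹ * ‖z‖ * (B * (√Λ)⁻¹) + (B * (√Λ)⁻¹) ^ 3)) := by
          gcongr; refine h2.trans ?_; rw [h3]; gcongr; exact le_max_left _ _
      _ = max K 0 * (‖z‖ * B + B ^ 3) * (√Λ)⁻¹ := by
          set q := √Λ; rw [hq]; field_simp
  have hmain : ∀ᶠ Λ : ℝ in atTop, I * (z
        + 1 / 2 * (β * ((1 + I * ((s * β : ℝ) : ℂ)) * u 0) ^ 2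
          + β' * ((1 + I * ((s * β' : ℝ) : ℂ)) * u 1) ^ 2))
        + I * (Λ * phaseRem Γ γ β β' (pt Λ)) = I * Λ * (Γ (pt Λ) - γ) := by
    filter_upwards [eventually_gt_atTop 0] with Λ hΛ
    have hΛc : (Λ : ℂ) ≠ 0 := by exact_mod_cast hΛ.ne'
    have hq : (Λ : ℂ) * (((√Λ)⁻¹ : ℝ) : ℂ) ^ 2 = 1 := by
      have : Λ * (√Λ)⁻¹ ^ 2 = 1 := by rw [inv_pow, sq_sqrt hΛ.le, mul_inv_cancel₀ hΛ.ne']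
      exact_mod_cast this
    have hl : (Λ : ℂ) * ((Λ⁻¹ : ℝ) : ℂ) = 1 := by
      have : Λ * Λ⁻¹ = 1 := mul_inv_cancel₀ hΛ.ne'; exact_mod_cast this
    have e0 : pt Λ 0 = ((Λ⁻¹ : ℝ) : ℂ) * z := rfl
    have e1 : pt Λ 1 = (1 + I * ((s * β : ℝ) : ℂ)) * ((((√Λ)⁻¹ : ℝ) : ℂ) * u 0) := by
      show (1 + I * ((s * β : ℝ) : ℂ)) * (((√Λ)⁻¹ • u) 0 : ℝ) = _
      rw [Pi.smul_apply, smul_eq_mul, ofReal_mul (√Λ)⁻¹ (u 0)]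
    have e2 : pt Λ 2 = (1 + I * ((s * β' : ℝ) : ℂ)) * ((((√Λ)⁻¹ : ℝ) : ℂ) * u 1) := by
      show (1 + I * ((s * β' : ℝ) : ℂ)) * (((√Λ)⁻¹ • u) 1 : ℝ) = _
      rw [Pi.smul_apply, smul_eq_mul, ofReal_mul (√Λ)⁻¹ (u 1)]
    rw [phaseRem, e0, e1, e2]
    linear_combination (-I * z) * hl
      - I / 2 * (β * ((1 + I * ((s * β : ℝ) : ℂ)) * u 0) ^ 2
        + β' * ((1 + I * ((s * β' : ℝ) : ℂ)) * u 1) ^ 2) * hq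
  refine Tendsto.congr' hmain ?_
  simpa using (hrem.const_mul I).const_add (I * (z
        + 1 / 2 * (β * ((1 + I * ((s * β : ℝ) : ℂ)) * u 0) ^ 2
          + β' * ((1 + I * ((s * β' : ℝ) : ℂ)) * u 1) ^ 2)))

end DipEstimates

/-! ### Asymptotics over a small box -/

section Rescaled

variable {V : Set C3} {Γ f : C3 → ℂ} {γ β β' : ℝ} {c μ : ℂ} {b K c0 : ℝ}

/-- Bounds for the phase `Γ` and the amplitude `f` on the domains that follow the quadratic form,
in the box of half-side `b`. -/
def HasDipBounds (V : Set C3) (Γ f : C3 → ℂ) (β β' : ℝ) (μ : ℂ) (b K c0 : ℝ) : Prop :=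
  ∀ s κ : ℝ, 0 < s → s ≤ 1 → 0 < κ → κ ≤ b → ∀ t : ℝ, |t| ≤ b →
    ∀ u : Fin 2 → ℝ, ‖u‖ ≤ b → ∀ k : ℝ, |k| ≤ |t| + 2 * κ →
    dipPt s β β' ((t : ℂ) + I * ((s * k : ℝ) : ℂ)) u ∈ V ∧
    ((t : ℂ) + I * ((s * k : ℝ) : ℂ) ∈ cutAbove →
      ‖f (dipPt s β β' ((t : ℂ) + I * ((s * k : ℝ) : ℂ)) u)‖
        ≤ K * ‖powBelow ((t : ℂ) + I * ((s * k : ℝ) : ℂ)) μ‖) ∧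
    s * (k - |t| / 4 - κ + c0 * (u 0 ^ 2 + u 1 ^ 2))
      ≤ (Γ (dipPt s β β' ((t : ℂ) + I * ((s * k : ℝ) : ℂ)) u)).im

theorem graphPt_dipProfile_eq (s κ t : ℝ) :
    graphPt (dipProfile s κ) t = (t : ℂ) + I * ((s * dipProfile 1 κ t : ℝ) : ℂ) := by
  simp [graphPt, dipProfile]

theorem abs_dipProfile_one_le {κ : ℝ} (hκ : 0 < κ) (t : ℝ) :
    |dipProfile 1 κ t| ≤ |t| + 2 * κ := by
  have h4 := dipProfile_lower (κ := κ) zero_le_one t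
  have h5 := dipProfile_upper (s := 1) zero_le_one hκ.le t; have := abs_nonneg t; rw [abs_le]
  constructor <;> linarith

theorem HasDipBounds.mem (hb : HasDipBounds V Γ f β β' μ b K c0) {s κ t : ℝ} {u : Fin 2 → ℝ}
    (hs : 0 < s) (hs1 : s ≤ 1) (hκ : 0 < κ) (hκb : κ ≤ b) (ht : |t| ≤ b) (hu : ‖u‖ ≤ b) :
    dipPt s β β' (graphPt (dipProfile s κ) t) u ∈ V ∩ cutDomain := by
  refine ⟨?_, graphPt_dipProfile_mem_cutAbove hs hκ t⟩; rw [graphPt_dipProfile_eq]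
  exact (hb s κ hs hs1 hκ hκb t ht u hu _ (abs_dipProfile_one_le hκ t)).1

theorem HasDipBounds.norm_le (hb : HasDipBounds V Γ f β β' μ b K c0) {s κ t : ℝ} {u : Fin 2 → ℝ}
    (hs : 0 < s) (hs1 : s ≤ 1) (hκ : 0 < κ) (hκb : κ ≤ b) (ht : |t| ≤ b) (hu : ‖u‖ ≤ b) :
    ‖f (dipPt s β β' (graphPt (dipProfile s κ) t) u)‖
      ≤ K * ‖powBelow (graphPt (dipProfile s κ) t) μ‖ ∧
    s * (3 / 4 * |t| - 3 * κ + c0 * (u 0 ^ 2 + u 1 ^ 2))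
      ≤ (Γ (dipPt s β β' (graphPt (dipProfile s κ) t) u)).im := by
  have h1 := hb s κ hs hs1 hκ hκb t ht u hu _ (abs_dipProfile_one_le hκ t)
  rw [← graphPt_dipProfile_eq] at h1
  refine ⟨h1.2.1 (graphPt_dipProfile_mem_cutAbove hs hκ t), le_trans ?_ h1.2.2⟩
  have h4 := dipProfile_lower (κ := κ) zero_le_one t
  exact mul_le_mul_of_nonneg_left (by linarith) hs.le

theorem continuous_dipPt (s β β' : ℝ) : Continuous fun v : ℂ × (Fin 2 → ℝ) =>
    dipPt s β β' v.1 v.2 := by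
  unfold dipPt
  refine continuous_pi fun i => ?_
  fin_cases i
  · exact continuous_fst
  · show Continuous fun v : ℂ × (Fin 2 → ℝ) => (1 + I * ((s * β : ℝ) : ℂ)) * (v.2 0 : ℂ)
    fun_prop
  · show Continuous fun v : ℂ × (Fin 2 → ℝ) => (1 + I * ((s * β' : ℝ) : ℂ)) * (v.2 1 : ℂ)
    fun_prop

theorem norm_tendsto_exp_phase (Γ : C3 → ℂ) (γ Λ : ℝ) (ζ : C3) :
    ‖exp (I * Λ * (Γ ζ - γ))‖ = Real.exp (-(Λ * (Γ ζ).im)) := by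
  rw [norm_exp]; congr 1; simp [mul_re, mul_im]

/-- The rescaled box. -/
def rescaledBox (ρ Λ : ℝ) : Set ((Fin 2 → ℝ) × ℝ) :=
  closedBall (0 : Fin 2 → ℝ) (√Λ * ρ) ×ˢ Ioc (-(Λ * ρ)) (Λ * ρ)

/-- The density of the oscillating integral in the rescaled coordinates. -/
noncomputable def rescaledDensity (Γ f : C3 → ℂ) (γ β β' s : ℝ) (μ : ℂ) (Λ : ℝ)
    (v : (Fin 2 → ℝ) × ℝ) : ℂ :=
  (Λ : ℂ) ^ μ
    * f (dipPt s β β' (((Λ⁻¹ : ℝ) : ℂ) * graphPt (dipProfile s 1) v.2) ((√Λ)⁻¹ • v.1))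
    * exp (I * Λ * (Γ (dipPt s β β'
      (((Λ⁻¹ : ℝ) : ℂ) * graphPt (dipProfile s 1) v.2) ((√Λ)⁻¹ • v.1)) - γ))
    * ((1 + I * ((deriv (dipProfile s 1) v.2 : ℝ) : ℂ)) * tiltDensity s β β')

/-- The limit of the integral over a rescaled domain. -/
theorem IsNormalPhase.tendsto_integral_rescaled (h : IsNormalPhase V Γ γ β β')
    (hf : DifferentiableOn ℂ f (V ∩ cutDomain))
    (hlead : HasLeadingPower f c μ) (hμ : μ = -1 ∨ ∀ n : ℤ, μ ≠ n)
    (hK : 0 < K) (hc0 : 0 < c0)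
    (hb : HasDipBounds V Γ f β β' μ b K c0) {ρ s : ℝ} (hρ : 0 < ρ) (hρb : ρ ≤ b) (hs : 0 < s)
    (hs1 : s ≤ 1) :
    (∀ᶠ Λ : ℝ in atTop, Integrable ((rescaledBox ρ Λ).indicator
      (rescaledDensity Γ f γ β β' s μ Λ))) ∧
    Tendsto (fun Λ : ℝ => ∫ v, (rescaledBox ρ Λ).indicator (rescaledDensity Γ f γ β β' s μ Λ) v)
      atTop (𝓝 (c * singConst μ * phaseConst β β')) := by
  set S : ℝ → Set ((Fin 2 → ℝ) × ℝ) := fun Λ =>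
    closedBall (0 : Fin 2 → ℝ) (√Λ * ρ) ×ˢ Ioc (-(Λ * ρ)) (Λ * ρ) with hS
  set pt : ℝ → (Fin 2 → ℝ) × ℝ → C3 := fun Λ v =>
    dipPt s β β' (((Λ⁻¹ : ℝ) : ℂ) * graphPt (dipProfile s 1) v.2) ((√Λ)⁻¹ • v.1) with hpt
  set D : (Fin 2 → ℝ) × ℝ → ℂ := fun v =>
    (1 + I * ((deriv (dipProfile s 1) v.2 : ℝ) : ℂ)) * tiltDensity s β β' with hD
  set k : ℝ → (Fin 2 → ℝ) × ℝ → ℂ := fun Λ v => (Λ : ℂ) ^ μ * f (pt Λ v)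
    * exp (I * Λ * (Γ (pt Λ v) - γ)) * D v with hk
  change (∀ᶠ Λ in atTop, Integrable ((S Λ).indicator (k Λ))) ∧
    Tendsto (fun Λ => ∫ v, (S Λ).indicator (k Λ) v) _ _
  have hSm : ∀ Λ, MeasurableSet (S Λ) := fun Λ =>
    isClosed_closedBall.measurableSet.prod measurableSet_Ioc
  have hcontd : Continuous (deriv (dipProfile s 1)) :=
    (contDiff_dipProfile s one_ne_zero (n := 1)).continuous_deriv le_rfl
  have hcontg : Continuous (graphPt (dipProfile s 1)) :=
    continuous_graphPt (contDiff_dipProfile s one_ne_zero (n := 1)).continuous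
  have hDc : Continuous D := by
    rw [hD]; fun_prop
  have hptc : ∀ Λ, Continuous (pt Λ) := fun Λ =>
    (continuous_dipPt s β β').comp (f := fun v : (Fin 2 → ℝ) × ℝ =>
      (((Λ⁻¹ : ℝ) : ℂ) * graphPt (dipProfile s 1) v.2, (√Λ)⁻¹ • v.1)) (by fun_prop)
  -- the points of the domain, in the unscaled coordinates
  have hmemS : ∀ Λ : ℝ, 0 < Λ → ∀ v ∈ S Λ, |Λ⁻¹ * v.2| ≤ b ∧ ‖(√Λ)⁻¹ • v.1‖ ≤ b := by
    intro Λ hΛ v hv; have hq : 0 < √Λ := sqrt_pos.2 hΛ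
    have h1 : |v.2| ≤ Λ * ρ := abs_le.2 ⟨hv.2.1.le, hv.2.2⟩
    have h2 : ‖v.1‖ ≤ √Λ * ρ := mem_closedBall_zero_iff.1 hv.1; constructor
    · rw [abs_mul, abs_of_pos (inv_pos.2 hΛ), inv_mul_le_iff₀ hΛ]; exact h1.trans (by gcongr)
    · rw [norm_smul, Real.norm_of_nonneg (inv_nonneg.2 hq.le), inv_mul_le_iff₀ hq]
      exact h2.trans (by gcongr)
  have hΛev : ∀ᶠ Λ : ℝ in atTop, 0 < Λ ∧ Λ⁻¹ ≤ b := by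
    filter_upwards [eventually_gt_atTop 0, eventually_ge_atTop b⁻¹] with Λ h1 h2
    exact ⟨h1, inv_le_of_inv_le₀ (hρ.trans_le hρb) h2⟩
  -- The exponential decays at rate `3s/4` in `|v.2|`; letting the power grow at rate `s/4` leaves
  -- the rate `s/2` of the dominating function `bd`.
  obtain ⟨K', hK'0, hK'⟩ := exists_norm_powBelow_dipProfile_le hs hs1 (max |μ.re| |μ.im|)
    (c := s / 4) (by positivity)
  set bd : (Fin 2 → ℝ) × ℝ → ℝ := fun v => Real.exp (-(s * c0 * (v.1 0 ^ 2 + v.1 1 ^ 2)))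
    * (K * K' * Real.exp (3 * s) * 2 * ‖tiltDensity s β β'‖ * Real.exp (-(s / 2 * |v.2|))) with hbd
  have hmeas : ∀ᶠ Λ : ℝ in atTop, AEStronglyMeasurable ((S Λ).indicator (k Λ)) volume := by
    filter_upwards [hΛev] with Λ ⟨hΛ0, hΛb⟩
    refine (aestronglyMeasurable_indicator_iff (hSm Λ)).2 ?_
    refine ContinuousOn.aestronglyMeasurable ?_ (hSm Λ)
    have hmap : MapsTo (pt Λ) (S Λ) (V ∩ cutDomain) := fun v hv => by
      have h1 := hmemS Λ hΛ0 v hv; have := hb.mem hs hs1 (inv_pos.2 hΛ0) hΛb h1.1 h1.2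
      rwa [graphPt_dipProfile_scale hΛ0] at this
    have h1 := hf.continuousOn.comp (hptc Λ).continuousOn hmap
    have h2 := h.holo.continuousOn.comp (hptc Λ).continuousOn fun v hv => (hmap hv).1
    exact ((continuousOn_const.mul h1).mul ((continuousOn_const.mul
      (h2.sub continuousOn_const)).cexp)).mul hDc.continuousOn
  have hbound : ∀ᶠ Λ : ℝ in atTop, ∀ v, ‖(S Λ).indicator (k Λ) v‖ ≤ bd v := by
    filter_upwards [hΛev] with Λ ⟨hΛ0, hΛb⟩ v; by_cases hv : v ∈ S Λ
    · rw [indicator_of_mem hv]; have h1 := hmemS Λ hΛ0 v hv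
      have h2 := hb.norm_le hs hs1 (inv_pos.2 hΛ0) hΛb h1.1 h1.2
      rw [graphPt_dipProfile_scale hΛ0, powBelow_mul
        (ne_zero_of_mem_cutAbove (graphPt_dipProfile_mem_cutAbove hs one_pos _)) (inv_pos.2 hΛ0),
        norm_mul] at h2
      have h3 : ‖(Λ : ℂ) ^ μ‖ * ‖((Λ⁻¹ : ℝ) : ℂ) ^ μ‖ = 1 := by
        rw [norm_cpow_eq_rpow_re_of_pos hΛ0,
          norm_cpow_eq_rpow_re_of_pos (inv_pos.2 hΛ0),
          ← mul_rpow hΛ0.le (inv_pos.2 hΛ0).le, mul_inv_cancel₀ hΛ0.ne', Real.one_rpow]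
      have h4 : ‖1 + I * ((deriv (dipProfile s 1) v.2 : ℝ) : ℂ)‖ ≤ 2 := by
        refine (norm_add_le _ _).trans ?_
        rw [norm_one, norm_mul, norm_I, one_mul, norm_real, norm_eq_abs]
        have := abs_deriv_dipProfile_le hs.le one_ne_zero v.2; linarith
      have h5 : ‖exp (I * Λ * (Γ (pt Λ v) - γ))‖
          ≤ Real.exp (-(s * (3 / 4 * |v.2| - 3 + c0 * (v.1 0 ^ 2 + v.1 1 ^ 2)))) := by
        rw [norm_tendsto_exp_phase]; refine exp_le_exp.2 (neg_le_neg ?_)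
        refine le_trans (le_of_eq ?_) (mul_le_mul_of_nonneg_left h2.2 hΛ0.le)
        have e1 : ∀ j, ((√Λ)⁻¹ • v.1) j ^ 2 = Λ⁻¹ * v.1 j ^ 2 := fun j => by
          rw [Pi.smul_apply, smul_eq_mul, mul_pow, inv_pow, sq_sqrt hΛ0.le]
        rw [e1, e1, abs_mul, abs_of_pos (inv_pos.2 hΛ0)]; field_simp
      rw [hk]; simp only [norm_mul, hD]
      calc _ ≤ ‖(Λ : ℂ) ^ μ‖ * (K * (‖((Λ⁻¹ : ℝ) : ℂ) ^ μ‖ * (K' * Real.exp (s / 4 * |v.2|))))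
            * Real.exp (-(s * (3 / 4 * |v.2| - 3 + c0 * (v.1 0 ^ 2 + v.1 1 ^ 2))))
            * (2 * ‖tiltDensity s β β'‖) := by
            gcongr; refine h2.1.trans ?_; gcongr
            exact hK' μ (le_max_left _ _) (le_max_right _ _) _
        _ = (‖(Λ : ℂ) ^ μ‖ * ‖((Λ⁻¹ : ℝ) : ℂ) ^ μ‖) * (K * K' * 2 * ‖tiltDensity s β β'‖)
            * (Real.exp (s / 4 * |v.2|)
            * Real.exp (-(s * (3 / 4 * |v.2| - 3 + c0 * (v.1 0 ^ 2 + v.1 1 ^ 2))))) := by ring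
        _ = _ := by
            rw [h3, one_mul, hbd, ← Real.exp_add]; simp only
            have : s / 4 * |v.2| + -(s * (3 / 4 * |v.2| - 3 + c0 * (v.1 0 ^ 2 + v.1 1 ^ 2)))
                = -(s * c0 * (v.1 0 ^ 2 + v.1 1 ^ 2)) + 3 * s + -(s / 2 * |v.2|) := by ring
            rw [this, Real.exp_add, Real.exp_add]; ring
    · rw [indicator_of_notMem hv, norm_zero, hbd]; positivity
  have hbdi : Integrable bd := by
    have h1 : Integrable (fun u : Fin 2 → ℝ => Real.exp (-(s * c0 * (u 0 ^ 2 + u 1 ^ 2)))) := by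
      have h2 := Integrable.fintype_prod (f := fun (_ : Fin 2) (x : ℝ) =>
        Real.exp (-(s * c0) * x ^ 2)) (μ := fun _ => volume)
        fun i => integrable_exp_neg_mul_sq (b := s * c0) (by positivity)
      refine h2.congr (.of_forall fun u => ?_); simp only [Fin.prod_univ_two]
      rw [← Real.exp_add]; congr 1; ring
    exact h1.mul_prod ((integrable_exp_neg_mul_abs (c := s / 2) (by positivity)).const_mul _)
  refine ⟨?_, ?_⟩
  · filter_upwards [hmeas, hbound] with Λ h1 h2
    exact hbdi.mono' h1 (.of_forall h2)
  -- The limit is a product of functions of single variables: Hankel's integral in the normal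
  -- variable and a tilted Gaussian in each tangential one.
  have hlimval : ∫ v : (Fin 2 → ℝ) × ℝ,
      (((1 + I * ((s * β : ℝ) : ℂ)) * exp (I * (1 / 2 * (β *
        ((1 + I * ((s * β : ℝ) : ℂ)) * v.1 0) ^ 2))))
      * ((1 + I * ((s * β' : ℝ) : ℂ)) * exp (I * (1 / 2 * (β' *
        ((1 + I * ((s * β' : ℝ) : ℂ)) * v.1 1) ^ 2)))))
      * (c * graphDensity (hankelIntegrand μ) (dipProfile s 1) v.2)
      = c * singConst μ * phaseConst β β' := by
    rw [phaseConst]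
    have h1 := integral_prod_mul (μ := (volume : Measure (Fin 2 → ℝ))) (ν := (volume : Measure ℝ))
      (fun u : Fin 2 → ℝ =>
      (((1 + I * ((s * β : ℝ) : ℂ)) * exp (I * (1 / 2 * (β *
        ((1 + I * ((s * β : ℝ) : ℂ)) * u 0) ^ 2))))
      * ((1 + I * ((s * β' : ℝ) : ℂ)) * exp (I * (1 / 2 * (β' *
        ((1 + I * ((s * β' : ℝ) : ℂ)) * u 1) ^ 2))))))
      (fun t => c * graphDensity (hankelIntegrand μ) (dipProfile s 1) t)
    refine h1.trans ?_
    rw [integral_const_mul, ← hankelIntegral_eq_singConst hs hs1 hμ, hankelIntegral]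
    have h2 := integral_fintype_prod_volume_eq_prod (𝕜 := ℂ) (fun (i : Fin 2) (x : ℝ) =>
      (1 + I * ((s * (![β, β'] i) : ℝ) : ℂ)) * exp (I * (1 / 2 *
        (((![β, β'] i : ℝ) : ℂ) * ((1 + I * ((s * (![β, β'] i) : ℝ) : ℂ)) * x) ^ 2))))
    simp only [Fin.prod_univ_two, Matrix.cons_val_zero, Matrix.cons_val_one] at h2
    rw [h2, integral_tilted_gaussian hs h.β₂_ne, integral_tilted_gaussian hs h.β₃_ne]; ring
  rw [← hlimval]
  refine tendsto_integral_filter_of_dominated_convergence bd hmeas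
    (hbound.mono fun Λ h => .of_forall h) hbdi (.of_forall fun v => ?_)
  have h1 := (h.tendsto_scaled hlead hs hs1
    (graphPt_dipProfile_mem_cutAbove hs one_pos v.2) v.1).mul_const (D v)
  have h2 : c * powBelow (graphPt (dipProfile s 1) v.2) μ * exp (I *
        (graphPt (dipProfile s 1) v.2
        + 1 / 2 * (β * ((1 + I * ((s * β : ℝ) : ℂ)) * v.1 0) ^ 2
          + β' * ((1 + I * ((s * β' : ℝ) : ℂ)) * v.1 1) ^ 2))) * D v
      = (((1 + I * ((s * β : ℝ) : ℂ)) * exp (I * (1 / 2 * (β *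
        ((1 + I * ((s * β : ℝ) : ℂ)) * v.1 0) ^ 2))))
      * ((1 + I * ((s * β' : ℝ) : ℂ)) * exp (I * (1 / 2 * (β' *
        ((1 + I * ((s * β' : ℝ) : ℂ)) * v.1 1) ^ 2)))))
      * (c * graphDensity (hankelIntegrand μ) (dipProfile s 1) v.2) := by
    rw [mul_add, mul_add, mul_add, exp_add, exp_add, graphDensity, hankelIntegrand, hD, tiltDensity]
    ring
  rw [← h2]; refine h1.congr' ?_
  filter_upwards [eventually_gt_atTop (|v.2| / ρ), eventually_gt_atTop 0,
    Real.tendsto_sqrt_atTop.eventually_gt_atTop (‖v.1‖ / ρ)] with Λ hΛ hΛ0 hΛ2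
  rw [div_lt_iff₀ hρ] at hΛ hΛ2
  have hv : v ∈ S Λ := ⟨mem_closedBall_zero_iff.2 hΛ2.le, (abs_lt.1 hΛ).1, (abs_lt.1 hΛ).2.le⟩
  rw [indicator_of_mem hv]

/-- The density of the oscillating integral on the slice with tangential coordinates `u`. -/
noncomputable def sliceDensity (Γ f : C3 → ℂ) (β β' s κ Λ : ℝ) (u : Fin 2 → ℝ) (t : ℝ) : ℂ :=
  graphDensity (fun z => f (dipPt s β β' z u) * exp (I * Λ * Γ (dipPt s β β' z u)))
    (dipProfile s κ) t

theorem HasDipBounds.integrableOn_sliceDensity (hb : HasDipBounds V Γ f β β' μ b K c0)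
    (hΓ : DifferentiableOn ℂ Γ V) (hf : DifferentiableOn ℂ f (V ∩ cutDomain))
    {s κ ρ : ℝ} (hs : 0 < s) (hs1 : s ≤ 1) (hκ : 0 < κ) (hκb : κ ≤ b) (hρb : ρ ≤ b) (Λ : ℝ) :
    IntegrableOn (fun v : (Fin 2 → ℝ) × ℝ => sliceDensity Γ f β β' s κ Λ v.1 v.2)
      (closedBall 0 ρ ×ˢ Icc (-ρ) ρ) := by
  have hcontd : Continuous (deriv (dipProfile s κ)) :=
    (contDiff_dipProfile s hκ.ne' (n := 1)).continuous_deriv le_rfl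
  have hcontg : Continuous (graphPt (dipProfile s κ)) :=
    continuous_graphPt (contDiff_dipProfile s hκ.ne' (n := 1)).continuous
  refine ContinuousOn.integrableOn_compact
    ((isCompact_closedBall (0 : Fin 2 → ℝ) ρ).prod isCompact_Icc) ?_
  set pt : (Fin 2 → ℝ) × ℝ → C3 := fun v =>
    dipPt s β β' (graphPt (dipProfile s κ) v.2) v.1 with hpt
  have hptc : Continuous pt := (continuous_dipPt s β β').comp (f := fun v : (Fin 2 → ℝ) × ℝ =>
      (graphPt (dipProfile s κ) v.2, v.1)) (by fun_prop)
  have hmap : MapsTo pt (closedBall (0 : Fin 2 → ℝ) ρ ×ˢ Icc (-ρ) ρ)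
      (V ∩ cutDomain) := fun v hv =>
    hb.mem hs hs1 hκ hκb ((abs_le.2 hv.2).trans hρb) ((mem_closedBall_zero_iff.1 hv.1).trans hρb)
  have h1 := hf.continuousOn.comp hptc.continuousOn hmap
  have h2 := hΓ.continuousOn.comp hptc.continuousOn fun v hv => (hmap hv).1
  have h3 : Continuous fun v : (Fin 2 → ℝ) × ℝ =>
      (1 + I * ((deriv (dipProfile s κ) v.2 : ℝ) : ℂ)) := by fun_prop
  exact (h1.mul ((continuousOn_const.mul h2).cexp)).mul h3.continuousOn

/-- The integral over a box as an iterated integral over slices. -/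
theorem setIntegral_dipField_eq (Γ f : C3 → ℂ) (β β' s : ℝ) {κ ρ : ℝ} (hκ : 0 < κ) (hρ : 0 < ρ)
    (Λ : ℝ) (hint : IntegrableOn (fun v : (Fin 2 → ℝ) × ℝ => sliceDensity Γ f β β' s κ Λ v.1 v.2)
      (closedBall 0 ρ ×ˢ Icc (-ρ) ρ)) :
    ∫ y in closedBall (0 : R3) ρ, f (domainPt (dipField s κ β β') y)
        * exp (I * Λ * Γ (domainPt (dipField s κ β β') y))
        * volumeDensity (dipField s κ β β') y
      = tiltDensity s β β' * ∫ u in closedBall (0 : Fin 2 → ℝ) ρ, ∫ t in (-ρ)..ρ,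
        sliceDensity Γ f β β' s κ Λ u t := by
  set e := MeasurableEquiv.piFinSuccAbove (fun _ : Fin 3 => ℝ) 0 with he
  have hmp := (volume_preserving_piFinSuccAbove (fun _ : Fin 3 => ℝ) 0).symm
  have hsymm : ∀ v : ℝ × (Fin 2 → ℝ), e.symm v = Fin.cons v.1 v.2 := fun v => by
    show Fin.insertNth (α := fun _ => ℝ) (0 : Fin 3) v.1 v.2 = _
    rw [Fin.insertNth_zero']
  have hpre : e.symm ⁻¹' (closedBall (0 : R3) ρ) = Icc (-ρ) ρ ×ˢ closedBall (0 : Fin 2 → ℝ) ρ := by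
    ext v
    rw [mem_preimage, hsymm, mem_prod, mem_closedBall_zero_iff, mem_closedBall_zero_iff,
      pi_norm_le_iff_of_nonneg hρ.le, pi_norm_le_iff_of_nonneg hρ.le, Fin.forall_fin_succ,
      Fin.cons_zero, norm_eq_abs, abs_le, mem_Icc]
    simp only [Fin.cons_succ]
  rw [← hmp.setIntegral_preimage_emb e.symm.measurableEmbedding, ← he, hpre,
    Measure.volume_eq_prod, ← setIntegral_prod_swap]
  have h1 : ∀ v : (Fin 2 → ℝ) × ℝ,
      f (domainPt (dipField s κ β β') (e.symm v.swap))
        * exp (I * Λ * Γ (domainPt (dipField s κ β β') (e.symm v.swap)))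
        * volumeDensity (dipField s κ β β') (e.symm v.swap)
      = tiltDensity s β β' * sliceDensity Γ f β β' s κ Λ v.1 v.2 := fun v => by
    rw [hsymm, Prod.fst_swap, Prod.snd_swap, domainPt_dipField_cons, volumeDensity_dipField _ _ _ hκ.ne',
      Fin.cons_zero, sliceDensity, graphDensity]
    ring
  simp_rw [h1]
  rw [integral_const_mul, ← Measure.volume_eq_prod, Measure.volume_eq_prod, setIntegral_prod _ hint]
  congr 1; refine integral_congr_ae (.of_forall fun u => ?_); simp only
  rw [integral_of_le (by linarith), integral_Icc_eq_integral_Ioc]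

open scoped Pointwise in
/-- The rescaled integral in the unscaled coordinates. -/
theorem integral_rescaled_eq (Γ f : C3 → ℂ) (γ β β' s : ℝ) (μ : ℂ) {ρ Λ : ℝ} (hρ : 0 < ρ)
    (hΛ : 0 < Λ)
    (hint : Integrable ((rescaledBox ρ Λ).indicator (rescaledDensity Γ f γ β β' s μ Λ))) :
    ∫ v, (rescaledBox ρ Λ).indicator (rescaledDensity Γ f γ β β' s μ Λ) v
      = (Λ : ℂ) ^ (μ + 2) * (exp (-(I * Λ * γ)) * (tiltDensity s β β' *
        ∫ u in closedBall (0 : Fin 2 → ℝ) ρ, ∫ t in (-ρ)..ρ,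
        sliceDensity Γ f β β' s Λ⁻¹ Λ u t)) := by
  have hΛc : (Λ : ℂ) ≠ 0 := by exact_mod_cast hΛ.ne'
  have hq : 0 < √Λ := sqrt_pos.2 hΛ
  have hSm : MeasurableSet (rescaledBox ρ Λ) :=
    isClosed_closedBall.measurableSet.prod measurableSet_Ioc
  rw [integral_indicator hSm, rescaledBox, Measure.volume_eq_prod, setIntegral_prod _
    ((integrable_indicator_iff hSm).1 hint)]
  have h1 : ∀ u : Fin 2 → ℝ, ∫ t in Ioc (-(Λ * ρ)) (Λ * ρ), rescaledDensity Γ f γ β β' s μ Λ (u, t)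
      = (Λ : ℂ) ^ μ * (exp (-(I * Λ * γ)) * (tiltDensity s β β'
        * (Λ * ∫ t in (-ρ)..ρ, sliceDensity Γ f β β' s Λ⁻¹ Λ ((√Λ)⁻¹ • u) t))) :=
    fun u => by
    have h2 : ∀ t : ℝ, rescaledDensity Γ f γ β β' s μ Λ (u, t)
        = ((Λ : ℂ) ^ μ * (exp (-(I * Λ * γ)) * tiltDensity s β β'))
          * sliceDensity Γ f β β' s Λ⁻¹ Λ ((√Λ)⁻¹ • u) (Λ⁻¹ * t) := fun t => by
      rw [rescaledDensity, sliceDensity, graphDensity, graphPt_dipProfile_scale hΛ, deriv_dipProfile_scale hΛ,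
        mul_sub, sub_eq_add_neg, exp_add]
      ring
    simp_rw [h2]
    rw [integral_const_mul, ← integral_of_le (by nlinarith),
      integral_comp_mul_left (fun t => sliceDensity Γ f β β' s Λ⁻¹ Λ
        ((√Λ)⁻¹ • u) t) (inv_ne_zero hΛ.ne'), inv_inv, real_smul]
    have e1 : Λ⁻¹ * -(Λ * ρ) = -ρ := by field_simp
    have e2 : Λ⁻¹ * (Λ * ρ) = ρ := by field_simp
    rw [e1, e2]; ring
  simp only [h1]
  rw [integral_const_mul, integral_const_mul, integral_const_mul, integral_const_mul]
  -- The tangential scaling contributes `(√Λ)² = Λ` and the normal one `Λ`. With the `Λ^μ` of the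
  -- amplitude this makes `Λ^{μ+2}`.
  have h3 := Measure.setIntegral_comp_smul_of_pos (volume : Measure (Fin 2 → ℝ))
    (fun u => ∫ t in (-ρ)..ρ, sliceDensity Γ f β β' s Λ⁻¹ Λ u t)
    (closedBall (0 : Fin 2 → ℝ) (√Λ * ρ)) (inv_pos.2 hq)
  have h4 : (√Λ)⁻¹ • closedBall (0 : Fin 2 → ℝ) (√Λ * ρ) = closedBall (0 : Fin 2 → ℝ) ρ := by
    rw [_root_.smul_closedBall _ _ (by positivity), smul_zero, Real.norm_of_nonneg (inv_nonneg.2 hq.le),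
      inv_mul_cancel_left₀ hq.ne']
  rw [h3, h4, Module.finrank_fin_fun, inv_pow, sq_sqrt hΛ.le, inv_inv, real_smul,
    cpow_add _ _ hΛc]
  have e3 : (Λ : ℂ) ^ (2 : ℂ) = Λ * Λ := by
    rw [show (2 : ℂ) = ((2 : ℕ) : ℂ) by norm_num, cpow_natCast]; ring
  rw [e3]; ring

/-- Moving the contour in a slice from the depth `κ1` to the depth `κ`. -/
theorem HasDipBounds.exists_norm_slice_sub_le (hb : HasDipBounds V Γ f β β' μ b K c0)
    (hK : 0 < K) (hc0 : 0 < c0) (hV : IsOpen V) (hΓ : DifferentiableOn ℂ Γ V)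
    (hf : DifferentiableOn ℂ f (V ∩ cutDomain)) {s κ1 ρ : ℝ} (hs : 0 < s)
    (hs1 : s ≤ 1) (hκ1 : 0 < κ1) (hκρ : 8 * κ1 ≤ ρ) (hρb : ρ ≤ b) :
    ∃ M : ℝ, ∀ κ Λ : ℝ, 0 < κ → κ ≤ κ1 → 0 < Λ → ∀ u : Fin 2 → ℝ, ‖u‖ ≤ ρ →
      ‖(∫ t in (-ρ)..ρ, sliceDensity Γ f β β' s κ Λ u t)
        - ∫ t in (-ρ)..ρ, sliceDensity Γ f β β' s κ1 Λ u t‖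
        ≤ M * Real.exp (-(s * (3 / 8 * ρ) * Λ)) := by
  have hρ : 0 < ρ := by linarith
  -- Contains the vertical segments that join the ends of the two contours, for every `κ ≤ κ1`; its
  -- compactness bounds the power there once and for all.
  set S : Set ℂ := {z | |z.re| = ρ ∧ |z.im| ≤ 2 * ρ} with hS
  have hScl : IsClosed S := (isClosed_eq (continuous_re.abs) continuous_const).inter
    (isClosed_le (continuous_im.abs) continuous_const)
  have hSc : IsCompact S := by
    refine isCompact_of_isClosed_isBounded hScl ?_
    refine (isBounded_closedBall (x := (0 : ℂ)) (r := 3 * ρ)).subset fun z hz => ?_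
    rw [mem_closedBall_zero_iff]; have := norm_le_abs_re_add_abs_im z; linarith [hz.1, hz.2]
  have hScut : S ⊆ cutAbove := fun z hz h0 => by
    have := hz.1; rw [h0, abs_zero] at this; linarith
  obtain ⟨M1, hM1⟩ := hSc.exists_bound_of_continuousOn (f := fun z => powBelow z μ) fun z hz =>
    (hasDerivAt_powBelow (hScut hz) μ).continuousAt.continuousWithinAt
  have hM₁0 : 0 ≤ M1 := (norm_nonneg _).trans (hM1 (ρ : ℂ) ⟨by simp [abs_of_pos hρ], by
    simp [hρ.le]⟩)
  refine ⟨K * M1 * (4 * ρ) + K * M1 * (4 * ρ), fun κ Λ hκ hκκ1 hΛ u hu => ?_⟩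
  set Ω : Set ℂ := {z | dipPt s β β' z u ∈ V} ∩ cutAbove with hΩ
  have hlin : Differentiable ℂ fun z => dipPt s β β' z u := by
    unfold dipPt
    rw [differentiable_pi]; intro i; fin_cases i
    · exact differentiable_id
    · exact differentiable_const _
    · exact differentiable_const _
  have hΩo : IsOpen Ω := (hV.preimage hlin.continuous).inter isOpen_cutAbove
  have hdiff : DifferentiableOn ℂ (fun z => f (dipPt s β β' z u)
      * exp (I * Λ * Γ (dipPt s β β' z u))) Ω := by
    refine (hf.comp hlin.differentiableOn fun z hz => ⟨hz.1, hz.2⟩).mul ?_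
    exact ((hΓ.comp hlin.differentiableOn fun z hz => hz.1).const_mul _).cexp
  have hpt : ∀ τ t : ℝ, graphPt (fun t => dipProfile s κ1 t
      + τ * (dipProfile s κ t - dipProfile s κ1 t)) t = (t : ℂ) + I *
        ((s * (dipProfile 1 κ1 t + τ * (dipProfile 1 κ t - dipProfile 1 κ1 t)) : ℝ) : ℂ) :=
    fun τ t => by
    simp only [graphPt, dipProfile]; push_cast; ring
  have hk : ∀ τ ∈ Icc (0 : ℝ) 1, ∀ t : ℝ, |t| - 2 * κ1
      ≤ dipProfile 1 κ1 t + τ * (dipProfile 1 κ t - dipProfile 1 κ1 t) ∧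
      dipProfile 1 κ1 t + τ * (dipProfile 1 κ t - dipProfile 1 κ1 t) ≤ |t| - κ := by
    intro τ hτ t; have h1 := dipProfile_lower (κ := κ) zero_le_one t
    have h2 := dipProfile_lower (κ := κ1) zero_le_one t
    have h3 := dipProfile_upper (s := 1) zero_le_one hκ.le t
    have h4 := dipProfile_upper (s := 1) zero_le_one hκ1.le t
    have e : dipProfile 1 κ1 t + τ * (dipProfile 1 κ t - dipProfile 1 κ1 t)
        = (1 - τ) * dipProfile 1 κ1 t + τ * dipProfile 1 κ t := by ring
    have hτ1 : 0 ≤ 1 - τ := by linarith [hτ.2]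
    have m1 := mul_le_mul_of_nonneg_left h1 hτ.1
    have m2 := mul_le_mul_of_nonneg_left h2 hτ1
    have m3 := mul_le_mul_of_nonneg_left h3 hτ.1
    have m4 := mul_le_mul_of_nonneg_left h4 hτ1
    have m5 := mul_le_mul_of_nonneg_left hκκ1 hτ.1
    have m6 := mul_le_mul_of_nonneg_left hκκ1 hτ1; rw [e]; constructor <;> linarith
  have hkabs : ∀ τ ∈ Icc (0 : ℝ) 1, ∀ t : ℝ,
      |dipProfile 1 κ1 t + τ * (dipProfile 1 κ t - dipProfile 1 κ1 t)| ≤ |t| + 2 * κ1 :=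
    fun τ hτ t => by
    have := hk τ hτ t; have := abs_nonneg t; rw [abs_le]; constructor <;> linarith
  have hcut : ∀ τ ∈ Icc (0 : ℝ) 1, ∀ t : ℝ, (t : ℂ) + I *
        ((s * (dipProfile 1 κ1 t + τ * (dipProfile 1 κ t - dipProfile 1 κ1 t)) : ℝ) : ℂ)
        ∈ cutAbove := fun τ hτ t h0 => by
    have ht : t = 0 := by simpa using h0
    have h1 := (hk τ hτ t).2; rw [add_im, ofReal_im, I_mul_im, ofReal_re, zero_add]
    refine mul_neg_of_pos_of_neg hs ?_; rw [ht, abs_zero] at h1; rw [ht]; linarith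
  have hedge : ∀ t : ℝ, |t| = ρ → ∀ τ ∈ Icc (0 : ℝ) 1,
      ‖(fun z => f (dipPt s β β' z u) * exp (I * Λ * Γ (dipPt s β β' z u)))
        (graphPt (fun t => dipProfile s κ1 t + τ * (dipProfile s κ t - dipProfile s κ1 t)) t)‖
        ≤ K * M1 * Real.exp (-(s * (3 / 8 * ρ) * Λ)) := fun t ht τ hτ => by
    have h1 := hb s κ1 hs hs1 hκ1 (by linarith) t (by linarith) u (hu.trans hρb) _ (hkabs τ hτ t)
    have h2 := h1.2.1 (hcut τ hτ t); have h3 := h1.2.2; rw [hpt]; simp only; rw [norm_mul]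
    refine mul_le_mul ?_ ?_ (norm_nonneg _) (by positivity)
    · refine h2.trans (mul_le_mul_of_nonneg_left (hM1 _ ⟨?_, ?_⟩) hK.le)
      · simpa using ht
      · rw [add_im, ofReal_im, I_mul_im, ofReal_re, zero_add, abs_mul, abs_of_pos hs]
        have h4 := hkabs τ hτ t
        have := mul_le_of_le_one_left (abs_nonneg
          (dipProfile 1 κ1 t + τ * (dipProfile 1 κ t - dipProfile 1 κ1 t))) hs1
        linarith
    · rw [norm_exp]; refine exp_le_exp.2 ?_
      have e : ∀ x : ℂ, (I * Λ * x).re = -(Λ * x.im) := fun x => by simp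
      rw [e]; have h5 := (hk τ hτ t).1
      -- At an end `k ≥ ρ - 2κ1`, so the phase is at least `s(3ρ/4 - 3κ1)`, and `8κ1 ≤ ρ` leaves
      -- `3ρ/8`.
      have h6 : s * (3 / 8 * ρ) ≤ _ := le_trans (mul_le_mul_of_nonneg_left (by
        have : 0 ≤ c0 * (u 0 ^ 2 + u 1 ^ 2) := by positivity
        rw [ht] at h5 ⊢
        linarith) hs.le) h3
      have := mul_le_mul_of_nonneg_left h6 hΛ.le; linarith
  have hmain := norm_integral_graphDensity_sub_le hΩo hdiff
    (contDiff_dipProfile s hκ1.ne') (contDiff_dipProfile s hκ.ne') (a := -ρ) (b := ρ)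
    (by linarith) (fun τ hτ t ht => by
      rw [hpt]
      exact ⟨(hb s κ1 hs hs1 hκ1 (by linarith) t ((abs_le.2 ht).trans hρb) u (hu.trans hρb) _
        (hkabs τ hτ t)).1, hcut τ hτ t⟩)
    (hedge (-ρ) (by rw [abs_neg, abs_of_pos hρ])) (hedge ρ (abs_of_pos hρ))
  have hd : ∀ t : ℝ, |t| = ρ → |dipProfile s κ t - dipProfile s κ1 t| ≤ 4 * ρ := fun t ht => by
    have h1 := dipProfile_lower (κ := κ) hs.le t
    have h2 := dipProfile_lower (κ := κ1) hs.le t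
    have h3 := dipProfile_upper hs.le hκ.le t
    have h4 := dipProfile_upper hs.le hκ1.le t; rw [ht] at h1 h2 h3 h4
    have e1 : s * κ1 ≤ κ1 := mul_le_of_le_one_left hκ1.le hs1
    have e2 : s * κ ≤ κ := mul_le_of_le_one_left hκ.le hs1
    have e3 : 0 ≤ s * κ := by positivity
    have e4 : 0 ≤ s * κ1 := by positivity
    rw [abs_le]; constructor <;> linarith
  refine hmain.trans ?_; have h1 := hd ρ (abs_of_pos hρ)
  have h2 := hd (-ρ) (by rw [abs_neg, abs_of_pos hρ])
  calc _ ≤ K * M1 * Real.exp (-(s * (3 / 8 * ρ) * Λ)) * (4 * ρ)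
        + K * M1 * Real.exp (-(s * (3 / 8 * ρ) * Λ)) * (4 * ρ) := by gcongr
    _ = _ := by ring

/-- The asymptotics of the integral over a small box. -/
theorem IsNormalPhase.exists_tendsto_box (h : IsNormalPhase V Γ γ β β')
    (hf : DifferentiableOn ℂ f (V ∩ cutDomain))
    (hlead : HasLeadingPower f c μ) (hμ : μ = -1 ∨ ∀ n : ℤ, μ ≠ n) :
    ∃ b > 0, ∀ ρ s κ1 : ℝ, ρ ≤ b → 0 < s → s ≤ 1 → 0 < κ1 → 8 * κ1 ≤ ρ →
      Tendsto (fun Λ : ℝ => (Λ : ℂ) ^ (μ + 2) * (exp (-(I * Λ * γ)) *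
        ∫ y in closedBall (0 : R3) ρ, f (domainPt (dipField s κ1 β β') y)
        * exp (I * Λ * Γ (domainPt (dipField s κ1 β β') y))
        * volumeDensity (dipField s κ1 β β') y)) atTop
        (𝓝 (c * singConst μ * phaseConst β β')) := by
  obtain ⟨b, hb0, K, hK, c0, hc0, hb'⟩ := h.exists_dipPt_bounds hlead
  have hb : HasDipBounds V Γ f β β' μ b K c0 := hb'
  refine ⟨b, hb0, fun ρ s κ1 hρb hs hs1 hκ1 hκρ => ?_⟩; have hρ : 0 < ρ := by linarith
  obtain ⟨hint, hlim⟩ := h.tendsto_integral_rescaled hf hlead hμ hK hc0 hb hρ hρb hs hs1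
  obtain ⟨M, hM⟩ := hb.exists_norm_slice_sub_le hK hc0 h.isOpen h.holo hf hs hs1 hκ1 hκρ hρb
  set m := s * (3 / 8 * ρ) with hm
  have hm0 : 0 < m := by positivity
  set vol := (volume : Measure (Fin 2 → ℝ)).real (closedBall (0 : Fin 2 → ℝ) ρ) with hvol
  -- The limit was computed on domains of depth `1/Λ`, whereas the comparison with a given domain
  -- needs one of fixed depth `κ1`. Slice by slice the two integrals differ by an exponentially
  -- small amount.
  have herr : Tendsto (fun Λ : ℝ => (Λ : ℂ) ^ (μ + 2) * (exp (-(I * Λ * γ)) *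
      (tiltDensity s β β' * ((∫ u in closedBall (0 : Fin 2 → ℝ) ρ, ∫ t in (-ρ)..ρ,
        sliceDensity Γ f β β' s Λ⁻¹ Λ u t) - ∫ u in closedBall (0 : Fin 2 → ℝ) ρ,
        ∫ t in (-ρ)..ρ, sliceDensity Γ f β β' s κ1 Λ u t)))) atTop (𝓝 0) := by
    have h1 := (tendsto_cpow_mul_exp_neg (μ + 2) hm0).const_mul (‖tiltDensity s β β'‖ * (M * vol))
    rw [mul_zero] at h1; refine squeeze_zero_norm' ?_ h1
    filter_upwards [eventually_gt_atTop 0, eventually_ge_atTop κ1⁻¹] with Λ hΛ hΛκ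
    have hκ : Λ⁻¹ ≤ κ1 := inv_le_of_inv_le₀ hκ1 hΛκ
    have hslice : ∀ κ, 0 < κ → κ ≤ κ1 → IntegrableOn (fun u : Fin 2 → ℝ => ∫ t in (-ρ)..ρ,
        sliceDensity Γ f β β' s κ Λ u t) (closedBall 0 ρ) := fun κ hκ0 hκ => by
      have h2 := hb.integrableOn_sliceDensity h.holo hf hs hs1 hκ0 (hκ.trans (by linarith)) hρb Λ
      rw [IntegrableOn, Measure.volume_eq_prod, ← Measure.prod_restrict] at h2
      refine h2.integral_prod_left.congr (.of_forall fun u => ?_); simp only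
      rw [integral_of_le (by linarith), integral_Icc_eq_integral_Ioc]
    rw [← integral_sub (hslice _ (inv_pos.2 hΛ) hκ) (hslice _ hκ1 le_rfl)]
    have h3 := norm_setIntegral_le_of_norm_le_const (μ := (volume : Measure (Fin 2 → ℝ)))
      (s := closedBall (0 : Fin 2 → ℝ) ρ)
      (f := fun u => (∫ t in (-ρ)..ρ, sliceDensity Γ f β β' s Λ⁻¹ Λ u t)
        - ∫ t in (-ρ)..ρ, sliceDensity Γ f β β' s κ1 Λ u t)
      (C := M * Real.exp (-(m * Λ)))
      (measure_closedBall_lt_top) (fun u hu => by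
        exact hM Λ⁻¹ Λ (inv_pos.2 hΛ) hκ hΛ u (mem_closedBall_zero_iff.1 hu))
    have h4 : ‖exp (-(I * Λ * γ))‖ = 1 := by
      rw [norm_exp]; simp
    rw [norm_mul, norm_mul, norm_mul, h4, one_mul]
    calc _ ≤ ‖(Λ : ℂ) ^ (μ + 2)‖ * (‖tiltDensity s β β'‖ * (M * Real.exp (-(m * Λ)) * vol)) := by
          gcongr
      _ = _ := by ring
  have h5 := hlim.sub herr; rw [sub_zero] at h5; refine h5.congr' ?_
  filter_upwards [eventually_gt_atTop 0, hint] with Λ hΛ hΛint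
  rw [integral_rescaled_eq Γ f γ β β' s μ hρ hΛ hΛint, setIntegral_dipField_eq Γ f β β' s hκ1 hρ Λ
    (hb.integrableOn_sliceDensity h.holo hf hs hs1 hκ1 (by linarith) hρb Λ)]
  ring

end Rescaled

/-! ### Replacing a domain by a model domain -/

theorem contDiff_smul_of_tsupport_subset {a : R3 → ℝ} {v : R3 → R3} {Y : Set R3}
    (hY : IsOpen Y) (ha : ContDiff ℝ ∞ a) (hs : tsupport a ⊆ Y) (hv : ContDiffOn ℝ ∞ v Y) :
    ContDiff ℝ ∞ (fun y => a y • v y) := by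
  rw [contDiff_iff_contDiffAt]; intro y; by_cases hy : y ∈ tsupport a
  · exact ha.contDiffAt.smul (hv.contDiffAt (hY.mem_nhds (hs hy)))
  · have h0 : (fun y => a y • v y) =ᶠ[𝓝 y] fun _ => 0 := by
      filter_upwards [notMem_tsupport_iff_eventuallyEq.1 hy] with z hz
      rw [hz, Pi.zero_apply, zero_smul]
    exact contDiffAt_const.congr_of_eventuallyEq h0

/-- A smooth function that is `1` near a compact set and has compact support in an open set. -/
theorem exists_contDiff_one_near {K Y : Set R3} (hK : IsCompact K) (hY : IsOpen Y) (hKY : K ⊆ Y) :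
    ∃ χ : R3 → ℝ, ContDiff ℝ ∞ χ ∧ HasCompactSupport χ ∧ tsupport χ ⊆ Y ∧
      (∀ y, χ y ∈ Icc (0 : ℝ) 1) ∧ ∀ y ∈ K, χ =ᶠ[𝓝 y] fun _ => 1 := by
  obtain ⟨L, hL, hKL, hLY⟩ := exists_compact_between hK hY hKY
  obtain ⟨χ, h1, h2, h3⟩ := exists_contMDiffMap_one_nhds_of_subset_interior
    (modelWithCornersSelf ℝ R3) (n := (⊤ : ℕ∞)) hK.isClosed hKL
  have hsupp : tsupport (χ : R3 → ℝ) ⊆ L := by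
    refine closure_minimal (fun y hy => ?_) hL.isClosed; by_contra hyL; exact hy (h2 y hyL)
  refine ⟨χ, χ.contMDiff.contDiff, hL.of_isClosed_subset (isClosed_tsupport _) hsupp,
    hsupp.trans hLY, h3, fun y hy => ?_⟩
  exact (eventually_nhdsSet_iff_forall.1 h1 y hy).mono fun z hz => hz

theorem volumeDensity_congr {θ1 θ2 : R3 → R3} {y : R3} (h : θ1 =ᶠ[𝓝 y] θ2) :
    volumeDensity θ1 y = volumeDensity θ2 y := by
  simp only [volumeDensity, h.fderiv_eq]

theorem norm_exp_phase (Γ : C3 → ℂ) (Λ : ℝ) (ζ : C3) :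
    ‖exp (I * Λ * Γ ζ)‖ = Real.exp (-(Λ * (Γ ζ).im)) := by
  rw [norm_exp]; congr 1; simp [mul_re, mul_im]

/-- The field `θ` may be replaced by `θ'` on a compact part of `Y`; only the integral over the set
`N` is not exponentially small. -/
theorem exists_norm_integral_sub_le {Γ f : C3 → ℂ} {Ω : Set C3} {Y Q N : Set R3} {θ θ' : R3 → R3}
    {m : ℝ} (hΩ : IsOpen Ω) (hΓ : DifferentiableOn ℂ Γ Ω) (hf : DifferentiableOn ℂ f Ω)
    (hY : IsOpen Y) (hQ : IsCompact Q) (hQY : Q ⊆ Y) (hN : MeasurableSet N) (hNQ : N ⊆ Q)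
    (hθ : ContDiffOn ℝ ∞ θ Y) (hθ' : ContDiff ℝ ∞ θ')
    (hmem : ∀ y ∈ Y, ∀ t ∈ Icc (0 : ℝ) 1, complexPt y (θ y + t • (θ' y - θ y)) ∈ Ω)
    (hin : ∀ y ∈ Q \ N, m ≤ (Γ (complexPt y (θ' y))).im)
    (hout : ∀ y ∈ Y \ Q, ∀ t ∈ Icc (0 : ℝ) 1, m ≤ (Γ (complexPt y (θ y + t • (θ' y - θ y)))).im)
    (hint : ∀ Λ : ℝ, IntegrableOn (fun y => f (domainPt θ y)
      * exp (I * Λ * Γ (domainPt θ y)) * volumeDensity θ y) Y) :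
    ∃ M : ℝ, ∀ Λ : ℝ, 0 ≤ Λ →
      ‖(∫ y in Y, f (domainPt θ y) * exp (I * Λ * Γ (domainPt θ y)) * volumeDensity θ y)
        - ∫ y in N, f (domainPt θ' y) * exp (I * Λ * Γ (domainPt θ' y))
          * volumeDensity θ' y‖ ≤ M * Real.exp (-(m * Λ)) := by
  obtain ⟨χ, hχ, hχc, hχY, hχI, hχ1⟩ := exists_contDiff_one_near hQ hY hQY
  -- The moved field is `θ'` near `Q` and lies on the segment from `θ` to `θ'` elsewhere. At time
  -- `t` the parameter on the segment is `t χ y`, so the hypotheses on the segments cover the whole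
  -- homotopy.
  set ψ : R3 → R3 := fun y => χ y • (θ' y - θ y) with hψ
  have hψs : tsupport ψ ⊆ tsupport χ := closure_mono fun y hy h0 => hy (by
    rw [hψ]; simp only
    rw [h0, zero_smul])
  have hψd : ContDiff ℝ ∞ ψ := contDiff_smul_of_tsupport_subset hY hχ hχY (hθ'.contDiffOn.sub hθ)
  have hψc : HasCompactSupport ψ := hχc.of_isClosed_subset (isClosed_tsupport _) hψs
  set θ'' : R3 → R3 := fun y => θ y + ψ y with hθ''
  have hstokes := fun Λ : ℝ => setIntegral_density_add
    (H := fun ζ => f ζ * exp (I * Λ * Γ ζ)) hΩ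
    (hf.mul ((hΓ.const_mul _).cexp)) hY hθ hψd hψc (hψs.trans hχY) (fun t ht y hy => by
      have h1 : domainPt (fun y => θ y + t • ψ y) y
          = complexPt y (θ y + (t * χ y) • (θ' y - θ y)) := by
        rw [domainPt_eq_complexPt, hψ, smul_smul]
      rw [h1]
      exact hmem y hy _ ⟨mul_nonneg ht.1 (hχI y).1, mul_le_one₀ ht.2 (hχI y).1 (hχI y).2⟩) (hint Λ)
  have hQ'' : ∀ y ∈ Q, θ'' =ᶠ[𝓝 y] θ' := fun y hy => by
    filter_upwards [hχ1 y hy] with z hz; rw [hθ'', hψ]; simp only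
    rw [hz, one_smul, add_sub_cancel]
  have hNY : N ⊆ Y := hNQ.trans hQY
  have hlow : ∀ y ∈ Y \ N, m ≤ (Γ (domainPt θ'' y)).im := fun y hy => by
    by_cases hyQ : y ∈ Q
    · rw [domainPt_eq_complexPt, (hQ'' y hyQ).self_of_nhds]; exact hin y ⟨hyQ, hy.2⟩
    · exact hout y ⟨hy.1, hyQ⟩ _ (hχI y)
  -- The case `Λ = 0` gives integrability of the amplitude alone; its integral is a constant `M`
  -- independent of `Λ`.
  have hint0 : IntegrableOn (fun y => f (domainPt θ'' y) * volumeDensity θ'' y) Y := by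
    have := (hstokes 0).1; simpa using this
  refine ⟨∫ y in Y, ‖f (domainPt θ'' y) * volumeDensity θ'' y‖, fun Λ hΛ => ?_⟩
  have h1 : ∫ y in N, f (domainPt θ' y) * exp (I * Λ * Γ (domainPt θ' y))
          * volumeDensity θ' y = ∫ y in N, f (domainPt θ'' y)
          * exp (I * Λ * Γ (domainPt θ'' y)) * volumeDensity θ'' y := by
    refine setIntegral_congr_fun hN fun y hy => ?_
    have h2 := hQ'' y (hNQ hy)
    rw [volumeDensity_congr h2, domainPt_eq_complexPt θ'', h2.self_of_nhds, domainPt_eq_complexPt]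
  have h2 : ∫ y in Y, f (domainPt θ'' y) * exp (I * Λ * Γ (domainPt θ'' y))
          * volumeDensity θ'' y = ∫ y in Y, f (domainPt θ y)
          * exp (I * Λ * Γ (domainPt θ y)) * volumeDensity θ y := (hstokes Λ).2
  have h3 : IntegrableOn (fun y => f (domainPt θ'' y)
      * exp (I * Λ * Γ (domainPt θ'' y)) * volumeDensity θ'' y) Y := (hstokes Λ).1
  rw [h1, ← h2, ← setIntegral_sdiff hN h3 hNY]
  have hsub : Y \ N ⊆ Y := sdiff_subset
  calc _ ≤ ∫ y in Y \ N, ‖f (domainPt θ'' y)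
          * exp (I * Λ * Γ (domainPt θ'' y)) * volumeDensity θ'' y‖ :=
        norm_integral_le_integral_norm _
    _ ≤ ∫ y in Y \ N, Real.exp (-(m * Λ)) * ‖f (domainPt θ'' y) * volumeDensity θ'' y‖ := by
        refine setIntegral_mono_on (h3.mono_set hsub).norm
          ((hint0.mono_set hsub).norm.const_mul _) (MeasurableSet.diff hY.measurableSet hN) fun y hy => ?_
        rw [norm_mul, norm_mul, norm_exp_phase, norm_mul]
        have h4 : Real.exp (-(Λ * (Γ (domainPt θ'' y)).im)) ≤ Real.exp (-(m * Λ)) := by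
          refine exp_le_exp.2 ?_; have := mul_le_mul_of_nonneg_left (hlow y hy) hΛ; linarith
        calc _ = Real.exp (-(Λ * (Γ (domainPt θ'' y)).im))
              * (‖f (domainPt θ'' y)‖ * ‖volumeDensity θ'' y‖) := by ring
          _ ≤ _ := by gcongr
    _ ≤ Real.exp (-(m * Λ)) * ∫ y in Y, ‖f (domainPt θ'' y) * volumeDensity θ'' y‖ := by
        rw [integral_const_mul]; refine mul_le_mul_of_nonneg_left ?_ (exp_pos _).le
        exact setIntegral_mono_set hint0.norm (.of_forall fun y => norm_nonneg _)
          hsub.eventuallyLE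
    _ = _ := mul_comm _ _

/-! ### Real and imaginary parts, and mixed determinants -/

/-- The inclusion of real points, as a linear map. -/
noncomputable def toC3L : R3 →L[ℝ] C3 :=
  ContinuousLinearMap.pi fun i => ofRealCLM.comp (proj i)

/-- The real part, as a linear map. -/
noncomputable def reL : C3 →L[ℝ] R3 :=
  ContinuousLinearMap.pi fun i => reCLM.comp (proj i)

/-- The imaginary part, as a linear map. -/
noncomputable def imL : C3 →L[ℝ] R3 :=
  ContinuousLinearMap.pi fun i => imCLM.comp (proj i)

theorem toC3L_apply (v : R3) : toC3L v = toC3 v := rfl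

theorem reL_apply (ζ : C3) (i : Fin 3) : reL ζ i = (ζ i).re := rfl

theorem imL_apply (ζ : C3) (i : Fin 3) : imL ζ i = (ζ i).im := rfl

theorem norm_toC3 (v : R3) : ‖toC3 v‖ = ‖v‖ := by
  refine le_antisymm ?_ ?_
  · refine (pi_norm_le_iff_of_nonneg (norm_nonneg _)).2 fun i => ?_
    rw [toC3, norm_real]; exact norm_le_pi_norm v i
  · refine (pi_norm_le_iff_of_nonneg (norm_nonneg _)).2 fun i => ?_
    refine le_trans ?_ (norm_le_pi_norm (toC3 v) i); rw [toC3, norm_real]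

theorem norm_reL_le (ζ : C3) : ‖reL ζ‖ ≤ ‖ζ‖ :=
  (pi_norm_le_iff_of_nonneg (norm_nonneg _)).2 fun i =>
    (abs_re_le_norm _).trans (norm_le_pi_norm ζ i)

theorem norm_imL_le (ζ : C3) : ‖imL ζ‖ ≤ ‖ζ‖ :=
  (pi_norm_le_iff_of_nonneg (norm_nonneg _)).2 fun i =>
    (abs_im_le_norm _).trans (norm_le_pi_norm ζ i)

theorem complexPt_reL_imL (ζ : C3) : complexPt (reL ζ) (imL ζ) = ζ := by
  funext i; rw [complexPt, reL_apply, imL_apply, mul_comm, re_add_im]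

theorem reL_complexPt (y θ : R3) : reL (complexPt y θ) = y := by
  funext i; simp [reL_apply, complexPt]

theorem imL_complexPt (y θ : R3) : imL (complexPt y θ) = θ := by
  funext i; simp [imL_apply, complexPt]

/-- The determinant of a real-linear map from `ℝ³` to `ℂ³`. -/
noncomputable def mixedDet (T : R3 →L[ℝ] C3) : ℂ :=
  Matrix.det (Matrix.of fun i j : Fin 3 => T (Pi.single j 1) i)

/-- The determinant of a complex-linear map. -/
noncomputable def complexDet (A : C3 →L[ℂ] C3) : ℂ :=
  Matrix.det (Matrix.of fun i j : Fin 3 => A (Pi.single j 1) i)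

theorem eq_sum_smul_single {𝕜 : Type*} [Semiring 𝕜] (v : Fin 3 → 𝕜) :
    v = ∑ j, v j • (Pi.single j 1 : Fin 3 → 𝕜) := by
  funext i; simp [Finset.sum_apply, Pi.single_apply]

/-- Determinants multiply across scalar types. Together with `mixedDet_comp_real` this is the
transformation rule of `dξ₁ ∧ dξ₂ ∧ dξ₃` under a holomorphic chart and a real change of parameters.
-/
theorem mixedDet_comp_complex (A : C3 →L[ℂ] C3) (T : R3 →L[ℝ] C3) :
    mixedDet ((A.restrictScalars ℝ).comp T) = complexDet A * mixedDet T := by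
  rw [mixedDet, complexDet, mixedDet, ← Matrix.det_mul]; congr 1; ext i j
  have h : A (T (Pi.single j 1)) = ∑ k, (T (Pi.single j 1) k) • A (Pi.single k 1) := by
    conv_lhs => rw [eq_sum_smul_single (T (Pi.single j 1)), map_sum]
    simp only [map_smul]
  show A (T (Pi.single j 1)) i = _
  rw [h, Finset.sum_apply, Matrix.mul_apply]
  refine Finset.sum_congr rfl fun k _ => ?_
  simp only [Pi.smul_apply, smul_eq_mul, Matrix.of_apply]; ring

theorem mixedDet_comp_real (T : R3 →L[ℝ] C3) (B : R3 →L[ℝ] R3) :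
    mixedDet (T.comp B) = mixedDet T * ((B.det : ℝ) : ℂ) := by
  have hB : ((B.det : ℝ) : ℂ)
      = Matrix.det (Matrix.of fun i j : Fin 3 => ((B (Pi.single j 1) i : ℝ) : ℂ)) := by
    have h1 : B.det = Matrix.det (Matrix.of fun i j : Fin 3 => B (Pi.single j 1) i) := by
      rw [ContinuousLinearMap.det, ← LinearMap.det_toMatrix']; congr 1
    rw [h1]; exact (ofRealHom.map_det _)
  rw [hB, mixedDet, mixedDet, ← Matrix.det_mul]; congr 1; ext i j
  have h : T (B (Pi.single j 1)) = ∑ k, (B (Pi.single j 1) k) • T (Pi.single k 1) := by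
    conv_lhs => rw [eq_sum_smul_single (B (Pi.single j 1)), map_sum]
    simp only [map_smul]
  show T (B (Pi.single j 1)) i = _
  rw [h, Finset.sum_apply, Matrix.mul_apply]
  refine Finset.sum_congr rfl fun k _ => ?_
  simp only [Pi.smul_apply, real_smul, Matrix.of_apply]; ring

theorem complexDet_comp (A B : C3 →L[ℂ] C3) :
    complexDet (A.comp B) = complexDet A * complexDet B := by
  rw [complexDet, complexDet, complexDet, ← Matrix.det_mul]; congr 1; ext i j
  have h : A (B (Pi.single j 1)) = ∑ k, (B (Pi.single j 1) k) • A (Pi.single k 1) := by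
    conv_lhs => rw [eq_sum_smul_single (B (Pi.single j 1)), map_sum]
    simp only [map_smul]
  show A (B (Pi.single j 1)) i = _
  rw [h, Finset.sum_apply, Matrix.mul_apply]
  refine Finset.sum_congr rfl fun k _ => ?_
  simp only [Pi.smul_apply, smul_eq_mul, Matrix.of_apply]; ring

theorem complexDet_id : complexDet (ContinuousLinearMap.id ℂ C3) = 1 := by
  rw [complexDet]
  have : (Matrix.of fun i j : Fin 3 => (ContinuousLinearMap.id ℂ C3) (Pi.single j 1) i) = 1 := by
    ext i j; simp [Matrix.one_apply, Pi.single_apply]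
  rw [this, Matrix.det_one]

theorem mixedDet_toC3L : mixedDet toC3L = 1 := by
  rw [mixedDet]
  have : (Matrix.of fun i j : Fin 3 => toC3L (Pi.single j 1) i) = 1 := by
    ext i j; simp only [Matrix.of_apply, toC3L_apply, toC3, Pi.single_apply, Matrix.one_apply]
    split_ifs <;> simp
  rw [this, Matrix.det_one]

theorem volumeDensity_eq_mixedDet {η : R3 → R3} {x : R3} (h : DifferentiableAt ℝ η x) :
    volumeDensity η x = mixedDet (fderiv ℝ (domainPt η) x) := by
  rw [volumeDensity, mixedDet]; congr 1; ext i j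
  rw [Matrix.of_apply, Matrix.of_apply, fderiv_domainPt_single h]; rfl

/-- Two real maps that are close to each other, relative to a lower bound for one of them, have
determinants of the same sign. -/
theorem det_mul_det_pos {L B : R3 →L[ℝ] R3} {a c : ℝ} (hc : c < a) (hL : ∀ v, a * ‖v‖ ≤ ‖L v‖)
    (hB : ‖B - L‖ ≤ c) : 0 < L.det * B.det := by
  -- The whole segment from `L` to `B` consists of injective maps, so by the intermediate value
  -- theorem the determinant cannot change sign along it.
  have hinj : ∀ t ∈ Icc (0 : ℝ) 1, (L + t • (B - L)).det ≠ 0 := fun t ht h0 => by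
    obtain ⟨v, hv, hv0⟩ := Submodule.exists_mem_ne_zero_of_ne_bot
      (LinearMap.bot_lt_ker_of_det_eq_zero h0).ne'
    have hpos : 0 < ‖v‖ := norm_pos_iff.2 hv0
    have h1 : L v + t • (B - L) v = 0 := hv
    have h2 : ‖L v‖ = ‖t • (B - L) v‖ := by rw [eq_neg_of_add_eq_zero_left h1, norm_neg]
    have h3 : ‖t • (B - L) v‖ ≤ c * ‖v‖ := by
      rw [norm_smul, Real.norm_of_nonneg ht.1]; have h4 := (B - L).le_opNorm v
      have h5 : ‖(B - L) v‖ ≤ c * ‖v‖ := h4.trans (by gcongr)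
      exact (mul_le_of_le_one_left (norm_nonneg _) ht.2).trans h5
    have h6 := hL v; nlinarith
  have hcont : Continuous fun t : ℝ => (L + t • (B - L)).det := by
    have : Continuous fun A : R3 →L[ℝ] R3 => A.det := ContinuousLinearMap.continuous_det
    exact this.comp (by fun_prop)
  have h0 : (L + (0 : ℝ) • (B - L)).det = L.det := by simp
  have h1 : (L + (1 : ℝ) • (B - L)).det = B.det := by simp
  by_contra hneg
  have hL0 : L.det ≠ 0 := h0 ▸ hinj 0 (by simp)
  have hB0 : B.det ≠ 0 := h1 ▸ hinj 1 (by simp)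
  have hlt : L.det * B.det < 0 := lt_of_le_of_ne (not_lt.1 hneg) (mul_ne_zero hL0 hB0)
  rcases mul_neg_iff.1 hlt with ⟨h2, h3⟩ | ⟨h2, h3⟩
  · obtain ⟨t, ht, ht0⟩ := intermediate_value_Icc' (zero_le_one (α := ℝ)) hcont.continuousOn
      (show (0 : ℝ) ∈ Icc _ _ from ⟨by rw [h1]; exact h3.le, by rw [h0]; exact h2.le⟩)
    exact hinj t ht ht0
  · obtain ⟨t, ht, ht0⟩ := intermediate_value_Icc (zero_le_one (α := ℝ)) hcont.continuousOn
      (show (0 : ℝ) ∈ Icc _ _ from ⟨by rw [h0]; exact h2.le, by rw [h1]; exact h3.le⟩)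
    exact hinj t ht ht0

/-! ### Derivatives of the chart and the change to its coordinates -/

section ChartDerivative

variable {U : Set C3} {g G : C3 → ℂ} {p : R3} {w : OpenPartialHomeomorph C3 C3} {α β β' : ℝ}
local notation "NChart" => IsNormalizingChart U g G p w α β β'

theorem exists_equiv_of_lower_bound {B : R3 →L[ℝ] R3} {a : ℝ} (ha : 0 < a)
    (hB : ∀ v, a * ‖v‖ ≤ ‖B v‖) : ∃ E : R3 ≃L[ℝ] R3, (E : R3 →L[ℝ] R3) = B := by
  have hinj : Function.Injective (B : R3 →ₗ[ℝ] R3) := by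
    refine (injective_iff_map_eq_zero _).2 fun v hv => ?_
    have h1 := hB v; have h2 : B v = 0 := hv; rw [h2, norm_zero] at h1
    have : ‖v‖ ≤ 0 := by
      by_contra h
      have := mul_pos ha (not_le.1 h); linarith
    exact norm_le_zero_iff.1 this
  exact ⟨(LinearEquiv.ofInjectiveEndo _ hinj).toContinuousLinearEquiv, by
    ext v
    rfl⟩

/-- The derivative of a chart at a real point, as a real map. -/
noncomputable def realDeriv (w : OpenPartialHomeomorph C3 C3) (x : R3) : R3 →L[ℝ] R3 :=
  reL.comp (((fderiv ℂ w (toC3 x)).restrictScalars ℝ).comp toC3L)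

theorem IsNormalizingChart.hasFDerivAt (hw : NChart) {ξ : C3}
    (hξ : ξ ∈ w.source) : HasFDerivAt w (fderiv ℂ w ξ) ξ :=
  ((hw.holo ξ hξ).differentiableAt (w.open_source.mem_nhds hξ)).hasFDerivAt

theorem IsNormalizingChart.hasFDerivAt_symm (hw : NChart) {ζ : C3}
    (hζ : ζ ∈ w.target) : HasFDerivAt w.symm (fderiv ℂ w.symm ζ) ζ :=
  ((hw.holo_symm ζ hζ).differentiableAt (w.open_target.mem_nhds hζ)).hasFDerivAt

theorem IsNormalizingChart.fderiv_symm_comp (hw : NChart) {ξ : C3}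
    (hξ : ξ ∈ w.source) : (fderiv ℂ w.symm (w ξ)).comp (fderiv ℂ w ξ) = ContinuousLinearMap.id ℂ C3 := by
  have h1 := (hw.hasFDerivAt_symm (w.map_source hξ)).comp ξ (hw.hasFDerivAt hξ)
  have h2 : w.symm ∘ w =ᶠ[𝓝 ξ] id := by
    filter_upwards [w.open_source.mem_nhds hξ] with z hz; exact w.left_inv hz
  exact h1.unique ((hasFDerivAt_id ξ).congr_of_eventuallyEq h2)

theorem IsNormalizingChart.im_eq_zero (hw : NChart) {x : R3}
    (hx : toC3 x ∈ w.source) : imL (w (toC3 x)) = 0 := by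
  funext i; exact (hw.real _ hx).1 (fun i => by simp [toC3]) i

theorem IsNormalizingChart.exists_symm_real (hw : NChart) {y : R3}
    (hy : toC3 y ∈ w.target) : w.symm (toC3 y) = toC3 (reL (w.symm (toC3 y))) := by
  have h1 := (hw.real _ (w.map_target hy)).2 (by
    rw [w.right_inv hy]
    simp [toC3])
  funext i; refine Complex.ext ?_ ?_
  · simp [toC3, reL_apply]
  · simp [toC3, h1 i]

/-- The chart takes real points to real points, so the imaginary part of `w` vanishes along real
lines, and so does its derivative. -/
theorem IsNormalizingChart.fderiv_toC3 (hw : NChart) {x : R3}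
    (hx : toC3 x ∈ w.source) (v : R3) :
    fderiv ℂ w (toC3 x) (toC3 v) = toC3 (realDeriv w x v) := by
  have hline : HasDerivAt (fun t : ℝ => toC3 x + t • toC3 v) (toC3 v) 0 := by
    simpa using ((hasDerivAt_id (0 : ℝ)).smul_const (toC3 v)).const_add (toC3 x)
  have h1 : HasDerivAt (fun t : ℝ => w (toC3 x + t • toC3 v)) (fderiv ℂ w (toC3 x) (toC3 v)) 0 := by
    have h2 : HasFDerivAt w ((fderiv ℂ w (toC3 x)).restrictScalars ℝ)
        (toC3 x + (0 : ℝ) • toC3 v) := by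
      rw [zero_smul, add_zero]; exact (hw.hasFDerivAt hx).restrictScalars ℝ
    exact h2.comp_hasDerivAt (0 : ℝ) hline
  have h3 := imL.hasFDerivAt.comp_hasDerivAt (0 : ℝ) h1
  have h4 : (fun t : ℝ => imL (w (toC3 x + t • toC3 v))) =ᶠ[𝓝 0] fun _ => 0 := by
    have hc : Tendsto (fun t : ℝ => toC3 x + t • toC3 v) (𝓝 0) (𝓝 (toC3 x)) := by
      simpa using hline.continuousAt.tendsto
    filter_upwards [hc.eventually (w.open_source.mem_nhds hx)] with t ht
    have h5 : toC3 x + t • toC3 v = toC3 (x + t • v) := by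
      funext i; simp [toC3]
    rw [h5] at ht ⊢; exact hw.im_eq_zero ht
  have h6 : imL (fderiv ℂ w (toC3 x) (toC3 v)) = 0 :=
    h3.unique ((hasDerivAt_const (0 : ℝ) (0 : R3)).congr_of_eventuallyEq h4)
  funext i; refine Complex.ext ?_ ?_
  · rfl
  · have h7 := congrFun h6 i; rw [imL_apply] at h7; simpa [toC3] using h7

/-- The derivative of the inverse chart is a left inverse, and its norm bounds the shrinking. -/
theorem IsNormalizingChart.exists_realDeriv_lower (hw : NChart) :
    ∃ a > 0, ∀ v, a * ‖v‖ ≤ ‖realDeriv w p v‖ := by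
  set A' := fderiv ℂ w.symm (w (toC3 p)) with hA'
  refine ⟨(‖A'‖ + 1)⁻¹, by positivity, fun v => ?_⟩
  have h1 : A' (fderiv ℂ w (toC3 p) (toC3 v)) = toC3 v := by
    have := congrArg (fun T : C3 →L[ℂ] C3 => T (toC3 v)) (hw.fderiv_symm_comp hw.mem)
    simpa using this
  rw [hw.fderiv_toC3 hw.mem] at h1
  rw [inv_mul_le_iff₀ (by positivity), ← norm_toC3 v, ← h1, ← norm_toC3 (realDeriv w p v)]
  refine (A'.le_opNorm _).trans ?_; gcongr; linarith

/-- At a real point the derivative is the complexification of a real map. Hence `J` is real, and it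
makes sense to speak of its sign. -/
theorem IsNormalizingChart.complexDet_fderiv (hw : NChart) :
    complexDet (fderiv ℂ w (toC3 p)) = (((realDeriv w p).det : ℝ) : ℂ) := by
  have h1 : ((fderiv ℂ w (toC3 p)).restrictScalars ℝ).comp toC3L = toC3L.comp (realDeriv w p) := by
    ext1 v; exact hw.fderiv_toC3 hw.mem v
  have h2 := mixedDet_comp_complex (fderiv ℂ w (toC3 p)) toC3L
  rw [h1, mixedDet_comp_real, mixedDet_toC3L, one_mul, mul_one] at h2; exact h2.symm

/-- Continuity of the derivative, from the smoothness of holomorphic maps. The radius `2 * R` leaves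
room for a real and an imaginary displacement of size `R` each. -/
theorem IsNormalizingChart.exists_fderiv_near (hw : NChart) {c : ℝ}
    (hc : 0 < c) : ∃ R > 0, ∀ ξ : C3, ‖ξ - toC3 p‖ ≤ 2 * R → ξ ∈ w.source ∧
      ‖fderiv ℂ w ξ - fderiv ℂ w (toC3 p)‖ ≤ c := by
  have h1 : ContinuousAt (fderiv ℂ w) (toC3 p) :=
    ((contDiffOn_pi_infty_of_holomorphic w.open_source hw.holo).continuousOn_fderiv_of_isOpen
      w.open_source (by simp)).continuousAt (w.open_source.mem_nhds hw.mem)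
  obtain ⟨ε, hε, h2⟩ := Metric.eventually_nhds_iff.1
    ((continuousAt_iff'.1 h1 c hc).and (w.open_source.mem_nhds hw.mem))
  refine ⟨ε / 4, by positivity, fun ξ hξ => ?_⟩
  have h3 := h2 (y := ξ) (by
    rw [dist_eq_norm]
    linarith)
  exact ⟨h3.2, by
    rw [← dist_eq_norm]
    exact h3.1.le⟩

theorem complexPt_eq (u v : R3) : complexPt u v = toC3 u + I • toC3 v := rfl

theorem toC3_sub (u v : R3) : toC3 (u - v) = toC3 u - toC3 v := toC3L.map_sub u v

theorem complexPt_sub (u v u' v' : R3) :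
    complexPt u v - complexPt u' v' = complexPt (u - u') (v - v') := by
  simp only [complexPt_eq, toC3_sub, smul_sub]; abel

theorem IsNormalizingChart.fderiv_complexPt (hw : NChart) {x : R3}
    (hx : toC3 x ∈ w.source) (u v : R3) :
    fderiv ℂ w (toC3 x) (complexPt u v) = complexPt (realDeriv w x u) (realDeriv w x v) := by
  rw [complexPt_eq, map_add, map_smul, hw.fderiv_toC3 hx, hw.fderiv_toC3 hx, complexPt_eq]

/-- The chart is close to its linear part at the centre. -/
theorem IsNormalizingChart.exists_strict (hw : NChart) {c : ℝ}
    (hc : 0 < c) : ∃ R > 0, (∀ x η : R3, ‖x - p‖ ≤ R → ‖η‖ ≤ R → complexPt x η ∈ w.source ∧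
        ‖fderiv ℂ w (complexPt x η) - fderiv ℂ w (toC3 p)‖ ≤ c) ∧
      ∀ x η x' η' : R3, ‖x - p‖ ≤ R → ‖η‖ ≤ R → ‖x' - p‖ ≤ R → ‖η'‖ ≤ R →
        ‖w (complexPt x η) - w (complexPt x' η')
          - complexPt (realDeriv w p (x - x')) (realDeriv w p (η - η'))‖
          ≤ c * (‖x - x'‖ + ‖η - η'‖) := by
  obtain ⟨R, hR, h⟩ := hw.exists_fderiv_near hc
  have hmem : ∀ x η : R3, ‖x - p‖ ≤ R → ‖η‖ ≤ R → ‖complexPt x η - toC3 p‖ ≤ 2 * R :=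
    fun x η hx hη => by
    rw [← complexPt_zero, complexPt_sub, sub_zero]
    exact (norm_complexPt_le _ _).trans (by linarith)
  refine ⟨R, hR, fun x η hx hη => h _ (hmem x η hx hη), fun x η x' η' hx hη hx' hη' => ?_⟩
  have h1 := (convex_closedBall (toC3 p) (2 * R)).norm_image_sub_le_of_norm_hasFDerivWithin_le'
    (f := w) (f' := fderiv ℂ w) (φ := fderiv ℂ w (toC3 p)) (C := c) (𝕜 := ℂ)
    (fun ξ hξ => (hw.hasFDerivAt (h ξ (by
      rwa [← dist_eq_norm, ← mem_closedBall])).1).hasFDerivWithinAt)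
    (fun ξ hξ => (h ξ (by rwa [← dist_eq_norm, ← mem_closedBall])).2)
    (x := complexPt x' η') (y := complexPt x η)
    (by rw [mem_closedBall, dist_eq_norm]; exact hmem _ _ hx' hη')
    (by rw [mem_closedBall, dist_eq_norm]; exact hmem _ _ hx hη)
  rw [complexPt_sub, hw.fderiv_complexPt hw.mem] at h1
  exact h1.trans (mul_le_mul_of_nonneg_left (norm_complexPt_le _ _) hc.le)

/-- Over small fields the coordinates are close to their values at the real points, and their real
parts are close to a linear function. -/
theorem IsNormalizingChart.exists_reL_approx (hw : NChart) {c : ℝ} (hc : 0 < c) :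
    ∃ R > 0, ∃ δ0 > 0, ∀ r δ : ℝ, r ≤ R → δ ≤ δ0 → ∀ η : R3 → R3, IsSmallField p r δ η →
      (∀ x ∈ closedBall p r, domainPt η x ∈ w.source ∧ toC3 x ∈ w.source ∧
        ‖w (domainPt η x) - w (toC3 x)‖ ≤ (‖realDeriv w p‖ + c) * δ) ∧
      ∀ x ∈ closedBall p r, ∀ x' ∈ closedBall p r,
        ‖reL (w (domainPt η x)) - reL (w (domainPt η x')) - realDeriv w p (x - x')‖
          ≤ 2 * c * ‖x - x'‖ := by
  obtain ⟨R, hR, hsrc, hst⟩ := hw.exists_strict hc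
  refine ⟨R, hR, min R 1, by positivity, fun r δ hr hδ η hη => ?_⟩
  rw [le_min_iff] at hδ
  have hx0 : ∀ x ∈ closedBall p r, ‖x - p‖ ≤ R := fun x hx => by
    rw [mem_closedBall, dist_eq_norm] at hx; exact hx.trans hr
  have hηR : ∀ x ∈ closedBall p r, ‖η x‖ ≤ R := fun x hx => (hη.2 x hx).1.trans hδ.1
  have h0 : ‖(0 : R3)‖ ≤ R := by simpa using hR.le
  refine ⟨fun x hx => ⟨(hsrc x _ (hx0 x hx) (hηR x hx)).1, ?_, ?_⟩, fun x hx x' hx' => ?_⟩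
  · have h1 := (hsrc x 0 (hx0 x hx) h0).1; rwa [complexPt_zero] at h1
  · have h1 := hst x _ x 0 (hx0 x hx) (hηR x hx) (hx0 x hx) h0
    rw [sub_self, map_zero, complexPt_zero, norm_zero, zero_add, sub_zero] at h1
    have h2 := norm_complexPt_le 0 (realDeriv w p (η x)); rw [norm_zero, zero_add] at h2
    have h3 := h2.trans ((realDeriv w p).le_opNorm (η x))
    have h4 := mul_le_mul_of_nonneg_left (hη.2 x hx).1 (by positivity : 0 ≤ ‖realDeriv w p‖ + c)
    refine (norm_le_norm_sub_add _ _).trans ((add_le_add h1 h3).trans (le_trans (le_of_eq ?_) h4))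
    ring
  · have h1 := hst x _ x' _ (hx0 x hx) (hηR x hx) (hx0 x' hx') (hηR x' hx')
    have h2 := (convex_closedBall p r).norm_image_sub_le_of_norm_fderiv_le
      (fun z _ => hη.1.contDiffAt.differentiableAt (by simp)) (fun z hz => (hη.2 z hz).2) hx' hx
    have h3 := (norm_reL_le _).trans h1; rw [map_sub, map_sub, reL_complexPt] at h3
    refine h3.trans ?_
    have h4 := mul_le_mul_of_nonneg_right hδ.2 (norm_nonneg (x - x'))
    have h5 := mul_le_mul_of_nonneg_left (h2.trans h4) hc.le; linarith

/-- The domain `x + i η(x)` over the cube of half-side `r`, read in the coordinates `w`, is the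
domain of the field `θ` in the parameters `y = e(x)`. -/
structure IsSurfaceChart (w : OpenPartialHomeomorph C3 C3) (p : R3) (r : ℝ) (η : R3 → R3)
    (e : OpenPartialHomeomorph R3 R3) (θ : R3 → R3) (σ : ℝ) : Prop where
  source : e.source = ball p r
  mem : ∀ x ∈ ball p r, domainPt η x ∈ w.source
  pt : ∀ x ∈ ball p r, domainPt θ (e x) = w (domainPt η x)
  smooth : ContDiffOn ℝ ∞ θ e.target
  differentiableAt : ∀ x ∈ ball p r, DifferentiableAt ℝ e x
  smooth_field : ContDiff ℝ ∞ η
  sign : ∀ x ∈ ball p r, |(fderiv ℝ e x).det| = σ * (fderiv ℝ e x).det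

/-- Existence of surface charts, with their metric properties. -/
theorem IsNormalizingChart.exists_surfaceChart (hw : NChart) :
    ∃ a > 0, ∃ C > 0, ∃ R > 0, ∃ δ0 > 0, ∃ σ : ℝ, (σ = 1 ∨ σ = -1) ∧
      (σ : ℂ) * jacobianDet w = ‖jacobianDet w‖ ∧
      ∀ r δ : ℝ, 0 < r → r ≤ R → δ ≤ δ0 → ∀ η : R3 → R3, IsSmallField p r δ η →
        (∀ x ∈ closedBall p r, domainPt η x ∈ w.source ∧
          ‖imL (w (domainPt η x))‖ ≤ C * δ ∧
          a * ‖x - p‖ - C * δ ≤ ‖reL (w (domainPt η x))‖ ∧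
          ‖reL (w (domainPt η x))‖ ≤ C * ‖x - p‖ + C * δ) ∧
        ∃ (e : OpenPartialHomeomorph R3 R3) (θ : R3 → R3), IsSurfaceChart w p r η e θ σ ∧
          closedBall 0 (a * (r / 2) - C * δ) ⊆ e '' closedBall p (r / 2) := by
  obtain ⟨a, ha, hlow⟩ := hw.exists_realDeriv_lower
  set L := realDeriv w p with hL
  obtain ⟨E, hE⟩ := exists_equiv_of_lower_bound ha hlow
  have hEN : a ≤ ‖(E.symm : R3 →L[ℝ] R3)‖⁻¹ := by
    have h1 : ‖(E.symm : R3 →L[ℝ] R3)‖ ≤ a⁻¹ := by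
      refine opNorm_le_bound _ (by positivity) fun v => ?_
      rw [inv_mul_eq_div, le_div_iff₀ ha, mul_comm]
      refine (hlow _).trans (le_of_eq ?_); rw [← hE]; simp
    exact le_inv_of_le_inv₀ E.norm_symm_pos h1
  -- The real part of the coordinates then differs from `L` by a map of Lipschitz constant `a/2`,
  -- half of the lower bound of `L`. The quantitative inverse function theorem therefore applies on
  -- the whole cube.
  obtain ⟨R, hR, δ0, hδ₀, hT⟩ := hw.exists_reL_approx (c := a / 4) (by positivity)
  have hdetL : L.det ≠ 0 := fun h0 => by
    have h1 := det_mul_det_pos (B := L) (c := 0) ha hlow (by simp)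
    rw [h0, zero_mul] at h1; exact lt_irrefl _ h1
  set σ : ℝ := sign L.det with hσ
  have hσL : ∀ d, 0 < L.det * d → |d| = σ * d := fun d hd => by
    rcases pos_and_pos_or_neg_and_neg_of_mul_pos hd with ⟨h, h'⟩ | ⟨h, h'⟩
    · rw [hσ, sign_of_pos h, abs_of_pos h', one_mul]
    · rw [hσ, sign_of_neg h, abs_of_neg h', neg_one_mul]
  -- The Jacobian `J` is the inverse of `det L`; so `σ`, the sign of `det L`, is also that of `J`.
  have hJ : jacobianDet w * ((L.det : ℝ) : ℂ) = 1 := by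
    have h1 := congrArg complexDet (hw.fderiv_symm_comp hw.mem)
    rw [complexDet_comp, complexDet_id, hw.complexDet_fderiv, hw.center] at h1; exact h1
  refine ⟨a / 2, by positivity, ‖L‖ + a, by positivity, R, hR, δ0, hδ₀, σ,
    (Real.sign_apply_eq_of_ne_zero _ hdetL).symm, ?_, fun r δ hr hrR hδ η hη => ?_⟩
  · rw [eq_inv_of_mul_eq_one_left hJ, norm_inv, norm_real, norm_eq_abs, ← abs_inv,
      hσL _ (by rw [mul_inv_cancel₀ hdetL]; exact one_pos), ofReal_mul, ofReal_inv]
  have hp : p ∈ closedBall p r := mem_closedBall_self hr.le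
  obtain ⟨hsrc, happ⟩ := hT r δ hrR hδ η hη
  have hδ0 : 0 ≤ δ := (norm_nonneg _).trans (hη.2 p hp).1
  have him : ∀ x ∈ closedBall p r, ‖w (domainPt η x) - w (toC3 x)‖ ≤ (‖L‖ + a) * δ := fun x hx =>
    (hsrc x hx).2.2.trans (mul_le_mul_of_nonneg_right (by linarith) hδ0)
  set y : R3 → R3 := fun x => reL (w (domainPt η x)) with hy
  replace happ : ∀ x ∈ closedBall p r, ∀ x' ∈ closedBall p r,
      ‖y x - y x' - L (x - x')‖ ≤ a / 2 * ‖x - x'‖ := fun x hx x' hx' =>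
    (happ x hx x' hx').trans (le_of_eq (by ring))
  have hyp : ‖y p‖ ≤ (‖L‖ + a) * δ := by
    have h1 := him p hp; rw [hw.center, sub_zero] at h1; exact (norm_reL_le _).trans h1
  refine ⟨fun x hx => ⟨(hsrc x hx).1, ?_, ?_, ?_⟩, ?_⟩
  · have h1 := him x hx
    have h2 : imL (w (domainPt η x)) = imL (w (domainPt η x) - w (toC3 x)) := by
      rw [map_sub, hw.im_eq_zero (hsrc x hx).2.1, sub_zero]
    rw [h2]; exact (norm_imL_le _).trans h1
  · have h1 := happ x hx p hp; have h2 := hlow (x - p)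
    have h3 := norm_le_norm_sub_add (L (x - p)) (y x - y p); rw [norm_sub_rev] at h3
    have h4 := norm_sub_le (y x) (y p)
    show a / 2 * ‖x - p‖ - _ ≤ ‖y x‖
    linarith
  · have h1 := happ x hx p hp
    have h2 := norm_le_norm_sub_add (y x - y p) (L (x - p))
    have h3 := norm_le_norm_sub_add (y x) (y p); have h5 := L.le_opNorm (x - p)
    have h4 : 0 ≤ a * ‖x - p‖ := by positivity
    show ‖y x‖ ≤ _
    linarith
  obtain ⟨c', hc'⟩ : ∃ c' : NNReal, (c' : ℝ) = a / 2 := ⟨⟨a / 2, by positivity⟩, rfl⟩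
  have happL : ApproximatesLinearOn y (E : R3 →L[ℝ] R3) (ball p r) c' := by
    intro x hx x' hx'; rw [hE, hc']
    exact happ x (ball_subset_closedBall hx) x' (ball_subset_closedBall hx')
  have hcN : c' < ‖(E.symm : R3 →L[ℝ] R3)‖₊⁻¹ := by
    rw [← NNReal.coe_lt_coe, NNReal.coe_inv, coe_nnnorm, hc']; linarith
  set e := happL.toOpenPartialHomeomorph y (ball p r) (Or.inr hcN) isOpen_ball with he
  have hecoe : (e : R3 → R3) = y := rfl
  have hesrc : e.source = ball p r := rfl
  have hwC : ContDiffOn ℝ ∞ (fun x => w (domainPt η x)) (ball p r) := by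
    have h1 : ContDiffOn ℝ ∞ w w.source :=
      (contDiffOn_pi_infty_of_holomorphic w.open_source hw.holo).restrict_scalars ℝ
    exact h1.comp (contDiffOn_domainPt hη.1.contDiffOn)
      fun x hx => (hsrc x (ball_subset_closedBall hx)).1
  have hder : ∀ x ∈ ball p r, ∃ B : R3 →L[ℝ] R3, HasFDerivAt e B x ∧ ‖B - L‖ ≤ a / 2 :=
    fun x hx => by
    have h1 : DifferentiableAt ℝ y x := reL.differentiableAt.comp x
      ((hwC.contDiffAt (isOpen_ball.mem_nhds hx)).differentiableAt (by simp))
    refine ⟨_, h1.hasFDerivAt, (h1.hasFDerivAt.sub L.hasFDerivAt).le_of_lip' (by positivity) ?_⟩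
    filter_upwards [isOpen_ball.mem_nhds hx] with z hz
    have h2 := happ z (ball_subset_closedBall hz) x (ball_subset_closedBall hx)
    rwa [map_sub, sub_sub_sub_comm] at h2
  have hesymm : ContDiffOn ℝ ∞ e.symm e.target := fun z hz => by
    have hx : e.symm z ∈ ball p r := e.map_target hz
    obtain ⟨B, hB1, hB2⟩ := hder _ hx
    obtain ⟨E', hE'⟩ := exists_equiv_of_lower_bound (B := B) (a := a / 2) (by positivity)
      fun v => by
        have h1 := hlow v
        have h2 : ‖(B - L) v‖ ≤ a / 2 * ‖v‖ := ((B - L).le_opNorm v).trans (by gcongr)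
        have h3 := norm_le_norm_sub_add (L v) (B v); rw [norm_sub_rev, ← sub_apply] at h3
        linarith
    refine (e.contDiffAt_symm hz (f₀' := E') (by rwa [hE']) ?_).contDiffWithinAt
    exact reL.contDiff.contDiffAt.comp _ (hwC.contDiffAt (isOpen_ball.mem_nhds hx))
  refine ⟨e, fun z => imL (w (domainPt η (e.symm z))), ⟨hesrc,
    fun x hx => (hsrc x (ball_subset_closedBall hx)).1, fun x hx => ?_, ?_, fun x hx => ?_, hη.1,
    fun x hx => ?_⟩, ?_⟩
  · rw [domainPt_eq_complexPt, e.left_inv (hesrc ▸ hx)]; exact complexPt_reL_imL _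
  · exact imL.contDiff.comp_contDiffOn (hwC.comp hesymm fun z hz => e.map_target hz)
  · obtain ⟨B, hB1, -⟩ := hder x hx; exact hB1.differentiableAt
  · obtain ⟨B, hB1, hB2⟩ := hder x hx; rw [hB1.fderiv]
    exact hσL _ (det_mul_det_pos (by linarith) hlow hB2)
  · have h1 := happL.surjOn_closedBall_of_nonlinearRightInverse E.toNonlinearRightInverse
      (ε := r / 2) (b := p) (by positivity) (closedBall_subset_ball (by linarith))
    refine Subset.trans (fun z hz => ?_) h1
    rw [mem_closedBall_zero_iff] at hz
    rw [mem_closedBall, dist_eq_norm]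
    have h2 : ((E.toNonlinearRightInverse.nnnorm : ℝ))⁻¹ = ‖(E.symm : R3 →L[ℝ] R3)‖⁻¹ := rfl
    rw [h2, hc']; have h3 : ‖z - y p‖ ≤ ‖z‖ + ‖y p‖ := norm_sub_le _ _
    have h4 : (a - a / 2) * (r / 2) ≤ (‖(E.symm : R3 →L[ℝ] R3)‖⁻¹ - a / 2) * (r / 2) := by gcongr
    linarith

/-- The determinant of the derivative of `w.symm`. -/
noncomputable def symmDet (w : OpenPartialHomeomorph C3 C3) (ζ : C3) : ℂ :=
  complexDet (fderiv ℂ w.symm ζ)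

theorem symmDet_zero : symmDet w 0 = jacobianDet w := rfl

theorem IsNormalizingChart.differentiableOn_symmDet
    (hw : NChart) : DifferentiableOn ℂ (symmDet w) w.target := by
  have h1 : ∀ i j : Fin 3, DifferentiableOn ℂ
      (fun ζ => fderiv ℂ w.symm ζ (Pi.single j 1) i) w.target := fun i j => by
    have h2 := differentiableOn_fderiv_apply_of_holomorphic w.open_target
      ((differentiableOn_pi.1 hw.holo_symm) i) (Pi.single j 1)
    refine h2.congr fun ζ hζ => ?_
    have h3 := (hasFDerivAt_pi'.1 (hw.hasFDerivAt_symm hζ)) i; rw [h3.fderiv]; rfl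
  refine DifferentiableOn.congr ?_ fun ζ _ => Matrix.det_fin_three _
  simp only [Matrix.of_apply]
  exact ((((((h1 0 0).mul (h1 1 1)).mul (h1 2 2)).sub (((h1 0 0).mul (h1 1 2)).mul (h1 2 1))).sub
    (((h1 0 1).mul (h1 1 0)).mul (h1 2 2))).add (((h1 0 1).mul (h1 1 2)).mul (h1 2 0))).add
    (((h1 0 2).mul (h1 1 0)).mul (h1 2 1)) |>.sub (((h1 0 2).mul (h1 1 1)).mul (h1 2 0))

theorem IsNormalizingChart.symmDet_mul (hw : NChart) {ξ : C3}
    (hξ : ξ ∈ w.source) : symmDet w (w ξ) * complexDet (fderiv ℂ w ξ) = 1 := by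
  rw [symmDet, ← complexDet_comp, hw.fderiv_symm_comp hξ, complexDet_id]

/-- Chain rule for the two expressions of the map `x ↦ w (x + iη(x))`, followed by mixed
determinants. The sign `σ` makes up for the absolute value in the change of variables formula. -/
theorem IsNormalizingChart.symmDet_mul_volumeDensity
    (hw : NChart) {r : ℝ} {η θ : R3 → R3}
    {e : OpenPartialHomeomorph R3 R3} {σ : ℝ} (he : IsSurfaceChart w p r η e θ σ) {x : R3}
    (hx : x ∈ ball p r) :
    ((|(fderiv ℝ e x).det| : ℝ) : ℂ) * (symmDet w (domainPt θ (e x)) * volumeDensity θ (e x))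
      = σ * volumeDensity η x := by
  have hex : e x ∈ e.target := e.map_source (he.source ▸ hx)
  have hθd : DifferentiableAt ℝ θ (e x) :=
    (he.smooth.contDiffAt (e.open_target.mem_nhds hex)).differentiableAt (by simp)
  have hηd : DifferentiableAt ℝ η x := he.smooth_field.contDiffAt.differentiableAt (by simp)
  have h1 : HasFDerivAt (fun x => domainPt θ (e x)) ((fderiv ℝ (domainPt θ) (e x)).comp
      (fderiv ℝ e x)) x :=
    (hasFDerivAt_domainPt hθd).differentiableAt.hasFDerivAt.comp x
      (he.differentiableAt x hx).hasFDerivAt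
  have h2 : HasFDerivAt (fun x => w (domainPt η x))
      (((fderiv ℂ w (domainPt η x)).restrictScalars ℝ).comp (fderiv ℝ (domainPt η) x)) x :=
    ((hw.hasFDerivAt (he.mem x hx)).restrictScalars ℝ).comp x
      (hasFDerivAt_domainPt hηd).differentiableAt.hasFDerivAt
  have h3 : (fun x => domainPt θ (e x)) =ᶠ[𝓝 x] fun x => w (domainPt η x) := by
    filter_upwards [isOpen_ball.mem_nhds hx] with z hz; exact he.pt z hz
  have h4 := congrArg mixedDet (h1.unique (h2.congr_of_eventuallyEq h3))
  rw [mixedDet_comp_real, mixedDet_comp_complex, ← volumeDensity_eq_mixedDet hθd,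
    ← volumeDensity_eq_mixedDet hηd] at h4
  have h5 := hw.symmDet_mul (he.mem x hx)
  rw [he.sign x hx, he.pt x hx, ofReal_mul]
  linear_combination (σ : ℂ) * symmDet w (w (domainPt η x)) * h4 + (σ : ℂ) * volumeDensity η x * h5

/-- An integral over the domain `x + i η(x)`, in the coordinates `w`. -/
theorem IsNormalizingChart.integral_surfaceChart
    (hw : NChart) {r : ℝ} {η θ : R3 → R3}
    {e : OpenPartialHomeomorph R3 R3} {σ : ℝ} (he : IsSurfaceChart w p r η e θ σ) {H : C3 → ℂ}
    (hH : ContinuousOn (fun x => H (domainPt η x)) (closedBall p r)) :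
    IntegrableOn (fun y => H (w.symm (domainPt θ y)) * symmDet w (domainPt θ y)
      * volumeDensity θ y) e.target ∧
    ∫ y in e.target, H (w.symm (domainPt θ y)) * symmDet w (domainPt θ y) * volumeDensity θ y
      = σ * ∫ x in closedBall p r, H (domainPt η x) * volumeDensity η x := by
  have himg : e '' ball p r = e.target := he.source ▸ e.image_source_eq_target
  have hinj : InjOn e (ball p r) := he.source ▸ e.injOn
  have hd : ∀ x ∈ ball p r, HasFDerivWithinAt e (fderiv ℝ e x) (ball p r) x :=
    fun x hx => (he.differentiableAt x hx).hasFDerivAt.hasFDerivWithinAt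
  set Q : R3 → ℂ := fun y => H (w.symm (domainPt θ y)) * symmDet w (domainPt θ y)
    * volumeDensity θ y with hQ
  have hcont : ContinuousOn (fun x => (σ : ℂ) * (H (domainPt η x) * volumeDensity η x))
      (closedBall p r) :=
    continuousOn_const.mul (hH.mul ((continuousOn_volumeDensity isOpen_univ
      he.smooth_field.contDiffOn).mono (subset_univ _)))
  have hkey : ∀ x ∈ ball p r, |(fderiv ℝ e x).det| • Q (e x)
      = (σ : ℂ) * (H (domainPt η x) * volumeDensity η x) := fun x hx => by
    have h1 := hw.symmDet_mul_volumeDensity he hx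
    have h2 : w.symm (domainPt θ (e x)) = domainPt η x := by
      rw [he.pt x hx, w.left_inv (he.mem x hx)]
    rw [hQ, real_smul]; simp only; rw [h2]
    linear_combination H (domainPt η x) * h1
  constructor
  · rw [← himg, integrableOn_image_iff_integrableOn_abs_det_fderiv_smul volume
      isOpen_ball.measurableSet hd hinj]
    refine IntegrableOn.congr_fun ?_ (fun x hx => (hkey x hx).symm) isOpen_ball.measurableSet
    exact (hcont.integrableOn_compact (isCompact_closedBall p r)).mono_set ball_subset_closedBall
  · rw [← himg, integral_image_eq_integral_abs_det_fderiv_smul volume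
      isOpen_ball.measurableSet hd hinj,
      setIntegral_congr_fun isOpen_ball.measurableSet hkey, integral_const_mul]
    -- The chart covers the open cube, which differs from the closed one by a null set.
    congr 1; refine setIntegral_congr_set ?_
    exact ae_eq_of_subset_of_measure_ge ball_subset_closedBall
      (Measure.addHaar_closedBall_eq_addHaar_ball volume p r).le
      isOpen_ball.measurableSet.nullMeasurableSet measure_closedBall_lt_top.ne

/-- The phase in normalized coordinates. -/
theorem IsNormalizingChart.isNormalPhase (hw : NChart)
    (hp : IsStationaryOnSingularity U g G p) :
    IsNormalPhase w.target (fun ζ => G (w.symm ζ)) (G (toC3 p)).re β β' where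
  isOpen := w.open_target
  zero_mem := hw.zero_mem_target
  holo := hp.holo_G.comp hw.holo_symm fun ζ hζ => hw.symm_mem hζ
  real y hy := by
    have h1 := hw.exists_symm_real hy; rw [h1]
    exact hp.real_G _ (h1 ▸ hw.symm_mem hy)
  β₂_ne := hw.β₂_ne
  β₃_ne := hw.β₃_ne
  rem := by
    have h0 : ((G (toC3 p)).re : ℂ) = G (toC3 p) := Complex.ext rfl (hp.real_G p hp.mem).symm
    have hto : Tendsto w.symm (𝓝 0) (𝓝 (toC3 p)) := by
      have := (w.continuousAt_symm hw.zero_mem_target).tendsto; rwa [hw.symm_zero] at this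
    refine (hw.phase.comp_tendsto hto).congr' ?_ ?_ <;>
    · filter_upwards [w.open_target.mem_nhds hw.zero_mem_target] with ζ hζ
      simp only [Function.comp_apply, w.right_inv hζ, h0]

/-! ### The side of passage is preserved by deformations -/

/-- A real vector along which the first coordinate, and no other one, changes. -/
theorem IsNormalizingChart.exists_normal (hw : NChart) :
    ∃ n : R3, n ≠ 0 ∧ realDeriv w p n = Pi.single 0 1 := by
  obtain ⟨a, ha, hlow⟩ := hw.exists_realDeriv_lower
  obtain ⟨E, hE⟩ := exists_equiv_of_lower_bound ha hlow
  have h1 : realDeriv w p (E.symm (Pi.single 0 1)) = Pi.single 0 1 := by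
    rw [← hE]; exact E.apply_symm_apply _
  refine ⟨E.symm (Pi.single 0 1), fun h0 => ?_, h1⟩; rw [h0, map_zero] at h1
  simpa using congrFun h1 0

/-- Along an increasing family of functions with values on both sides of zero, a second function
that does not vanish where the first one does keeps its sign there. -/
theorem pos_of_homotopy {f k : ℝ × ℝ → ℝ}
    (hf : ContinuousOn f (Icc (0 : ℝ) 1 ×ˢ Icc (-1 : ℝ) 1))
    (hk : ContinuousOn k (Icc (0 : ℝ) 1 ×ˢ Icc (-1 : ℝ) 1))
    (hmono : ∀ τ ∈ Icc (0 : ℝ) 1, ∀ s ∈ Icc (-1 : ℝ) 1, ∀ s' ∈ Icc (-1 : ℝ) 1, s < s' →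
      f (τ, s) < f (τ, s'))
    (hneg : ∀ τ ∈ Icc (0 : ℝ) 1, f (τ, -1) ≤ 0) (hpos : ∀ τ ∈ Icc (0 : ℝ) 1, 0 ≤ f (τ, 1))
    (hne : ∀ τ ∈ Icc (0 : ℝ) 1, ∀ s ∈ Icc (-1 : ℝ) 1, f (τ, s) = 0 → k (τ, s) ≠ 0)
    (h0 : ∀ s ∈ Icc (-1 : ℝ) 1, f (0, s) = 0 → 0 < k (0, s)) {s : ℝ} (hs : s ∈ Icc (-1 : ℝ) 1)
    (h1 : f (1, s) = 0) : 0 < k (1, s) := by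
  set D := Icc (0 : ℝ) 1 ×ˢ Icc (-1 : ℝ) 1 with hD
  have hDc : IsCompact D := isCompact_Icc.prod isCompact_Icc
  have hzero : ∀ τ ∈ Icc (0 : ℝ) 1, ∃ s ∈ Icc (-1 : ℝ) 1, f (τ, s) = 0 := fun τ hτ => by
    have h2 : ContinuousOn (fun s => f (τ, s)) (Icc (-1 : ℝ) 1) :=
      hf.comp (by fun_prop) fun s hs => ⟨hτ, hs⟩
    exact intermediate_value_Icc (by norm_num) h2 ⟨hneg τ hτ, hpos τ hτ⟩
  have huniq : ∀ τ ∈ Icc (0 : ℝ) 1, ∀ s ∈ Icc (-1 : ℝ) 1, ∀ s' ∈ Icc (-1 : ℝ) 1,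
      f (τ, s) = 0 → f (τ, s') = 0 → s = s' := fun τ hτ s hs s' hs' h2 h3 => by
    rcases lt_trichotomy s s' with h | h | h
    · exact absurd (hmono τ hτ s hs s' hs' h) (by rw [h2, h3]; exact lt_irrefl _)
    · exact h
    · exact absurd (hmono τ hτ s' hs' s hs h) (by rw [h2, h3]; exact lt_irrefl _)
  have hclosed : ∀ S : Set (ℝ × ℝ), IsClosed S →
      IsClosed (Prod.fst '' (D ∩ (fun q => (f q, k q)) ⁻¹' S)) := fun S hS =>
    ((hDc.of_isClosed_subset ((hf.prodMk hk).preimage_isClosed_of_isClosed hDc.isClosed hS)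
      inter_subset_left).image continuous_fst).isClosed
  have hA := hclosed {q | q.1 = 0 ∧ 0 ≤ q.2} ((isClosed_eq continuous_fst continuous_const).inter
    (isClosed_le continuous_const continuous_snd))
  have hB := hclosed {q | q.1 = 0 ∧ q.2 ≤ 0} ((isClosed_eq continuous_fst continuous_const).inter
    (isClosed_le continuous_snd continuous_const))
  by_contra hcon
  -- The closed sets of times at which `k ≥ 0`, respectively `k ≤ 0`, at a zero of `f` cover the
  -- interval. If both were nonempty they would meet, and since the zero of `f` is unique at each
  -- time, `k` would vanish there.
  have h2 := isPreconnected_closed_iff.1 (isPreconnected_Icc (a := (0 : ℝ)) (b := 1)) _ _ hA hB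
    (fun τ hτ => by
      obtain ⟨s, hs, hs0⟩ := hzero τ hτ
      rcases le_total 0 (k (τ, s)) with h | h
      · exact Or.inl ⟨(τ, s), ⟨⟨hτ, hs⟩, hs0, h⟩, rfl⟩
      · exact Or.inr ⟨(τ, s), ⟨⟨hτ, hs⟩, hs0, h⟩, rfl⟩)
    (by
      obtain ⟨s, hs, hs0⟩ := hzero 0 (by simp)
      exact ⟨0, by simp, (0, s), ⟨⟨by simp, hs⟩, hs0, (h0 s hs hs0).le⟩, rfl⟩)
    ⟨1, by simp, (1, s), ⟨⟨by simp, hs⟩, h1, not_lt.1 hcon⟩, rfl⟩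
  obtain ⟨τ, hτ, ⟨⟨τ1, s1⟩, ⟨⟨-, hs1⟩, h3, h4⟩, rfl⟩, ⟨τ2, s2⟩, ⟨⟨-, hs2⟩, h5, h6⟩, rfl⟩ := h2
  have h7 := huniq _ hτ s1 hs1 s2 hs2 h3 h5; subst h7
  exact hne _ hτ s1 hs1 h3 (le_antisymm h6 h4)

/-- An allowed deformation preserves the side on which a domain passes the singularity. -/
theorem IsNormalizingChart.exists_passes_transport (hw : NChart) :
    ∃ R > 0, ∀ r : ℝ, 0 < r → r ≤ R → ∃ δ0 > 0, ∀ δ ≤ δ0, ∀ η : ℝ → R3 → R3,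
      IsAllowedDeformation g p r δ η → ∀ ς : ℝ, ς ≠ 0 →
      (∀ x ∈ closedBall p r, (α * g (domainPt (η 0) x)).re = 0 →
        0 < ς * (α * g (domainPt (η 0) x)).im) →
      ∀ x ∈ closedBall p r, (α * g (domainPt (η 1) x)).re = 0 →
        0 < ς * (α * g (domainPt (η 1) x)).im := by
  obtain ⟨n, hn0, hn⟩ := hw.exists_normal
  have hnpos : 0 < ‖n‖ := norm_pos_iff.2 hn0; set m := ‖n‖⁻¹ with hm
  have hm0 : 0 < m := by positivity
  obtain ⟨R, hR, δ1, hδ₁, happ⟩ := hw.exists_reL_approx (c := m / 16) (by positivity)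
  set C := ‖realDeriv w p‖ + m / 16
  have hC : 0 < C := by positivity
  refine ⟨R, hR, fun r hr hrR => ⟨min δ1 (m * r / 8 / C),
    by positivity, fun δ hδ η hη ς hς hside x hx hx0 => ?_⟩⟩
  rw [le_min_iff, le_div_iff₀' hC] at hδ
  replace happ := fun τ hτ => happ r δ hrR hδ.1 (η τ) (hη.small τ hτ)
  set ℓ : R3 → ℝ := fun v => realDeriv w p v 0 with hℓ
  have hℓadd : ∀ u v, ℓ (u + v) = ℓ u + ℓ v := fun u v => by simp [hℓ]
  have hℓsmul : ∀ (t : ℝ) v, ℓ (t • v) = t * ℓ v := fun t v => by simp [hℓ]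
  have hℓsub : ∀ u v, ℓ (u - v) = ℓ u - ℓ v := fun u v => by simp [hℓ]
  have hℓn : ℓ n = 1 := by simp [hℓ, hn]
  set f : ℝ → R3 → ℝ := fun τ x => (α * g (domainPt (η τ) x)).re with hf
  have hsrc : ∀ τ ∈ Icc (0 : ℝ) 1, ∀ x ∈ closedBall p r, domainPt (η τ) x ∈ w.source :=
    fun τ hτ x hx => ((happ τ hτ).1 x hx).1
  have hfw : ∀ τ ∈ Icc (0 : ℝ) 1, ∀ x ∈ closedBall p r,
      f τ x = reL (w (domainPt (η τ) x)) 0 := fun τ hτ x hx => by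
    rw [reL_apply, hw.first _ (hsrc τ hτ x hx)]
  have hfa : ∀ τ ∈ Icc (0 : ℝ) 1, ∀ x ∈ closedBall p r, ∀ x' ∈ closedBall p r,
      |f τ x - f τ x' - ℓ (x - x')| ≤ m / 8 * ‖x - x'‖ := fun τ hτ x hx x' hx' => by
    rw [hfw τ hτ x hx, hfw τ hτ x' hx']
    refine (norm_le_pi_norm _ 0).trans (((happ τ hτ).2 x hx x' hx').trans (le_of_eq (by ring)))
  have hpm : p ∈ closedBall p r := mem_closedBall_self hr.le
  have hfp : ∀ τ ∈ Icc (0 : ℝ) 1, |f τ p| ≤ m * r / 8 := fun τ hτ => by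
    rw [hfw τ hτ p hpm]
    have h1 := ((happ τ hτ).1 p hpm).2.2; rw [hw.center, sub_zero] at h1
    exact (norm_le_pi_norm _ 0).trans ((norm_reL_le _).trans (h1.trans hδ.2))
  set u : R3 := (r * m) • n with hu
  have hun : ‖u‖ = r := by
    rw [hu, norm_smul, Real.norm_of_nonneg (by positivity), hm, mul_assoc,
      inv_mul_cancel₀ hnpos.ne', mul_one]
  have hℓu : ℓ u = r * m := by rw [hu, hℓsmul, hℓn, mul_one]
  have hup : p + u ∈ closedBall p r := by
    rw [mem_closedBall, dist_eq_norm, add_sub_cancel_left, hun]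
  have hum : p - u ∈ closedBall p r := by
    rw [mem_closedBall, dist_eq_norm, sub_sub_cancel_left, norm_neg, hun]
  have hxp : ‖x - p‖ ≤ r := by rwa [← dist_eq_norm, ← mem_closedBall]
  have h01 : (1 : ℝ) ∈ Icc (0 : ℝ) 1 := by simp
  have hℓx : |ℓ (x - p)| ≤ m * r / 4 := by
    have h1 := hfa 1 h01 x hx p hpm; have h2 := hfp 1 h01; have h3 : f 1 x = 0 := hx0
    have h4 : m / 8 * ‖x - p‖ ≤ m / 8 * r := by gcongr
    rw [h3] at h1; have h5 := abs_le.1 h1; have h6 := abs_le.1 h2; rw [abs_le]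
    constructor <;> linarith [h5.1, h5.2, h6.1, h6.2]
  -- The broken line `p - u`, `x`, `p + u`. A straight normal line through `x` might leave the cube
  -- before `Re w₁` has changed sign; this path stays inside by convexity, and its ends have `Re w₁`
  -- of opposite signs.
  set path : ℝ → R3 := fun s => x + max s 0 • (p + u - x) + max (-s) 0 • (p - u - x) with hpath
  have hpath0 : path 0 = x := by simp [hpath]
  have hpath1 : path 1 = p + u := by simp [hpath]
  have hpathm : path (-1) = p - u := by simp [hpath]
  have hpathmem : ∀ s ∈ Icc (-1 : ℝ) 1, path s ∈ closedBall p r := fun s hs => by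
    have hconv := convex_closedBall p r; rcases le_total 0 s with h | h
    · have h1 : path s = (1 - s) • x + s • (p + u) := by
        rw [hpath]; simp only; rw [max_eq_left h, max_eq_right (by linarith : -s ≤ 0)]; module
      rw [h1]; exact hconv hx hup (by linarith [hs.2]) h (by ring)
    · have h1 : path s = (1 + s) • x + (-s) • (p - u) := by
        rw [hpath]; simp only; rw [max_eq_right h, max_eq_left (by linarith : 0 ≤ -s)]; module
      rw [h1]; exact hconv hx hum (by linarith [hs.1]) (by linarith) (by ring)
  have hpathc : Continuous path := by fun_prop
  have hdist : ∀ z ∈ closedBall p r, ‖z - x‖ ≤ 2 * r := fun z hz => by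
    have h1 : ‖z - p‖ ≤ r := by rwa [← dist_eq_norm, ← mem_closedBall]
    have : z - x = (z - p) - (x - p) := by abel
    rw [this]; exact (norm_sub_le _ _).trans (by linarith)
  have hcont : ContinuousOn (fun q : ℝ × ℝ => α * g (domainPt (η q.1) (path q.2)))
      (Icc (0 : ℝ) 1 ×ˢ Icc (-1 : ℝ) 1) := by
    have h1 : ContinuousOn (fun q : ℝ × ℝ => domainPt (η q.1) (path q.2))
        (Icc (0 : ℝ) 1 ×ˢ Icc (-1 : ℝ) 1) := by
      have h2 : ContinuousOn (fun q : ℝ × ℝ => η q.1 (path q.2))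
          (Icc (0 : ℝ) 1 ×ˢ Icc (-1 : ℝ) 1) :=
        hη.continuousOn.comp (f := fun q : ℝ × ℝ => (q.1, path q.2)) (by fun_prop)
          fun q hq => ⟨hq.1, hpathmem _ hq.2⟩
      refine continuousOn_pi.2 fun i => ?_
      have h3 : ContinuousOn (fun q : ℝ × ℝ => ((η q.1 (path q.2) i : ℝ) : ℂ))
          (Icc (0 : ℝ) 1 ×ˢ Icc (-1 : ℝ) 1) :=
        continuous_ofReal.comp_continuousOn ((continuous_apply i).comp_continuousOn h2)
      have h4 : Continuous fun q : ℝ × ℝ => ((path q.2 i : ℝ) : ℂ) :=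
        continuous_ofReal.comp ((continuous_apply i).comp (hpathc.comp continuous_snd))
      exact h4.continuousOn.add (continuousOn_const.mul h3)
    have h5 : ContinuousOn (fun ξ => w ξ 0) w.source :=
      (continuous_apply 0).comp_continuousOn w.continuousOn
    refine (h5.comp h1 fun q hq => hsrc q.1 hq.1 _ (hpathmem _ hq.2)).congr fun q hq => ?_
    exact (hw.first _ (hsrc q.1 hq.1 _ (hpathmem _ hq.2))).symm
  have hrm : 0 < r * m := by positivity
  have key := pos_of_homotopy (f := fun q => f q.1 (path q.2))
    (k := fun q => ς * (α * g (domainPt (η q.1) (path q.2))).im)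
    (continuous_re.comp_continuousOn hcont)
    (continuousOn_const.mul (continuous_im.comp_continuousOn hcont))
    (fun τ hτ s hs s' hs' hss => by
      have h1 := (abs_le.1 (hfa τ hτ _ (hpathmem s' hs') _ (hpathmem s hs))).1
      set A := max s' 0 - max s 0 with hA
      set B := max (-s) 0 - max (-s') 0 with hB
      have hA0 : 0 ≤ A := sub_nonneg.2 (max_le_max hss.le le_rfl)
      have hB0 : 0 ≤ B := sub_nonneg.2 (max_le_max (by linarith) le_rfl)
      have hAB : A + B = s' - s := by
        have e1 : max s' 0 - max (-s') 0 = s' := max_zero_sub_eq_self s'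
        have e2 : max s 0 - max (-s) 0 = s := max_zero_sub_eq_self s; linarith
      have h2 : path s' - path s = A • (p + u - x) - B • (p - u - x) := by
        rw [hpath, hA, hB]; module
      have h3 : ‖path s' - path s‖ ≤ (A + B) * (2 * r) := by
        rw [h2]; refine (norm_sub_le _ _).trans ?_
        rw [norm_smul, norm_smul, Real.norm_of_nonneg hA0, Real.norm_of_nonneg hB0, add_mul]
        exact add_le_add (mul_le_mul_of_nonneg_left (hdist _ hup) hA0)
          (mul_le_mul_of_nonneg_left (hdist _ hum) hB0)
      have h4 : ℓ (path s' - path s) = (A + B) * (r * m) - (A - B) * ℓ (x - p) := by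
        have e1 : p + u - x = u - (x - p) := by abel
        have e2 : p - u - x = (-1 : ℝ) • u - (x - p) := by module
        rw [h2, hℓsub, hℓsmul, hℓsmul, e1, e2, hℓsub u, hℓsub ((-1 : ℝ) • u), hℓsmul (-1) u, hℓu]
        ring
      have h5 : (A - B) * ℓ (x - p) ≤ (A + B) * (m * r / 4) := by
        refine (le_abs_self _).trans ?_; rw [abs_mul]
        refine mul_le_mul ?_ hℓx (abs_nonneg _) (by linarith); rw [abs_le]; constructor <;> linarith
      have h6 : m / 8 * ‖path s' - path s‖ ≤ m / 8 * ((A + B) * (2 * r)) :=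
        mul_le_mul_of_nonneg_left h3 (by positivity)
      have h7 : 0 < (A + B) * (r * m) := by
        rw [hAB]; exact mul_pos (by linarith) hrm
      have h8 : (A + B) * (m * r / 4) = (A + B) * (r * m) / 4 := by ring
      have h9 : m / 8 * ((A + B) * (2 * r)) = (A + B) * (r * m) / 4 := by ring
      -- The main increment is `(A + B) r m`. The obliqueness of the path, caused by `x - p`, and
      -- the nonlinearity of the chart take away at most a quarter of it each.
      show f τ (path s) < f τ (path s')
      linarith)
    (fun τ hτ => by
      have h1 := (abs_le.1 (hfa τ hτ _ hum _ hpm)).2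
      have h2 := (abs_le.1 (hfp τ hτ)).2; show f τ (path (-1)) ≤ 0; rw [hpathm]
      rw [show p - u - p = (-1 : ℝ) • u by module, hℓsmul, hℓu, norm_smul, hun] at h1
      norm_num at h1
      nlinarith)
    (fun τ hτ => by
      have h1 := (abs_le.1 (hfa τ hτ _ hup _ hpm)).1
      have h2 := (abs_le.1 (hfp τ hτ)).1; show 0 ≤ f τ (path 1); rw [hpath1]
      rw [show p + u - p = u by abel, hℓu, hun] at h1
      nlinarith)
    (fun τ hτ s hs h0 => by
      refine mul_ne_zero hς fun him => ?_
      have h1 : α * g (domainPt (η τ) (path s)) = 0 := Complex.ext h0 him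
      rcases mul_eq_zero.1 h1 with h2 | h2
      · exact hw.α_ne (by exact_mod_cast h2)
      · exact hη.avoids τ hτ _ (hpathmem s hs) h2)
    (fun s hs h0 => hside _ (hpathmem s hs) h0)
    (s := 0) (by norm_num) (by
      show f 1 (path 0) = 0
      rw [hpath0]
      exact hx0)
  simp only [hpath0] at key; exact key

/-! ### Local integrals up to exponentially small errors -/

theorem IsSurfaceChart.reL_eq {r : ℝ} {η θ : R3 → R3} {e : OpenPartialHomeomorph R3 R3} {σ : ℝ}
    (he : IsSurfaceChart w p r η e θ σ) {x : R3} (hx : x ∈ ball p r) :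
    reL (w (domainPt η x)) = e x := by
  rw [← he.pt x hx, domainPt_eq_complexPt, reL_complexPt]

theorem IsSurfaceChart.imL_eq {r : ℝ} {η θ : R3 → R3} {e : OpenPartialHomeomorph R3 R3} {σ : ℝ}
    (he : IsSurfaceChart w p r η e θ σ) {x : R3} (hx : x ∈ ball p r) :
    imL (w (domainPt η x)) = θ (e x) := by
  rw [← he.pt x hx, domainPt_eq_complexPt, imL_complexPt]

/-- Up to an exponentially small error, the local integral over a domain that is desired outside a
core is the integral over a part `N` of a model domain `y + i θ'(y)` in the coordinates `w`. -/
theorem IsNormalizingChart.exists_norm_localIntegral_sub_le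
    (hw : NChart) (hp : IsStationaryOnSingularity U g G p)
    {r : ℝ} (hr : 0 < r) {η θ θ' : R3 → R3} {e : OpenPartialHomeomorph R3 R3} {σ : ℝ}
    (he : IsSurfaceChart w p r η e θ σ) {S : Set ℂ} (hSo : IsOpen S)
    (hsrc : ∀ x ∈ closedBall p r, domainPt η x ∈ w.source)
    (hS : ∀ x ∈ closedBall p r, (α : ℂ) * g (domainPt η x) ∈ S)
    {F : C3 → ℂ} (hF : DifferentiableOn ℂ F {ξ ∈ U | α * g ξ ∈ S})
    {K b : ℝ} (hbt : ∀ y θ : R3, ‖y‖ ≤ b → ‖θ‖ ≤ b → complexPt y θ ∈ w.target)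
    (hcombo : ∀ y θ0 θ1 : R3, ‖y‖ ≤ b → ‖θ0‖ ≤ b → ‖θ1‖ ≤ b → ∀ t ∈ Icc (0 : ℝ) 1,
      (1 - t) * (G (w.symm (complexPt y θ0))).im + t * (G (w.symm (complexPt y θ1))).im
        - K * t * ‖θ1 - θ0‖ ^ 2 ≤ (G (w.symm (complexPt y (θ0 + t • (θ1 - θ0))))).im)
    (hre : ∀ x ∈ closedBall p r, ‖reL (w (domainPt η x))‖ ≤ b)
    (him : ∀ x ∈ closedBall p r, ‖imL (w (domainPt η x))‖ ≤ b)
    (hθ' : ContDiff ℝ ∞ θ') (hθ'b : ∀ y, ‖y‖ ≤ b → ‖θ' y‖ ≤ b)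
    (hcut : ∀ y θ0, ∀ t ∈ Icc (0 : ℝ) 1, complexPt y θ0 0 ∈ S →
      complexPt y (θ0 + t • (θ' y - θ0)) 0 ∈ S)
    {q0 q1 : ℝ} (hq0 : 0 < q0) (hq1 : 0 < q1)
    (hoff : ∀ x ∈ closedBall p r \ ball p (r / 2),
      q0 ≤ (G (w.symm (complexPt (reL (w (domainPt η x))) (θ' (reL (w (domainPt η x))))))).im ∧
      2 * K * ‖θ' (reL (w (domainPt η x))) - imL (w (domainPt η x))‖ ^ 2
        ≤ (G (w.symm (complexPt (reL (w (domainPt η x))) (θ' (reL (w (domainPt η x))))))).im)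
    {N : Set R3} (hN : MeasurableSet N) (hNe : N ⊆ e '' closedBall p (r / 2))
    (hcore : ∀ y ∈ (e '' closedBall p (r / 2)) \ N, q1 ≤ (G (w.symm (complexPt y (θ' y)))).im)
    (hdes : DesiredOn G (closedBall p r \ ball p (r / 2)) η) :
    ∃ m > 0, ∃ M : ℝ, ∀ Λ : ℝ, 0 ≤ Λ →
      ‖σ * localIntegral F G p r η Λ - ∫ y in N, F (w.symm (domainPt θ' y))
        * symmDet w (domainPt θ' y) * exp (I * Λ * G (w.symm (domainPt θ' y)))
        * volumeDensity θ' y‖ ≤ M * Real.exp (-(m * Λ)) := by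
  have hball : ∀ {x}, x ∈ ball p r → x ∈ closedBall p r := fun h => ball_subset_closedBall h
  have hηc : Continuous (domainPt η) :=
    continuousOn_univ.1 (contDiffOn_domainPt he.smooth_field.contDiffOn).continuousOn
  have hGc : ContinuousOn (fun x => G (domainPt η x)) (closedBall p r) :=
    hp.holo_G.continuousOn.comp hηc.continuousOn fun x hx => hw.subset (hsrc x hx)
  have hFc : ContinuousOn (fun x => F (domainPt η x)) (closedBall p r) :=
    hF.continuousOn.comp hηc.continuousOn fun x hx => ⟨hw.subset (hsrc x hx), hS x hx⟩
  -- the phase off the core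
  obtain ⟨m0, hm0, hm₀le⟩ : ∃ m0 > 0, ∀ x ∈ closedBall p r \ ball p (r / 2),
      m0 ≤ (G (domainPt η x)).im := by
    have hcomp : IsCompact (closedBall p r \ ball p (r / 2)) :=
      (isCompact_closedBall p r).diff isOpen_ball
    rcases (closedBall p r \ ball p (r / 2)).eq_empty_or_nonempty with h | h
    · exact ⟨1, one_pos, fun x hx => absurd hx (by rw [h]; exact notMem_empty x)⟩
    · obtain ⟨x0, hx0, hmin⟩ := hcomp.exists_isMinOn h
        (continuous_im.comp_continuousOn (hGc.mono sdiff_subset))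
      exact ⟨_, hdes x0 hx0, fun x hx => hmin hx⟩
  set m := min (min m0 (q0 / 2)) q1 with hm
  have hmpos : 0 < m := by positivity
  have hmem : ∀ y ∈ e.target, ∃ x ∈ ball p r, e x = y := fun y hy =>
    ⟨e.symm y, he.source ▸ e.map_target hy, e.right_inv hy⟩
  have hcoreSub : e '' closedBall p (r / 2) ⊆ e.target := by
    rintro y ⟨x, hx, rfl⟩; refine e.map_source ?_; rw [he.source]
    exact closedBall_subset_ball (by linarith) hx
  have hbound : ∀ y ∈ e.target, ‖y‖ ≤ b ∧ ‖θ y‖ ≤ b ∧ complexPt y (θ y) 0 ∈ S := fun y hy => by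
    obtain ⟨x, hx, rfl⟩ := hmem y hy; refine ⟨?_, ?_, ?_⟩
    · rw [← he.reL_eq hx]; exact hre x (hball hx)
    · rw [← he.imL_eq hx]; exact him x (hball hx)
    · rw [← domainPt_eq_complexPt, he.pt x hx, hw.first _ (hsrc x (hball hx))]
      exact hS x (hball hx)
  set Ω := w.target ∩ {ζ : C3 | ζ 0 ∈ S} with hΩ
  have hΩo : IsOpen Ω := w.open_target.inter (hSo.preimage (continuous_apply 0))
  have hΓ : DifferentiableOn ℂ (fun ζ => G (w.symm ζ)) Ω :=
    (hw.isNormalPhase hp).holo.mono inter_subset_left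
  have hf : DifferentiableOn ℂ (fun ζ => F (w.symm ζ) * symmDet w ζ) Ω :=
    (hw.differentiableOn_comp_symm hF).mul (hw.differentiableOn_symmDet.mono inter_subset_left)
  have hcont : ∀ Λ : ℝ, ContinuousOn (fun x => F (domainPt η x)
      * exp (I * Λ * G (domainPt η x))) (closedBall p r) := fun Λ =>
    hFc.mul (continuousOn_const.mul hGc).cexp
  have hchange := fun Λ : ℝ => hw.integral_surfaceChart he
    (H := fun ξ => F ξ * exp (I * Λ * G ξ)) (hcont Λ)
  have hcongr : ∀ (Λ : ℝ) (y : R3), F (w.symm (domainPt θ y))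
      * exp (I * Λ * G (w.symm (domainPt θ y))) * symmDet w (domainPt θ y)
        * volumeDensity θ y = F (w.symm (domainPt θ y)) * symmDet w (domainPt θ y)
      * exp (I * Λ * G (w.symm (domainPt θ y))) * volumeDensity θ y :=
    fun Λ y => by ring
  obtain ⟨M, hM⟩ := exists_norm_integral_sub_le (m := m) hΩo hΓ hf e.open_target
    (Q := e '' closedBall p (r / 2)) (N := N) (θ := θ) (θ' := θ')
    ((isCompact_closedBall p (r / 2)).image_of_continuousOn (e.continuousOn.mono fun x hx => by
      rw [he.source]
      exact closedBall_subset_ball (by linarith) hx))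
    hcoreSub hN hNe he.smooth hθ'
    (fun y hy t ht => by
      obtain ⟨h1, h2, h3⟩ := hbound y hy
      refine ⟨hbt y _ h1 ?_, hcut y _ t ht h3⟩
      have h4 : θ y + t • (θ' y - θ y) = (1 - t) • θ y + t • θ' y := by module
      rw [h4]; refine (norm_add_le _ _).trans ?_
      rw [norm_smul, norm_smul, Real.norm_of_nonneg ht.1, Real.norm_of_nonneg (by linarith [ht.2])]
      have h5 := mul_le_mul_of_nonneg_left h2 (by linarith [ht.2] : 0 ≤ 1 - t)
      have h6 := mul_le_mul_of_nonneg_left (hθ'b y h1) ht.1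
      linarith)
    (fun y hy => (min_le_right _ _).trans (hcore y hy))
    (fun y hy t ht => by
      obtain ⟨h1, h2, -⟩ := hbound y hy.1
      obtain ⟨x, hx, rfl⟩ := hmem y hy.1
      have hxoff : x ∈ closedBall p r \ ball p (r / 2) :=
        ⟨hball hx, fun h => hy.2 ⟨x, ball_subset_closedBall h, rfl⟩⟩
      have h3 := hcombo _ _ _ h1 h2 (hθ'b _ h1) t ht; have h4 := hoff x hxoff
      rw [he.reL_eq hx, he.imL_eq hx] at h4; have h5 := hm₀le x hxoff
      have h6 : G (w.symm (complexPt (e x) (θ (e x)))) = G (domainPt η x) := by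
        rw [← domainPt_eq_complexPt, he.pt x hx, w.left_inv (hsrc x (hball hx))]
      rw [h6] at h3; refine le_trans ?_ h3
      -- Near concavity bounds the phase from below by `(1 - t) m0 + tQ` minus an error of at most
      -- `tQ/2`, by the second half of `hoff`. What remains is a convex combination of `m0` and
      -- `Q/2`.
      set Q := (G (w.symm (complexPt (e x) (θ' (e x))))).im
      have h7 : m ≤ m0 := (min_le_left _ _).trans (min_le_left _ _)
      have h8 : m ≤ q0 / 2 := (min_le_left _ _).trans (min_le_right _ _)
      have h9 := mul_le_mul_of_nonneg_left (h7.trans h5) (by linarith [ht.2] : 0 ≤ 1 - t)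
      have h10 := mul_le_mul_of_nonneg_left (h8.trans (by linarith [h4.1] : q0 / 2 ≤ Q / 2)) ht.1
      have h11 := mul_le_mul_of_nonneg_left h4.2 ht.1
      have h12 : K * t * ‖θ' (e x) - θ (e x)‖ ^ 2
        = t * (2 * K * ‖θ' (e x) - θ (e x)‖ ^ 2) / 2 := by ring
      rw [h12]
      linarith)
    (fun Λ => (hchange Λ).1.congr_fun (fun y _ => hcongr Λ y) e.open_target.measurableSet)
  refine ⟨m, hmpos, M, fun Λ hΛ => ?_⟩; have h1 := hM Λ hΛ
  have h2 : σ * localIntegral F G p r η Λ = ∫ y in e.target, F (w.symm (domainPt θ y))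
      * symmDet w (domainPt θ y) * exp (I * Λ * G (w.symm (domainPt θ y)))
      * volumeDensity θ y := by
    rw [localIntegral, ← (hchange Λ).2]
    exact setIntegral_congr_fun e.open_target.measurableSet fun y _ => hcongr Λ y
  rw [h2]; exact h1

/-- A domain that passes above the singularity and is desired outside a core gives no
contribution. -/
theorem IsNormalizingChart.exists_localIntegral_isBigO (hw : NChart)
    (hp : IsStationaryOnSingularity U g G p) :
    ∃ R > 0, ∀ r : ℝ, 0 < r → r ≤ R → ∃ δ0 > 0, ∀ δ ≤ δ0, ∀ η : R3 → R3, IsSmallField p r δ η →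
      DesiredOn G (closedBall p r \ ball p (r / 2)) η →
      PassesAbove (fun ξ => α * g ξ) p r η →
      ∀ F : C3 → ℂ, DifferentiableOn ℂ F {ξ ∈ U | α * g ξ ∈ cutBelow} →
        ∃ ζ > 0, localIntegral F G p r η =O[atTop] fun Λ : ℝ => Real.exp (-(ζ * Λ)) := by
  obtain ⟨a, ha, C, hC, R1, hR1, δ1, hδ₁, σ, hσ, -, hch⟩ := hw.exists_surfaceChart
  have hphase := hw.isNormalPhase hp
  obtain ⟨K, hK, b1, hb1, hbt, hcombo⟩ := hphase.exists_im_combo_ge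
  obtain ⟨b2, hb2, hconst⟩ := hphase.exists_im_const_ge; set b := min b1 b2 with hb
  have hb0 : 0 < b := by positivity
  have hbb₁ : b ≤ b1 := min_le_left _ _
  have hbb2 : b ≤ b2 := min_le_right _ _
  -- The model gains `s/2`, linear in `s`, while the concavity error is quadratic in the distance of
  -- the fields, at most `(1 + C)s` once `δ ≤ s`. A small `s` therefore lets the gain win.
  set s := min b (1 / (4 * K * (1 + C) ^ 2)) with hs
  have hs0 : 0 < s := by positivity
  have hsb : s ≤ b := min_le_left _ _
  have hsK : 2 * K * ((1 + C) * s) ^ 2 ≤ s / 2 := by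
    have h1 : s * (4 * K * (1 + C) ^ 2) ≤ 1 := by
      rw [← le_div_iff₀ (by positivity)]; exact min_le_right _ _
    have h2 := mul_le_mul_of_nonneg_left h1 (by positivity : 0 ≤ s / 2)
    linarith [show 2 * K * ((1 + C) * s) ^ 2 = s / 2 * (s * (4 * K * (1 + C) ^ 2)) by ring]
  refine ⟨min R1 (b / 2 / C), by positivity, fun r hr hrR =>
    ⟨min (min δ1 (b / 2 / C)) s, by positivity, fun δ hδ η hη hdes habove F hF => ?_⟩⟩
  simp only [le_min_iff, le_div_iff₀' hC] at hrR hδ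
  obtain ⟨⟨hrR, hCr⟩, ⟨hδ1, hCδ⟩, hδs⟩ := And.intro hrR hδ
  obtain ⟨hgeo, e, θ, he, -⟩ := hch r δ hr hrR hδ1 η hη
  have hre : ∀ x ∈ closedBall p r, ‖reL (w (domainPt η x))‖ ≤ b := fun x hx => by
    have h1 := (hgeo x hx).2.2.2; have h2 : ‖x - p‖ ≤ r := by rwa [← dist_eq_norm, ← mem_closedBall]
    have h3 := mul_le_mul_of_nonneg_left h2 hC.le; linarith
  have hnorm : ‖s • (![1, 0, 0] : R3)‖ ≤ s := by
    refine (pi_norm_le_iff_of_nonneg hs0.le).2 fun i => ?_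
    fin_cases i <;> simp [abs_of_pos hs0, hs0.le]
  have h0 : (s • (![1, 0, 0] : R3)) 0 = s := by simp
  obtain ⟨m, hm, M, hM⟩ := hw.exists_norm_localIntegral_sub_le hp hr he isOpen_cutBelow
    (fun x hx => (hgeo x hx).1) habove hF (K := K) (b := b)
    (fun y θ h1 h2 => hbt y θ (h1.trans hbb₁) (h2.trans hbb₁))
    (fun y θ0 θ1 h1 h2 h3 => hcombo y θ0 θ1 (h1.trans hbb₁) (h2.trans hbb₁) (h3.trans hbb₁))
    hre (fun x hx => (hgeo x hx).2.1.trans (by linarith))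
    (θ' := fun _ => s • ![1, 0, 0]) contDiff_const (fun y _ => hnorm.trans hsb)
    (fun y θ0 t ht h1 => by
      simp only [cutBelow, complexPt, mem_ofPred_eq, add_re, ofReal_re,
        I_mul_re, ofReal_im, neg_zero, add_zero, add_im, zero_add,
        I_mul_im] at h1 ⊢
      intro h2; have h3 := h1 h2
      have h4 : (θ0 + t • (s • (![1, 0, 0] : R3) - θ0)) 0 = (1 - t) * θ0 0 + t * s := by
        rw [Pi.add_apply, Pi.smul_apply, Pi.sub_apply, h0, smul_eq_mul]; ring
      rw [h4]; rcases eq_or_lt_of_le ht.1 with h5 | h5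
      · rw [← h5]; linarith
      · have h6 : 0 ≤ (1 - t) * θ0 0 := mul_nonneg (by linarith [ht.2]) h3.le
        have h7 := mul_pos h5 hs0
        linarith)
    (q0 := s / 2) (q1 := s / 2) (by positivity) (by positivity)
    (fun x hx => by
      have h1 := (hconst s hs0 (hsb.trans hbb2) _ ((hre x hx.1).trans hbb2)).2
      refine ⟨h1, le_trans ?_ h1⟩; refine le_trans ?_ hsK
      have h2 : ‖s • (![1, 0, 0] : R3) - imL (w (domainPt η x))‖ ≤ (1 + C) * s := by
        refine (norm_sub_le _ _).trans ?_; have h3 := (hgeo x hx.1).2.1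
        have h4 := mul_le_mul_of_nonneg_left hδs hC.le; linarith
      have h3 := pow_le_pow_left₀ (norm_nonneg _) h2 2
      exact mul_le_mul_of_nonneg_left h3 (by positivity))
    -- The constant field is desired over the whole core, so no part of the model integral has to be
    -- kept.
    (N := ∅) MeasurableSet.empty (empty_subset _)
    (fun y hy => by
      obtain ⟨x, hx, rfl⟩ := hy.1
      have hxr : x ∈ ball p r := closedBall_subset_ball (by linarith) hx
      refine (hconst s hs0 (hsb.trans hbb2) _ ?_).2; rw [← he.reL_eq hxr]
      exact (hre x (ball_subset_closedBall hxr)).trans hbb2)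
    hdes
  refine ⟨m, hm, IsBigO.of_bound M ?_⟩
  filter_upwards [eventually_ge_atTop 0] with Λ hΛ; have h1 := hM Λ hΛ
  rw [Measure.restrict_empty, integral_zero_measure, sub_zero, norm_mul] at h1
  have h2 : ‖(σ : ℂ)‖ = 1 := by
    rcases hσ with h | h <;> rw [h] <;> simp
  rw [h2, one_mul] at h1; rwa [Real.norm_of_nonneg (exp_pos _).le]

/-- Some coordinate is at least `ρ` in size. If it is the normal one, its linear term beats `ρ²`
because `ρ ≤ 1`. -/
theorem outside_cube_lower {c ρ : ℝ} (hc : 0 < c) (hρ : 0 ≤ ρ) (hρ1 : ρ ≤ 1) {y : R3} (hy : ρ ≤ ‖y‖) :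
    min (3 / 4) c * ρ ^ 2 ≤ 3 / 4 * |y 0| + c * (y 1 ^ 2 + y 2 ^ 2) := by
  obtain ⟨i, hi⟩ : ∃ i, ρ ≤ |y i| := by
    obtain ⟨i, hi⟩ := Finite.exists_max fun i => |y i|
    exact ⟨i, hy.trans ((pi_norm_le_iff_of_nonneg (abs_nonneg _)).2 hi)⟩
  have h1 : min (3 / 4) c ≤ 3 / 4 := min_le_left _ _
  have h2 : min (3 / 4) c ≤ c := min_le_right _ _
  have h3 : ρ ^ 2 ≤ ρ := by nlinarith
  have h4 : ∀ j, ρ ≤ |y j| → c * ρ ^ 2 ≤ c * y j ^ 2 := fun j hj => by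
    rw [← sq_abs (y j)]; exact mul_le_mul_of_nonneg_left (pow_le_pow_left₀ hρ hj 2) hc.le
  have h5 : 0 ≤ c * y 1 ^ 2 := by positivity
  have h6 : 0 ≤ c * y 2 ^ 2 := by positivity
  have h7 := abs_nonneg (y 0)
  have h8 : min (3 / 4) c * ρ ^ 2 ≤ c * ρ ^ 2 := mul_le_mul_of_nonneg_right h2 (sq_nonneg ρ)
  have h9 : min (3 / 4) c * ρ ^ 2 ≤ 3 / 4 * ρ ^ 2 := mul_le_mul_of_nonneg_right h1 (sq_nonneg ρ)
  fin_cases i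
  · have h10 : ρ ≤ |y 0| := hi; linarith
  · have := h4 1 hi; linarith
  · have := h4 2 hi; linarith

/-- Over the dip field the imaginary part of the phase is positive outside a cube. -/
theorem IsNormalPhase.exists_im_dip_outside_ge {V : Set C3} {Γ : C3 → ℂ} {γ : ℝ}
    (h : IsNormalPhase V Γ γ β β') : ∃ b > 0, ∃ c > 0, ∀ s κ ρ : ℝ, 0 < s → s ≤ 1 → 0 < κ →
      κ ≤ b → 0 ≤ ρ → ρ ≤ 1 → 6 * κ ≤ c * ρ ^ 2 → ∀ y : R3, ‖y‖ ≤ b → ρ ≤ ‖y‖ →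
      s * (c * ρ ^ 2 / 2) ≤ (Γ (complexPt y (dipField s κ β β' y))).im := by
  obtain ⟨b, hb, c, hc, hdip⟩ := h.exists_im_dip_ge
  refine ⟨b, hb, min (3 / 4) c, by positivity, fun s κ ρ hs hs1 hκ hκb hρ hρ1 hκρ y hy hρy => ?_⟩
  have h1 := (hdip s κ hs hs1 hκ hκb y hy _ (abs_dipProfile_one_le hκ (y 0))).2
  rw [← dipField_eq_smul] at h1; refine le_trans (mul_le_mul_of_nonneg_left ?_ hs.le) h1
  have h2 := outside_cube_lower hc hρ hρ1 hρy
  have h3 := dipProfile_lower (κ := κ) zero_le_one (y 0); rw [one_mul] at h3; linarith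

theorem norm_dipField_le {s κ β β' : ℝ} (hs : 0 ≤ s) (hκ : 0 < κ) (hκ1 : κ ≤ 1) {y : R3}
    (hy : ‖y‖ ≤ 1) : ‖dipField s κ β β' y‖ ≤ (3 + |β| + |β'|) * s := by
  have hyi : ∀ i, |y i| ≤ 1 := fun i => (norm_le_pi_norm y i).trans hy
  rw [dipField_eq_smul, norm_smul, Real.norm_of_nonneg hs, mul_comm]
  refine mul_le_mul_of_nonneg_right ?_ hs
  refine (pi_norm_le_iff_of_nonneg (by positivity)).2 fun i => ?_
  have h2 := abs_nonneg β; have h3 := abs_nonneg β'; fin_cases i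
  · have := abs_dipProfile_one_le hκ (y 0); have := hyi 0
    show |dipProfile 1 κ (y 0)| ≤ _
    linarith
  · show |β * y 1| ≤ _
    rw [abs_mul]; have := mul_le_mul_of_nonneg_left (hyi 1) h2; linarith
  · show |β' * y 2| ≤ _
    rw [abs_mul]; have := mul_le_mul_of_nonneg_left (hyi 2) h3; linarith

/-- The leading behaviour of the local integral over a domain that passes below the singularity and
is desired outside a core. -/
theorem IsNormalizingChart.exists_tendsto_localIntegral
    (hw : NChart) (hp : IsStationaryOnSingularity U g G p) :
    ∃ R > 0, ∀ r : ℝ, 0 < r → r ≤ R → ∃ δ0 > 0, ∀ δ ≤ δ0, ∀ η : R3 → R3, IsSmallField p r δ η →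
      DesiredOn G (closedBall p r \ ball p (r / 2)) η →
      PassesBelow (fun ξ => α * g ξ) p r η →
      ∀ (F : C3 → ℂ) (C : ℂ × ℂ → ℂ) (μ : ℂ),
        DifferentiableOn ℂ F {ξ ∈ U | α * g ξ ∈ cutAbove} →
        HasPowerSingularity F p w C μ →
        Tendsto (fun Λ : ℝ => (Λ : ℂ) ^ (μ + 2) * (exp (-(I * Λ * (G (toC3 p)).re))
          * localIntegral F G p r η Λ)) atTop (𝓝 (C 0 * ‖jacobianDet w‖ * singConst μ * phaseConst β β')) := by
  obtain ⟨a, ha, C, hC, R1, hR1, δ1, hδ₁, σ, hσ, hσJ, hch⟩ := hw.exists_surfaceChart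
  have hphase := hw.isNormalPhase hp
  obtain ⟨K, hK, b1, hb1, hbt, hcombo⟩ := hphase.exists_im_combo_ge
  obtain ⟨b2, hb2, c', hc'0, hdip'⟩ := hphase.exists_im_dip_outside_ge
  set b := min (min b1 b2) 1 with hb
  have hb0 : 0 < b := by positivity
  obtain ⟨⟨hbb₁, hbb2⟩, hbb1⟩ : (b ≤ b1 ∧ b ≤ b2) ∧ b ≤ 1 := by
    simp only [← le_min_iff, hb, le_refl]
  set C' := 3 + |β| + |β'| with hC'
  have hC'0 : 0 < C' := by positivity
  refine ⟨min R1 (b / 2 / C), by positivity, fun r hr hrR => ?_⟩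
  -- In the coordinates, points outside the core have norm at least `a r/2 - Cδ`, and the choice of
  -- `δ` below makes this at least `a r/4`.
  set ρ := min (a * r / 4) 1 with hρ
  have hρ0 : 0 < ρ := by positivity
  have hρ1 : ρ ≤ 1 := min_le_right _ _
  -- Linear gain `s c'ρ²/2` against the quadratic concavity error, as for the upper side.
  set s := min (min 1 (b / C')) (c' * ρ ^ 2 / (4 * K * (C' + C) ^ 2)) with hs
  have hs0 : 0 < s := by positivity
  have hs1 : s ≤ 1 := (min_le_left _ _).trans (min_le_left _ _)
  have hsb : C' * s ≤ b := by
    rw [mul_comm, ← le_div_iff₀ hC'0]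
    exact (min_le_left _ _).trans (min_le_right _ _)
  have hsK : 2 * K * ((C' + C) * s) ^ 2 ≤ s * (c' * ρ ^ 2 / 2) := by
    have h1 : s * (4 * K * (C' + C) ^ 2) ≤ c' * ρ ^ 2 := by
      rw [← le_div_iff₀ (by positivity)]; exact min_le_right _ _
    have h2 := mul_le_mul_of_nonneg_left h1 (by positivity : 0 ≤ s / 2)
    linarith [show 2 * K * ((C' + C) * s) ^ 2 = s / 2 * (s * (4 * K * (C' + C) ^ 2)) by ring]
  refine ⟨min (min δ1 (b / 2 / C)) (min s (a * r / 4 / C)), by positivity,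
    fun δ hδ η hη hdes hbelow F Cf μ hF hsing => ?_⟩
  simp only [le_min_iff, le_div_iff₀' hC] at hrR hδ
  obtain ⟨⟨hrR, hCr⟩, ⟨hδ1, hCδ⟩, hδs, hCδr⟩ := And.intro hrR hδ
  obtain ⟨hgeo, e, θ, he, hecore⟩ := hch r δ hr hrR hδ1 η hη
  have hre : ∀ x ∈ closedBall p r, ‖reL (w (domainPt η x))‖ ≤ b := fun x hx => by
    have h1 := (hgeo x hx).2.2.2; have h2 : ‖x - p‖ ≤ r := by rwa [← dist_eq_norm, ← mem_closedBall]
    have h3 := mul_le_mul_of_nonneg_left h2 hC.le; linarith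
  set f : C3 → ℂ := fun ζ => F (w.symm ζ) * symmDet w ζ with hf
  have hfholo : DifferentiableOn ℂ f (w.target ∩ cutDomain) :=
    (hw.differentiableOn_comp_symm hF).mul (hw.differentiableOn_symmDet.mono inter_subset_left)
  -- The amplitude includes the Jacobian of the chart, whose value at the origin multiplies the
  -- leading coefficient.
  have hlead : HasLeadingPower f (Cf 0 * jacobianDet w) μ := by
    have h1 := hsing.leading_symm hw
    have h2 : Tendsto (symmDet w) (𝓝[cutDomain] 0) (𝓝 (jacobianDet w)) :=
      ((hw.differentiableOn_symmDet.continuousOn.continuousAt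
        (w.open_target.mem_nhds hw.zero_mem_target)).tendsto).mono_left nhdsWithin_le_nhds
    have h3 := h1.mul_isBigO (h2.isBigO_one ℂ)
    have h4 : (fun ζ => symmDet w ζ - jacobianDet w) =o[𝓝[cutDomain] 0]
        fun _ => (1 : ℂ) := by
      rw [isLittleO_one_iff]; have := h2.sub_const (jacobianDet w); rwa [sub_self] at this
    have h5 := (isBigO_const_mul_self (Cf 0) (fun ζ : C3 => powBelow (ζ 0) μ)
      (𝓝[cutDomain] 0)).mul_isLittleO h4
    have h6 := h3.add h5; refine (h6.congr_left fun ζ => ?_).congr_right fun ζ => mul_one _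
    rw [hf]; ring
  obtain ⟨b3, hb3, hbox⟩ := hphase.exists_tendsto_box hfholo hlead hsing.exponent
  -- The size `b3` of the box with known asymptotics depends on `F`, whereas `δ` must not. Hence
  -- `ρ`, `s` and `δ` are fixed before `F`, and only the box `ρ1` and the dip `κ` of the model adapt
  -- to it.
  set ρ1 := min ρ b3 with hρ₁; have hρ₁0 : 0 < ρ1 := by positivity
  have hρ₁ρ : ρ1 ≤ ρ := min_le_left _ _
  set κ := min (ρ1 / 8) (min b (c' * ρ1 ^ 2 / 6)) with hκ
  have hκ0 : 0 < κ := by positivity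
  have hκρ : 8 * κ ≤ ρ1 := by
    have : κ ≤ ρ1 / 8 := min_le_left _ _; linarith
  have hκb : κ ≤ b := (min_le_right _ _).trans (min_le_left _ _)
  have hκc : 6 * κ ≤ c' * ρ1 ^ 2 := by
    have : κ ≤ c' * ρ1 ^ 2 / 6 := (min_le_right _ _).trans (min_le_right _ _); linarith
  have hκc' : 6 * κ ≤ c' * ρ ^ 2 :=
    hκc.trans (mul_le_mul_of_nonneg_left (pow_le_pow_left₀ hρ₁0.le hρ₁ρ 2) hc'0.le)
  have hnorm : ∀ y : R3, ‖y‖ ≤ b → ‖dipField s κ β β' y‖ ≤ C' * s := fun y hy =>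
    norm_dipField_le hs0.le hκ0 (hκb.trans hbb1) (hy.trans hbb1)
  have hzero : ∀ y : R3, y 0 = 0 → dipField s κ β β' y 0 < 0 := fun y hy => by
    show dipProfile s κ (y 0) < 0
    rw [hy, dipProfile, zero_pow two_ne_zero, zero_add, sqrt_sq hκ0.le]
    exact mul_neg_of_pos_of_neg hs0 (by linarith)
  obtain ⟨m, hm, M, hM⟩ := hw.exists_norm_localIntegral_sub_le hp hr he isOpen_cutAbove
    (fun x hx => (hgeo x hx).1) hbelow hF (K := K) (b := b)
    (fun y θ h1 h2 => hbt y θ (h1.trans hbb₁) (h2.trans hbb₁))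
    (fun y θ0 θ1 h1 h2 h3 => hcombo y θ0 θ1 (h1.trans hbb₁) (h2.trans hbb₁) (h3.trans hbb₁))
    hre (fun x hx => (hgeo x hx).2.1.trans (by linarith))
    (θ' := dipField s κ β β') (contDiff_dipField s β β' hκ0.ne')
    (fun y hy => (hnorm y hy).trans hsb)
    (fun y θ0 t ht h1 => by
      simp only [cutAbove, complexPt, mem_ofPred_eq, add_re, ofReal_re,
        I_mul_re, ofReal_im, neg_zero, add_zero, add_im, zero_add,
        I_mul_im] at h1 ⊢
      intro h2; have h3 := h1 h2
      have h4 : (θ0 + t • (dipField s κ β β' y - θ0)) 0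
          = (1 - t) * θ0 0 + t * dipField s κ β β' y 0 := by
        rw [Pi.add_apply, Pi.smul_apply, Pi.sub_apply, smul_eq_mul]; ring
      rw [h4]; rcases eq_or_lt_of_le ht.1 with h5 | h5
      · rw [← h5]; linarith
      · have h6 : (1 - t) * θ0 0 ≤ 0 := mul_nonpos_of_nonneg_of_nonpos (by linarith [ht.2]) h3.le
        have h7 := mul_neg_of_pos_of_neg h5 (hzero y h2)
        linarith)
    (q0 := s * (c' * ρ ^ 2 / 2)) (q1 := s * (c' * ρ1 ^ 2 / 2)) (by positivity) (by positivity)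
    (fun x hx => by
      have h4 : ρ ≤ ‖reL (w (domainPt η x))‖ := by
        have h1 := (hgeo x hx.1).2.2.1
        have h2 : r / 2 ≤ ‖x - p‖ := by
          rw [← dist_eq_norm]; exact not_lt.1 hx.2
        have h3 := mul_le_mul_of_nonneg_left h2 ha.le
        have h5 : ρ ≤ a * r / 4 := min_le_left _ _; linarith
      have h1 := hdip' s κ ρ hs0 hs1 hκ0 (hκb.trans hbb2) hρ0.le hρ1 hκc' _
        ((hre x hx.1).trans hbb2) h4
      refine ⟨h1, le_trans (le_trans ?_ hsK) h1⟩
      have h2 : ‖dipField s κ β β' (reL (w (domainPt η x))) - imL (w (domainPt η x))‖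
          ≤ (C' + C) * s := by
        refine (norm_sub_le _ _).trans ?_; have h3 := (hgeo x hx.1).2.1
        have h5 := mul_le_mul_of_nonneg_left hδs hC.le
        have h6 := hnorm _ (hre x hx.1); linarith
      exact mul_le_mul_of_nonneg_left (pow_le_pow_left₀ (norm_nonneg _) h2 2) (by positivity))
    (N := closedBall 0 ρ1) isClosed_closedBall.measurableSet
    ((closedBall_subset_closedBall (by
      have h5 : ρ ≤ a * r / 4 := min_le_left _ _
      linarith)).trans hecore)
    (fun y hy => by
      obtain ⟨⟨x, hx, rfl⟩, hyN⟩ := hy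
      have hxr : x ∈ ball p r := closedBall_subset_ball (by linarith) hx
      refine hdip' s κ ρ1 hs0 hs1 hκ0 (hκb.trans hbb2) hρ₁0.le (hρ₁ρ.trans hρ1) hκc _ ?_ ?_
      · rw [← he.reL_eq hxr]; exact (hre x (ball_subset_closedBall hxr)).trans hbb2
      · rw [mem_closedBall_zero_iff, not_le] at hyN
        exact hyN.le)
    hdes
  have hlim := hbox ρ1 s κ (min_le_right _ _) hs0 hs1 hκ0 hκρ
  set X := fun Λ : ℝ => ∫ y in closedBall (0 : R3) ρ1, f (domainPt (dipField s κ β β') y)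
        * exp (I * Λ * G (w.symm (domainPt (dipField s κ β β') y)))
        * volumeDensity (dipField s κ β β') y with hX
  have hσ2 : (σ : ℂ) * σ = 1 := by
    rcases hσ with h | h <;> rw [h] <;> simp
  have hdiff : Tendsto (fun Λ : ℝ => (Λ : ℂ) ^ (μ + 2)
      * (exp (-(I * Λ * (G (toC3 p)).re))
        * (σ * localIntegral F G p r η Λ - X Λ))) atTop (𝓝 0) := by
    have h1 := (tendsto_cpow_mul_exp_neg (μ + 2) hm).const_mul M; rw [mul_zero] at h1
    refine squeeze_zero_norm' ?_ h1
    filter_upwards [eventually_ge_atTop 0] with Λ hΛ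
    have h2 : ‖exp (-(I * Λ * (G (toC3 p)).re))‖ = 1 := by
      rw [norm_exp]; simp
    rw [norm_mul, norm_mul, h2, one_mul]
    have h3 := mul_le_mul_of_nonneg_left (hM Λ hΛ) (norm_nonneg ((Λ : ℂ) ^ (μ + 2)))
    exact h3.trans (le_of_eq (by ring))
  -- Multiplication by `σ` removes the orientation sign of the change of variables, as `σ² = 1`, and
  -- turns `J` into `|J|`.
  have htot := (hdiff.add hlim).const_mul (σ : ℂ)
  have hval : (σ : ℂ) * (0 + Cf 0 * jacobianDet w * singConst μ * phaseConst β β')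
      = Cf 0 * ‖jacobianDet w‖ * singConst μ * phaseConst β β' := by
    rw [← hσJ]; ring
  rw [hval] at htot; refine htot.congr fun Λ => ?_
  show (σ : ℂ) * ((Λ : ℂ) ^ (μ + 2) * (exp (-(I * Λ * (G (toC3 p)).re))
        * (σ * localIntegral F G p r η Λ - X Λ))
      + (Λ : ℂ) ^ (μ + 2) * (exp (-(I * Λ * (G (toC3 p)).re)) * X Λ)) = _
  linear_combination (Λ : ℂ) ^ (μ + 2) * exp (-(I * Λ * (G (toC3 p)).re))
    * localIntegral F G p r η Λ * hσ2

/-! ### The leading term, and why a lower domain is never desired everywhere -/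

theorem IsNormalizingChart.jacobianDet_ne_zero (hw : NChart) :
    jacobianDet w ≠ 0 := by
  have h := hw.symmDet_mul hw.mem
  rw [hw.center, symmDet_zero] at h
  exact left_ne_zero_of_mul_eq_one h

theorem sqrt_two_pi_div_mul (β β' : ℝ) :
    √(2 * π / |β|) * √(2 * π / |β'|) = 2 * π / √|β * β'| := by
  have hpi := pi_pos
  rw [← sqrt_mul (by positivity), div_mul_div_comm, ← abs_mul,
    Real.sqrt_div (by positivity), Real.sqrt_mul_self (by positivity)]

/-- Both the asymptotic equivalence and the impossibility of a desired lower domain rest on this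
constant being nonzero. -/
theorem IsNormalizingChart.limit_ne_zero (hw : NChart)
    {C : ℂ × ℂ → ℂ} {μ : ℂ} (hC : C 0 ≠ 0) (hμ : μ = -1 ∨ ∀ n : ℤ, μ ≠ n) :
    C 0 * ‖jacobianDet w‖ * singConst μ * phaseConst β β' ≠ 0 := by
  have hpi := pi_pos
  have h1 : ∀ b : ℝ, b ≠ 0 → ((√(2 * π / |b|) : ℝ) : ℂ) ≠ 0 := fun b hb => by
    have : 0 < |b| := abs_pos.2 hb; exact_mod_cast (sqrt_pos.2 (by positivity)).ne'
  have h2 : ((‖jacobianDet w‖ : ℝ) : ℂ) ≠ 0 := by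
    exact_mod_cast norm_ne_zero_iff.2 hw.jacobianDet_ne_zero
  exact mul_ne_zero (mul_ne_zero (mul_ne_zero hC h2) (singConst_ne_zero hμ))
    (mul_ne_zero (mul_ne_zero (h1 _ hw.β₂_ne) (exp_ne_zero _))
      (mul_ne_zero (h1 _ hw.β₃_ne) (exp_ne_zero _)))

theorem IsNormalizingChart.isEquivalent_leadingTerm (hw : NChart)
    (hp : IsStationaryOnSingularity U g G p) {u : ℝ → ℂ} {C : ℂ × ℂ → ℂ} {μ : ℂ} (hC : C 0 ≠ 0)
    (hμ : μ = -1 ∨ ∀ n : ℤ, μ ≠ n)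
    (h : Tendsto (fun Λ : ℝ => (Λ : ℂ) ^ (μ + 2)
      * (exp (-(I * Λ * (G (toC3 p)).re)) * u Λ)) atTop
      (𝓝 (C 0 * ‖jacobianDet w‖ * singConst μ * phaseConst β β'))) :
    u ~[atTop] leadingTerm G p w β β' C μ := by
  have hβ := hw.β₂_ne; have hβ' := hw.β₃_ne; have hpi := pi_pos
  have h1 := (IsEquivalent.refl (u := fun Λ : ℝ =>
    exp (I * Λ * (G (toC3 p)).re)) (l := atTop)).mul
    (isEquivalent_of_tendsto_cpow_mul (hw.limit_ne_zero hC hμ) h)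
  have h0 : ((G (toC3 p)).re : ℂ) = G (toC3 p) := Complex.ext rfl (hp.real_G p hp.mem).symm
  refine (h1.congr_left ?_).congr_right ?_
  · refine .of_forall fun Λ => ?_
    simp only [Pi.mul_apply]; rw [← mul_assoc, ← exp_add, add_neg_cancel, exp_zero, one_mul]
  · filter_upwards [eventually_gt_atTop 0] with Λ hΛ
    have hΛc : (Λ : ℂ) ≠ 0 := by exact_mod_cast hΛ.ne'
    simp only [Pi.mul_apply]
    have h2 : (Λ : ℂ) ^ (-(μ + 2)) = (Λ : ℂ) ^ (-μ - 1) * (Λ : ℂ)⁻¹ := by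
      rw [← cpow_neg_one, ← cpow_add _ _ hΛc]; congr 1; ring
    have h3 : ((2 * π * ‖jacobianDet w‖ / (Λ * √|β * β'|) : ℝ) : ℂ)
        = (Λ : ℂ)⁻¹ * ‖jacobianDet w‖ * (√(2 * π / |β|) * √(2 * π / |β'|)) := by
      rw [← ofReal_mul (√(2 * π / |β|)), sqrt_two_pi_div_mul,
        ← ofReal_inv, ← ofReal_mul, ← ofReal_mul]
      congr 1; have : 0 < √|β * β'| := sqrt_pos.2 (abs_pos.2 (mul_ne_zero hβ hβ'))
      field_simp
    have h4 : exp (I * (Λ : ℂ) * G (toC3 p)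
          + I * (π : ℂ) / 4 * ((sign β + sign β' : ℝ) : ℂ))
        = exp (I * Λ * (G (toC3 p)).re)
          * (exp (I * π / 4 * sign β)
          * exp (I * π / 4 * sign β')) := by
      rw [← exp_add, ← exp_add, h0, ofReal_add]; congr 1; ring
    rw [leadingTerm, Phi, phaseConst, h2, h3, h4]; ring

/-- The reciprocal of the first coordinate has a power singularity. -/
theorem IsNormalizingChart.hasPowerSingularity_inv (hw : NChart) :
    HasPowerSingularity (fun ξ => (α * g ξ)⁻¹) p w (fun _ => 1) (-1) where
  analyticAt := analyticAt_const
  ne_zero := one_ne_zero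
  exponent := Or.inl rfl
  leading := by
    have h1 : (fun ξ => (α * g ξ)⁻¹ - 1 * powBelow (w ξ 0) (-1))
        =ᶠ[𝓝[{ξ | w ξ 0 ∈ cutAbove}] (toC3 p)] fun _ => 0 := by
      filter_upwards [self_mem_nhdsWithin,
        nhdsWithin_le_nhds (w.open_source.mem_nhds hw.mem)] with ξ h2 h3
      have h4 : w ξ 0 ≠ 0 := fun h0 => by
        have h5 : w ξ 0 ∈ cutAbove := h2; rw [h0] at h5; exact lt_irrefl _ (h5 rfl)
      rw [← hw.first ξ h3, powBelow_neg_one h4, one_mul, sub_self]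
    exact (isLittleO_zero _ _).congr' h1.symm (EventuallyEq.refl _ _)

/-- The local integral over a domain that is desired everywhere is exponentially small. -/
theorem exists_norm_localIntegral_le {F : C3 → ℂ} {r : ℝ} {η : R3 → R3} (hη : ContDiff ℝ ∞ η)
    (hF : ContinuousOn (fun x => F (domainPt η x)) (closedBall p r))
    (hG : ContinuousOn (fun x => G (domainPt η x)) (closedBall p r))
    (hdes : DesiredOn G (closedBall p r) η) :
    ∃ m > 0, ∃ M : ℝ, ∀ Λ : ℝ, 0 ≤ Λ → ‖localIntegral F G p r η Λ‖ ≤ M * Real.exp (-(m * Λ)) := by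
  obtain ⟨m, hm, hle⟩ : ∃ m > 0, ∀ x ∈ closedBall p r, m ≤ (G (domainPt η x)).im := by
    rcases (closedBall p r).eq_empty_or_nonempty with h | h
    · exact ⟨1, one_pos, fun x hx => absurd hx (by rw [h]; exact notMem_empty x)⟩
    · obtain ⟨x0, hx₀, hmin⟩ := (isCompact_closedBall p r).exists_isMinOn h
        (continuous_im.comp_continuousOn hG)
      exact ⟨_, hdes x0 hx₀, fun x hx => hmin hx⟩
  have hvd : ContinuousOn (volumeDensity η) (closedBall p r) :=
    (continuousOn_volumeDensity isOpen_univ hη.contDiffOn).mono (subset_univ _)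
  have hint : IntegrableOn (fun x => ‖F (domainPt η x) * volumeDensity η x‖) (closedBall p r) :=
    (hF.mul hvd).norm.integrableOn_compact (isCompact_closedBall p r)
  refine ⟨m, hm, ∫ x in closedBall p r, ‖F (domainPt η x) * volumeDensity η x‖, fun Λ hΛ => ?_⟩
  refine (norm_integral_le_integral_norm _).trans ?_; rw [← integral_mul_const]
  refine setIntegral_mono_on ?_ (hint.mul_const _) isClosed_closedBall.measurableSet fun x hx => ?_
  · exact ((hF.mul (continuousOn_const.mul hG).cexp).mul hvd).norm.integrableOn_compact
      (isCompact_closedBall p r)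
  · rw [norm_mul, norm_mul, norm_exp_phase, norm_mul]
    have h4 : Real.exp (-(Λ * (G (domainPt η x)).im)) ≤ Real.exp (-(m * Λ)) := by
      refine exp_le_exp.2 ?_; have := mul_le_mul_of_nonneg_left (hle x hx) hΛ; linarith
    have h5 := mul_le_mul_of_nonneg_left h4
      (by positivity : 0 ≤ ‖F (domainPt η x)‖ * ‖volumeDensity η x‖)
    linarith

/-- A domain that passes below the singularity cannot be desired everywhere. -/
theorem not_desiredOn_of_tendsto
    (hp : IsStationaryOnSingularity U g G p) {r : ℝ} {η : R3 → R3} (hη : ContDiff ℝ ∞ η)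
    (hU : ∀ x ∈ closedBall p r, domainPt η x ∈ U)
    (hbelow : PassesBelow (fun ξ => α * g ξ) p r η) {L : ℂ} (hL : L ≠ 0)
    (h : Tendsto (fun Λ : ℝ => (Λ : ℂ) ^ ((-1 : ℂ) + 2)
      * (exp (-(I * Λ * (G (toC3 p)).re))
        * localIntegral (fun ξ => (α * g ξ)⁻¹) G p r η Λ)) atTop (𝓝 L)) :
    ¬ DesiredOn G (closedBall p r) η := by
  intro hdes
  have hηc : Continuous (domainPt η) :=
    continuousOn_univ.1 (contDiffOn_domainPt hη.contDiffOn).continuousOn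
  have hGc : ContinuousOn (fun x => G (domainPt η x)) (closedBall p r) :=
    hp.holo_G.continuousOn.comp hηc.continuousOn hU
  have hgc : ContinuousOn (fun x => g (domainPt η x)) (closedBall p r) :=
    hp.holo_g.continuousOn.comp hηc.continuousOn hU
  have hFc : ContinuousOn (fun x => ((α : ℂ) * g (domainPt η x))⁻¹) (closedBall p r) := by
    refine (continuousOn_const.mul hgc).inv₀ fun x hx hx0 => ?_
    have h0 : (α : ℂ) * g (domainPt η x) = 0 := hx0
    have h1 : ((α : ℂ) * g (domainPt η x)).im < 0 := hbelow x hx (by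
      show ((α : ℂ) * g (domainPt η x)).re = 0
      rw [h0, zero_re])
    rw [h0, zero_im] at h1; exact lt_irrefl _ h1
  obtain ⟨m, hm, M, hM⟩ := exists_norm_localIntegral_le
    (F := fun ξ => (α * g ξ)⁻¹) hη hFc hGc hdes
  -- If the domain were desired everywhere, the integral would be exponentially small and its
  -- normalized limit zero, contrary to `hL`.
  refine hL (tendsto_nhds_unique h (squeeze_zero_norm' ?_ (by
    have h1 := (tendsto_cpow_mul_exp_neg ((-1 : ℂ) + 2) hm).const_mul M
    rwa [mul_zero] at h1)))
  filter_upwards [eventually_ge_atTop 0] with Λ hΛ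
  have h2 : ‖exp (-(I * Λ * (G (toC3 p)).re))‖ = 1 := by
    rw [norm_exp]; simp
  rw [norm_mul, norm_mul, h2, one_mul]
  have h3 := mul_le_mul_of_nonneg_left (hM Λ hΛ) (norm_nonneg ((Λ : ℂ) ^ ((-1 : ℂ) + 2)))
  exact h3.trans (le_of_eq (by ring))

/-! ### Construction of the deformations -/

/-- A domain that passes the singularity on one side over a larger cube may be shifted further to
that side. -/
theorem IsNormalizingChart.exists_shift_avoids (hw : NChart) {n : R3}
    (hn : realDeriv w p n = Pi.single 0 1) (hn0 : n ≠ 0) :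
    ∃ R > 0, ∃ δ0 > 0, ∀ r δ : ℝ, 0 < r → r ≤ R → δ ≤ δ0 → ∀ η : R3 → R3,
      IsSmallField p (2 * r) δ η → ∀ ς : ℝ, (ς = 1 ∨ ς = -1) →
      (∀ x ∈ closedBall p (2 * r), (α * g (domainPt η x)).re = 0 →
        0 < ς * (α * g (domainPt η x)).im) →
      ∀ d : ℝ, 0 ≤ d → d * ‖n‖ ≤ r → ∀ x ∈ closedBall p r,
        g (complexPt x (η x + (ς * d) • n)) ≠ 0 := by
  have hnpos : 0 < ‖n‖ := norm_pos_iff.2 hn0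
  -- The two points compared below differ by at most `d‖n‖` in the real and `2d‖n‖` in the imaginary
  -- part, so this constant makes the error of the linear approximation at most `d/4`.
  obtain ⟨R, hR, hsrc, hst⟩ := hw.exists_strict (c := 1 / (12 * ‖n‖)) (by positivity)
  refine ⟨R / 2, by positivity, min (min 1 (R / 2)) (1 / (4 * (‖realDeriv w p‖ + 1) * ‖n‖)),
    by positivity, fun r δ hr hrR hδ η hη ς hς hside d hd hdn x hx h0 => ?_⟩
  have hδ1 : δ ≤ 1 := (hδ.trans (min_le_left _ _)).trans (min_le_left _ _)
  have hδR : δ ≤ R / 2 := (hδ.trans (min_le_left _ _)).trans (min_le_right _ _)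
  have hδ0 : 0 ≤ δ := (norm_nonneg _).trans (hη.2 p (mem_closedBall_self (by positivity))).1
  have hδL : ‖realDeriv w p‖ * (δ * ‖n‖) ≤ 1 / 4 := by
    have h1 : δ * (4 * (‖realDeriv w p‖ + 1) * ‖n‖) ≤ 1 := by
      rw [← le_div_iff₀ (by positivity)]
      exact hδ.trans (min_le_right _ _)
    have h2 : 0 ≤ δ * ‖n‖ := by positivity
    linarith [show δ * (4 * (‖realDeriv w p‖ + 1) * ‖n‖)
      = 4 * (‖realDeriv w p‖ * (δ * ‖n‖)) + 4 * (δ * ‖n‖) by ring]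
  have hς1 : |ς| = 1 := by rcases hς with h | h <;> simp [h]
  have hςς : ς * ς = 1 := by rcases hς with h | h <;> simp [h]
  have hxp : ‖x - p‖ ≤ r := by rwa [← dist_eq_norm, ← mem_closedBall]
  set ξ := complexPt x (η x + (ς * d) • n) with hξ
  -- Suppose the shifted point over `x` lies on the singularity. Relative to it, the unshifted
  -- domain over `x + tn` has `w₁ ≈ t - iςd`. So its real part vanishes for some `t ∈ [-d, d]`, and
  -- there the imaginary part has the wrong sign. This line through `x` is the reason for the larger
  -- cube.
  set pt : ℝ → R3 := fun t => x + t • n with hpt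
  have hptn : ∀ t ∈ Icc (-d) d, ‖pt t - x‖ ≤ d * ‖n‖ := fun t ht => by
    rw [hpt]; simp only [add_sub_cancel_left]; rw [norm_smul]
    exact mul_le_mul_of_nonneg_right (abs_le.2 ht) hnpos.le
  have hpt2 : ∀ t ∈ Icc (-d) d, pt t ∈ closedBall p (2 * r) := fun t ht => by
    rw [mem_closedBall, dist_eq_norm]
    have h1 : pt t - p = (pt t - x) + (x - p) := by abel
    rw [h1]; exact (norm_add_le _ _).trans (by linarith [hptn t ht])
  have hx2 : x ∈ closedBall p (2 * r) := closedBall_subset_closedBall (by linarith) hx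
  have hball : ∀ z ∈ closedBall p (2 * r), ‖z - p‖ ≤ R := fun z hz => by
    rw [mem_closedBall, dist_eq_norm] at hz; linarith
  have hηR : ∀ z ∈ closedBall p (2 * r), ‖η z‖ ≤ R := fun z hz => (hη.2 z hz).1.trans (by linarith)
  have hshift : ‖η x + (ς * d) • n‖ ≤ R := by
    refine (norm_add_le _ _).trans ?_
    rw [norm_smul, norm_eq_abs, abs_mul, hς1, one_mul, abs_of_nonneg hd]
    linarith [(hη.2 x hx2).1]
  have hdiff : ∀ t ∈ Icc (-d) d, ‖η (pt t) - η x‖ ≤ δ * (d * ‖n‖) := fun t ht => by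
    have h1 := (convex_closedBall p (2 * r)).norm_image_sub_le_of_norm_hasFDerivWithin_le
      (f := η) (f' := fderiv ℝ η) (C := δ)
      (fun z _ => (hη.1.contDiffAt.differentiableAt (by simp)).hasFDerivAt.hasFDerivWithinAt)
      (fun z hz => (hη.2 z hz).2) hx2 (hpt2 t ht)
    exact h1.trans (mul_le_mul_of_nonneg_left (hptn t ht) hδ0)
  have hfirst : ∀ z ∈ closedBall p (2 * r),
      w (domainPt η z) 0 = α * g (domainPt η z) := fun z hz =>
    hw.first _ (hsrc z (η z) (hball z hz) (hηR z hz)).1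
  have hξ0 : w ξ 0 = 0 := by rw [hw.first ξ (hsrc x _ (hball x hx2) hshift).1, h0, mul_zero]
  have hkey : ∀ t ∈ Icc (-d) d, ‖w (domainPt η (pt t)) 0 - (t + I *
      (realDeriv w p (η (pt t) - η x) 0 - ς * d : ℝ))‖ ≤ d / 4 := fun t ht => by
    have h1 := hst (pt t) (η (pt t)) x (η x + (ς * d) • n) (hball _ (hpt2 t ht))
      (hηR _ (hpt2 t ht)) (hball x hx2) hshift
    have h2 : pt t - x = t • n := by simp [hpt]
    have h3 : η (pt t) - (η x + (ς * d) • n) = (η (pt t) - η x) - (ς * d) • n := by abel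
    have h4 := (norm_le_pi_norm _ 0).trans h1
    rw [Pi.sub_apply, Pi.sub_apply, ← hξ, hξ0, sub_zero, h2, h3, map_smul, hn] at h4
    have h5 : complexPt (t • (Pi.single 0 1 : R3)) (realDeriv w p (η (pt t) - η x - (ς * d) • n)) 0
        = t + I * (realDeriv w p (η (pt t) - η x) 0 - ς * d : ℝ) := by
      rw [map_sub, map_smul, hn]; simp [complexPt]
    rw [h5, ← domainPt_eq_complexPt] at h4; refine h4.trans ?_
    have h6 : ‖t • n‖ ≤ d * ‖n‖ := h2 ▸ hptn t ht
    have h7 : ‖η (pt t) - η x - (ς * d) • n‖ ≤ 2 * (d * ‖n‖) := by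
      refine (norm_sub_le _ _).trans ?_
      rw [norm_smul, norm_eq_abs, abs_mul, hς1, one_mul, abs_of_nonneg hd]
      have := mul_le_mul_of_nonneg_right hδ1 (by positivity : 0 ≤ d * ‖n‖); linarith [hdiff t ht]
    refine (mul_le_mul_of_nonneg_left (add_le_add h6 h7) (by positivity)).trans (le_of_eq ?_)
    field_simp; ring
  have hre : ∀ t ∈ Icc (-d) d, |(w (domainPt η (pt t)) 0).re - t| ≤ d / 4 := fun t ht => by
    have h1 := (abs_re_le_norm _).trans (hkey t ht); simpa using h1
  have hcont : ContinuousOn (fun t => (w (domainPt η (pt t)) 0).re) (Icc (-d) d) := by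
    have h1 : Continuous (domainPt η) :=
      continuousOn_univ.1 (contDiffOn_domainPt hη.1.contDiffOn).continuousOn
    have h2 : ContinuousOn (fun t => w (domainPt η (pt t))) (Icc (-d) d) :=
      w.continuousOn.comp (h1.comp (by fun_prop : Continuous pt)).continuousOn fun t ht =>
        (hsrc _ _ (hball _ (hpt2 t ht)) (hηR _ (hpt2 t ht))).1
    exact continuous_re.comp_continuousOn ((continuous_apply 0).comp_continuousOn h2)
  have hdd : -d ≤ d := by linarith
  obtain ⟨t, ht, ht0⟩ := intermediate_value_Icc hdd hcont (show (0 : ℝ) ∈ Icc _ _ by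
    have h1 := abs_le.1 (hre (-d) ⟨le_rfl, hdd⟩)
    have h2 := abs_le.1 (hre d ⟨hdd, le_rfl⟩)
    constructor <;> linarith [h1.2, h2.1])
  have ht0' : (w (domainPt η (pt t)) 0).re = 0 := ht0
  have h1 := hside (pt t) (hpt2 t ht) (by rw [← hfirst _ (hpt2 t ht)]; exact ht0')
  rw [← hfirst _ (hpt2 t ht)] at h1
  have h2 := (abs_im_le_norm _).trans (hkey t ht)
  have h3 : |(w (domainPt η (pt t)) 0).im - (realDeriv w p (η (pt t) - η x) 0 - ς * d)| ≤ d / 4 := by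
    simpa using h2
  have h4 : |realDeriv w p (η (pt t) - η x) 0| ≤ d / 4 := by
    refine (norm_le_pi_norm (realDeriv w p (η (pt t) - η x)) 0).trans
      ((le_opNorm _ _).trans ?_)
    have h5 := mul_le_mul_of_nonneg_left (hdiff t ht) (norm_nonneg (realDeriv w p))
    have h6 := mul_le_mul_of_nonneg_right hδL hd; linarith
  have h5 := abs_le.1 h3; have h6 := abs_le.1 h4
  rcases hς with h | h <;> rw [h] at h1 h5 <;> linarith [h5.1, h5.2, h6.1, h6.2]

/-- The combinations of fields that occur in the deformations are small. -/
theorem isSmallField_combination {r δ ε s M A B D : ℝ} {η v : R3 → R3} {n : R3}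
    (hη : IsSmallField p (2 * r) δ η) (hr : 0 < r) (hv : ContDiff ℝ ∞ v)
    (hvM : ∀ x ∈ closedBall p r, ‖v x‖ ≤ M ∧ ‖fderiv ℝ v x‖ ≤ M)
    (hA : |A| ≤ 1) (hB : |B| * ‖n‖ ≤ s) (hD : |D| * M ≤ s) (hε : δ + 2 * s ≤ ε) :
    IsSmallField p r ε (fun x => A • η x + B • n + D • v x) := by
  have hs : 0 ≤ s := (by positivity : 0 ≤ |B| * ‖n‖).trans hB
  refine ⟨((hη.1.const_smul A).add contDiff_const).add (hv.const_smul D), fun x hx => ?_⟩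
  have h1 := hη.2 x (closedBall_subset_closedBall (by linarith) hx); have h2 := hvM x hx
  have hbound : ∀ a b : ℝ, 0 ≤ a → a ≤ δ → b ≤ M → |A| * a + |D| * b ≤ δ + s :=
    fun a b ha h3 h4 => by
    have h5 := mul_le_mul_of_nonneg_right hA ha
    have h6 := mul_le_mul_of_nonneg_left h4 (abs_nonneg D); linarith
  constructor
  · refine (norm_add_le _ _).trans ((add_le_add_left (norm_add_le _ _) _).trans ?_)
    rw [norm_smul, norm_smul, norm_smul, norm_eq_abs, norm_eq_abs, norm_eq_abs]
    linarith [hbound _ _ (norm_nonneg _) h1.1 h2.1]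
  · have h3 : HasFDerivAt (fun x => A • η x + B • n + D • v x)
        (A • fderiv ℝ η x + D • fderiv ℝ v x) x :=
      (((hη.1.contDiffAt.differentiableAt (by simp)).hasFDerivAt.const_smul A).add_const _).add
        ((hv.contDiffAt.differentiableAt (by simp)).hasFDerivAt.const_smul D)
    rw [h3.fderiv]; refine (norm_add_le _ _).trans ?_
    rw [norm_smul, norm_smul, norm_eq_abs, norm_eq_abs]
    linarith [hbound _ _ (norm_nonneg _) h1.2 h2.2]

/-- In the coordinates `w` the phase is Lipschitz near the origin. -/
theorem IsNormalPhase.exists_lipschitz {V : Set C3} {Γ : C3 → ℂ} {γ : ℝ}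
    (h : IsNormalPhase V Γ γ β β') : ∃ K ≥ 1, ∃ b > 0, ∀ ζ ζ' : C3, ‖ζ‖ ≤ b → ‖ζ'‖ ≤ b →
      |(Γ ζ).im - (Γ ζ').im| ≤ K * ‖ζ - ζ'‖ := by
  have hC : ContDiffAt ℂ 1 Γ 0 := ((contDiffOn_infty_of_holomorphic h.isOpen h.holo).contDiffAt
    (h.isOpen.mem_nhds h.zero_mem)).of_le (by simp)
  obtain ⟨K, t, ht, hK⟩ := hC.exists_lipschitzOnWith
  obtain ⟨b, hb, hball⟩ := nhds_basis_closedBall.mem_iff.1 ht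
  refine ⟨K + 1, by simp, b, hb, fun ζ ζ' hζ hζ' => ?_⟩
  have h1 := hK.dist_le_mul ζ (hball (mem_closedBall_zero_iff.2 hζ)) ζ'
    (hball (mem_closedBall_zero_iff.2 hζ'))
  rw [dist_eq_norm, dist_eq_norm] at h1; rw [← sub_im]
  refine (abs_im_le_norm _).trans (h1.trans ?_)
  exact mul_le_mul_of_nonneg_right (by linarith) (norm_nonneg _)

theorem IsNormalizingChart.toC3_reL (hw : NChart) {x : R3}
    (hx : toC3 x ∈ w.source) : toC3 (reL (w (toC3 x))) = w (toC3 x) := by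
  conv_rhs => rw [← complexPt_reL_imL (w (toC3 x)), hw.im_eq_zero hx, complexPt_zero]

/-- A domain that passes above the singularity can be deformed to a desired one. -/
theorem IsNormalizingChart.exists_deformation_above (hw : NChart)
    (hp : IsStationaryOnSingularity U g G p) :
    ∃ R > 0, ∀ r : ℝ, 0 < r → r ≤ R → ∀ ε > 0, ∃ δ0 > 0, ∀ δ ≤ δ0, ∀ η0 : R3 → R3,
      IsSmallField p (2 * r) δ η0 → PassesAbove (fun ξ => α * g ξ) p (2 * r) η0 →
      ∃ η : ℝ → R3 → R3, IsAllowedDeformation g p r ε η ∧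
        (∀ x ∈ closedBall p r, η 0 x = η0 x) ∧
        DesiredOn G (closedBall p r) (η 1) := by
  obtain ⟨n, hn0, hn⟩ := hw.exists_normal
  have hnpos : 0 < ‖n‖ := norm_pos_iff.2 hn0
  have hphase := hw.isNormalPhase hp
  obtain ⟨K, hK1, b1, hb1, hlip⟩ := hphase.exists_lipschitz; have hK : 0 < K := by linarith
  obtain ⟨b2, hb2, hconst⟩ := hphase.exists_im_const_ge; set L := realDeriv w p with hL
  set c := 1 / (16 * K * (‖n‖ + 1)) with hc
  have hc0 : 0 < c := by positivity
  obtain ⟨R1, hR1, hsrc, hst⟩ := hw.exists_strict hc0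
  obtain ⟨R2, hR2, δ2, hδ₂, hshift⟩ := hw.exists_shift_avoids hn hn0; set b := min b1 b2 with hb
  have hb0 : 0 < b := by positivity
  have hbb1 : b ≤ b1 := min_le_left _ _
  have hbb2 : b ≤ b2 := min_le_right _ _
  refine ⟨min (min R1 R2) (b / 4 / (‖L‖ + c)), by positivity, fun r hr hrR ε hε => ?_⟩
  simp only [le_min_iff, le_div_iff₀' (by positivity : 0 < ‖L‖ + c)] at hrR
  obtain ⟨⟨hrR1, hrR2⟩, hrb⟩ := hrR
  set s := min (b / 4) (min (r / ‖n‖) (min (R1 / 2 / ‖n‖) (ε / 4 / ‖n‖))) with hs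
  have hs0 : 0 < s := by positivity
  have hs' := hs.le; simp only [le_min_iff, le_div_iff₀ hnpos] at hs'
  obtain ⟨hsb, hsr, hsR, hsε⟩ := hs'
  refine ⟨min (min δ2 (R1 / 2)) (min (ε / 2) (s / 16 / (K * (c + ‖L‖)))),
    by positivity, fun δ hδ η0 hη0 habove => ?_⟩
  simp only [le_min_iff, le_div_iff₀' (by positivity : 0 < K * (c + ‖L‖)), mul_assoc] at hδ
  obtain ⟨⟨hδ2, hδR⟩, hδε, hδs⟩ := hδ
  have hδ0 : 0 ≤ δ := (norm_nonneg _).trans (hη0.2 p (mem_closedBall_self (by positivity))).1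
  have hδs' : (c + ‖L‖) * δ ≤ s / 16 := (le_mul_of_one_le_left (by positivity) hK1).trans hδs
  have hfield : ∀ (τ : ℝ) (x : R3), η0 x + (1 * (τ * s)) • n
      = (1 : ℝ) • η0 x + (τ * s) • n + (0 : ℝ) • (0 : R3) := fun τ x => by module
  have hsub : ∀ {x}, x ∈ closedBall p r → x ∈ closedBall p (2 * r) := fun hx =>
    closedBall_subset_closedBall (by linarith) hx
  have hηc := hη0.1.continuous
  -- The deformation is a uniform shift along `n`; the factor `1` is the sign `ς` of
  -- `exists_shift_avoids`.
  refine ⟨fun τ x => η0 x + (1 * (τ * s)) • n, ⟨?_, fun τ hτ => ?_, fun τ hτ x hx => ?_⟩,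
    fun x _ => by simp, fun x hx => ?_⟩
  · exact Continuous.continuousOn (by fun_prop)
  · simp only [hfield]
    refine isSmallField_combination (M := 0) (s := s * ‖n‖) hη0 hr contDiff_const
      (fun x _ => by simp) (by simp) ?_ (by simp; positivity) (by linarith)
    rw [abs_of_nonneg (mul_nonneg hτ.1 hs0.le)]
    exact mul_le_mul_of_nonneg_right (mul_le_of_le_one_left hs0.le hτ.2) hnpos.le
  · refine hshift r δ hr hrR2 hδ2 η0 hη0 1 (Or.inl rfl)
      (fun x hx h0 => by rw [one_mul]; exact habove x hx h0) (τ * s) (mul_nonneg hτ.1 hs0.le) ?_ x hx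
    exact (mul_le_mul_of_nonneg_right (mul_le_of_le_one_left hs0.le hτ.2) hnpos.le).trans hsr
  · have hηx := (hη0.2 x (hsub hx)).1
    have hxp : ‖x - p‖ ≤ r := by rwa [← dist_eq_norm, ← mem_closedBall]
    have hfield1 : η0 x + (1 * (1 * s)) • n = η0 x + s • n := by rw [one_mul, one_mul]
    set y := reL (w (toC3 x)) with hy
    have hη1 : ‖η0 x + s • n‖ ≤ δ + s * ‖n‖ := by
      refine (norm_add_le _ _).trans ?_
      rw [norm_smul, Real.norm_of_nonneg hs0.le]; linarith
    have hx0 : toC3 x ∈ w.source := by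
      have := (hsrc x 0 (hxp.trans hrR1) (by simpa using hR1.le)).1; rwa [complexPt_zero] at this
    have h1 := hst x (η0 x + s • n) x 0 (hxp.trans hrR1) (by linarith) (hxp.trans hrR1)
      (by simpa using hR1.le)
    rw [complexPt_zero, ← hw.toC3_reL hx0, ← hy, sub_self, map_zero, norm_zero, zero_add, sub_zero,
      ← hL, map_add, map_smul, hn] at h1
    set ξ := complexPt x (η0 x + s • n) with hξ
    -- Comparison with the model point `y + i s e₁`, where the phase is at least `s/2`. The initial
    -- field and the nonlinearity of the chart change the phase by at most `s/16` each.
    have h2 : w ξ - complexPt y (s • ![1, 0, 0])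
        = (w ξ - toC3 y - complexPt 0 (L (η0 x) + s • Pi.single 0 1)) + complexPt 0 (L (η0 x)) := by
      funext i; fin_cases i <;> simp [complexPt, toC3]; ring
    have h3 : ‖w ξ - complexPt y (s • ![1, 0, 0])‖ ≤ (c + ‖L‖) * δ + c * (s * ‖n‖) := by
      rw [h2]; refine (norm_add_le _ _).trans ?_
      have e1 := (norm_complexPt_le 0 (L (η0 x))).trans (add_le_add_right (L.le_opNorm _) _)
      rw [norm_zero, zero_add] at e1; have e2 := mul_le_mul_of_nonneg_left hη1 hc0.le
      have e3 := mul_le_mul_of_nonneg_left hηx (norm_nonneg L); linarith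
    have h4 : K * (c * (s * ‖n‖)) ≤ s / 16 := by
      have e1 : K * (c * (s * ‖n‖)) = s / 16 * (‖n‖ / (‖n‖ + 1)) := by
        rw [hc]; field_simp
      rw [e1]; refine mul_le_of_le_one_right (by positivity) ?_
      rw [div_le_one (by positivity)]; linarith
    have h5 : ‖y‖ ≤ b / 4 := by
      have e1 := hst x 0 p 0 (hxp.trans hrR1) (by simpa using hR1.le) (by simpa using hR1.le)
        (by simpa using hR1.le)
      rw [complexPt_zero, complexPt_zero, hw.center, sub_zero, sub_self, norm_zero, add_zero,
        map_zero, complexPt_zero, ← hw.toC3_reL hx0, ← toC3_sub, norm_toC3, ← hy, ← hL] at e1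
      have e2 : ‖y‖ ≤ ‖y - L (x - p)‖ + ‖L (x - p)‖ := by
        simpa using norm_add_le (y - L (x - p)) (L (x - p))
      have e3 := L.le_opNorm (x - p)
      have e4 := mul_le_mul_of_nonneg_left hxp (by positivity : 0 ≤ ‖L‖ + c); linarith
    have h6 : ‖complexPt y (s • ![1, 0, 0])‖ ≤ b / 2 := by
      refine (norm_complexPt_le _ _).trans ?_
      have e1 : ‖s • (![1, 0, 0] : R3)‖ ≤ s := by
        refine (pi_norm_le_iff_of_nonneg hs0.le).2 fun i => ?_
        fin_cases i <;> simp [abs_of_pos hs0, hs0.le]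
      linarith
    have h7 : ‖w ξ‖ ≤ b := by
      have e1 := norm_le_norm_sub_add (w ξ) (complexPt y (s • ![1, 0, 0]))
      have e2 : c * (s * ‖n‖) ≤ s / 16 := (le_mul_of_one_le_left (by positivity) hK1).trans h4
      linarith
    have h8 := hlip _ _ (h7.trans hbb1) (h6.trans (by linarith))
    have h9 := (hconst s hs0 (by linarith) y (by linarith)).2
    have h10 := mul_le_mul_of_nonneg_left h3 hK.le; have h11 := (abs_le.1 h8).1
    have hξs : ξ ∈ w.source := (hsrc x _ (hxp.trans hrR1) (by linarith)).1
    rw [w.left_inv hξs] at h11; show 0 < (G (complexPt x (η0 x + (1 * (1 * s)) • n))).im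
    rw [hfield1, ← hξ]; linarith

/-- The coordinates of a point near a real one, up to a quadratic error. -/
theorem IsNormalizingChart.exists_taylor (hw : NChart) :
    ∃ C > 0, ∃ R > 0, ∀ x η : R3, ‖x - p‖ ≤ R → ‖η‖ ≤ R →
      ‖w (complexPt x η) - complexPt (reL (w (toC3 x))) (realDeriv w x η)‖ ≤ C * ‖η‖ ^ 2 := by
  have hC : ContDiffAt ℂ 1 (fderiv ℂ w) (toC3 p) :=
    ((contDiffOn_pi_infty_of_holomorphic w.open_source hw.holo).contDiffAt
      (w.open_source.mem_nhds hw.mem)).fderiv_right (m := 1) (by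
        rw [one_add_one_eq_two]
        exact ENat.LEInfty.out)
  obtain ⟨K, t, ht, hK⟩ := hC.exists_lipschitzOnWith
  obtain ⟨b, hb, hball⟩ := nhds_basis_closedBall.mem_iff.1
    (inter_mem ht (w.open_source.mem_nhds hw.mem))
  refine ⟨K + 1, by positivity, b / 2, by positivity, fun x η hx hη => ?_⟩
  have hmem : ∀ ξ ∈ closedBall (toC3 x) ‖η‖, ξ ∈ t ∩ w.source := fun ξ hξ => hball (by
    rw [mem_closedBall, dist_eq_norm] at hξ ⊢
    have h1 : ‖toC3 x - toC3 p‖ ≤ b / 2 := by rwa [← toC3_sub, norm_toC3]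
    exact (norm_sub_le_norm_sub_add_norm_sub ξ (toC3 x) (toC3 p)).trans (by linarith))
  have hx0 : toC3 x ∈ closedBall (toC3 x) ‖η‖ := mem_closedBall_self (norm_nonneg _)
  have hsub : complexPt x η - toC3 x = complexPt 0 η := by
    rw [← complexPt_zero, complexPt_sub, sub_self, sub_zero]
  have hxη : ‖complexPt x η - toC3 x‖ ≤ ‖η‖ := by
    rw [hsub]; simpa using norm_complexPt_le 0 η
  have h1 := (convex_closedBall (toC3 x) ‖η‖).norm_image_sub_le_of_norm_hasFDerivWithin_le'
    (f := w) (f' := fderiv ℂ w) (φ := fderiv ℂ w (toC3 x)) (C := K * ‖η‖) (𝕜 := ℂ)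
    (fun ξ hξ => (hw.hasFDerivAt (hmem ξ hξ).2).hasFDerivWithinAt)
    (fun ξ hξ => by
      have h2 := hK.dist_le_mul ξ (hmem ξ hξ).1 (toC3 x) (hmem _ hx0).1; rw [dist_eq_norm] at h2
      exact h2.trans (mul_le_mul_of_nonneg_left hξ K.2))
    (x := toC3 x) (y := complexPt x η) hx0
    (by rwa [mem_closedBall, dist_eq_norm])
  have h3 : w (complexPt x η) - complexPt (reL (w (toC3 x))) (realDeriv w x η)
      = w (complexPt x η) - w (toC3 x) - fderiv ℂ w (toC3 x) (complexPt x η - toC3 x) := by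
    rw [hsub, hw.fderiv_complexPt (hmem _ hx0).2, map_zero, sub_sub, complexPt_eq (reL _),
      hw.toC3_reL (hmem _ hx0).2, complexPt_eq 0, show toC3 0 = 0 from toC3L.map_zero, zero_add]
  rw [h3]; refine h1.trans ?_
  have h4 := mul_le_mul_of_nonneg_left hxη (by positivity : 0 ≤ K * ‖η‖); nlinarith [sq_nonneg ‖η‖]

/-- A smooth real field with a given direction in the coordinates `w`. -/
theorem IsNormalizingChart.exists_field (hw : NChart) {r : ℝ}
    (hr : ∀ x ∈ closedBall p r, toC3 x ∈ w.source) {k : R3 → R3} (hk : ContDiff ℝ ∞ k) :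
    ∃ v : R3 → R3, ContDiff ℝ ∞ v ∧
      (∃ M > 0, ∀ x ∈ closedBall p r, ‖v x‖ ≤ M ∧ ‖fderiv ℝ v x‖ ≤ M) ∧
      ∀ x ∈ closedBall p r, realDeriv w x (v x) = k (reL (w (toC3 x))) := by
  set Y : Set R3 := {x | toC3 x ∈ w.source} with hY
  have hYo : IsOpen Y := w.open_source.preimage toC3L.continuous
  obtain ⟨χ, hχ, -, hχY, -, hχ1⟩ := exists_contDiff_one_near (isCompact_closedBall p r) hYo hr
  set u : R3 → R3 := fun x => reL (fderiv ℂ w.symm (w (toC3 x)) (toC3 (k (reL (w (toC3 x))))))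
    with hu
  have hwC : ContDiffOn ℝ ∞ (fun x => w (toC3 x)) Y :=
    ((contDiffOn_pi_infty_of_holomorphic w.open_source hw.holo).restrict_scalars ℝ).comp
      toC3L.contDiff.contDiffOn fun x hx => hx
  have hsym : ContDiffOn ℝ ∞ (fderiv ℂ w.symm) w.target :=
    ((contDiffOn_pi_infty_of_holomorphic w.open_target hw.holo_symm).fderiv_of_isOpen
      w.open_target (by simp)).restrict_scalars ℝ
  have huC : ContDiffOn ℝ ∞ u Y := by
    have h1 : ContDiffOn ℝ ∞ (fun x => fderiv ℂ w.symm (w (toC3 x))) Y :=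
      hsym.comp hwC fun x hx => w.map_source hx
    have h2 : ContDiffOn ℝ ∞ (fun x => toC3 (k (reL (w (toC3 x))))) Y :=
      toC3L.contDiff.comp_contDiffOn (hk.comp_contDiffOn (reL.contDiff.comp_contDiffOn hwC))
    have h3 := (restrictScalarsL ℂ C3 C3 ℝ ℝ).contDiff.comp_contDiffOn h1
    exact reL.contDiff.comp_contDiffOn (h3.clm_apply h2)
  have hvC : ContDiff ℝ ∞ fun x => χ x • u x := contDiff_smul_of_tsupport_subset hYo hχ hχY huC
  have hv : ∀ x ∈ closedBall p r, χ x • u x = u x := fun x hx => by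
    rw [(hχ1 x hx).self_of_nhds, one_smul]
  refine ⟨fun x => χ x • u x, hvC, ?_, fun x hx => ?_⟩
  · obtain ⟨M1, hM1⟩ := (isCompact_closedBall p r).exists_bound_of_continuousOn
      hvC.continuous.continuousOn
    obtain ⟨M2, hM2⟩ := (isCompact_closedBall p r).exists_bound_of_continuousOn
      (hvC.continuous_fderiv (by simp)).continuousOn
    exact ⟨max 1 (max M1 M2), by positivity, fun x hx =>
      ⟨(hM1 x hx).trans ((le_max_left _ _).trans (le_max_right _ _)),
      (hM2 x hx).trans ((le_max_right _ _).trans (le_max_right _ _))⟩⟩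
  · have hxs := hr x hx; simp only [hv x hx]; set A := realDeriv w x with hA
    have hinv : ∀ z : R3, fderiv ℂ w.symm (w (toC3 x)) (toC3 (A z)) = toC3 z := fun z => by
      rw [← hw.fderiv_toC3 hxs]
      exact congrArg (fun T : C3 →L[ℂ] C3 => T (toC3 z)) (hw.fderiv_symm_comp hxs)
    have hreL : ∀ z : R3, reL (toC3 z) = z := fun z => by rw [← complexPt_zero, reL_complexPt]
    have hinj : Function.Injective (A : R3 →ₗ[ℝ] R3) := fun z z' h => by
      have h1 : A z = A z' := h; rw [← hreL z, ← hreL z', ← hinv z, ← hinv z', h1]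
    obtain ⟨z, hz⟩ := LinearMap.injective_iff_surjective.1 hinj (k (reL (w (toC3 x))))
    have hz' : A z = k (reL (w (toC3 x))) := hz; rw [hu]; simp only; rw [← hz', hinv, hreL]

/-- With it, one `s` is chosen subject to finitely many smallness conditions `A * s ≤ B` at once. -/
theorem eventually_mul_le (A : ℝ) {B : ℝ} (hB : 0 < B) : ∀ᶠ s in 𝓝[>] (0 : ℝ), A * s ≤ B := by
  have h : Tendsto (fun s => A * s) (𝓝[>] (0 : ℝ)) (𝓝 (A * 0)) :=
    ((continuous_const.mul continuous_id).tendsto 0).mono_left nhdsWithin_le_nhds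
  rw [mul_zero] at h; exact h.eventually_le_const hB

set_option maxHeartbeats 1000000 in
/-- A domain that passes below the singularity can be deformed to one that is desired outside an
arbitrarily small cube. -/
theorem IsNormalizingChart.exists_deformation_below (hw : NChart)
    (hp : IsStationaryOnSingularity U g G p) :
    ∃ R > 0, ∀ r : ℝ, 0 < r → r ≤ R → ∀ ε > 0, ∃ δ0 > 0, ∀ δ ≤ δ0, ∀ η0 : R3 → R3,
      IsSmallField p (2 * r) δ η0 → PassesBelow (fun ξ => α * g ξ) p (2 * r) η0 →
      ∀ r1 > 0, ∃ η : ℝ → R3 → R3, IsAllowedDeformation g p r ε η ∧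
        (∀ x ∈ closedBall p r, η 0 x = η0 x) ∧
        DesiredOn G (closedBall p r \ ball p r1) (η 1) := by
  obtain ⟨n, hn0, hn⟩ := hw.exists_normal
  have hnpos : 0 < ‖n‖ := norm_pos_iff.2 hn0
  have hphase := hw.isNormalPhase hp
  obtain ⟨K, hK1, b1, hb1, hlip⟩ := hphase.exists_lipschitz; have hK : 0 < K := by linarith
  obtain ⟨b2, hb2, c', hc', hdip⟩ := hphase.exists_im_dip_outside_ge
  obtain ⟨a, ha, hlow⟩ := hw.exists_realDeriv_lower
  obtain ⟨C, hC, R₃, hR3, htay⟩ := hw.exists_taylor; set L := realDeriv w p with hL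
  -- The first bound keeps `‖y‖ ≥ (a/2)‖x - p‖`; the second keeps the first coordinate of the image
  -- of `n` above `3/4` at all points of the cube.
  set c := min (a / 2) (1 / 4 / ‖n‖) with hc
  have hc0 : 0 < c := by positivity
  have hca : c ≤ a / 2 := min_le_left _ _
  have hcn : c * ‖n‖ ≤ 1 / 4 := by rw [← le_div_iff₀ hnpos]; exact min_le_right _ _
  obtain ⟨R1, hR1, hsrc, hst⟩ := hw.exists_strict hc0
  obtain ⟨R2, hR2, δ2, hδ₂, hshift⟩ := hw.exists_shift_avoids hn hn0
  set b := min (min b1 b2) 1 with hb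
  have hb0 : 0 < b := by positivity
  obtain ⟨⟨hbb₁, hbb2⟩, hbb1⟩ : (b ≤ b1 ∧ b ≤ b2) ∧ b ≤ 1 := by
    simp only [← le_min_iff, hb, le_refl]
  refine ⟨min (min R1 R2) (min R₃ (b / 4 / (‖L‖ + c))), by positivity, fun r hr hrR ε hε => ?_⟩
  have hLc : 0 < ‖L‖ + c := by positivity
  simp only [le_min_iff, le_div_iff₀' hLc] at hrR
  obtain ⟨⟨hrR1, hrR2⟩, hrR3, hrb⟩ := hrR
  set R' := min R1 R₃ with hR'; have hR'0 : 0 < R' := by positivity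
  set N := 1 + ‖n‖ with hN; have hN0 : 0 < N := by positivity
  -- The amplitude of the downward shift. It must dominate the initial field, so it is chosen before
  -- `δ` and independently of `r1`.
  obtain ⟨s0, hs0, hs₀r, hs₀R, hs₀ε, hs₀C⟩ : ∃ s0 : ℝ, 0 < s0 ∧ ‖n‖ * s0 ≤ r ∧ N * s0 ≤ R' / 2 ∧
      ‖n‖ * s0 ≤ ε / 4 ∧ 2 * C * N ^ 2 * s0 ≤ 1 / 8 := by
    have h1 : ∀ᶠ s in 𝓝[>] (0 : ℝ), 0 < s := self_mem_nhdsWithin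
    exact (h1.and ((eventually_mul_le _ hr).and ((eventually_mul_le _ (by positivity)).and
      ((eventually_mul_le _ (by positivity)).and (eventually_mul_le _ (by positivity)))))).exists
  refine ⟨min (min δ2 s0) (min (ε / 2) (s0 / 4 / (‖L‖ + c))), by positivity,
    fun δ hδ η0 hη0 hbelow r1 hr1 => ?_⟩
  simp only [le_min_iff, le_div_iff₀' hLc] at hδ
  obtain ⟨⟨hδ2, hδs0⟩, hδε, hδL⟩ := hδ
  set ρ := min (a / 2 * r1) 1 with hρ
  have hρ0 : 0 < ρ := by positivity
  have hρ1 : ρ ≤ 1 := min_le_right _ _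
  set κ := min b (c' * ρ ^ 2 / 6) with hκ
  have hκ0 : 0 < κ := by positivity
  have hκb : κ ≤ b := min_le_left _ _
  have hκρ : 6 * κ ≤ c' * ρ ^ 2 := by
    have : κ ≤ c' * ρ ^ 2 / 6 := min_le_right _ _; linarith
  have hsrc0 : ∀ x ∈ closedBall p r, toC3 x ∈ w.source := fun x hx => by
    rw [mem_closedBall, dist_eq_norm] at hx
    have := (hsrc x 0 (hx.trans hrR1) (by simpa using hR1.le)).1; rwa [complexPt_zero] at this
  obtain ⟨v, hv, ⟨M, hM, hvM⟩, hvk⟩ := hw.exists_field hsrc0 (contDiff_dipField 1 β β' hκ0.ne')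
  set C' := 3 + |β| + |β'| with hC'
  -- The amplitude of the final dip field. It depends on `κ` and the bound `M`, hence on `r1`, and
  -- may be far smaller than `δ`.
  obtain ⟨s, hs, hs1, hsR, hsε, hsκ, hsb, hsK⟩ : ∃ s : ℝ, 0 < s ∧ 1 * s ≤ 1 ∧ M * s ≤ R' / 2 ∧
      M * s ≤ ε / 4 ∧ 2 * C * M ^ 2 * s ≤ κ / 4 ∧ C' * s ≤ b / 4 ∧
      K * C * M ^ 2 * s ≤ c' * ρ ^ 2 / 4 := by
    have h1 : ∀ᶠ s in 𝓝[>] (0 : ℝ), 0 < s := self_mem_nhdsWithin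
    exact (h1.and ((eventually_mul_le _ one_pos).and ((eventually_mul_le _ (by positivity)).and
      ((eventually_mul_le _ (by positivity)).and ((eventually_mul_le _ (by positivity)).and
      ((eventually_mul_le _ (by positivity)).and (eventually_mul_le _ (by positivity)))))))).exists
  rw [one_mul] at hs1
  have hsub : ∀ {x}, x ∈ closedBall p r → x ∈ closedBall p (2 * r) := fun hx =>
    closedBall_subset_closedBall (by linarith) hx
  have hηc := hη0.1.continuous; have hvc := hv.continuous
  -- Two stages. Since `s` may be much smaller than `η0`, a direct passage to `s • v` could not be
  -- controlled. Up to `τ = 1/2` the domain is pushed down by `s0`, which dominates `η0`; afterwards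
  -- the shifted field is exchanged linearly for `s • v`, where `v` is the dip field transported to
  -- the variables `x`.
  set η : ℝ → R3 → R3 := fun τ x => min 1 (2 - 2 * τ) • η0 x
    + (-(s0 * min (2 * τ) (2 - 2 * τ))) • n + (s * max 0 (2 * τ - 1)) • v x with hη
  have hη1 : ∀ τ ≤ 1 / 2, ∀ x, η τ x = η0 x + (-1 * (2 * τ * s0)) • n := fun τ hτ x => by
    rw [hη]; simp only
    rw [min_eq_left (by linarith : (1 : ℝ) ≤ 2 - 2 * τ), min_eq_left (by linarith),
      max_eq_left (by linarith)]
    module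
  have hη2 : ∀ τ, 1 / 2 ≤ τ → ∀ x, η τ x = (2 - 2 * τ) • η0 x + (-(s0 * (2 - 2 * τ))) • n
      + (s * (2 * τ - 1)) • v x := fun τ hτ x => by
    rw [hη]; simp only
    rw [min_eq_right (by linarith : 2 - 2 * τ ≤ 1), min_eq_right (by linarith),
      max_eq_right (by linarith)]
  have hcoord : ∀ x ∈ closedBall p r, ∀ u : R3, ‖u‖ ≤ R' → complexPt x u ∈ w.source ∧
      ‖w (complexPt x u) - complexPt (reL (w (toC3 x))) (realDeriv w x u)‖ ≤ C * ‖u‖ ^ 2 :=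
    fun x hx u hu => by
    rw [mem_closedBall, dist_eq_norm] at hx
    exact ⟨(hsrc x u (hx.trans hrR1) (hu.trans (min_le_left _ _))).1,
      htay x u (hx.trans hrR3) (hu.trans (min_le_right _ _))⟩
  refine ⟨η, ⟨?_, fun τ hτ => ?_, fun τ hτ x hx h0 => ?_⟩, fun x _ => ?_, fun x hx => ?_⟩
  · exact Continuous.continuousOn (by fun_prop)
  · have h1 : 0 ≤ min (2 * τ) (2 - 2 * τ) := le_min (by linarith [hτ.1]) (by linarith [hτ.2])
    have h2 : min (2 * τ) (2 - 2 * τ) ≤ 1 := by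
      rcases le_total τ (1 / 2) with h | h
      · exact (min_le_left _ _).trans (by linarith)
      · exact (min_le_right _ _).trans (by linarith)
    have h3 : max 0 (2 * τ - 1) ≤ 1 := max_le zero_le_one (by linarith [hτ.2])
    refine isSmallField_combination (s := ε / 4) hη0 hr hv hvM ?_ ?_ ?_ (by linarith)
    · rw [abs_of_nonneg (le_min zero_le_one (by linarith [hτ.2]))]; exact min_le_left _ _
    · rw [abs_neg, abs_of_nonneg (mul_nonneg hs0.le h1)]
      have := mul_le_mul_of_nonneg_right (mul_le_of_le_one_right hs0.le h2) hnpos.le; linarith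
    · rw [abs_of_nonneg (mul_nonneg hs.le (le_max_left _ _))]
      have := mul_le_mul_of_nonneg_right (mul_le_of_le_one_right hs.le h3) hM.le; linarith
  · rcases le_or_gt τ (1 / 2) with h | h
    · rw [domainPt_eq_complexPt, hη1 τ h] at h0
      refine hshift r δ hr hrR2 hδ2 η0 hη0 (-1) (Or.inr rfl)
        (fun x hx h0 => by linarith [hbelow x hx h0]) (2 * τ * s0)
        (mul_nonneg (by linarith [hτ.1]) hs0.le) ?_ x hx h0
      have := mul_le_mul_of_nonneg_right
        (mul_le_of_le_one_left hs0.le (by linarith : 2 * τ ≤ 1)) hnpos.le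
      linarith
    · set A := 2 - 2 * τ with hA; have hA0 : 0 ≤ A := by linarith [hτ.2]
      have hA1 : A ≤ 1 := by linarith
      set t := 2 * τ - 1 with ht; have ht0 : 0 < t := by linarith
      have ht1 : t ≤ 1 := by linarith [hτ.2]
      set u := η τ x with hu
      have hux : u = A • η0 x + (-(s0 * A)) • n + (s * t) • v x := hη2 τ h.le x
      have hηx := (hη0.2 x (hsub hx)).1
      have hun : ‖u‖ ≤ A * (N * s0) + t * (M * s) := by
        rw [hux]; refine (norm_add_le _ _).trans ((add_le_add_left (norm_add_le _ _) _).trans ?_)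
        rw [norm_smul, norm_smul, norm_smul, norm_neg, Real.norm_of_nonneg hA0,
          Real.norm_of_nonneg (by positivity), Real.norm_of_nonneg (by positivity)]
        have h1 := mul_le_mul_of_nonneg_left (hηx.trans hδs0) hA0
        have h2 := mul_le_mul_of_nonneg_left (hvM x hx).1 (by positivity : 0 ≤ s * t)
        linarith [show A * (N * s0) = A * s0 + s0 * A * ‖n‖ by rw [hN]; ring]
      have huR : ‖u‖ ≤ R' := by
        have h1 := mul_le_mul_of_nonneg_right hA1 (by positivity : 0 ≤ N * s0)
        have h2 := mul_le_mul_of_nonneg_right ht1 (by positivity : 0 ≤ M * s); linarith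
      -- A bound for the quadratic Taylor error of the coordinates, split so that each part is a
      -- fraction of the depth contributed by the corresponding field.
      set Q := A * s0 / 8 + t * s * κ / 4 with hQ
      have hQ0 : 0 ≤ Q := by positivity
      have huQ : C * ‖u‖ ^ 2 ≤ Q := by
        have h1 := pow_le_pow_left₀ (norm_nonneg u) hun 2
        have h2 : (A * (N * s0) + t * (M * s)) ^ 2
            ≤ 2 * (A * (N * s0)) ^ 2 + 2 * (t * (M * s)) ^ 2 := by
          linarith [sq_nonneg (A * (N * s0) - t * (M * s))]
        have h3 := mul_le_mul_of_nonneg_left (h1.trans h2) hC.le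
        have h4 : A ^ 2 * s0 * (2 * C * N ^ 2 * s0) ≤ A * s0 * (1 / 8) :=
          mul_le_mul (mul_le_mul_of_nonneg_right (pow_le_of_le_one hA0 hA1 two_ne_zero) hs0.le) hs₀C (by positivity)
            (by positivity)
        have h5 : t ^ 2 * s * (2 * C * M ^ 2 * s) ≤ t * s * (κ / 4) :=
          mul_le_mul (mul_le_mul_of_nonneg_right (pow_le_of_le_one ht0.le ht1 two_ne_zero) hs.le) hsκ (by positivity)
            (by positivity)
        linarith [show C * (2 * (A * (N * s0)) ^ 2 + 2 * (t * (M * s)) ^ 2)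
          = A ^ 2 * s0 * (2 * C * N ^ 2 * s0) + t ^ 2 * s * (2 * C * M ^ 2 * s) by ring]
      obtain ⟨hξs, hξ⟩ := hcoord x hx u huR
      have hw0 : w (complexPt x u) 0 = 0 := by
        rw [hw.first _ hξs]; exact mul_eq_zero_of_right _ h0
      set y := reL (w (toC3 x)) with hy
      have h1 := ((norm_le_pi_norm _ 0).trans hξ).trans huQ
      rw [Pi.sub_apply, hw0, zero_sub, norm_neg] at h1
      have hre : |y 0| ≤ Q := by
        have h2 := (abs_re_le_norm _).trans h1; simpa [complexPt] using h2
      have him : |realDeriv w x u 0| ≤ Q := by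
        have h2 := (abs_im_le_norm _).trans h1; simpa [complexPt] using h2
      have hxp : ‖x - p‖ ≤ r := by rwa [← dist_eq_norm, ← mem_closedBall]
      have hdL : ∀ z : R3, ‖(realDeriv w x - L) z‖ ≤ c * ‖z‖ := fun z => by
        have h2 := (hsrc x 0 (hxp.trans hrR1) (by simpa using hR1.le)).2; rw [complexPt_zero] at h2
        have h3 : (realDeriv w x - L) z
            = reL ((fderiv ℂ w (toC3 x) - fderiv ℂ w (toC3 p)) (toC3 z)) := by
          rw [sub_apply, sub_apply, map_sub]; rfl
        rw [h3]; refine (norm_reL_le _).trans ((le_opNorm _ _).trans ?_)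
        rw [norm_toC3]; exact mul_le_mul_of_nonneg_right h2 (norm_nonneg _)
      have hn1 : 3 / 4 ≤ realDeriv w x n 0 := by
        have h2 := (norm_le_pi_norm ((realDeriv w x - L) n) 0).trans (hdL n)
        rw [sub_apply, hn, Pi.sub_apply, Pi.single_eq_same, norm_eq_abs] at h2
        linarith [(abs_le.1 h2).1]
      have hη01 : realDeriv w x (η0 x) 0 ≤ s0 / 4 := by
        have h2 : ‖realDeriv w x (η0 x)‖ ≤ c * ‖η0 x‖ + ‖L‖ * ‖η0 x‖ := by
          have h3 : realDeriv w x (η0 x) = (realDeriv w x - L) (η0 x) + L (η0 x) := by simp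
          rw [h3]; exact (norm_add_le _ _).trans (add_le_add (hdL _) (L.le_opNorm _))
        have h3 := (le_abs_self _).trans (norm_le_pi_norm (realDeriv w x (η0 x)) 0)
        have h4 := mul_le_mul_of_nonneg_left hηx hLc.le; linarith
      have hval : realDeriv w x u 0 = A * realDeriv w x (η0 x) 0 - s0 * A * realDeriv w x n 0
          + s * t * dipProfile 1 κ (y 0) := by
        rw [hux, map_add, map_add, map_smul, map_smul, map_smul, hvk x hx]
        show A * realDeriv w x (η0 x) 0 + (-(s0 * A)) * realDeriv w x n 0
          + s * t * dipProfile 1 κ (y 0) = _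
        ring
      have h2 := dipProfile_upper (s := 1) zero_le_one hκ0.le (y 0)
      have h3 := mul_le_mul_of_nonneg_left (h2.trans (by linarith :
        1 * (|y 0| - κ) ≤ Q - κ)) (by positivity : 0 ≤ s * t)
      have h4 := mul_le_mul_of_nonneg_left hη01 hA0
      have h5 := mul_le_mul_of_nonneg_left hn1 (by positivity : 0 ≤ s0 * A)
      have h6 : s * t * Q ≤ Q := mul_le_of_le_one_left hQ0 (mul_le_one₀ hs1 ht0.le ht1)
      have h7 := (abs_le.1 him).1; have h8 : 0 < t * s * κ := by positivity
      have h9 : 0 ≤ A * s0 := by positivity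
      -- On the singularity the first coordinate of the linearized field would be at least `-Q`. But
      -- it is at most `-A s0/2 + Q - s t κ`, below `-Q` because `2Q = A s0/4 + s t κ/2`.
      rw [hval] at h7; linarith
  · rw [hη1 0 (by norm_num)]; simp
  · have hxp : ‖x - p‖ ≤ r := by
      rw [← dist_eq_norm]; exact hx.1
    have hxr1 : r1 ≤ ‖x - p‖ := by
      rw [← dist_eq_norm]; exact not_lt.1 hx.2
    set y := reL (w (toC3 x)) with hy
    have hu : η 1 x = s • v x := by
      rw [hη2 1 (by norm_num)]; module
    have hun : ‖s • v x‖ ≤ M * s := by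
      rw [norm_smul, Real.norm_of_nonneg hs.le, mul_comm]
      exact mul_le_mul_of_nonneg_right (hvM x hx.1).1 hs.le
    obtain ⟨hξs, hξ⟩ := hcoord x hx.1 (s • v x) (hun.trans (by linarith))
    have hk : realDeriv w x (s • v x) = dipField s κ β β' y := by
      rw [map_smul, hvk x hx.1, dipField_eq_smul, dipField_eq_smul, one_smul]
    rw [hk, ← hy] at hξ
    have hξ' := hξ.trans (mul_le_mul_of_nonneg_left (pow_le_pow_left₀ (norm_nonneg _) hun 2) hC.le)
    have e1 := hst x 0 p 0 (hxp.trans hrR1) (by simpa using hR1.le) (by simpa using hR1.le)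
      (by simpa using hR1.le)
    rw [complexPt_zero, complexPt_zero, hw.center, sub_zero, sub_self, norm_zero, add_zero,
      map_zero, complexPt_zero, ← hw.toC3_reL (hsrc0 x hx.1), ← toC3_sub, norm_toC3, ← hy, ← hL]
      at e1
    have hyb : ‖y‖ ≤ b / 4 := by
      have e2 := norm_le_norm_sub_add y (L (x - p)); have e3 := L.le_opNorm (x - p)
      have e4 := mul_le_mul_of_nonneg_left hxp hLc.le; linarith
    have hyρ : ρ ≤ ‖y‖ := by
      have e2 := norm_le_norm_sub_add (L (x - p)) y; rw [norm_sub_rev] at e2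
      have e3 := hlow (x - p); have e4 := mul_le_mul_of_nonneg_right hca (norm_nonneg (x - p))
      have e5 := mul_le_mul_of_nonneg_left hxr1 (by positivity : 0 ≤ a / 2)
      have e6 : ρ ≤ a / 2 * r1 := min_le_left _ _; linarith
    -- The final field has exactly the direction of the dip field in the coordinates, where the
    -- phase is at least `s c'ρ²/2`. The Taylor error is quadratic in `s` and changes the phase by
    -- at most `s c'ρ²/4`.
    have h1 := hdip s κ ρ hs hs1 hκ0 (hκb.trans hbb2) hρ0.le hρ1 hκρ y (hyb.trans (by linarith)) hyρ
    have h2 : ‖complexPt y (dipField s κ β β' y)‖ ≤ b / 2 := by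
      have e2 := norm_dipField_le (β := β) (β' := β') hs.le hκ0 (hκb.trans hbb1)
        (hyb.trans (by linarith))
      exact (norm_complexPt_le _ _).trans (by linarith)
    have h3 : C * (M * s) ^ 2 ≤ b / 8 := by
      have e2 := mul_le_mul_of_nonneg_right hs1 (by positivity : 0 ≤ 2 * C * M ^ 2 * s)
      linarith [show C * (M * s) ^ 2 = s * (2 * C * M ^ 2 * s) / 2 by ring]
    have h4 := norm_le_norm_sub_add (w (complexPt x (s • v x))) (complexPt y (dipField s κ β β' y))
    have h5 := hlip _ _ ((by linarith : ‖w (complexPt x (s • v x))‖ ≤ b).trans hbb₁)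
      (h2.trans (by linarith))
    rw [w.left_inv hξs] at h5; have h6 := mul_le_mul_of_nonneg_left hξ' hK.le
    have h7 := mul_le_mul_of_nonneg_left hsK hs.le
    have h8 : 0 < s * (c' * ρ ^ 2) := by positivity
    show 0 < (G (complexPt x (η 1 x))).im
    rw [hu]
    linarith [(abs_le.1 h5).1,
      show K * (C * (M * s) ^ 2) = s * (K * C * M ^ 2 * s) by ring]

end ChartDerivative

/-! ### Taylor expansions of holomorphic functions -/

section Taylor

variable {F : Type*} [NormedAddCommGroup F] [NormedSpace ℂ F]

/-- The mean value inequality on the ball of radius `‖ξ - a‖`: integrating a bound for the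
derivative gains one order. -/
theorem isBigO_sub_of_fderiv {h : C3 → F} {h' : C3 → C3 →L[ℂ] F} {a : C3} {k : ℕ}
    (hd : ∀ᶠ ξ in 𝓝 a, HasFDerivAt h (h' ξ) ξ) (ho : h' =O[𝓝 a] fun ξ => ‖ξ - a‖ ^ k) :
    (fun ξ => h ξ - h a) =O[𝓝 a] fun ξ => ‖ξ - a‖ ^ (k + 1) := by
  obtain ⟨C, hC, hb⟩ := ho.exists_pos
  obtain ⟨ε, hε, hball⟩ := eventually_nhds_iff_ball.1 (hd.and hb.bound); refine IsBigO.of_bound C ?_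
  filter_upwards [ball_mem_nhds a hε] with ξ hξ
  have hsub : closedBall a ‖ξ - a‖ ⊆ ball a ε := closedBall_subset_ball (by rwa [← dist_eq_norm])
  have h1 := (convex_closedBall a ‖ξ - a‖).norm_image_sub_le_of_norm_hasFDerivWithin_le (𝕜 := ℂ)
    (f := h) (f' := h') (C := C * ‖ξ - a‖ ^ k)
    (fun ζ hζ => (hball ζ (hsub hζ)).1.hasFDerivWithinAt)
    (fun ζ hζ => (hball ζ (hsub hζ)).2.trans (by
      rw [norm_pow, norm_norm, ← dist_eq_norm ζ]
      exact mul_le_mul_of_nonneg_left (pow_le_pow_left₀ dist_nonneg hζ k) hC.le))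
    (mem_closedBall_self (norm_nonneg _))
    (by rw [mem_closedBall, dist_eq_norm] : ξ ∈ closedBall a ‖ξ - a‖)
  rw [norm_pow, norm_norm, pow_succ, ← mul_assoc]; exact h1

variable {U : Set C3} {f : C3 → ℂ} {a : C3}

theorem isBigO_taylor_one (hU : IsOpen U) (hf : DifferentiableOn ℂ f U) (ha : a ∈ U) :
    (fun ξ => f ξ - f a - fderiv ℂ f a (ξ - a)) =O[𝓝 a] fun ξ => ‖ξ - a‖ ^ 2 := by
  have hc := (contDiffOn_infty_of_holomorphic hU hf).contDiffAt (hU.mem_nhds ha)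
  have h1 : DifferentiableAt ℂ (fderiv ℂ f) a :=
    (hc.fderiv_right (m := 1) (by rw [one_add_one_eq_two]; exact ENat.LEInfty.out)).differentiableAt one_ne_zero
  have h2 := isBigO_sub_of_fderiv (k := 1) (h := fun ξ => f ξ - fderiv ℂ f a ξ)
    (h' := fun ξ => fderiv ℂ f ξ - fderiv ℂ f a) (a := a) (by
      filter_upwards [hU.mem_nhds ha] with ξ hξ
      exact ((hf ξ hξ).differentiableAt (hU.mem_nhds hξ)).hasFDerivAt.sub
        (fderiv ℂ f a).hasFDerivAt)
    (by simpa only [pow_one] using h1.hasFDerivAt.isBigO_sub.norm_right)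
  refine h2.congr_left fun ξ => ?_
  rw [map_sub]; ring

/-- The gain of one order is used twice, first for the derivative and then for the function.
Symmetry of the second derivative is needed to differentiate the quadratic term. -/
theorem isBigO_taylor_two (hU : IsOpen U) (hf : DifferentiableOn ℂ f U) (ha : a ∈ U)
    (h0 : fderiv ℂ f a = 0) :
    (fun ξ => f ξ - f a - 1 / 2 * fderiv ℂ (fderiv ℂ f) a (ξ - a) (ξ - a))
      =O[𝓝 a] fun ξ => ‖ξ - a‖ ^ 3 := by
  have hc := (contDiffOn_infty_of_holomorphic hU hf).contDiffAt (hU.mem_nhds ha)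
  have hc1 : ContDiffAt ℂ 2 (fderiv ℂ f) a :=
    (hc.fderiv_right (m := ∞) (by simp)).of_le ENat.LEInfty.out
  have hd : ∀ᶠ ξ in 𝓝 a, DifferentiableAt ℂ (fderiv ℂ f) ξ :=
    (hc1.eventually (by simp)).mono fun ξ hξ => hξ.differentiableAt two_ne_zero
  set B := fderiv ℂ (fderiv ℂ f) a with hB
  have hsym : ∀ u v, B u v = B v u := hc.isSymmSndFDerivAt (by simp; exact ENat.LEInfty.out)
  have h1 : (fun ξ => fderiv ℂ f ξ - B (ξ - a)) =O[𝓝 a] fun ξ => ‖ξ - a‖ ^ 2 := by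
    have hcd : ContDiffAt ℂ 1 (fderiv ℂ (fderiv ℂ f)) a := hc1.fderiv_right (m := 1) (by
      rw [one_add_one_eq_two])
    have h2 := isBigO_sub_of_fderiv (k := 1) (h := fun ξ => fderiv ℂ f ξ - B ξ)
      (h' := fun ξ => fderiv ℂ (fderiv ℂ f) ξ - B) (a := a) (by
        filter_upwards [hd] with ξ hξ
        exact hξ.hasFDerivAt.sub B.hasFDerivAt)
      (by simpa only [pow_one] using
        (hcd.differentiableAt one_ne_zero).hasFDerivAt.isBigO_sub.norm_right)
    refine h2.congr_left fun ξ => ?_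
    rw [map_sub, h0]; abel
  have h2 := isBigO_sub_of_fderiv (k := 2) (h := fun ξ => f ξ - 1 / 2 * B (ξ - a) (ξ - a))
    (h' := fun ξ => fderiv ℂ f ξ - B (ξ - a)) (a := a) (by
      filter_upwards [hU.mem_nhds ha] with ξ hξ
      have e1 : HasFDerivAt (fun ξ => ξ - a) (ContinuousLinearMap.id ℂ C3) ξ :=
        (hasFDerivAt_id ξ).sub_const a
      have e2 := ((B.hasFDerivAt.comp ξ e1).clm_apply e1).const_mul (1 / 2 : ℂ)
      refine (((hf ξ hξ).differentiableAt (hU.mem_nhds hξ)).hasFDerivAt.sub e2).congr_fderiv ?_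
      ext1 v
      simp only [sub_apply, smul_apply, add_apply, ContinuousLinearMap.comp_apply,
        flip_apply, ContinuousLinearMap.id_apply, Function.comp_apply,
        smul_eq_mul]
      rw [hsym v]
      ring) h1
  refine h2.congr_left fun ξ => ?_
  rw [sub_self, map_zero, mul_zero, sub_zero]; ring

end Taylor

/-! ### Real structure, and the Hessian along a surface -/

section RealStructure

variable {U : Set C3} {f : C3 → ℂ} {x : R3}

theorem hasFDerivAt_comp_toC3 (hU : IsOpen U) (hf : DifferentiableOn ℂ f U) (hx : toC3 x ∈ U) :
    HasFDerivAt (fun x : R3 => f (toC3 x)) (((fderiv ℂ f (toC3 x)).restrictScalars ℝ).comp toC3L) x :=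
  (((hf _ hx).differentiableAt (hU.mem_nhds hx)).hasFDerivAt.restrictScalars ℝ).comp x
    toC3L.hasFDerivAt

/-- The derivatives in real directions of a function that is real at real points. -/
theorem im_fderiv_toC3 (hU : IsOpen U) (hf : DifferentiableOn ℂ f U)
    (hr : ∀ x : R3, toC3 x ∈ U → (f (toC3 x)).im = 0) (hx : toC3 x ∈ U) (v : R3) :
    (fderiv ℂ f (toC3 x) (toC3 v)).im = 0 := by
  have h1 : HasFDerivAt (fun x : R3 => (f (toC3 x)).im) _ x :=
    imCLM.hasFDerivAt.comp x (hasFDerivAt_comp_toC3 hU hf hx)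
  have h2 : (fun x : R3 => (f (toC3 x)).im) =ᶠ[𝓝 x] fun _ => 0 := by
    filter_upwards [(hU.preimage toC3L.continuous).mem_nhds hx] with y hy; exact hr y hy
  exact congrArg (fun T : R3 →L[ℝ] ℝ => T v)
    (h1.unique ((hasFDerivAt_const (0 : ℝ) x).congr_of_eventuallyEq h2))

theorem im_fderiv_fderiv_toC3 (hU : IsOpen U) (hf : DifferentiableOn ℂ f U)
    (hr : ∀ x : R3, toC3 x ∈ U → (f (toC3 x)).im = 0) (hx : toC3 x ∈ U) (u v : R3) :
    (fderiv ℂ (fderiv ℂ f) (toC3 x) (toC3 u) (toC3 v)).im = 0 := by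
  have h1 := im_fderiv_toC3 hU (differentiableOn_fderiv_apply_of_holomorphic hU hf (toC3 v))
    (fun y hy => im_fderiv_toC3 hU hf hr hy v) hx u
  have hd : DifferentiableAt ℂ (fderiv ℂ f) (toC3 x) :=
    (((contDiffOn_infty_of_holomorphic hU hf).contDiffAt (hU.mem_nhds hx)).fderiv_right (m := 1)
      (by rw [one_add_one_eq_two]; exact ENat.LEInfty.out)).differentiableAt one_ne_zero
  rwa [fderiv_clm_apply hd (differentiableAt_const _), fderiv_const_apply,
    ContinuousLinearMap.comp_zero, zero_add, flip_apply] at h1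

/-- The Hessian of a function along a surface, at a critical point of the function. -/
theorem hessian2_comp (hU : IsOpen U) (hf : DifferentiableOn ℂ f U) (hx : toC3 x ∈ U)
    (h0 : fderiv ℂ f (toC3 x) = 0) {φ : (Fin 2 → ℝ) → R3} (hφ : ContDiffAt ℝ ∞ φ 0)
    (hφ0 : φ 0 = x) (i j : Fin 2) :
    hessian2 (fun t => (f (toC3 (φ t))).re) i j
      = (fderiv ℂ (fderiv ℂ f) (toC3 x) (toC3 (fderiv ℝ φ 0 (Pi.single i 1)))
        (toC3 (fderiv ℝ φ 0 (Pi.single j 1)))).re := by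
  subst hφ0; rw [hessian2, Matrix.of_apply, iteratedFDeriv_two_apply]
  simp only [Matrix.cons_val_zero, Matrix.cons_val_one]
  set u : Fin 2 → ℝ := Pi.single i 1
  set v : Fin 2 → ℝ := Pi.single j 1
  have hφc : ContDiffAt ℝ 1 (fderiv ℝ φ) 0 := hφ.fderiv_right (by rw [one_add_one_eq_two]; exact ENat.LEInfty.out)
  have hev : ∀ᶠ t in 𝓝 (0 : Fin 2 → ℝ), DifferentiableAt ℝ φ t ∧ toC3 (φ t) ∈ U := by
    refine Eventually.and ?_ ?_
    · exact ((hφ.of_le (by simp : (1 : WithTop ℕ∞) ≤ ∞)).eventually (by simp)).mono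
        fun t ht => ht.differentiableAt one_ne_zero
    · exact (toC3L.continuous.continuousAt.comp hφ.continuousAt).eventually (hU.mem_nhds hx)
  have hder : ∀ᶠ t in 𝓝 (0 : Fin 2 → ℝ), HasFDerivAt (fun t => (f (toC3 (φ t))).re)
      (reCLM.comp ((((fderiv ℂ f (toC3 (φ t))).restrictScalars ℝ).comp toC3L).comp
        (fderiv ℝ φ t))) t := by
    filter_upwards [hev] with t ht
    exact reCLM.hasFDerivAt.comp t ((hasFDerivAt_comp_toC3 hU hf ht.2).comp t ht.1.hasFDerivAt)
  have hd : DifferentiableAt ℂ (fderiv ℂ f) (toC3 (φ 0)) :=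
    (((contDiffOn_infty_of_holomorphic hU hf).contDiffAt (hU.mem_nhds hx)).fderiv_right (m := 1)
      (by rw [one_add_one_eq_two]; exact ENat.LEInfty.out)).differentiableAt one_ne_zero
  have hT : HasFDerivAt (fun t => (fderiv ℂ f (toC3 (φ t))).restrictScalars ℝ) _ 0 :=
    (restrictScalarsL ℂ C3 ℂ ℝ ℝ).hasFDerivAt.comp (0 : Fin 2 → ℝ)
      ((hd.hasFDerivAt.restrictScalars ℝ).comp (0 : Fin 2 → ℝ) (toC3L.hasFDerivAt.comp
        (0 : Fin 2 → ℝ) (hφ.differentiableAt (by simp)).hasFDerivAt))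
  have hV : HasFDerivAt (fun t => toC3L (fderiv ℝ φ t v)) _ 0 :=
    toC3L.hasFDerivAt.comp (0 : Fin 2 → ℝ)
      ((hφc.differentiableAt one_ne_zero).hasFDerivAt.clm_apply (hasFDerivAt_const v 0))
  have hmain : HasFDerivAt (fun t => reCLM ((fderiv ℂ f (toC3 (φ t))).restrictScalars ℝ
      (toC3L (fderiv ℝ φ t v)))) _ 0 :=
    reCLM.hasFDerivAt.comp (0 : Fin 2 → ℝ) (hT.clm_apply hV)
  have heq : (fun t => fderiv ℝ (fun t => (f (toC3 (φ t))).re) t v) =ᶠ[𝓝 0]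
      fun t => reCLM ((fderiv ℂ f (toC3 (φ t))).restrictScalars ℝ (toC3L (fderiv ℝ φ t v))) := by
    filter_upwards [hder] with t ht; rw [ht.fderiv]; rfl
  have hd2 : DifferentiableAt ℝ (fderiv ℝ fun t => (f (toC3 (φ t))).re) 0 := by
    have e1 : ContDiffAt ℝ ∞ (fun t => (f (toC3 (φ t))).re) 0 :=
      reCLM.contDiff.contDiffAt.comp (0 : Fin 2 → ℝ)
        ((((contDiffOn_infty_of_holomorphic hU hf).contDiffAt
          (hU.mem_nhds hx)).restrict_scalars ℝ).comp (0 : Fin 2 → ℝ)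
          (toC3L.contDiff.contDiffAt.comp (0 : Fin 2 → ℝ) hφ))
    exact (e1.fderiv_right (m := 1) (by rw [one_add_one_eq_two]; exact ENat.LEInfty.out)).differentiableAt
      one_ne_zero
  have h3 : fderiv ℝ (fderiv ℝ fun t => (f (toC3 (φ t))).re) 0 u v
      = fderiv ℝ (fun t => fderiv ℝ (fun t => (f (toC3 (φ t))).re) t v) 0 u := by
    rw [fderiv_clm_apply hd2 (differentiableAt_const _), fderiv_const_apply,
      ContinuousLinearMap.comp_zero, zero_add, flip_apply]
  -- The term with the second derivative of `φ` carries the first derivative of `f` as a factor, and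
  -- this vanishes at the critical point.
  rw [h3, heq.fderiv_eq, hmain.fderiv]; simp [h0]; rfl

/-- A nondegenerate quadratic form in two real variables can be diagonalized. -/
theorem exists_diagonal {a b c : ℝ} (h : a * c - b * b ≠ 0) :
    ∃ x y z t : ℝ, a * x * x + 2 * b * x * y + c * y * y ≠ 0 ∧
      a * z * z + 2 * b * z * t + c * t * t ≠ 0 ∧ a * x * z + b * (x * t + y * z) + c * y * t = 0 := by
  by_cases ha : a = 0
  · by_cases hc : c = 0
    -- If both diagonal entries vanish, the form is `2bxy`, diagonal along `(1, 1)` and `(1, -1)`.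
    -- In the other cases a nonisotropic axis is completed by a vector orthogonal to it.
    · subst ha hc; have hb : b ≠ 0 := fun hb => h (by rw [hb]; ring)
      refine ⟨1, 1, 1, -1, ?_, ?_, by ring⟩
      · simpa using hb
      · simpa using hb
    · refine ⟨0, 1, c, -b, by simpa using hc, ?_, by ring⟩
      have e : a * c * c + 2 * b * c * -b + c * -b * -b = c * (a * c - b * b) := by ring
      rw [e]; exact mul_ne_zero hc h
  · refine ⟨1, 0, -b, a, by simpa using ha, ?_, by ring⟩
    have e : a * -b * -b + 2 * b * -b * a + c * a * a = a * (a * c - b * b) := by ring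
    rw [e]; exact mul_ne_zero ha h

end RealStructure

/-! ### Lagrange multiplier and normal frame -/

section NormalFrame

variable {U : Set C3} {g G : C3 → ℂ} {p : R3}

/-- Real vectors span the complex space over `ℂ`. -/
theorem eq_zero_of_toC3 {L : C3 →L[ℂ] ℂ} (h : ∀ v : R3, L (toC3 v) = 0) : L = 0 := by
  ext1 ξ
  rw [← complexPt_reL_imL ξ, complexPt_eq, map_add, map_smul, h, h, smul_zero, add_zero, zero_apply]

/-- Along a real surface on which the function is critical, the derivative of a function that is
real at real points vanishes. -/
theorem fderiv_tangent {U : Set C3} {f : C3 → ℂ} {φ : (Fin 2 → ℝ) → R3} (hU : IsOpen U)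
    (hf : DifferentiableOn ℂ f U) (hr : ∀ x : R3, toC3 x ∈ U → (f (toC3 x)).im = 0)
    (hφ : DifferentiableAt ℝ φ 0) (hx : toC3 (φ 0) ∈ U)
    (h0 : fderiv ℝ (fun t => (f (toC3 (φ t))).re) 0 = 0) (t : Fin 2 → ℝ) :
    fderiv ℂ f (toC3 (φ 0)) (toC3 (fderiv ℝ φ 0 t)) = 0 := by
  have h1 : HasFDerivAt (fun t => (f (toC3 (φ t))).re) _ 0 :=
    reCLM.hasFDerivAt.comp (0 : Fin 2 → ℝ)
      ((hasFDerivAt_comp_toC3 hU hf hx).comp (0 : Fin 2 → ℝ) hφ.hasFDerivAt)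
  rw [h1.fderiv] at h0
  exact Complex.ext (congrArg (fun T : (Fin 2 → ℝ) →L[ℝ] ℝ => T t) h0)
    (im_fderiv_toC3 hU hf hr hx _)

theorem differentiableOn_sub_const_mul (hp : IsStationaryOnSingularity U g G p) (α : ℝ) :
    DifferentiableOn ℂ (fun ξ => G ξ - α * g ξ) U :=
  hp.holo_G.sub (hp.holo_g.const_mul _)

/-- A Lagrange multiplier, and the Hessian of the Lagrange function. -/
theorem IsStationaryOnSingularity.exists_multiplier (hp : IsStationaryOnSingularity U g G p) :
    ∃ (α : ℝ) (d : Fin 2 → R3) (n : R3), α ≠ 0 ∧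
      fderiv ℂ (fun ξ => G ξ - α * g ξ) (toC3 p) = 0 ∧
      (∀ i, fderiv ℂ g (toC3 p) (toC3 (d i)) = 0) ∧ α * fderiv ℂ g (toC3 p) (toC3 n) = 1 ∧
      (Matrix.of fun i j => (fderiv ℂ (fderiv ℂ fun ξ => G ξ - α * g ξ) (toC3 p) (toC3 (d i))
        (toC3 (d j))).re).det ≠ 0 := by
  obtain ⟨φ, hφ, rfl, hinj, hg, hG, hH⟩ := hp.stationary
  have hφd : DifferentiableAt ℝ φ 0 := hφ.differentiableAt (by simp); set D := fderiv ℝ φ 0 with hD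
  have tg : ∀ t, fderiv ℂ g (toC3 (φ 0)) (toC3 (D t)) = 0 :=
    fderiv_tangent hp.isOpen hp.holo_g hp.real_g hφd hp.mem (by
      have : (fun t => (g (toC3 (φ t))).re) =ᶠ[𝓝 0] fun _ => 0 := by
        filter_upwards [hg] with t ht; rw [ht, zero_re]
      rw [this.fderiv_eq, fderiv_const_apply])
  have tG : ∀ t, fderiv ℂ G (toC3 (φ 0)) (toC3 (D t)) = 0 :=
    fderiv_tangent hp.isOpen hp.holo_G hp.real_G hφd hp.mem hG
  obtain ⟨v, hv⟩ : ∃ v : R3, fderiv ℂ g (toC3 (φ 0)) (toC3 v) ≠ 0 := by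
    by_contra! h
    exact hp.regular (eq_zero_of_toC3 h)
  have rg := fun v => Complex.ext (z := fderiv ℂ g (toC3 (φ 0)) (toC3 v))
    (w := ((fderiv ℂ g (toC3 (φ 0)) (toC3 v)).re : ℂ)) rfl
    (im_fderiv_toC3 hp.isOpen hp.holo_g hp.real_g hp.mem v)
  have rG := fun v => Complex.ext (z := fderiv ℂ G (toC3 (φ 0)) (toC3 v))
    (w := ((fderiv ℂ G (toC3 (φ 0)) (toC3 v)).re : ℂ)) rfl
    (im_fderiv_toC3 hp.isOpen hp.holo_G hp.real_G hp.mem v)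
  -- Both derivatives vanish on the tangent plane, so they are proportional; the multiplier is the
  -- ratio `b / a` of their values on one transversal vector.
  set a := (fderiv ℂ g (toC3 (φ 0)) (toC3 v)).re with ha
  set b := (fderiv ℂ G (toC3 (φ 0)) (toC3 v)).re with hb
  have ha0 : (a : ℂ) ≠ 0 := rg v ▸ hv
  have hfd : fderiv ℂ (fun ξ => G ξ - ((b / a : ℝ) : ℂ) * g ξ) (toC3 (φ 0))
      = fderiv ℂ G (toC3 (φ 0)) - ((b / a : ℝ) : ℂ) • fderiv ℂ g (toC3 (φ 0)) :=
    (((hp.holo_G _ hp.mem).differentiableAt (hp.isOpen.mem_nhds hp.mem)).hasFDerivAt.sub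
      (((hp.holo_g _ hp.mem).differentiableAt
        (hp.isOpen.mem_nhds hp.mem)).hasFDerivAt.const_mul _)).fderiv
  -- The transversal vector and the tangent plane span `ℝ³`: injectivity of this map suffices for
  -- surjectivity.
  let P : (Fin 3 → ℝ) →ₗ[ℝ] R3 :=
    { toFun := fun z => z 0 • v + D ![z 1, z 2]
      map_add' := fun z z' => by
        have : ![z 1 + z' 1, z 2 + z' 2] = ![z 1, z 2] + ![z' 1, z' 2] := by simp
        simp only [Pi.add_apply, this, map_add, add_smul]; abel
      map_smul' := fun c z => by
        have : ![c * z 1, c * z 2] = c • ![z 1, z 2] := by simp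
        simp only [Pi.smul_apply, smul_eq_mul, this, map_smul, smul_add, mul_smul, RingHom.id_apply] }
  have hPg : ∀ (f : C3 →L[ℂ] ℂ) z, (∀ t, f (toC3 (D t)) = 0) →
      f (toC3 (P z)) = z 0 * f (toC3 v) := fun f z hf => by
    have : toC3 (P z) = z 0 • toC3 v + toC3 (D ![z 1, z 2]) := by
      change toC3L (z 0 • v + D ![z 1, z 2]) = _; rw [map_add, map_smul]; rfl
    rw [this, map_add, hf, add_zero, ← coe_smul, map_smul, smul_eq_mul]
  have hPinj : Function.Injective P := (injective_iff_map_eq_zero P).2 fun z hz => by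
    have h0 : z 0 = 0 := by
      have := hPg _ z tg; rw [hz, show toC3 0 = 0 from toC3L.map_zero, map_zero] at this
      exact_mod_cast (mul_eq_zero.1 this.symm).resolve_right hv
    have h1 : D ![z 1, z 2] = 0 := by
      have : z 0 • v + D ![z 1, z 2] = 0 := hz
      rwa [h0, zero_smul, zero_add] at this
    have h2 := (injective_iff_map_eq_zero D).1 hinj _ h1; ext i; fin_cases i
    · exact h0
    · exact congrFun h2 0
    · exact congrFun h2 1
  have hK0 : fderiv ℂ (fun ξ => G ξ - ((b / a : ℝ) : ℂ) * g ξ) (toC3 (φ 0)) = 0 := by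
    refine eq_zero_of_toC3 fun u => ?_
    obtain ⟨z, rfl⟩ := LinearMap.injective_iff_surjective.1 hPinj u
    rw [hfd, hPg _ z fun t => by rw [sub_apply, smul_apply, tg, tG, smul_zero, sub_zero], sub_apply,
      smul_apply, rg v, rG v, ← ha, ← hb, smul_eq_mul, ofReal_div, div_mul_cancel₀ _ ha0,
      sub_self, mul_zero]
  -- A zero multiplier would make `G` itself critical at the point, contrary to the assumption.
  have hα : b / a ≠ 0 := fun h => hp.not_critical (by simpa [hfd, h] using hK0)
  refine ⟨b / a, fun i => D (Pi.single i 1), (b / a * a)⁻¹ • v, hα, hK0, fun i => tg _, ?_, ?_⟩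
  · rw [show toC3 ((b / a * a)⁻¹ • v) = ((b / a * a)⁻¹ : ℝ) • toC3 v from toC3L.map_smul _ _,
      ← coe_smul, map_smul, rg v, ← ha, smul_eq_mul]
    have : (b : ℂ) ≠ 0 := fun h => hα (by rw [ofReal_eq_zero.1 h, zero_div])
    push_cast; field_simp
  -- On the surface `g` vanishes, so the Lagrange function and `G` have the same Hessian in the
  -- parametrization.
  · have hev : (fun t => (G (toC3 (φ t))).re) =ᶠ[𝓝 0]
        fun t => (G (toC3 (φ t)) - ((b / a : ℝ) : ℂ) * g (toC3 (φ t))).re := by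
      filter_upwards [hg] with t ht; rw [ht, mul_zero, sub_zero]
    convert hH using 3
    ext i j
    rw [Matrix.of_apply, ← hessian2_comp hp.isOpen (differentiableOn_sub_const_mul hp _) hp.mem hK0 hφ
      rfl i j, hessian2, hessian2, Matrix.of_apply, Matrix.of_apply, (hev.iteratedFDeriv ℝ 2).eq_of_nhds]

/-- Real linear coordinates in which the second-order part of the phase is diagonal. -/
theorem IsStationaryOnSingularity.exists_frame (hp : IsStationaryOnSingularity U g G p) :
    ∃ (α β β' : ℝ) (A : C3 ≃L[ℂ] C3) (n : R3), α ≠ 0 ∧ β ≠ 0 ∧ β' ≠ 0 ∧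
      fderiv ℂ (fun ξ => G ξ - α * g ξ) (toC3 p) = 0 ∧
      (∀ ξ, α * fderiv ℂ g (toC3 p) ξ = A ξ 0) ∧ A (toC3 n) = Pi.single 0 1 ∧
      (∀ y, imL (A (toC3 y)) = 0) ∧
      ∃ c : C3 →L[ℂ] ℂ, ∀ ξ, fderiv ℂ (fderiv ℂ fun ξ => G ξ - α * g ξ) (toC3 p) ξ ξ
        = A ξ 0 * c ξ + (β * A ξ 1 ^ 2 + β' * A ξ 2 ^ 2) := by
  obtain ⟨α, d, n, hα, hK0, hgd, hgn, hdet⟩ := hp.exists_multiplier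
  have hK := differentiableOn_sub_const_mul hp α
  have hKr : ∀ x : R3, toC3 x ∈ U → (G (toC3 x) - α * g (toC3 x)).im = 0 := fun x hx => by
    rw [sub_im, im_ofReal_mul, hp.real_G x hx, hp.real_g x hx, mul_zero, sub_zero]
  have hBim := im_fderiv_fderiv_toC3 hp.isOpen hK hKr hp.mem
  have hsym : ∀ u v, fderiv ℂ (fderiv ℂ fun ξ => G ξ - α * g ξ) (toC3 p) u v
      = fderiv ℂ (fderiv ℂ fun ξ => G ξ - α * g ξ) (toC3 p) v u :=
    ((contDiffOn_infty_of_holomorphic hp.isOpen hK).contDiffAt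
      (hp.isOpen.mem_nhds hp.mem)).isSymmSndFDerivAt (by simp; exact ENat.LEInfty.out)
  set B := fderiv ℂ (fderiv ℂ fun ξ => G ξ - α * g ξ) (toC3 p) with hB
  have hBd : ∀ i j, B (toC3 (d i)) (toC3 (d j)) = ((B (toC3 (d i)) (toC3 (d j))).re : ℂ) :=
    fun i j => Complex.ext rfl (hBim _ _)
  rw [Matrix.det_fin_two] at hdet
  simp only [Matrix.of_apply] at hdet
  rw [hsym (toC3 (d 1)) (toC3 (d 0))] at hdet
  obtain ⟨x, y, z, t, h2, h3, h23⟩ := exists_diagonal hdet; have e00 := hBd 0 0; have e01 := hBd 0 1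
  have e10 := (hsym (toC3 (d 1)) (toC3 (d 0))).trans e01; have e11 := hBd 1 1
  set a := (B (toC3 (d 0)) (toC3 (d 0))).re
  set b := (B (toC3 (d 0)) (toC3 (d 1))).re
  set c := (B (toC3 (d 1)) (toC3 (d 1))).re
  have hcomb : ∀ s s' : ℝ, toC3 (s • d 0 + s' • d 1)
      = (s : ℂ) • toC3 (d 0) + (s' : ℂ) • toC3 (d 1) := fun s s' => by
    rw [coe_smul, coe_smul]; exact (toC3L.map_add _ _).trans (by rw [map_smul, map_smul]; rfl)
  have hBc : ∀ s s' q q' : ℝ, B (toC3 (s • d 0 + s' • d 1)) (toC3 (q • d 0 + q' • d 1))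
      = ((a * s * q + b * (s * q' + s' * q) + c * s' * q' : ℝ) : ℂ) := fun s s' q q' => by
    simp only [hcomb, map_add, map_smul, add_apply, smul_apply, e00, e01, e10, e11, smul_eq_mul]
    push_cast; ring
  set b2 := x • d 0 + y • d 1 with hb2
  set b3 := z • d 0 + t • d 1 with hb3
  have hg2 : fderiv ℂ g (toC3 p) (toC3 b2) = 0 := by
    rw [hcomb, map_add, map_smul, map_smul, hgd, hgd, smul_zero, smul_zero, add_zero]
  have hg3 : fderiv ℂ g (toC3 p) (toC3 b3) = 0 := by
    rw [hcomb, map_add, map_smul, map_smul, hgd, hgd, smul_zero, smul_zero, add_zero]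
  have hB22 : B (toC3 b2) (toC3 b2) = ((a * x * x + 2 * b * x * y + c * y * y : ℝ) : ℂ) := by
    rw [hBc]; congr 1; ring
  have hB33 : B (toC3 b3) (toC3 b3) = ((a * z * z + 2 * b * z * t + c * t * t : ℝ) : ℂ) := by
    rw [hBc]; congr 1; ring
  have hB23 : B (toC3 b2) (toC3 b3) = 0 := by rw [hBc, h23, ofReal_zero]
  have hB32 := (hsym (toC3 b3) (toC3 b2)).trans hB23
  let P : C3 →ₗ[ℂ] C3 :=
    { toFun := fun z => z 0 • toC3 n + z 1 • toC3 b2 + z 2 • toC3 b3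
      map_add' := fun z z' => by
        simp only [Pi.add_apply, add_smul]; abel
      map_smul' := fun c z => by
        simp only [Pi.smul_apply, smul_eq_mul, mul_smul, smul_add, RingHom.id_apply] }
  have hP : ∀ z, P z = z 0 • toC3 n + z 1 • toC3 b2 + z 2 • toC3 b3 := fun z => rfl
  have hPg : ∀ z, α * fderiv ℂ g (toC3 p) (P z) = z 0 := fun z => by
    rw [hP, map_add, map_add, map_smul, map_smul, map_smul, hg2, hg3, smul_zero, smul_zero, add_zero,
      add_zero, smul_eq_mul, mul_left_comm, hgn, mul_one]
  have hβ := ofReal_ne_zero.2 h2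
  have hβ' := ofReal_ne_zero.2 h3
  have hPinj : Function.Injective P := (injective_iff_map_eq_zero P).2 fun z hz => by
    have h0 : z 0 = 0 := by rw [← hPg z, hz, map_zero, mul_zero]
    rw [hP, h0, zero_smul, zero_add] at hz
    have e2 := congrArg (B (toC3 b2)) hz
    have e3 := congrArg (B (toC3 b3)) hz
    rw [map_add, map_smul, map_smul, map_zero, hB22, hB23, smul_zero, add_zero, smul_eq_mul] at e2
    rw [map_add, map_smul, map_smul, map_zero, hB32, hB33, smul_zero, zero_add, smul_eq_mul] at e3
    ext i; fin_cases i
    · exact h0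
    · exact (mul_eq_zero.1 e2).resolve_right hβ
    · exact (mul_eq_zero.1 e3).resolve_right hβ'
  set A := (LinearEquiv.ofInjectiveEndo P hPinj).toContinuousLinearEquiv.symm with hA
  have hAP : ∀ z, A (P z) = z := fun z => (LinearEquiv.ofInjectiveEndo P hPinj).symm_apply_apply z
  have hPA : ∀ ξ, P (A ξ) = ξ := fun ξ => (LinearEquiv.ofInjectiveEndo P hPinj).apply_symm_apply ξ
  have hPr : ∀ v : R3, P (toC3 v) = toC3 (v 0 • n + v 1 • b2 + v 2 • b3) := fun v => by
    change (v 0 : ℂ) • toC3 n + (v 1 : ℂ) • toC3 b2 + (v 2 : ℂ) • toC3 b3 = _; ext i; simp [toC3]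
  have him : ∀ v, imL (toC3 v) = 0 := fun v => by rw [← complexPt_zero, imL_complexPt]
  -- The last witness collects all second-order terms that contain the normal coordinate: `2 B(n,
  -- ·)` counts the square of that coordinate twice, and the subtracted multiple of the derivative
  -- of `g` removes the excess.
  refine ⟨α, _, _, A, n, hα, h2, h3, hK0, fun ξ => ?_, ?_, fun v => ?_,
    (2 : ℂ) • B (toC3 n) - (B (toC3 n) (toC3 n) * α) • fderiv ℂ g (toC3 p), fun ξ => ?_⟩
  · rw [← hPg (A ξ), hPA]
  · rw [← hAP (Pi.single 0 1), hP]; simp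
  · have h1 := hPA (toC3 v)
    rw [← complexPt_reL_imL (A (toC3 v)), complexPt_eq, map_add, map_smul, hPr, hPr,
      ← complexPt_eq] at h1
    have h2 := congrArg imL h1; rw [imL_complexPt, him] at h2
    have h3 : P (toC3 (imL (A (toC3 v)))) = 0 := by
      rw [hPr, h2]; exact toC3L.map_zero
    have h4 := congrArg reL ((injective_iff_map_eq_zero P).1 hPinj _ h3)
    rwa [← complexPt_zero, reL_complexPt, map_zero] at h4
  · obtain ⟨z, rfl⟩ : ∃ z, P z = ξ := ⟨A ξ, hPA ξ⟩; change B (P z) (P z) = _; rw [hAP]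
    simp only [sub_apply, smul_apply, smul_eq_mul, mul_assoc, hPg]
    simp only [hP, map_add, map_smul, add_apply, smul_apply, smul_eq_mul, hB22, hB23, hB32, hB33,
      hsym (toC3 b2) (toC3 n), hsym (toC3 b3) (toC3 n)]
    ring_nf

end NormalFrame

/-! ### Existence of normalized coordinates -/

theorem eq_toC3_of_imL_eq_zero {ξ : C3} (h : imL ξ = 0) : ξ = toC3 (reL ξ) := by
  conv_lhs => rw [← complexPt_reL_imL ξ, h, complexPt_zero]

theorem imL_eq_zero_iff {ξ : C3} : imL ξ = 0 ↔ ∀ i, (ξ i).im = 0 := funext_iff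

/-- Normalized coordinates exist. -/
theorem IsStationaryOnSingularity.exists_isNormalizingChart {U : Set C3} {g G : C3 → ℂ} {p : R3}
    (hp : IsStationaryOnSingularity U g G p) : ∃ (w : OpenPartialHomeomorph C3 C3) (α β β' : ℝ),
      IsNormalizingChart U g G p w α β β' := by
  obtain ⟨α, β, β', A, n, hα, hβ, hβ', hK0, hA0, hAn, hAr, L, hL⟩ := hp.exists_frame
  -- Only the first coordinate is nonlinear. Linear tangential coordinates suffice, since the
  -- admissible error contains `|w₁||w|` and `|w|³`.
  set W : C3 → C3 := fun ξ i => if i = 0 then α * g ξ else A (ξ - toC3 p) i with hWdef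
  have hW0 : ∀ ξ, W ξ 0 = α * g ξ := fun ξ => if_pos rfl
  have hWi : ∀ ξ i, i ≠ 0 → W ξ i = A (ξ - toC3 p) i := fun ξ i hi => if_neg hi
  have hWU : DifferentiableOn ℂ W U := differentiableOn_pi.2 fun i => by
    by_cases hi : i = 0
    · subst hi; exact hp.holo_g.const_mul _
    · simp only [hWi _ i hi]
      exact (differentiableOn_pi.1 (A.differentiable.comp
        (differentiable_id.sub_const (toC3 p))).differentiableOn) i
  have hWc : ContDiffAt ℂ ∞ W (toC3 p) :=
    (contDiffOn_pi.2 fun i => contDiffOn_infty_of_holomorphic hp.isOpen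
      (differentiableOn_pi.1 hWU i)).contDiffAt (hp.isOpen.mem_nhds hp.mem)
  have hg' := ((hp.holo_g _ hp.mem).differentiableAt (hp.isOpen.mem_nhds hp.mem)).hasFDerivAt
  have hWA : HasFDerivAt W (A : C3 →L[ℂ] C3) (toC3 p) := hasFDerivAt_pi'.2 fun i => by
    by_cases hi : i = 0
    · subst hi; refine (hg'.const_mul (α : ℂ)).congr_fderiv ?_; ext1 ξ; exact hA0 ξ
    · simp only [hWi _ i hi]
      exact (proj (R := ℂ) (φ := fun _ : Fin 3 => ℂ) i).hasFDerivAt.comp _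
        (A.hasFDerivAt.comp (toC3 p) ((hasFDerivAt_id (toC3 p)).sub_const (toC3 p)))
  have hWp : W (toC3 p) = 0 := by
    ext i; by_cases hi : i = 0
    · rw [hi, hW0, hp.zero, mul_zero, Pi.zero_apply]
    · rw [hWi _ i hi, sub_self, map_zero]
  have hst : HasStrictFDerivAt W (A : C3 →L[ℂ] C3) (toC3 p) :=
    hWA.fderiv ▸ hWc.hasStrictFDerivAt (by simp)
  have hA' : 0 < ‖(A.symm : C3 →L[ℂ] C3)‖₊ :=
    A.subsingleton_or_nnnorm_symm_pos.resolve_left (not_subsingleton C3)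
  -- The first bound makes `W` invertible on a ball; the second is for the proof below that points
  -- with real coordinates are real.
  obtain ⟨c, hc0, hcA, hcn⟩ : ∃ c : NNReal, 0 < c ∧ c < ‖(A.symm : C3 →L[ℂ] C3)‖₊⁻¹ ∧
      c * ‖n‖₊ < 1 := by
    refine ⟨min (‖(A.symm : C3 →L[ℂ] C3)‖₊⁻¹ / 2) (‖n‖₊ + 1)⁻¹, by positivity,
      (min_le_left _ _).trans_lt (half_lt_self (by positivity)), ?_⟩
    calc _ ≤ (‖n‖₊ + 1)⁻¹ * ‖n‖₊ := mul_le_mul_left (min_le_right _ _) _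
      _ < (‖n‖₊ + 1)⁻¹ * (‖n‖₊ + 1) := mul_lt_mul_of_pos_left (lt_add_one _) (by positivity)
      _ = 1 := inv_mul_cancel₀ (by positivity)
  obtain ⟨s, hs, hsA⟩ := hst.approximates_deriv_on_nhds (c := c) (Or.inr hc0)
  -- Invertibility of the derivative on the whole ball, needed for the inverse chart to be
  -- holomorphic on all of its domain.
  have hinv : ∀ᶠ ξ in 𝓝 (toC3 p), fderiv ℂ W ξ ∈ range ((↑) : (C3 ≃L[ℂ] C3) → C3 →L[ℂ] C3) := by
    have h1 : ContinuousAt (fderiv ℂ W) (toC3 p) :=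
      (hWc.fderiv_right (m := ∞) (by simp)).continuousAt
    refine h1.eventually ?_; rw [hWA.fderiv]; exact A.nhds
  obtain ⟨ρ, hρ, hball⟩ := eventually_nhds_iff_ball.1
    ((eventually_mem_set.2 hs).and ((hp.isOpen.eventually_mem hp.mem).and hinv))
  have happ : ApproximatesLinearOn W (A : C3 →L[ℂ] C3) (ball (toC3 p) ρ) c :=
    hsA.mono_set fun ξ hξ => (hball ξ hξ).1
  set w := happ.toOpenPartialHomeomorph W (ball (toC3 p) ρ) (Or.inr hcA) isOpen_ball with hw
  have hws : w.source = ball (toC3 p) ρ := rfl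
  have hwW : ∀ ξ, w ξ = W ξ := fun ξ => rfl
  have hmem := mem_ball_self (x := toC3 p) hρ
  have hO : (fun ξ => ξ - toC3 p) =O[𝓝 (toC3 p)] W := by
    refine IsBigO.of_bound ((‖(A.symm : C3 →L[ℂ] C3)‖₊⁻¹ - c)⁻¹ : NNReal) ?_
    filter_upwards [ball_mem_nhds _ hρ] with ξ hξ
    have := (happ.antilipschitz (Or.inr hcA)).le_mul_dist ⟨ξ, hξ⟩ ⟨toC3 p, hmem⟩
    simpa only [Subtype.dist_eq, dist_eq_norm, Set.domRestrict_apply, hWp, sub_zero] using this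
  have h3 : (fun ξ => ‖ξ - toC3 p‖ ^ 3) =O[𝓝 (toC3 p)] fun ξ => ‖W ξ 0‖ * ‖W ξ‖ + ‖W ξ‖ ^ 3 := by
    refine (hO.norm_norm.pow 3).trans (IsBigO.of_norm_le fun ξ => ?_)
    rw [Real.norm_of_nonneg (by positivity)]
    exact le_add_of_nonneg_left (by positivity)
  refine ⟨w, α, β, β', ?_⟩; constructor
  · exact hmem
  · exact fun ξ hξ => (hball ξ hξ).2.1
  · exact hWp
  · exact hWU.mono fun ξ hξ => (hball ξ hξ).2.1
  · intro ζ hζ; obtain ⟨E, hE⟩ := (hball _ (w.map_target hζ)).2.2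
    have h1 : HasFDerivAt w (E : C3 →L[ℂ] C3) (w.symm ζ) := by
      rw [hE]; have hU := (hball _ (w.map_target hζ)).2.1
      exact ((hWU _ hU).differentiableAt (hp.isOpen.mem_nhds hU)).hasFDerivAt
    exact (w.hasFDerivAt_symm hζ h1).differentiableAt.differentiableWithinAt
  · intro ξ hξ; rw [← imL_eq_zero_iff, ← imL_eq_zero_iff, hwW]
    have hreal : ∀ y : R3, toC3 y ∈ U → imL (W (toC3 y)) = 0 := fun y hy =>
      imL_eq_zero_iff.2 fun i => by
        by_cases hi : i = 0
        · rw [hi, hW0, im_ofReal_mul, hp.real_g y hy, mul_zero]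
        · rw [hWi _ i hi, ← toC3_sub]; exact congrFun (hAr _) i
    refine ⟨fun h => ?_, fun h => ?_⟩
    · rw [eq_toC3_of_imL_eq_zero h] at hξ ⊢; exact hreal _ (hball _ hξ).2.1
    -- Let `ξ = x + iy` have real coordinates. The linear ones being real, `y` is a multiple `q 0 •
    -- n`. Comparing the first coordinate with its value at the real point `x` gives `|q 0| ≤ c‖y‖ =
    -- c|q 0|‖n‖`, and `c‖n‖ < 1` forces `y = 0`.
    · set x := reL ξ; set y := imL ξ
      have hξ' : ξ = toC3 x + I • toC3 y := by rw [← complexPt_eq, complexPt_reL_imL]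
      have hx : toC3 x ∈ ball (toC3 p) ρ := by
        rw [mem_ball, dist_eq_norm, ← toC3_sub, norm_toC3,
          show x - p = reL (ξ - toC3 p) by rw [map_sub, ← complexPt_zero p, reL_complexPt]]
        exact (norm_reL_le _).trans_lt (by rwa [← dist_eq_norm])
      set q := reL (A (toC3 y)) with hq
      have hAq : A (toC3 y) = toC3 q := eq_toC3_of_imL_eq_zero (hAr y)
      have hqi : ∀ i, i ≠ 0 → q i = 0 := fun i hi => by
        have h1 := congrFun h i
        rw [imL_apply, hWi _ i hi, hξ', add_sub_right_comm, map_add, map_smul, ← toC3_sub,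
          hAq, Pi.add_apply, add_im] at h1
        rw [show (A (toC3 (x - p)) i).im = 0 from congrFun (hAr _) i] at h1; simpa [toC3] using h1
      have hyn : y = q 0 • n := by
        have h1 : A (toC3 y) = A (toC3 (q 0 • n)) := by
          rw [show toC3 (q 0 • n) = q 0 • toC3 n from toC3L.map_smul _ _, ← coe_smul,
            map_smul, hAn, hAq]
          ext i; by_cases hi : i = 0
          · subst hi; simp [toC3]
          · simp [toC3, hqi i hi, hi]
        have h2 := congrArg reL (A.injective h1)
        rwa [← complexPt_zero, ← complexPt_zero, reL_complexPt, reL_complexPt] at h2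
      have h1 := happ ξ hξ (toC3 x) hx
      rw [show ξ - toC3 x = I • toC3 y by rw [hξ']; abel, norm_smul, norm_I, one_mul,
        norm_toC3] at h1
      have h2 := (abs_im_le_norm _).trans ((norm_le_pi_norm _ 0).trans h1)
      have h4 : (W ξ - W (toC3 x) - (A : C3 →L[ℂ] C3) (I • toC3 y)) 0
          = W ξ 0 - W (toC3 x) 0 - I * A (toC3 y) 0 := by
        rw [map_smul]; rfl
      rw [h4, hAq, sub_im, sub_im, show (W ξ 0).im = 0 from congrFun h 0,
        show (W (toC3 x) 0).im = 0 from congrFun (hreal x (hball _ hx).2.1) 0] at h2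
      have h5 : |q 0| ≤ c * ‖y‖ := by simpa [toC3] using h2
      have h6 : ‖y‖ = |q 0| * ‖n‖ := by conv_lhs => rw [hyn, norm_smul, norm_eq_abs]
      have h7 : (c : ℝ) * ‖n‖ < 1 := by exact_mod_cast hcn
      have h8 : q 0 = 0 := by
        by_contra h0
        have := abs_pos.2 h0; rw [h6] at h5; nlinarith
      rw [hyn, h8, zero_smul]
  · exact hα
  · exact hβ
  · exact hβ'
  · exact fun ξ _ => hW0 ξ
  · have e1 := isBigO_taylor_two hp.isOpen (differentiableOn_sub_const_mul hp α) hp.mem hK0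
    -- Replacing the linear part of the first coordinate by the coordinate itself costs a quadratic
    -- error. Multiplied by the linear form `L` it becomes cubic, while `W ξ 0 * L` is of the
    -- admissible type.
    have e2 : (fun ξ => A (ξ - toC3 p) 0 - W ξ 0) =O[𝓝 (toC3 p)] fun ξ => ‖ξ - toC3 p‖ ^ 2 := by
      refine ((isBigO_taylor_one hp.isOpen hp.holo_g hp.mem).const_mul_left (-(α : ℂ))).congr_left
        fun ξ => ?_
      rw [← hA0, hW0, hp.zero]; ring
    have e3 : (fun ξ => L (ξ - toC3 p)) =O[𝓝 (toC3 p)] fun ξ => ‖ξ - toC3 p‖ :=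
      (L.isBigO_sub _ _).norm_right
    have e4 := (e2.mul e3).congr_right fun ξ => (pow_succ _ 2).symm
    have e5 : (fun ξ => W ξ 0 * L (ξ - toC3 p)) =O[𝓝 (toC3 p)]
        fun ξ => ‖W ξ 0‖ * ‖W ξ‖ + ‖W ξ‖ ^ 3 := by
      refine ((isBigO_refl (fun ξ => W ξ 0) _).norm_right.mul (e3.trans hO.norm_norm)).trans
        (IsBigO.of_norm_le fun ξ => ?_)
      rw [Real.norm_of_nonneg (by positivity)]
      exact le_add_of_nonneg_right (by positivity)
    refine (((e1.trans h3).add ((e4.trans h3).const_mul_left (1 / 2))).add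
      (e5.const_mul_left (1 / 2))).congr_left fun ξ => ?_
    rw [hL, hwW, hWi ξ 1 one_ne_zero, hWi ξ 2 (by decide), hW0, hp.zero]; ring

/-! ### Assembly -/

theorem mainTheorem1 (U : Set C3) (g G : C3 → ℂ) (p : R3)
    (hp : IsStationaryOnSingularity U g G p) :
    -- normalized coordinates exist
    (∃ (w : OpenPartialHomeomorph C3 C3) (α β₂ β₃ : ℝ),
      IsNormalizingChart U g G p w α β₂ β₃) ∧
    -- and in any of them:
    ∀ (w : OpenPartialHomeomorph C3 C3) (α β₂ β₃ : ℝ),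
      IsNormalizingChart U g G p w α β₂ β₃ →
      (∃ R > 0, ∀ r : ℝ, 0 < r → r < R →
        -- allowed deformations with the required final domain exist
        (∀ ε > 0, ∃ δ > 0, ∀ η₀ : R3 → R3, IsSmallField p (2 * r) δ η₀ →
          (PassesAbove (fun ξ => (α : ℂ) * g ξ) p (2 * r) η₀ →
            ∃ η : ℝ → R3 → R3, IsAllowedDeformation g p r ε η ∧
              (∀ x ∈ Metric.closedBall p r, η 0 x = η₀ x) ∧
              DesiredOn G (Metric.closedBall p r) (η 1)) ∧
          (PassesBelow (fun ξ => (α : ℂ) * g ξ) p (2 * r) η₀ →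
            ∀ r₁ > 0, ∃ η : ℝ → R3 → R3, IsAllowedDeformation g p r ε η ∧
              (∀ x ∈ Metric.closedBall p r, η 0 x = η₀ x) ∧
              DesiredOn G (Metric.closedBall p r \ Metric.ball p r₁) (η 1))) ∧
        -- the contribution, whatever the allowed deformation
        (∃ δ > 0, ∀ η : ℝ → R3 → R3, IsAllowedDeformation g p r δ η →
          DesiredOn G (Metric.closedBall p r \ Metric.ball p (r / 2)) (η 1) →
          (PassesAbove (fun ξ => (α : ℂ) * g ξ) p r (η 0) →
            ∀ F : C3 → ℂ, DifferentiableOn ℂ F {ξ ∈ U | (α : ℂ) * g ξ ∈ cutBelow} →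
              ∃ ζ > 0, localIntegral F G p r (η 1) =O[atTop] fun Λ : ℝ => Real.exp (-(ζ * Λ))) ∧
          (PassesBelow (fun ξ => (α : ℂ) * g ξ) p r (η 0) →
            ¬ DesiredOn G (Metric.closedBall p r) (η 1) ∧
            ∀ (F : C3 → ℂ) (C : ℂ × ℂ → ℂ) (μ : ℂ),
              DifferentiableOn ℂ F {ξ ∈ U | (α : ℂ) * g ξ ∈ cutAbove} →
              HasPowerSingularity F p w C μ →
              localIntegral F G p r (η 1) ~[atTop] leadingTerm G p w β₂ β₃ C μ))) ∧
      -- `Φ` is the leading term of the one-dimensional integral across the singularity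
      (∃ ρ₀ > 0, ∀ ρ : ℝ, 0 < ρ → ρ < ρ₀ → ∀ h : ℝ → ℝ, IsLowerContour ρ h →
        ∀ (F : C3 → ℂ) (C : ℂ × ℂ → ℂ) (μ : ℂ),
          DifferentiableOn ℂ F {ξ ∈ U | (α : ℂ) * g ξ ∈ cutAbove} →
          HasPowerSingularity F p w C μ →
          contourIntegral F w ρ h ~[atTop] Phi C μ) := by
  refine ⟨hp.exists_isNormalizingChart, fun w α β2 β3 hw => ⟨?_, contourIntegral_isEquivalent hw⟩⟩
  obtain ⟨R1, hR1, habove⟩ := hw.exists_deformation_above hp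
  obtain ⟨R2, hR2, hbelow⟩ := hw.exists_deformation_below hp
  obtain ⟨R3, hR3, htrans⟩ := hw.exists_passes_transport
  obtain ⟨R4, hR4, hdecay⟩ := hw.exists_localIntegral_isBigO hp
  obtain ⟨R5, hR5, hlim⟩ := hw.exists_tendsto_localIntegral hp
  obtain ⟨R6, hR6, δ6, hδ6, hnear⟩ := hw.exists_reL_approx one_pos
  refine ⟨min (min (min R1 R2) (min R3 R4)) (min R5 R6), by positivity, fun r hr hrR => ?_⟩
  simp only [lt_min_iff] at hrR; obtain ⟨⟨⟨h1, h2⟩, h3, h4⟩, h5, h6⟩ := hrR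
  refine ⟨fun ε hε => ?_, ?_⟩
  · obtain ⟨δ1, hδ1, ha⟩ := habove r hr h1.le ε hε
    obtain ⟨δ2, hδ2, hb⟩ := hbelow r hr h2.le ε hε
    exact ⟨min δ1 δ2, by positivity, fun η0 hη0 =>
      ⟨ha _ (min_le_left _ _) η0 hη0, hb _ (min_le_right _ _) η0 hη0⟩⟩
  · obtain ⟨δ3, hδ3, ht⟩ := htrans r hr h3.le
    obtain ⟨δ4, hδ4, hd⟩ := hdecay r hr h4.le
    obtain ⟨δ5, hδ5, hl⟩ := hlim r hr h5.le
    refine ⟨min (min δ3 δ4) (min δ5 δ6), by positivity, fun η hη hdes => ?_⟩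
    set δ := min (min δ3 δ4) (min δ5 δ6)
    have hle3 : δ ≤ δ3 := (min_le_left _ _).trans (min_le_left _ _)
    have hle4 : δ ≤ δ4 := (min_le_left _ _).trans (min_le_right _ _)
    have hle5 : δ ≤ δ5 := (min_le_right _ _).trans (min_le_left _ _)
    have hle6 : δ ≤ δ6 := (min_le_right _ _).trans (min_le_right _ _)
    have hsmall := hη.small 1 ⟨zero_le_one, le_rfl⟩
    refine ⟨fun hpass => ?_, fun hpass => ?_⟩
    -- Only the initial domain is assumed to pass above; transport with `ς = 1` gives the same for
    -- the final one. The case below uses `ς = -1`.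
    · exact hd δ hle4 _ hsmall hdes fun x hx h0 => by
        simpa using ht δ hle3 η hη 1 one_ne_zero (fun x hx h0 => by simpa using hpass x hx h0) x hx h0
    · have hpass1 : PassesBelow (fun ξ => (α : ℂ) * g ξ) p r (η 1) := fun x hx h0 => by
        have := ht δ hle3 η hη (-1) (by norm_num)
          (fun x hx h0 => by simpa using hpass x hx h0) x hx h0
        simpa using this
      have hU : ∀ x ∈ closedBall p r, domainPt (η 1) x ∈ U := fun x hx =>
        hw.subset ((hnear r δ h6.le hle6 _ hsmall).1 x hx).1
      have hlim' := hl δ hle5 _ hsmall hdes hpass1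
      refine ⟨?_, fun F C μ hF hFs =>
        hw.isEquivalent_leadingTerm hp hFs.ne_zero hFs.exponent (hlim' F C μ hF hFs)⟩
      -- The test amplitude `1/w₁`, with exponent `μ = -1`: its nonzero asymptotics exclude that the
      -- final domain is desired everywhere.
      have hF : DifferentiableOn ℂ (fun ξ => ((α : ℂ) * g ξ)⁻¹) {ξ ∈ U | (α : ℂ) * g ξ ∈ cutAbove} := by
        refine ((hp.holo_g.const_mul _).mono fun ξ hξ => hξ.1).inv fun ξ hξ h0 => ?_
        have h7 : (α : ℂ) * g ξ ∈ cutAbove := hξ.2; rw [h0] at h7; exact lt_irrefl _ (h7 rfl)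
      have h8 := hlim' _ _ _ hF hw.hasPowerSingularity_inv
      exact not_desiredOn_of_tendsto hp hsmall.1 hU hpass1
        (hw.limit_ne_zero (C := fun _ => 1) one_ne_zero (Or.inl rfl)) h8
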